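/- **Theorem (Local Law).** Fix $\beta>0$, constants $(c_p)_{p\ge 3}$, $L>0$ and $\nu>0$. For $N\ge 1$ let $N^{\beta}\le q\le N^{1/2}$ and let $H$ be a random Laplacian-type matrix: a real symmetric $(N+1)\times(N+1)$ random matrix with off-diagonal entries $H_{ij}=h_{ij}=h_{ji}$ $(i\ne j)$ and diagonal entries $H_{ii}=-\sum_{k\ne i}h_{ik}$, where the $h_{ij}$, $i<j$, are independent, have mean $0$ and variance $1/N$, and satisfy $\mathbb E|h_{ij}|^p\le c_p/(q^{p-2}N)$ for every integer $p\ge 3$. Put $\xi=N^{\nu}$, $G(z)=(H-z)^{-1}$, $m_N(z)=\frac1N\operatorname{Tr}G(z)$, $\eta=\operatorname{Im}z$ and $$\Psi(z)=\frac1q+\frac1{(N\eta)^{1/2}} .$$ For $\operatorname{Im}z>0$ let $m_{\mathrm{fc}}(z)$ be the Stieltjes transform of the free convolution of the semicircle law and the standard Gaussian law, that is, the unique $m\in\mathbb C$ with $\operatorname{Im}m\ge 0$ and $$m=\int_{\mathbb R}\frac{1}{x-z-m}\,\frac{e^{-x^2/2}}{\sqrt{2\pi}}\,dx .$$ Let $\mathcal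 D_L=\mathcal D_L^{(0)}\cup\mathcal D_L^{(1)}\cup\mathcal D_L^{(2)}$, where, with $z=E+\mathrm i\eta$, $$\mathcal D_L^{(0)}=\{|E|\le 2\xi+L,\ 2\le\eta\le L\},\quad \mathcal D_L^{(1)}=\{|E|\le L,\ \xi^3N^{-1}\le\eta\le 2\},\quad \mathcal D_L^{(2)}=\{2\xi\le|E|\le 2\xi+L,\ \xi^3N^{-1}\le\eta\le 2\}.$$ Then there is a constant $C>0$, depending only on $\beta,(c_p),L,\nu$, such that for every $D>0$ there is an $N_0$, depending only on $D,\beta,(c_p),L,\nu$, such that for all $N\ge N_0$ and all $q$, $H$ as above, with probability at least $1-N^{-D}$ the bounds $$|m_N(z)-m_{\mathrm{fc}}(z)|\le C\xi\Psi(z)\qquad\text{and}\qquad \left|G_{ij}(z)-\delta_{ij}\frac{1}{-\sum_{k\ne i}h_{ik}-z-m_{\mathrm{fc}}(z)}\right|\le C\xi\Psi(z)$$ hold simultaneously for all $z\in\mathcal D_L$ and all $1\le i,j\le N+1$. -/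

import Mathlib

open MeasureTheory ProbabilityTheory

noncomputable section

namespace LaplacianLocalLaw

/-! ### The Stieltjes transform of the free convolution of the semicircle and Gaussian laws -/

/-- The Stieltjes transform `∫ ρ_G(x) / (x - w) dx` of the standard Gaussian law. -/
def gaussStieltjes (w : ℂ) : ℂ := ∫ x : ℝ, 1 / ((x : ℂ) - w) ∂(gaussianReal 0 1)

/-- `m` solves the functional equation `m = ∫ ρ_G(x) / (x - z - m) dx` with `Im m ≥ 0`. -/
def IsFreeConvSolution (z m : ℂ) : Prop :=
  0 ≤ m.im ∧ m = ∫ x : ℝ, 1 / ((x : ℂ) - z - m) ∂(gaussianReal 0 1)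

lemma sub_ne_zero_of_im_pos {w : ℂ} (hw : 0 < w.im) (x : ℝ) : (x : ℂ) - w ≠ 0 := by
  intro h
  have := congrArg Complex.im h
  simp at this
  linarith

lemma im_le_norm_sub {w : ℂ} (x : ℝ) : w.im ≤ ‖(x : ℂ) - w‖ := by
  have := Complex.abs_im_le_norm ((x : ℂ) - w)
  simp only [Complex.sub_im, Complex.ofReal_im, zero_sub, abs_neg] at this
  exact (le_abs_self _).trans this

lemma norm_inv_sub_le {w : ℂ} (hw : 0 < w.im) (x : ℝ) : ‖1 / ((x : ℂ) - w)‖ ≤ 1 / w.im := by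
  rw [norm_div, norm_one]
  exact one_div_le_one_div_of_le hw (im_le_norm_sub x)

lemma continuous_inv_sub {w : ℂ} (hw : 0 < w.im) :
    Continuous fun x : ℝ => 1 / ((x : ℂ) - w) :=
  continuous_const.div (Complex.continuous_ofReal.sub continuous_const)
    (sub_ne_zero_of_im_pos hw)

lemma memLp_inv_sub {w : ℂ} (hw : 0 < w.im) (p : ENNReal) :
    MemLp (fun x : ℝ => 1 / ((x : ℂ) - w)) p (gaussianReal 0 1) :=
  MemLp.of_bound (continuous_inv_sub hw).aestronglyMeasurable (1 / w.im)
    (Filter.Eventually.of_forall (norm_inv_sub_le hw))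

lemma integrable_inv_sub {w : ℂ} (hw : 0 < w.im) :
    Integrable (fun x : ℝ => 1 / ((x : ℂ) - w)) (gaussianReal 0 1) :=
  memLp_one_iff_integrable.1 (memLp_inv_sub hw 1)

lemma norm_gaussStieltjes_le {w : ℂ} (hw : 0 < w.im) : ‖gaussStieltjes w‖ ≤ 1 / w.im := by
  have := norm_integral_le_of_norm_le_const (μ := gaussianReal 0 1)
    (Filter.Eventually.of_forall (norm_inv_sub_le hw))
  simpa [gaussStieltjes] using this

lemma im_gaussStieltjes {w : ℂ} (hw : 0 < w.im) :
    (gaussStieltjes w).im =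
      w.im * ∫ x : ℝ, ‖1 / ((x : ℂ) - w)‖ ^ 2 ∂(gaussianReal 0 1) := by
  have h1 : (gaussStieltjes w).im =
      ∫ x : ℝ, (1 / ((x : ℂ) - w)).im ∂(gaussianReal 0 1) :=
    (integral_im (𝕜 := ℂ) (integrable_inv_sub hw)).symm
  rw [h1, ← integral_const_mul]
  refine integral_congr_ae (Filter.Eventually.of_forall fun x => ?_)
  have : Complex.normSq ((x : ℂ) - w) ≠ 0 :=
    fun h => sub_ne_zero_of_im_pos hw x (Complex.normSq_eq_zero.1 h)
  simp only [one_div, Complex.inv_im, norm_inv, inv_pow, ← Complex.normSq_eq_norm_sq]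
  simp [div_eq_mul_inv]

lemma gaussStieltjes_im_nonneg {w : ℂ} (hw : 0 < w.im) : 0 ≤ (gaussStieltjes w).im := by
  rw [im_gaussStieltjes hw]
  exact mul_nonneg hw.le (integral_nonneg fun x => by positivity)

lemma norm_gaussStieltjes_sub_sq_le {w v : ℂ} (hw : 0 < w.im) (hv : 0 < v.im) :
    ‖gaussStieltjes w - gaussStieltjes v‖ ^ 2 ≤ ‖w - v‖ ^ 2 *
      (((gaussStieltjes w).im / w.im) * ((gaussStieltjes v).im / v.im)) := by
  set a : ℝ → ℂ := fun x => 1 / ((x : ℂ) - w) with ha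
  set b : ℝ → ℂ := fun x => 1 / ((x : ℂ) - v) with hb
  have e : gaussStieltjes w - gaussStieltjes v =
      (w - v) * ∫ x, a x * b x ∂(gaussianReal 0 1) := by
    unfold gaussStieltjes
    rw [← integral_sub (integrable_inv_sub hw) (integrable_inv_sub hv), ← integral_const_mul]
    refine integral_congr_ae (Filter.Eventually.of_forall fun x => ?_)
    have h1 := sub_ne_zero_of_im_pos hw x
    have h2 := sub_ne_zero_of_im_pos hv x
    simp only [ha, hb]
    field_simp
    ring
  have cs := integral_mul_norm_le_Lp_mul_Lq (μ := gaussianReal 0 1) (f := a) (g := b)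
    Real.HolderConjugate.two_two
    (memLp_inv_sub hw _) (memLp_inv_sub hv _)
  set A := ∫ x, ‖a x‖ ^ 2 ∂(gaussianReal 0 1) with hA
  set B := ∫ x, ‖b x‖ ^ 2 ∂(gaussianReal 0 1) with hB
  have hA0 : 0 ≤ A := integral_nonneg fun x => by positivity
  have hB0 : 0 ≤ B := integral_nonneg fun x => by positivity
  simp only [Real.rpow_two, ← hA, ← hB, ← Real.sqrt_eq_rpow] at cs
  have n1 : ‖∫ x, a x * b x ∂(gaussianReal 0 1)‖ ≤ √A * √B := by
    refine (norm_integral_le_integral_norm _).trans ?_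
    simpa only [norm_mul] using cs
  have n2 : ‖∫ x, a x * b x ∂(gaussianReal 0 1)‖ ^ 2 ≤ A * B := by
    calc _ ≤ (√A * √B) ^ 2 := by gcongr
      _ = A * B := by rw [mul_pow, Real.sq_sqrt hA0, Real.sq_sqrt hB0]
  rw [e, norm_mul, mul_pow, im_gaussStieltjes hw, im_gaussStieltjes hv,
    mul_div_cancel_left₀ _ hw.ne', mul_div_cancel_left₀ _ hv.ne']
  gcongr

lemma isFreeConvSolution_iff (z m : ℂ) :
    IsFreeConvSolution z m ↔ 0 ≤ m.im ∧ m = gaussStieltjes (z + m) := by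
  simp only [IsFreeConvSolution, gaussStieltjes, sub_sub]

/-- At every point of the upper half plane the functional equation has exactly one solution in
the closed upper half plane. -/
theorem existsUnique_freeConvSolution {z : ℂ} (hz : 0 < z.im) :
    ∃! m, IsFreeConvSolution z m := by
  simp only [isFreeConvSolution_iff]
  have key : ∀ m n : ℂ, 0 ≤ m.im → 0 ≤ n.im →
      ‖gaussStieltjes (z + m) - gaussStieltjes (z + n)‖ ^ 2 ≤ ‖m - n‖ ^ 2 *
        (((gaussStieltjes (z + m)).im / (z.im + m.im)) *
          ((gaussStieltjes (z + n)).im / (z.im + n.im))) := by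
    intro m n hm hn
    have := norm_gaussStieltjes_sub_sq_le (w := z + m) (v := z + n)
      (by rw [Complex.add_im]; linarith) (by rw [Complex.add_im]; linarith)
    simpa [Complex.add_im] using this
  have hfrac : ∀ t : ℝ, 0 ≤ t → t / (z.im + t) < 1 := fun t ht => by
    rw [div_lt_one (by linarith)]; linarith
  have him : ∀ m : ℂ, 0 ≤ m.im → 0 ≤ (gaussStieltjes (z + m)).im := fun m hm =>
    gaussStieltjes_im_nonneg (by rw [Complex.add_im]; linarith)
  have hbd : ∀ m : ℂ, 0 ≤ m.im → ‖gaussStieltjes (z + m)‖ ≤ 1 / z.im := fun m hm =>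
    (norm_gaussStieltjes_le (by rw [Complex.add_im]; linarith)).trans
      (one_div_le_one_div_of_le hz (by rw [Complex.add_im]; linarith))
  have hprod : ∀ s t : ℝ, 0 ≤ s → 0 ≤ t → s / (z.im + s) * (t / (z.im + t)) < 1 := by
    intro s t hs ht
    have h1 := hfrac s hs
    have h2 := hfrac t ht
    have h3 : 0 ≤ s / (z.im + s) := by positivity
    have h4 : 0 ≤ t / (z.im + t) := by positivity
    nlinarith
  obtain ⟨m, ⟨hm0, hmb⟩, hmin⟩ : ∃ m ∈ {m : ℂ | 0 ≤ m.im ∧ ‖m‖ ≤ 1 / z.im},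
      IsMinOn (fun m : ℂ => ‖m - gaussStieltjes (z + m)‖ ^ 2 /
        ((z.im + m.im) * (z.im + (gaussStieltjes (z + m)).im)))
        {m : ℂ | 0 ≤ m.im ∧ ‖m‖ ≤ 1 / z.im} m := by
    have hK : IsCompact {m : ℂ | 0 ≤ m.im ∧ ‖m‖ ≤ 1 / z.im} := by
      refine Metric.isCompact_of_isClosed_isBounded ?_ ?_
      · exact (isClosed_le continuous_const Complex.continuous_im).inter
          (isClosed_le continuous_norm continuous_const)
      · exact (Metric.isBounded_closedBall (x := (0 : ℂ)) (r := 1 / z.im)).subset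
          fun m hm => by simpa using hm.2
    have hc : ContinuousOn (fun m : ℂ => gaussStieltjes (z + m))
        {m : ℂ | 0 ≤ m.im ∧ ‖m‖ ≤ 1 / z.im} := by
      refine LipschitzOnWith.continuousOn (K := (1 / z.im ^ 2).toNNReal) ?_
      refine LipschitzOnWith.of_dist_le_mul fun m hm n hn => ?_
      rw [dist_eq_norm, dist_eq_norm, Real.coe_toNNReal _ (by positivity)]
      have q1 : ∀ m : ℂ, 0 ≤ m.im →
          (gaussStieltjes (z + m)).im / (z.im + m.im) ≤ 1 / z.im ^ 2 := by
        intro m hm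
        have : (gaussStieltjes (z + m)).im ≤ 1 / z.im :=
          ((le_abs_self _).trans (Complex.abs_im_le_norm _)).trans (hbd m hm)
        calc _ ≤ (1 / z.im) / z.im := by gcongr; linarith
          _ = 1 / z.im ^ 2 := by field_simp
      refine le_of_sq_le_sq ?_ (by positivity)
      refine (key m n hm.1 hn.1).trans ?_
      have a1 := q1 m hm.1
      have a2 := q1 n hn.1
      have b2 : 0 ≤ (gaussStieltjes (z + n)).im / (z.im + n.im) :=
        div_nonneg (him n hn.1) (by linarith [hn.1])
      calc _ ≤ ‖m - n‖ ^ 2 * (1 / z.im ^ 2 * (1 / z.im ^ 2)) := by gcongr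
        _ = _ := by ring
    refine hK.exists_isMinOn ⟨0, by simp [hz.le]⟩ ?_
    refine ContinuousOn.div ((continuousOn_id.sub hc).norm.pow 2) ?_ ?_
    · exact (continuousOn_const.add Complex.continuous_im.continuousOn).mul
        (continuousOn_const.add (Complex.continuous_im.comp_continuousOn hc))
    · intro m hm
      have h1 := him m hm.1
      have h2 := hm.1
      positivity
  have hfix : m = gaussStieltjes (z + m) := by
    by_contra hne
    set n := gaussStieltjes (z + m) with hn
    have hn0 : 0 ≤ n.im := him m hm0
    have hle := hmin (show n ∈ _ from ⟨hn0, hbd m hm0⟩)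
    simp only [Set.mem_ofPred_eq] at hle
    set p := gaussStieltjes (z + n) with hp
    have hp0 : 0 ≤ p.im := him n hn0
    have hk := key m n hm0 hn0
    rw [← hn, ← hp] at hk
    have hpos : 0 < ‖m - n‖ ^ 2 / ((z.im + m.im) * (z.im + n.im)) := by
      have : 0 < ‖m - n‖ := norm_pos_iff.2 (sub_ne_zero.2 hne)
      positivity
    have hlt : ‖n - p‖ ^ 2 / ((z.im + n.im) * (z.im + p.im)) ≤
        ‖m - n‖ ^ 2 / ((z.im + m.im) * (z.im + n.im)) *
          (n.im / (z.im + n.im) * (p.im / (z.im + p.im))) := by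
      calc _ ≤ ‖m - n‖ ^ 2 * (n.im / (z.im + m.im) * (p.im / (z.im + n.im))) /
            ((z.im + n.im) * (z.im + p.im)) := by gcongr
        _ = _ := by field_simp
    have := hprod n.im p.im hn0 hp0
    nlinarith
  refine ⟨m, ⟨hm0, hfix⟩, ?_⟩
  rintro n ⟨hn0, hn⟩
  by_contra hne
  have hk := key n m hn0 hm0
  rw [← hfix, ← hn] at hk
  have := hprod n.im m.im hn0 hm0
  have hpos : 0 < ‖n - m‖ ^ 2 := by
    have : 0 < ‖n - m‖ := norm_pos_iff.2 (sub_ne_zero.2 hne)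
    positivity
  nlinarith

/-- `m_fc(z)` for `Im z > 0`: the unique solution with nonnegative imaginary part of
`m = ∫ ρ_G(x) / (x - z - m) dx` (and `0` elsewhere). It is the Stieltjes transform of the free
convolution of the semicircle law and the standard Gaussian law. Uniqueness holds pointwise in
`z`, so no normalisation at infinity is needed to single out the solution. -/
def mfc (z : ℂ) : ℂ :=
  if hz : 0 < z.im then (existsUnique_freeConvSolution hz).choose else 0

theorem mfc_spec {z : ℂ} (hz : 0 < z.im) : IsFreeConvSolution z (mfc z) := by
  rw [mfc, dif_pos hz]
  exact (existsUnique_freeConvSolution hz).choose_spec.1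

/-! ### Random Laplacian-type matrices -/

/-- `H` is a random Laplacian-type matrix of size `N + 1`, with sparsity parameter `q`, sparsity
exponent `β` and moment constants `c`. For `i ≠ j` the entry `H i j` is `h_ij`. -/
structure IsRandomLaplacianType {Ω : Type*} [MeasurableSpace Ω] (N : ℕ) (β q : ℝ) (c : ℕ → ℝ)
    (μ : Measure Ω) (H : Ω → Matrix (Fin (N + 1)) (Fin (N + 1)) ℝ) : Prop where
  measurable : ∀ i j, Measurable fun ω => H ω i j
  symm : ∀ ω i j, H ω i j = H ω j i
  diag : ∀ ω i, H ω i i = -∑ k ∈ Finset.univ.erase i, H ω i k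
  indep : iIndepFun (fun (p : {p : Fin (N + 1) × Fin (N + 1) // p.1 < p.2}) ω =>
    H ω p.1.1 p.1.2) μ
  sq_integrable : ∀ i j, i ≠ j → Integrable (fun ω => H ω i j ^ 2) μ
  mean_zero : ∀ i j, i ≠ j → ∫ ω, H ω i j ∂μ = 0
  variance_eq : ∀ i j, i ≠ j → ∫ ω, H ω i j ^ 2 ∂μ = 1 / (N : ℝ)
  moment_integrable : ∀ i j, i ≠ j → ∀ p : ℕ, 3 ≤ p → Integrable (fun ω => |H ω i j| ^ p) μ
  moment_le : ∀ i j, i ≠ j → ∀ p : ℕ, 3 ≤ p →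
    ∫ ω, |H ω i j| ^ p ∂μ ≤ c p / (q ^ (p - 2) * (N : ℝ))
  le_q : (N : ℝ) ^ β ≤ q
  q_le : q ≤ (N : ℝ) ^ (1 / 2 : ℝ)

/-- The resolvent `G(z) = (H - z)⁻¹` of a real matrix. -/
def resolvent {n : ℕ} (H : Matrix (Fin n) (Fin n) ℝ) (z : ℂ) : Matrix (Fin n) (Fin n) ℂ :=
  (H.map (fun x : ℝ => (x : ℂ)) - z • (1 : Matrix (Fin n) (Fin n) ℂ))⁻¹

/-- `m_N(z) = N⁻¹ Tr G(z)`; the matrix has size `N + 1`, the normalisation is `1 / N`. -/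
def mN {N : ℕ} (H : Matrix (Fin (N + 1)) (Fin (N + 1)) ℝ) (z : ℂ) : ℂ :=
  (1 / (N : ℂ)) * (resolvent H z).trace

/-- `ξ = N ^ ν`. -/
def xi (N : ℕ) (ν : ℝ) : ℝ := (N : ℝ) ^ ν

/-- The control parameter `Ψ(z) = 1 / q + 1 / (N η) ^ (1 / 2)`, `η = Im z`. -/
def Psi (N : ℕ) (q : ℝ) (z : ℂ) : ℝ := 1 / q + 1 / ((N : ℝ) * z.im) ^ (1 / 2 : ℝ)

/-- The first part of the spectral domain. -/
def domain0 (N : ℕ) (ν L : ℝ) : Set ℂ :=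
  {z | |z.re| ≤ 2 * xi N ν + L ∧ 2 ≤ z.im ∧ z.im ≤ L}

/-- The second part of the spectral domain. -/
def domain1 (N : ℕ) (ν L : ℝ) : Set ℂ :=
  {z | |z.re| ≤ L ∧ xi N ν ^ 3 / (N : ℝ) ≤ z.im ∧ z.im ≤ 2}

/-- The third part of the spectral domain. -/
def domain2 (N : ℕ) (ν L : ℝ) : Set ℂ :=
  {z | 2 * xi N ν ≤ |z.re| ∧ |z.re| ≤ 2 * xi N ν + L ∧
    xi N ν ^ 3 / (N : ℝ) ≤ z.im ∧ z.im ≤ 2}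

/-- The spectral domain `D_L`. -/
def spectralDomain (N : ℕ) (ν L : ℝ) : Set ℂ :=
  domain0 N ν L ∪ domain1 N ν L ∪ domain2 N ν L

end LaplacianLocalLaw

end

/-! All errors are measured in powers of T = `scale P N` = N^(1/P), where P depends only on β and ν
and is so large that T^100 is at most both q and N^ν. Each absolute constant costs one more factor
T, and ξ = N^ν pays for all of them.

The central quantity is the remainder R_ab = δ_ab + (z - H_aa + m_N) G_ab. If R is small, then G is
nearly diagonal with entries 1 / (H_aa - z - m_N), and averaging the diagonal shows that m_N nearly
solves m = S(z + m), where S(w) is the average of 1 / (H_aa - w). Three facts are needed: R is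
small, S is close to the Gaussian Stieltjes transform, and the equation m = S(z + m) is stable.

Smallness of R. The defining equation of G gives R_ij = ∑_k h_ik G_kj + m_N G_ij. The diagonal of H
depends on all the weights in its row, so no minor of H is independent of that row. Instead one edge
is removed at a time: `cut H i k` is a rank-one perturbation of H along e_i - e_k and is independent
of h_ik. Expanding in h_ik, the first order has mean zero, and the second order, summed over k with
variance 1/N, cancels m_N G_ij up to averages of off-diagonal entries, which the Ward identity makes
small. The abstract moment estimate is `integral_norm_pow_le_of_decoupling`; its deterministic input
is `Tame.error_le_edgeError` and `Tame.drift_add_sum_le`. The resulting bound for the moments of the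
largest entry of R contains that entry again, but to a smaller power or with a small factor, so it
closes (`whp_remainderNorm_le`). The a priori input is |G_ab| ≤ T².

The diagonal entries. H_ii is a sum of independent centred weights of total variance one, and
different entries share only one weight. The same decoupling estimate, applied to the average of
f'(H_ii) - H_ii f(H_ii), shows that Stein's equation holds on average up to a power of T over q
(`whp_steinAvg_le`). An explicit Stein solution for 1 / (x - w) turns this into S(w) ≈
`gaussStieltjes w` when Im w is bounded below. When Re w is large and Im w may be tiny, a high-order
finite difference in the imaginary direction is negligible, so the value at w is determined by the
values at w + i, w + 2i, and so on (`whp_diagStieltjes_sub_le_of_le_re`).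

Stability. Both m_N and m_fc nearly solve m = S(z + m). Subtracting gives (m_N - m_fc)(1 - X) =
small, where X averages 1 / ((H_aa - w₁)(H_aa - w₂)). Either z is so far away that |X| ≤ 1/2, or Re
X stays below 1 by a negative power of T, because (with p and r the two factors of a summand) |p -
conj r| is bounded below when the imaginary parts of w₁ and w₂ are (`resolvent_close_of_remainder`).

The a priori bounds come from a descent in Im z. They are trivial for Im z ≥ 2, and dividing Im z by
T enlarges the entries of G by at most 1 + T and shrinks Im m_N by at most 4T. Hence the law at one
height supplies the input at the next, and P steps cover the whole range
(`whp_closeEvent_stableSet`). Every step compares two deterministic points, so no continuity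
argument is needed; a polynomial net makes the bounds uniform at the very end. -/

noncomputable section
namespace LaplacianLocalLaw

/-! ### Resolvents of real symmetric matrices -/

variable {n : ℕ}

/-- The shifted complexified matrix `A - z`. -/
def shifted (A : Matrix (Fin n) (Fin n) ℝ) (z : ℂ) : Matrix (Fin n) (Fin n) ℂ :=
  A.map (fun x : ℝ => (x : ℂ)) - z • (1 : Matrix (Fin n) (Fin n) ℂ)

lemma resolvent_eq (A : Matrix (Fin n) (Fin n) ℝ) (z : ℂ) : resolvent A z = (shifted A z)⁻¹ := rfl

lemma shifted_mulVec (A : Matrix (Fin n) (Fin n) ℝ) (z : ℂ) (y : Fin n → ℂ) (a : Fin n) :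
    (shifted A z).mulVec y a = ∑ b, (A a b : ℂ) * y b - z * y a := by
  rw [shifted, Matrix.sub_mulVec, Matrix.smul_mulVec, Matrix.one_mulVec]
  simp [Matrix.mulVec, dotProduct]

/-- A real symmetric matrix has a real quadratic form on complex vectors, so only the shift by z
contributes to the imaginary part. -/
lemma im_quadratic_form {A : Matrix (Fin n) (Fin n) ℝ} (hA : ∀ i j, A i j = A j i) (z : ℂ)
    (y : Fin n → ℂ) :
    (∑ a, (starRingEnd ℂ) (y a) * (shifted A z).mulVec y a).im = - (z.im * ∑ a, ‖y a‖ ^ 2) := by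
  have h1 : ∑ a, (starRingEnd ℂ) (y a) * (shifted A z).mulVec y a =
      ∑ a, ∑ b, (starRingEnd ℂ) (y a) * ((A a b : ℂ) * y b) - z * ((∑ a, ‖y a‖ ^ 2 : ℝ) : ℂ) := by
    simp only [shifted_mulVec, mul_sub, Finset.sum_sub_distrib, Finset.mul_sum]
    congr 1
    push_cast
    rw [Finset.mul_sum]
    refine Finset.sum_congr rfl fun a _ => ?_
    rw [← Complex.conj_mul']
    ring
  have h2 : (∑ a, ∑ b, (starRingEnd ℂ) (y a) * ((A a b : ℂ) * y b)).im = 0 := by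
    rw [← Complex.conj_eq_iff_im]
    simp only [map_sum, map_mul, Complex.conj_conj, Complex.conj_ofReal]
    rw [Finset.sum_comm]
    refine Finset.sum_congr rfl fun a _ => Finset.sum_congr rfl fun b _ => ?_
    rw [hA]; ring
  rw [h1, Complex.sub_im, h2, Complex.im_mul_ofReal]
  ring

/-- Coercivity: the imaginary part of the quadratic form has modulus Im z times the squared norm,
and the Cauchy-Schwarz inequality does the rest. It yields invertibility and the operator bound 1 /
Im z without the spectral theorem. -/
lemma sq_mul_sum_sq_le {A : Matrix (Fin n) (Fin n) ℝ} (hA : ∀ i j, A i j = A j i) {z : ℂ}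
    (hz : 0 < z.im) (y : Fin n → ℂ) :
    z.im ^ 2 * ∑ a, ‖y a‖ ^ 2 ≤ ∑ a, ‖(shifted A z).mulVec y a‖ ^ 2 := by
  set x := (shifted A z).mulVec y with hx
  have h := im_quadratic_form hA z y
  rw [← hx] at h
  have h1 : z.im * ∑ a, ‖y a‖ ^ 2 ≤ ∑ a, ‖y a‖ * ‖x a‖ := by
    calc z.im * ∑ a, ‖y a‖ ^ 2 = -(∑ a, (starRingEnd ℂ) (y a) * x a).im := by rw [h]; ring
      _ ≤ ‖∑ a, (starRingEnd ℂ) (y a) * x a‖ :=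
          (neg_le_abs _).trans (Complex.abs_im_le_norm _)
      _ ≤ ∑ a, ‖(starRingEnd ℂ) (y a) * x a‖ := norm_sum_le _ _
      _ = ∑ a, ‖y a‖ * ‖x a‖ := by simp
  have h2 := Finset.sum_mul_sq_le_sq_mul_sq Finset.univ (fun a => ‖y a‖) (fun a => ‖x a‖)
  set S := ∑ a, ‖y a‖ ^ 2
  set X := ∑ a, ‖x a‖ ^ 2
  have hS : 0 ≤ S := Finset.sum_nonneg fun a _ => by positivity
  have hX : 0 ≤ X := Finset.sum_nonneg fun a _ => by positivity
  have h3 : (z.im * S) ^ 2 ≤ S * X := (pow_le_pow_left₀ (by positivity) h1 2).trans h2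
  rcases hS.eq_or_lt with h0 | h0
  · rw [← h0]; simpa using hX
  · have : S * (z.im ^ 2 * S) ≤ S * X := by nlinarith
    exact le_of_mul_le_mul_left this h0

lemma isUnit_shifted {A : Matrix (Fin n) (Fin n) ℝ} (hA : ∀ i j, A i j = A j i) {z : ℂ}
    (hz : 0 < z.im) : IsUnit (shifted A z) := by
  rw [← Matrix.mulVec_injective_iff_isUnit]
  intro x y hxy
  have h := sq_mul_sum_sq_le hA hz (x - y)
  have h0 : (shifted A z).mulVec (x - y) = 0 := by
    rw [Matrix.mulVec_sub]; exact sub_eq_zero.2 hxy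
  rw [h0] at h
  simp only [Pi.zero_apply, norm_zero, ne_eq, OfNat.ofNat_ne_zero, not_false_eq_true, zero_pow,
    Finset.sum_const_zero] at h
  have h1 : ∑ a, ‖(x - y) a‖ ^ 2 = 0 :=
    le_antisymm (by by_contra hc; push Not at hc; have := mul_pos (pow_pos hz 2) hc; linarith)
      (Finset.sum_nonneg fun a _ => by positivity)
  rw [Finset.sum_eq_zero_iff_of_nonneg (fun a _ => by positivity)] at h1
  ext a
  have := h1 a (Finset.mem_univ a)
  simpa [sub_eq_zero] using this

lemma isUnit_det_shifted {A : Matrix (Fin n) (Fin n) ℝ} (hA : ∀ i j, A i j = A j i) {z : ℂ}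
    (hz : 0 < z.im) : IsUnit (shifted A z).det :=
  (Matrix.isUnit_iff_isUnit_det _).1 (isUnit_shifted hA hz)

lemma shifted_mul_resolvent {A : Matrix (Fin n) (Fin n) ℝ} (hA : ∀ i j, A i j = A j i) {z : ℂ}
    (hz : 0 < z.im) : shifted A z * resolvent A z = 1 :=
  Matrix.mul_nonsing_inv _ (isUnit_det_shifted hA hz)

lemma resolvent_mul_shifted {A : Matrix (Fin n) (Fin n) ℝ} (hA : ∀ i j, A i j = A j i) {z : ℂ}
    (hz : 0 < z.im) : resolvent A z * shifted A z = 1 :=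
  Matrix.nonsing_inv_mul _ (isUnit_det_shifted hA hz)

lemma resolvent_symm {A : Matrix (Fin n) (Fin n) ℝ} (hA : ∀ i j, A i j = A j i) (z : ℂ)
    (i j : Fin n) : resolvent A z i j = resolvent A z j i := by
  have h : (shifted A z).transpose = shifted A z := by
    ext a b
    simp only [shifted, Matrix.transpose_apply, Matrix.sub_apply, Matrix.map_apply,
      Matrix.smul_apply, Matrix.one_apply, hA a b]
    simp [eq_comm]
  have : (resolvent A z).transpose = resolvent A z := by
    rw [resolvent_eq, Matrix.transpose_nonsing_inv, h]
  exact congrFun (congrFun this j) i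

/-- One identity covers both changes that are needed later: of the spectral parameter with the
matrix fixed, and of the matrix with the spectral parameter fixed. -/
lemma resolvent_eq_add_mul {A B : Matrix (Fin n) (Fin n) ℝ} (hA : ∀ i j, A i j = A j i)
    (hB : ∀ i j, B i j = B j i) {z w : ℂ} (hz : 0 < z.im) (hw : 0 < w.im) :
    resolvent A z = resolvent B w +
      resolvent B w * (shifted B w - shifted A z) * resolvent A z := by
  rw [mul_sub, sub_mul, resolvent_mul_shifted hB hw, mul_assoc, shifted_mul_resolvent hA hz]
  simp

/-- The first resolvent identity. -/
lemma resolvent_sub_resolvent {A : Matrix (Fin n) (Fin n) ℝ} (hA : ∀ i j, A i j = A j i)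
    {z w : ℂ} (hz : 0 < z.im) (hw : 0 < w.im) (a b : Fin n) :
    resolvent A z a b = resolvent A w a b +
      (z - w) * ∑ c, resolvent A w a c * resolvent A z c b := by
  have h := resolvent_eq_add_mul hA hA hz hw
  have h1 : shifted A w - shifted A z = (z - w) • (1 : Matrix (Fin n) (Fin n) ℂ) := by
    simp [shifted, sub_smul]
  rw [h1] at h
  conv_lhs => rw [h]
  simp [Matrix.add_apply, Matrix.mul_apply]

/-- The entrywise conjugate of G is the resolvent at the conjugate of z. The resolvent identity
between these two points, read on the diagonal, is the claim. It is the only source of smallness for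
averages of off-diagonal entries. -/
lemma ward_identity {A : Matrix (Fin n) (Fin n) ℝ} (hA : ∀ i j, A i j = A j i) {z : ℂ}
    (hz : 0 < z.im) (a : Fin n) :
    ∑ c, ‖resolvent A z a c‖ ^ 2 = (resolvent A z a a).im / z.im := by
  set G := resolvent A z with hG
  set Gb := G.map (starRingEnd ℂ) with hGb
  have hb : shifted A ((starRingEnd ℂ) z) * Gb = 1 := by
    have h := congrArg (fun M => M.map (starRingEnd ℂ)) (shifted_mul_resolvent hA hz)
    simp only [Matrix.map_mul] at h
    have e : (shifted A z).map (starRingEnd ℂ) = shifted A ((starRingEnd ℂ) z) := by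
      ext i j
      by_cases hij : i = j <;> simp [shifted, Matrix.map_apply, hij]
    rw [e] at h
    rw [h]
    exact Matrix.map_one _ (map_zero _) (map_one _)
  have h1 : G = Gb + G * (shifted A ((starRingEnd ℂ) z) - shifted A z) * Gb := by
    rw [mul_sub, sub_mul, mul_assoc, hb, hG, resolvent_mul_shifted hA hz]; simp
  have h2 : shifted A ((starRingEnd ℂ) z) - shifted A z =
      (z - (starRingEnd ℂ) z) • (1 : Matrix (Fin n) (Fin n) ℂ) := by
    simp [shifted, sub_smul]
  have h3 := congrFun (congrFun h1 a) a
  rw [h2] at h3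
  simp only [Matrix.add_apply, Matrix.mul_smul, mul_one, Matrix.smul_mul, Matrix.smul_apply,
    Matrix.mul_apply, smul_eq_mul, hGb, Matrix.map_apply] at h3
  have h4 : ∑ c, G a c * (starRingEnd ℂ) (G c a) = ((∑ c, ‖G a c‖ ^ 2 : ℝ) : ℂ) := by
    push_cast
    refine Finset.sum_congr rfl fun c _ => ?_
    rw [hG, resolvent_symm hA z c a, Complex.mul_conj']
  rw [h4, Complex.sub_conj] at h3
  have h5 := congrArg Complex.im h3
  simp only [Complex.add_im, Complex.conj_im, Complex.im_mul_ofReal] at h5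
  rw [eq_div_iff hz.ne']
  have h6 : (((2 * z.im : ℝ) : ℂ) * Complex.I).im = 2 * z.im := by simp
  rw [h6] at h5
  linarith

lemma im_resolvent_nonneg {A : Matrix (Fin n) (Fin n) ℝ} (hA : ∀ i j, A i j = A j i) {z : ℂ}
    (hz : 0 < z.im) (a : Fin n) : 0 ≤ (resolvent A z a a).im := by
  have h := ward_identity hA hz a
  rw [eq_div_iff hz.ne'] at h
  rw [← h]
  exact mul_nonneg (Finset.sum_nonneg fun c _ => by positivity) hz.le

lemma sum_sq_resolvent_le {A : Matrix (Fin n) (Fin n) ℝ} (hA : ∀ i j, A i j = A j i) {z : ℂ}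
    (hz : 0 < z.im) {Γ : ℝ} (hΓ : ∀ a b, ‖resolvent A z a b‖ ≤ Γ) (a : Fin n) :
    ∑ c, ‖resolvent A z a c‖ ^ 2 ≤ Γ / z.im := by
  rw [ward_identity hA hz]
  gcongr
  exact (le_abs_self _).trans ((Complex.abs_im_le_norm _).trans (hΓ a a))

/-- The Ward identity gives |G_ab|² ≤ |G_aa| / Im z. Taking b = a bounds the diagonal, which then
bounds every entry. -/
lemma norm_resolvent_le {A : Matrix (Fin n) (Fin n) ℝ} (hA : ∀ i j, A i j = A j i) {z : ℂ}
    (hz : 0 < z.im) (a b : Fin n) : ‖resolvent A z a b‖ ≤ 1 / z.im := by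
  have hle : ∀ a b, ‖resolvent A z a b‖ ^ 2 ≤ ‖resolvent A z a a‖ / z.im := fun a b => by
    calc _ ≤ ∑ c, ‖resolvent A z a c‖ ^ 2 :=
          Finset.single_le_sum (f := fun c => ‖resolvent A z a c‖ ^ 2)
            (fun c _ => by positivity) (Finset.mem_univ b)
      _ = (resolvent A z a a).im / z.im := ward_identity hA hz a
      _ ≤ _ := by
        gcongr
        exact (le_abs_self _).trans (Complex.abs_im_le_norm _)
  have h1 : ‖resolvent A z a a‖ ≤ 1 / z.im := by
    have h := hle a a
    rcases (norm_nonneg (resolvent A z a a)).eq_or_lt with h0 | h0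
    · rw [← h0]; positivity
    · rw [le_div_iff₀ hz] at h ⊢
      nlinarith
  refine le_of_sq_le_sq ((hle a b).trans ?_) (by positivity)
  calc _ ≤ (1 / z.im) / z.im := by gcongr
    _ = _ := by field_simp

/-! ### Moving the spectral parameter vertically -/

/-- The Euclidean norm of a column of the resolvent. -/
def colNorm (A : Matrix (Fin n) (Fin n) ℝ) (z : ℂ) (a : Fin n) : ℝ :=
  ‖WithLp.toLp 2 (fun c => resolvent A z c a)‖

lemma colNorm_sq {A : Matrix (Fin n) (Fin n) ℝ} (hA : ∀ i j, A i j = A j i) {z : ℂ}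
    (hz : 0 < z.im) (a : Fin n) : colNorm A z a ^ 2 = (resolvent A z a a).im / z.im := by
  rw [colNorm, EuclideanSpace.norm_sq_eq, ← ward_identity hA hz a]
  exact Finset.sum_congr rfl fun c _ => by rw [resolvent_symm hA]

lemma norm_toLp_resolvent_mulVec_le {A : Matrix (Fin n) (Fin n) ℝ} (hA : ∀ i j, A i j = A j i)
    {z : ℂ} (hz : 0 < z.im) (x : Fin n → ℂ) :
    z.im * ‖WithLp.toLp 2 ((resolvent A z).mulVec x)‖ ≤ ‖WithLp.toLp 2 x‖ := by
  refine le_of_sq_le_sq ?_ (norm_nonneg _)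
  have h := sq_mul_sum_sq_le hA hz ((resolvent A z).mulVec x)
  rw [Matrix.mulVec_mulVec, shifted_mul_resolvent hA hz, Matrix.one_mulVec] at h
  rw [mul_pow, EuclideanSpace.norm_sq_eq, EuclideanSpace.norm_sq_eq]
  exact h

/-- A column of G(z) equals the column of G(w) plus (z - w) G(w) applied to the column of G(z), and
G(w) has operator norm at most 1 / Im w. -/
lemma colNorm_le_add {A : Matrix (Fin n) (Fin n) ℝ} (hA : ∀ i j, A i j = A j i) {z w : ℂ}
    (hz : 0 < z.im) (hw : 0 < w.im) (a : Fin n) :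
    colNorm A z a ≤ colNorm A w a + ‖z - w‖ * (colNorm A z a / w.im) := by
  have e : (fun c => resolvent A z c a) = (fun c => resolvent A w c a) +
      (z - w) • (resolvent A w).mulVec (fun c => resolvent A z c a) := by
    ext c
    simp only [Pi.add_apply, Pi.smul_apply, smul_eq_mul]
    exact resolvent_sub_resolvent hA hz hw c a
  have h1 : colNorm A z a ≤ colNorm A w a + ‖z - w‖ *
      ‖WithLp.toLp 2 ((resolvent A w).mulVec (fun c => resolvent A z c a))‖ := by
    conv_lhs => rw [colNorm, e, WithLp.toLp_add, WithLp.toLp_smul]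
    refine (norm_add_le _ _).trans ?_
    rw [norm_smul, colNorm]
  refine h1.trans ?_
  gcongr
  rw [le_div_iff₀ hw, mul_comm]
  exact norm_toLp_resolvent_mulVec_le hA hw _

lemma norm_sub_of_re_eq {z w : ℂ} (h : z.re = w.re) : ‖z - w‖ = |z.im - w.im| := by
  have : z - w = ((z.im - w.im : ℝ) : ℂ) * Complex.I := by
    apply Complex.ext <;> simp [h]
  rw [this, norm_mul, Complex.norm_I, mul_one, Complex.norm_real, Real.norm_eq_abs]

lemma colNorm_nonneg (A : Matrix (Fin n) (Fin n) ℝ) (z : ℂ) (a : Fin n) : 0 ≤ colNorm A z a :=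
  norm_nonneg _

/-- Along a vertical line |z - w| is the difference of the imaginary parts, so the triangle
inequality rearranges into monotonicity of Im z times the column norm. -/
lemma colNorm_le_of_im_le {A : Matrix (Fin n) (Fin n) ℝ} (hA : ∀ i j, A i j = A j i) {z w : ℂ}
    (hz : 0 < z.im) (hzw : z.im ≤ w.im) (hre : z.re = w.re) (a : Fin n) :
    z.im * colNorm A z a ≤ w.im * colNorm A w a := by
  have hw : 0 < w.im := hz.trans_le hzw
  have h := colNorm_le_add hA hz hw a
  rw [norm_sub_of_re_eq hre, abs_sub_comm, abs_of_nonneg (by linarith)] at h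
  have h2 : w.im * colNorm A z a ≤ w.im * colNorm A w a + (w.im - z.im) * colNorm A z a := by
    calc _ ≤ w.im * (colNorm A w a + (w.im - z.im) * (colNorm A z a / w.im)) := by gcongr
      _ = _ := by field_simp
  linarith

/-- Here the resolvent at the higher point multiplies the error; its norm times the distance of the
two points is at most 1, so the column norm at most doubles on the way up. -/
lemma colNorm_le_two_mul {A : Matrix (Fin n) (Fin n) ℝ} (hA : ∀ i j, A i j = A j i) {z w : ℂ}
    (hz : 0 < z.im) (hzw : z.im ≤ w.im) (hre : z.re = w.re) (a : Fin n) :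
    colNorm A w a ≤ 2 * colNorm A z a := by
  have hw : 0 < w.im := hz.trans_le hzw
  have e : (fun c => resolvent A w c a) = (fun c => resolvent A z c a) +
      (w - z) • (resolvent A w).mulVec (fun c => resolvent A z c a) := by
    ext c
    simp only [Pi.add_apply, Pi.smul_apply, smul_eq_mul, Matrix.mulVec, dotProduct]
    rw [resolvent_sub_resolvent hA hz hw c a]
    ring
  have h1 : colNorm A w a ≤ colNorm A z a + ‖w - z‖ *
      ‖WithLp.toLp 2 ((resolvent A w).mulVec (fun c => resolvent A z c a))‖ := by
    conv_lhs => rw [colNorm, e, WithLp.toLp_add, WithLp.toLp_smul]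
    refine (norm_add_le _ _).trans ?_
    rw [norm_smul, colNorm]
  have h2 := norm_toLp_resolvent_mulVec_le hA hw (fun c => resolvent A z c a)
  rw [norm_sub_of_re_eq hre.symm, abs_of_nonneg (by linarith)] at h1
  have h3 : (w.im - z.im) *
      ‖WithLp.toLp 2 ((resolvent A w).mulVec (fun c => resolvent A z c a))‖ ≤ colNorm A z a := by
    refine le_trans ?_ h2
    gcongr
    linarith
  linarith

/-- Lowering the imaginary part from `w` to `z` increases the entries of the resolvent by at most
a factor `1 + Im w / Im z`. -/
lemma norm_resolvent_le_of_im_le {A : Matrix (Fin n) (Fin n) ℝ} (hA : ∀ i j, A i j = A j i)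
    {z w : ℂ} (hz : 0 < z.im) (hzw : z.im ≤ w.im) (hre : z.re = w.re) {Γ : ℝ}
    (hΓ : ∀ a b, ‖resolvent A w a b‖ ≤ Γ) (a b : Fin n) :
    ‖resolvent A z a b‖ ≤ (1 + w.im / z.im) * Γ := by
  have hw : 0 < w.im := hz.trans_le hzw
  have hΓ0 : 0 ≤ Γ := (norm_nonneg _).trans (hΓ a b)
  -- By the Ward identity Im w times the squared column norm is Im G_aa, which is at most Γ.
  -- Bounding the columns at w this way and moving one column down to z costs only the ratio of the
  -- imaginary parts.
  have hcol : ∀ a, w.im * colNorm A w a ^ 2 ≤ Γ := fun a => by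
    rw [colNorm_sq hA hw, mul_div_cancel₀ _ hw.ne']
    exact (le_abs_self _).trans ((Complex.abs_im_le_norm _).trans (hΓ a a))
  have cs : ‖∑ c, resolvent A w a c * resolvent A z c b‖ ≤ colNorm A w a * colNorm A z b := by
    refine (norm_sum_le _ _).trans ?_
    refine le_of_sq_le_sq ?_ (mul_nonneg (colNorm_nonneg _ _ _) (colNorm_nonneg _ _ _))
    simp only [norm_mul]
    refine (Finset.sum_mul_sq_le_sq_mul_sq _ _ _).trans (le_of_eq ?_)
    rw [mul_pow, colNorm, colNorm, EuclideanSpace.norm_sq_eq, EuclideanSpace.norm_sq_eq]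
    congr 1
    exact Finset.sum_congr rfl fun c _ => by rw [resolvent_symm hA]
  rw [resolvent_sub_resolvent hA hz hw a b]
  refine (norm_add_le _ _).trans ?_
  rw [norm_mul, norm_sub_of_re_eq hre, abs_sub_comm, abs_of_nonneg (by linarith), add_mul, one_mul]
  refine add_le_add (hΓ a b) ?_
  have h1 : (w.im - z.im) * ‖∑ c, resolvent A w a c * resolvent A z c b‖ ≤
      w.im * (colNorm A w a * colNorm A z b) := by
    have := colNorm_nonneg A w a
    have := colNorm_nonneg A z b
    gcongr
    linarith
  refine h1.trans ?_
  have h2 := colNorm_le_of_im_le hA hz hzw hre b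
  have h3 : colNorm A z b ≤ w.im / z.im * colNorm A w b := by
    rw [div_mul_eq_mul_div, le_div_iff₀ hz]; linarith
  have h4 : w.im * (colNorm A w a * colNorm A w b) ≤ Γ := by
    have e1 := hcol a
    have e2 := hcol b
    nlinarith [sq_nonneg (colNorm A w a - colNorm A w b)]
  have := colNorm_nonneg A w a
  calc w.im * (colNorm A w a * colNorm A z b)
      ≤ w.im * (colNorm A w a * (w.im / z.im * colNorm A w b)) := by gcongr
    _ = w.im / z.im * (w.im * (colNorm A w a * colNorm A w b)) := by ring
    _ ≤ w.im / z.im * Γ := by gcongr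

/-- Im G_aa is Im z times a squared column norm, and column norms at most double upwards; the 4 is
the square of that 2. In the descent it keeps Im m_N from collapsing. -/
lemma im_resolvent_ge_of_im_le {A : Matrix (Fin n) (Fin n) ℝ} (hA : ∀ i j, A i j = A j i)
    {z w : ℂ} (hz : 0 < z.im) (hzw : z.im ≤ w.im) (hre : z.re = w.re) (a : Fin n) :
    z.im / w.im * (resolvent A w a a).im / 4 ≤ (resolvent A z a a).im := by
  have hw : 0 < w.im := hz.trans_le hzw
  have h := pow_le_pow_left₀ (colNorm_nonneg _ _ _) (colNorm_le_two_mul hA hz hzw hre a) 2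
  rw [mul_pow, colNorm_sq hA hz, colNorm_sq hA hw] at h
  have : z.im * ((resolvent A w a a).im / w.im) ≤ z.im * (2 ^ 2 * ((resolvent A z a a).im / z.im)) := by
    gcongr
  have e : z.im * (2 ^ 2 * ((resolvent A z a a).im / z.im)) = 4 * (resolvent A z a a).im := by
    field_simp; ring
  rw [e] at this
  have e2 : z.im / w.im * (resolvent A w a a).im / 4 =
    z.im * ((resolvent A w a a).im / w.im) / 4 := by ring
  rw [e2]; linarith

/-- A crude Lipschitz bound, used only to pass from a net to the whole domain. -/
lemma norm_resolvent_sub_le {A : Matrix (Fin n) (Fin n) ℝ} (hA : ∀ i j, A i j = A j i) {z w : ℂ}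
    {ε : ℝ} (hε : 0 < ε) (hz : ε ≤ z.im) (hw : ε ≤ w.im) (a b : Fin n) :
    ‖resolvent A z a b - resolvent A w a b‖ ≤ ‖z - w‖ * (n / ε ^ 2) := by
  have hz0 := hε.trans_le hz
  have hw0 := hε.trans_le hw
  rw [resolvent_sub_resolvent hA hz0 hw0 a b, add_sub_cancel_left, norm_mul]
  gcongr
  refine (norm_sum_le _ _).trans ?_
  calc _ ≤ ∑ _c : Fin n, 1 / ε ^ 2 := by
        refine Finset.sum_le_sum fun c _ => ?_
        rw [norm_mul]
        have h1 := (norm_resolvent_le hA hw0 a c).trans (one_div_le_one_div_of_le hε hw)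
        have h2 := (norm_resolvent_le hA hz0 c b).trans (one_div_le_one_div_of_le hε hz)
        calc _ ≤ (1 / ε) * (1 / ε) := by gcongr
          _ = _ := by ring
    _ = _ := by simp [div_eq_mul_inv]

end LaplacianLocalLaw
end

noncomputable section
namespace LaplacianLocalLaw

/-! ### Removing an edge -/

/-- The vector `e_i - e_k`. -/
def edgeVec {n : ℕ} (i k a : Fin n) : ℝ := (if a = i then 1 else 0) - (if a = k then 1 else 0)

/-- The Laplacian-type matrix with the weight of the edge `{i, k}` set to zero. -/
def cut {n : ℕ} (A : Matrix (Fin n) (Fin n) ℝ) (i k : Fin n) : Matrix (Fin n) (Fin n) ℝ :=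
  fun a b => A a b + A i k * (edgeVec i k a * edgeVec i k b)

lemma cut_symm {n : ℕ} {A : Matrix (Fin n) (Fin n) ℝ} (hA : ∀ i j, A i j = A j i) (i k : Fin n)
    (a b : Fin n) : cut A i k a b = cut A i k b a := by
  simp only [cut, hA a b]; ring

lemma edgeVec_sq_le_one {n : ℕ} (i k a : Fin n) : edgeVec i k a ^ 2 ≤ 1 := by
  unfold edgeVec; split_ifs <;> norm_num

lemma sum_mul_edgeVec {n : ℕ} (i k : Fin n) (f : Fin n → ℂ) :
    ∑ a, f a * (edgeVec i k a : ℂ) = f i - f k := by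
  simp [edgeVec, mul_sub, Finset.sum_sub_distrib, apply_ite Complex.ofReal]

/-- The weight of an edge occurs at two off-diagonal places and, with the opposite sign, at two
diagonal ones. Removing it is therefore a rank-one perturbation along e_i - e_k. -/
lemma resolvent_cut {n : ℕ} {A : Matrix (Fin n) (Fin n) ℝ} (hA : ∀ i j, A i j = A j i)
    {z : ℂ} (hz : 0 < z.im) (i k a b : Fin n) :
    resolvent A z a b = resolvent (cut A i k) z a b + (A i k : ℂ) *
      ((resolvent (cut A i k) z a i - resolvent (cut A i k) z a k) *
        (resolvent A z i b - resolvent A z k b)) := by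
  have h := resolvent_eq_add_mul hA (cut_symm hA i k) hz hz
  have h1 : shifted (cut A i k) z - shifted A z =
      (A i k : ℂ) • Matrix.vecMulVec (fun a => (edgeVec i k a : ℂ)) (fun a => (edgeVec i k a : ℂ)) := by
    ext a b
    simp [shifted, cut, Matrix.vecMulVec_apply]
  rw [h1] at h
  conv_lhs => rw [h]
  rw [Matrix.add_apply, Matrix.mul_smul, Matrix.smul_mul, Matrix.smul_apply, smul_eq_mul,
    Matrix.mul_vecMulVec, Matrix.vecMulVec_mul, Matrix.vecMulVec_apply]
  have e1 : (resolvent (cut A i k) z).mulVec (fun a => (edgeVec i k a : ℂ)) a =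
      resolvent (cut A i k) z a i - resolvent (cut A i k) z a k := sum_mul_edgeVec i k _
  have e2 : Matrix.vecMul (fun a => (edgeVec i k a : ℂ)) (resolvent A z) b =
      resolvent A z i b - resolvent A z k b := by
    rw [← sum_mul_edgeVec i k (fun c => resolvent A z c b), Matrix.vecMul, dotProduct]
    exact Finset.sum_congr rfl fun c _ => mul_comm (edgeVec i k c : ℂ) (resolvent A z c b)
  rw [e1, e2]

variable {N : ℕ}

/-- The error `δ_ab + (z - A_aa + m_N) G_ab` in the self-consistent equation. -/
def remainder (A : Matrix (Fin (N + 1)) (Fin (N + 1)) ℝ) (z : ℂ) (a b : Fin (N + 1)) : ℂ :=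
  (if a = b then 1 else 0) + (z - A a a + mN A z) * resolvent A z a b

/-- Row a of (A - z) G = 1, with the diagonal term moved to the left. The sum carries the randomness
of the row, and m_N G_ab is the counterterm for its second-order part. -/
lemma remainder_eq_sum {A : Matrix (Fin (N + 1)) (Fin (N + 1)) ℝ} (hA : ∀ i j, A i j = A j i)
    {z : ℂ} (hz : 0 < z.im) (a b : Fin (N + 1)) :
    remainder A z a b = ∑ c ∈ Finset.univ.erase a, (A a c : ℂ) * resolvent A z c b +
      mN A z * resolvent A z a b := by
  have h := congrFun (congrFun (shifted_mul_resolvent hA hz) a) b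
  have h1 : (shifted A z * resolvent A z) a b =
      ∑ c, (A a c : ℂ) * resolvent A z c b - z * resolvent A z a b := by
    have := shifted_mulVec A z (fun c => resolvent A z c b) a
    exact this
  rw [h1, ← Finset.add_sum_erase _ _ (Finset.mem_univ a), Matrix.one_apply] at h
  unfold remainder
  rw [← h]; ring

lemma mN_cut {A : Matrix (Fin (N + 1)) (Fin (N + 1)) ℝ} (hA : ∀ i j, A i j = A j i)
    {z : ℂ} (hz : 0 < z.im) (i k : Fin (N + 1)) :
    mN A z - mN (cut A i k) z = (A i k : ℂ) * ((1 / (N : ℂ)) *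
      ∑ b, (resolvent (cut A i k) z b i - resolvent (cut A i k) z b k) *
        (resolvent A z i b - resolvent A z k b)) := by
  have h : (resolvent A z).trace - (resolvent (cut A i k) z).trace = (A i k : ℂ) *
      ∑ b, (resolvent (cut A i k) z b i - resolvent (cut A i k) z b k) *
        (resolvent A z i b - resolvent A z k b) := by
    rw [Matrix.trace, Matrix.trace, ← Finset.sum_sub_distrib, Finset.mul_sum]
    refine Finset.sum_congr rfl fun b _ => ?_
    rw [Matrix.diag_apply, Matrix.diag_apply, resolvent_cut hA hz i k b b, add_sub_cancel_left]
  unfold mN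
  rw [← mul_sub, h]; ring

/-- Removing the edge changes three things: m_N, the diagonal entry A_aa, and the resolvent. The
last change, multiplied by z - A_aa + m_N of the cut matrix, reproduces the remainder of the cut
matrix, and the Kronecker delta in it leaves the term in `edgeVec`. -/
lemma remainder_sub_cut {A : Matrix (Fin (N + 1)) (Fin (N + 1)) ℝ} (hA : ∀ i j, A i j = A j i)
    {z : ℂ} (hz : 0 < z.im) (i k a b : Fin (N + 1)) :
    remainder A z a b - remainder (cut A i k) z a b =
      (mN A z - mN (cut A i k) z + A i k * edgeVec i k a ^ 2) * resolvent A z a b +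
      (A i k : ℂ) * ((remainder (cut A i k) z a i - remainder (cut A i k) z a k
        - (edgeVec i k a : ℂ)) * (resolvent A z i b - resolvent A z k b)) := by
  have h := resolvent_cut hA hz i k a b
  have h2 : ((cut A i k a a : ℝ) : ℂ) = (A a a : ℂ) + A i k * edgeVec i k a ^ 2 := by
    simp only [cut]; push_cast; ring
  have h3 : (edgeVec i k a : ℂ) = (if a = i then 1 else 0) - (if a = k then 1 else 0) := by
    unfold edgeVec; split_ifs <;> simp
  simp only [remainder, h2]
  generalize resolvent (cut A i k) z = G at *
  linear_combination (z - (A a a + A i k * edgeVec i k a ^ 2) + mN (cut A i k) z) * h +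
    (A i k : ℂ) * (resolvent A z i b - resolvent A z k b) * h3

/-! ### Size of the perturbation caused by removing one edge. -/

section Bounds

variable {A : Matrix (Fin (N + 1)) (Fin (N + 1)) ℝ} {z : ℂ} {Γ : ℝ}

/-- Let M be the largest entry of the cut resolvent. The rank-one formula gives M ≤ Γ + 4 |A_ik| Γ
M, and the last term is at most M / 2. -/
lemma norm_resolvent_cut_le (hA : ∀ i j, A i j = A j i) (hz : 0 < z.im)
    (hΓ : ∀ a b, ‖resolvent A z a b‖ ≤ Γ) {i k : Fin (N + 1)} (hh : 8 * |A i k| * Γ ≤ 1)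
    (a b : Fin (N + 1)) : ‖resolvent (cut A i k) z a b‖ ≤ 2 * Γ := by
  obtain ⟨⟨a₀, b₀⟩, h0⟩ := Finite.exists_max
    (fun p : Fin (N + 1) × Fin (N + 1) => ‖resolvent (cut A i k) z p.1 p.2‖)
  set M := ‖resolvent (cut A i k) z a₀ b₀‖ with hM
  have hle : ∀ a b, ‖resolvent (cut A i k) z a b‖ ≤ M := fun a b => h0 (a, b)
  refine (hle a b).trans ?_
  have h := resolvent_cut hA hz i k a₀ b₀
  have e : resolvent (cut A i k) z a₀ b₀ = resolvent A z a₀ b₀ - (A i k : ℂ) *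
      ((resolvent (cut A i k) z a₀ i - resolvent (cut A i k) z a₀ k) *
        (resolvent A z i b₀ - resolvent A z k b₀)) := by rw [h]; ring
  have hM0 : 0 ≤ M := norm_nonneg _
  have : M ≤ Γ + |A i k| * ((M + M) * (Γ + Γ)) := by
    have h1 := norm_sub_le (resolvent A z a₀ b₀) ((A i k : ℂ) *
      ((resolvent (cut A i k) z a₀ i - resolvent (cut A i k) z a₀ k) *
        (resolvent A z i b₀ - resolvent A z k b₀)))
    rw [← e] at h1
    refine h1.trans (add_le_add (hΓ _ _) ?_)
    rw [norm_mul, norm_mul, Complex.norm_real, Real.norm_eq_abs]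
    gcongr
    · exact (norm_sub_le _ _).trans (add_le_add (hle _ _) (hle _ _))
    · exact (norm_sub_le _ _).trans (add_le_add (hΓ _ _) (hΓ _ _))
  nlinarith [mul_le_mul_of_nonneg_left hh hM0]

lemma norm_resolvent_sub_cut_le (hA : ∀ i j, A i j = A j i) (hz : 0 < z.im)
    (hΓ : ∀ a b, ‖resolvent A z a b‖ ≤ Γ) {i k : Fin (N + 1)} (hh : 8 * |A i k| * Γ ≤ 1)
    (a b : Fin (N + 1)) :
    ‖resolvent A z a b - resolvent (cut A i k) z a b‖ ≤ 8 * Γ ^ 2 * |A i k| := by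
  have hc := norm_resolvent_cut_le hA hz hΓ hh
  have hΓ0 : 0 ≤ Γ := (norm_nonneg _).trans (hΓ a b)
  rw [resolvent_cut hA hz i k a b, add_sub_cancel_left, norm_mul, norm_mul, Complex.norm_real,
    Real.norm_eq_abs]
  calc _ ≤ |A i k| * ((2 * Γ + 2 * Γ) * (Γ + Γ)) := by
        gcongr
        · exact (norm_sub_le _ _).trans (add_le_add (hc _ _) (hc _ _))
        · exact (norm_sub_le _ _).trans (add_le_add (hΓ _ _) (hΓ _ _))
    _ = _ := by ring

lemma sum_sq_sub_le {f g : Fin (N + 1) → ℂ} {S : ℝ} (hf : ∑ b, ‖f b‖ ^ 2 ≤ S)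
    (hg : ∑ b, ‖g b‖ ^ 2 ≤ S) : ∑ b, ‖f b - g b‖ ^ 2 ≤ 4 * S := by
  calc _ ≤ ∑ b, (2 * ‖f b‖ ^ 2 + 2 * ‖g b‖ ^ 2) := by
        refine Finset.sum_le_sum fun b _ => ?_
        have := norm_sub_le (f b) (g b)
        have h2 := pow_le_pow_left₀ (norm_nonneg _) this 2
        nlinarith [sq_nonneg (‖f b‖ - ‖g b‖)]
    _ = 2 * ∑ b, ‖f b‖ ^ 2 + 2 * ∑ b, ‖g b‖ ^ 2 := by
        rw [Finset.sum_add_distrib, Finset.mul_sum, Finset.mul_sum]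
    _ ≤ _ := by linarith

/-- The trace of a rank-one perturbation is a scalar product of two columns, and each column has
squared norm of order Γ / Im z by the Ward identity. This wins the factor 1 / (N Im z). The 6 is 4
from the cut resolvent, whose entries are bounded by 2Γ, plus 2 from G. -/
lemma norm_mN_sub_cut_le (hA : ∀ i j, A i j = A j i) (hz : 0 < z.im)
    (hΓ : ∀ a b, ‖resolvent A z a b‖ ≤ Γ) {i k : Fin (N + 1)} (hh : 8 * |A i k| * Γ ≤ 1) :
    ‖mN A z - mN (cut A i k) z‖ ≤ |A i k| * (6 * Γ / (N * z.im)) := by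
  have hc := norm_resolvent_cut_le hA hz hΓ hh
  have hΓ0 : 0 ≤ Γ := (norm_nonneg _).trans (hΓ i i)
  have w1 : ∀ a, ∑ b, ‖resolvent (cut A i k) z b a‖ ^ 2 ≤ 2 * Γ / z.im := fun a => by
    simp_rw [fun b => resolvent_symm (cut_symm hA i k) z b a]
    exact sum_sq_resolvent_le (cut_symm hA i k) hz hc a
  have w2 := sum_sq_resolvent_le hA hz hΓ
  have s1 := sum_sq_sub_le (w1 i) (w1 k)
  have s2 := sum_sq_sub_le (w2 i) (w2 k)
  rw [mN_cut hA hz, norm_mul, norm_mul, Complex.norm_real, Real.norm_eq_abs]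
  gcongr
  have s3 : ‖∑ b, (resolvent (cut A i k) z b i - resolvent (cut A i k) z b k) *
        (resolvent A z i b - resolvent A z k b)‖ ≤ 6 * Γ / z.im := by
    refine (norm_sum_le _ _).trans ?_
    calc _ ≤ ∑ b, (‖resolvent (cut A i k) z b i - resolvent (cut A i k) z b k‖ ^ 2 / 2 +
          ‖resolvent A z i b - resolvent A z k b‖ ^ 2 / 2) := by
          refine Finset.sum_le_sum fun b _ => ?_
          rw [norm_mul]
          nlinarith [sq_nonneg (‖resolvent (cut A i k) z b i - resolvent (cut A i k) z b k‖ -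
            ‖resolvent A z i b - resolvent A z k b‖)]
      _ ≤ (4 * (2 * Γ / z.im)) / 2 + (4 * (Γ / z.im)) / 2 := by
          rw [Finset.sum_add_distrib, ← Finset.sum_div, ← Finset.sum_div]
          gcongr
      _ = _ := by ring
  calc _ ≤ (1 / (N : ℝ)) * (6 * Γ / z.im) := by
        simp only [norm_div, norm_one, Complex.norm_natCast]
        gcongr
    _ = _ := by
      rw [div_mul_div_comm, one_mul]

/-- The effect on the remainder of removing an edge. -/
lemma norm_remainder_sub_cut_le (hA : ∀ i j, A i j = A j i) (hz : 0 < z.im)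
    (hΓ : ∀ a b, ‖resolvent A z a b‖ ≤ Γ) {i k : Fin (N + 1)} (hh : 8 * |A i k| * Γ ≤ 1)
    {Λ : ℝ} (hΛ : ∀ a b, ‖remainder (cut A i k) z a b‖ ≤ Λ) (a b : Fin (N + 1)) :
    ‖remainder A z a b - remainder (cut A i k) z a b‖ ≤
      |A i k| * (6 * Γ ^ 2 / (N * z.im) + 3 * Γ + 4 * Γ * Λ) := by
  have hΓ0 : 0 ≤ Γ := (norm_nonneg _).trans (hΓ i i)
  have hΛ0 : 0 ≤ Λ := (norm_nonneg _).trans (hΛ i i)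
  have hu : |edgeVec i k a| ≤ 1 := by
    rw [← sq_le_one_iff_abs_le_one]; exact edgeVec_sq_le_one i k a
  rw [remainder_sub_cut hA hz]
  calc _ ≤ (|A i k| * (6 * Γ / (N * z.im)) + |A i k| * 1) * Γ +
        |A i k| * ((Λ + Λ + 1) * (Γ + Γ)) := by
        refine (norm_add_le _ _).trans (add_le_add ?_ ?_)
        · rw [norm_mul]
          gcongr
          · refine (norm_add_le _ _).trans (add_le_add (norm_mN_sub_cut_le hA hz hΓ hh) ?_)
            rw [norm_mul, norm_pow, Complex.norm_real, Complex.norm_real, Real.norm_eq_abs,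
              Real.norm_eq_abs, sq_abs]
            gcongr
            exact edgeVec_sq_le_one i k a
          · exact hΓ _ _
        · rw [norm_mul, norm_mul, Complex.norm_real, Real.norm_eq_abs]
          gcongr
          · refine (norm_sub_le _ _).trans (add_le_add ((norm_sub_le _ _).trans
              (add_le_add (hΛ _ _) (hΛ _ _))) ?_)
            rw [Complex.norm_real, Real.norm_eq_abs]; exact hu
          · exact (norm_sub_le _ _).trans (add_le_add (hΓ _ _) (hΓ _ _))
    _ = _ := by ring

/-- The effect on the `i`-th row of the remainder of removing an edge at `i`. -/
lemma norm_remainder_sub_cut_row_le (hA : ∀ i j, A i j = A j i) (hz : 0 < z.im)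
    (hΓ : ∀ a b, ‖resolvent A z a b‖ ≤ Γ) {i k : Fin (N + 1)} (hik : i ≠ k)
    (hh : 8 * |A i k| * Γ ≤ 1)
    {Λ : ℝ} (hΛ : ∀ a b, ‖remainder (cut A i k) z a b‖ ≤ Λ) (b : Fin (N + 1)) :
    ‖remainder A z i b - remainder (cut A i k) z i b‖ ≤
      |A i k| * (6 * Γ ^ 2 / (N * z.im) + ‖resolvent A z k b‖ + 4 * Γ * Λ) := by
  have hΓ0 : 0 ≤ Γ := (norm_nonneg _).trans (hΓ i i)
  have hu : edgeVec i k i = 1 := by simp [edgeVec, hik]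
  -- In row i the diagonal change h G_ib meets -h (G_ib - G_kb) from the Kronecker delta, and only h
  -- G_kb survives. This cancellation is essential: G_kb is small on average over k, whereas G_ib
  -- need not be.
  have e : remainder A z i b - remainder (cut A i k) z i b =
      (mN A z - mN (cut A i k) z) * resolvent A z i b + (A i k : ℂ) * resolvent A z k b +
      (A i k : ℂ) * ((remainder (cut A i k) z i i - remainder (cut A i k) z i k) *
        (resolvent A z i b - resolvent A z k b)) := by
    rw [remainder_sub_cut hA hz, hu]; push_cast; ring
  rw [e]
  calc _ ≤ |A i k| * (6 * Γ / (N * z.im)) * Γ + |A i k| * ‖resolvent A z k b‖ +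
        |A i k| * ((Λ + Λ) * (Γ + Γ)) := by
        refine (norm_add_le _ _).trans (add_le_add ((norm_add_le _ _).trans (add_le_add ?_ ?_)) ?_)
        · rw [norm_mul]
          gcongr
          · exact norm_mN_sub_cut_le hA hz hΓ hh
          · exact hΓ _ _
        · rw [norm_mul, Complex.norm_real, Real.norm_eq_abs]
        · rw [norm_mul, norm_mul, Complex.norm_real, Real.norm_eq_abs]
          have := (norm_nonneg _).trans (hΛ i i)
          gcongr
          · exact (norm_sub_le _ _).trans (add_le_add (hΛ _ _) (hΛ _ _))
          · exact (norm_sub_le _ _).trans (add_le_add (hΓ _ _) (hΓ _ _))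
    _ = _ := by ring

end Bounds

/-! ### Measurability -/

lemma continuous_shifted {n : ℕ} (z : ℂ) :
    Continuous fun A : Fin n → Fin n → ℝ => shifted (Matrix.of A) z := by
  refine Continuous.sub ?_ continuous_const
  refine continuous_matrix fun i j => ?_
  simp only [Matrix.map_apply, Matrix.of_apply]
  fun_prop

/-- By Cramer's rule an entry is the inverse of a determinant times a cofactor, both continuous in
the matrix. The formula needs no invertibility. -/
lemma measurable_resolvent {n : ℕ} (z : ℂ) (a b : Fin n) :
    Measurable fun A : Fin n → Fin n → ℝ => resolvent (Matrix.of A) z a b := by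
  have e : (fun A : Fin n → Fin n → ℝ => resolvent (Matrix.of A) z a b) =
      fun A => ((shifted (Matrix.of A) z).det)⁻¹ * (shifted (Matrix.of A) z).adjugate a b := by
    funext A
    rw [resolvent_eq, Matrix.inv_def, Matrix.smul_apply, smul_eq_mul, Ring.inverse_eq_inv']
  rw [e]
  have h := continuous_shifted (n := n) z
  exact (h.matrix_det.measurable.inv).mul (h.matrix_adjugate.matrix_elem a b).measurable

lemma measurable_mN {N : ℕ} (z : ℂ) :
    Measurable fun A : Fin (N + 1) → Fin (N + 1) → ℝ => mN (Matrix.of A) z := by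
  unfold mN Matrix.trace
  refine Measurable.const_mul ?_ _
  exact Finset.measurable_sum _ fun a _ => measurable_resolvent z a a

lemma measurable_remainder {N : ℕ} (z : ℂ) (a b : Fin (N + 1)) :
    Measurable fun A : Fin (N + 1) → Fin (N + 1) → ℝ => remainder (Matrix.of A) z a b := by
  unfold remainder
  have h1 := measurable_resolvent (n := N + 1) z a b
  have h2 := measurable_mN (N := N) z
  have h3 : Measurable fun A : Fin (N + 1) → Fin (N + 1) → ℝ => ((Matrix.of A a a : ℝ) : ℂ) := by
    simp only [Matrix.of_apply]
    fun_prop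
  exact measurable_const.add (((measurable_const.sub h3).add h2).mul h1)

lemma measurable_cut {n : ℕ} (i k : Fin n) :
    Measurable fun (A : Fin n → Fin n → ℝ) (a b : Fin n) => cut (Matrix.of A) i k a b := by
  refine measurable_pi_lambda _ fun a => measurable_pi_lambda _ fun b => ?_
  simp only [cut, Matrix.of_apply]
  fun_prop

end LaplacianLocalLaw
end

noncomputable section
namespace LaplacianLocalLaw

/-! ### Moment bounds by decoupling -/

/-- The function `x̄ |x|^(2m)`, whose product with `x` is `|x|^(2m+2)`. -/
def oddPow (m : ℕ) (x : ℂ) : ℂ := (starRingEnd ℂ) x * ((‖x‖ ^ (2 * m) : ℝ) : ℂ)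

lemma mul_oddPow (m : ℕ) (x : ℂ) : x * oddPow m x = ((‖x‖ ^ (2 * m + 2) : ℝ) : ℂ) := by
  rw [oddPow, ← mul_assoc, Complex.mul_conj']
  push_cast; ring

lemma norm_oddPow (m : ℕ) (x : ℂ) : ‖oddPow m x‖ = ‖x‖ ^ (2 * m + 1) := by
  rw [oddPow, norm_mul, Complex.norm_conj, Complex.norm_real, Real.norm_eq_abs,
    abs_of_nonneg (by positivity)]
  ring

lemma measurable_oddPow (m : ℕ) : Measurable (oddPow m) := by
  unfold oddPow
  exact (Complex.continuous_conj.mul (by fun_prop)).measurable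

/-- The mean value bound for powers, multiplied by a + b to avoid the exponent k - 1 and hence a
separate case k = 0. -/
lemma mul_abs_pow_sub_pow_le {a b : ℝ} (ha : 0 ≤ a) (hb : 0 ≤ b) (k : ℕ) :
    (a + b) * |a ^ k - b ^ k| ≤ k * |a - b| * (a + b) ^ k := by
  induction k with
  | zero => simp
  | succ k ih =>
    have e : a ^ (k + 1) - b ^ (k + 1) = a * (a ^ k - b ^ k) + (a - b) * b ^ k := by ring
    rw [e]
    calc _ ≤ (a + b) * (|a * (a ^ k - b ^ k)| + |(a - b) * b ^ k|) := by
          gcongr; exact abs_add_le _ _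
      _ = a * ((a + b) * |a ^ k - b ^ k|) + (a + b) * (|a - b| * b ^ k) := by
          rw [abs_mul, abs_mul, abs_of_nonneg ha, abs_of_nonneg (pow_nonneg hb k)]; ring
      _ ≤ (a + b) * (k * |a - b| * (a + b) ^ k) + (a + b) * (|a - b| * (a + b) ^ k) := by
          gcongr <;> linarith
      _ = _ := by push_cast; ring

lemma norm_oddPow_sub_le (m : ℕ) (x y : ℂ) :
    ‖oddPow m x - oddPow m y‖ ≤ (2 * m + 1) * ‖x - y‖ * (‖x‖ + ‖y‖) ^ (2 * m) := by
  have e : oddPow m x - oddPow m y = (starRingEnd ℂ) (x - y) * ((‖x‖ ^ (2 * m) : ℝ) : ℂ) +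
      (starRingEnd ℂ) y * ((‖x‖ ^ (2 * m) - ‖y‖ ^ (2 * m) : ℝ) : ℂ) := by
    unfold oddPow; rw [map_sub]; push_cast; ring
  have h := mul_abs_pow_sub_pow_le (norm_nonneg x) (norm_nonneg y) (2 * m)
  have h2 : |‖x‖ - ‖y‖| ≤ ‖x - y‖ := abs_norm_sub_norm_le x y
  rw [e]
  calc _ ≤ ‖x - y‖ * ‖x‖ ^ (2 * m) + ‖y‖ * |‖x‖ ^ (2 * m) - ‖y‖ ^ (2 * m)| := by
        refine (norm_add_le _ _).trans (le_of_eq ?_)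
        rw [norm_mul, norm_mul, Complex.norm_conj, Complex.norm_conj, Complex.norm_real,
          Complex.norm_real, Real.norm_eq_abs, Real.norm_eq_abs, abs_of_nonneg (by positivity)]
    _ ≤ ‖x - y‖ * (‖x‖ + ‖y‖) ^ (2 * m) +
          (‖x‖ + ‖y‖) * |‖x‖ ^ (2 * m) - ‖y‖ ^ (2 * m)| := by
        have := norm_nonneg x
        have := norm_nonneg y
        gcongr <;> linarith
    _ ≤ ‖x - y‖ * (‖x‖ + ‖y‖) ^ (2 * m) +
          ((2 * m : ℕ) : ℝ) * ‖x - y‖ * (‖x‖ + ‖y‖) ^ (2 * m) := by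
        refine add_le_add le_rfl (h.trans ?_)
        gcongr
    _ = _ := by push_cast; ring

lemma integrable_of_norm_le_mul_pow {Ω E : Type*} [MeasurableSpace Ω] [NormedAddCommGroup E]
    {μ : Measure Ω} {W : Ω → ℝ} (hW : ∀ d : ℕ, Integrable (fun ω => W ω ^ d) μ)
    {f : Ω → E} (hf : AEStronglyMeasurable f μ) (C : ℝ) (d : ℕ)
    (h : ∀ ω, ‖f ω‖ ≤ C * W ω ^ d) : Integrable f μ :=
  ((hW d).const_mul C).mono' hf (Filter.Eventually.of_forall h)

/-- The basic decoupling estimate. A random variable `Z = ∑ h_k A_k + D`, where `h_k` is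
centred, has its moments bounded by means of versions `A₀`, `Z₀` of `A`, `Z` that do not depend
on `h_k`. -/
theorem integral_norm_pow_le_of_decoupling {Ω κ : Type*} [MeasurableSpace Ω] {μ : Measure Ω}
    [IsProbabilityMeasure μ] (s : Finset κ) (m d : ℕ) (hd : 2 * m + 5 ≤ d) {σ2 : ℝ} (hσ : 0 ≤ σ2)
    {Z D : Ω → ℂ} {h : κ → Ω → ℝ} {A A₀ A' A'₀ A'' Z₀ : κ → Ω → ℂ} {Y₀ : κ → Ω → ℝ} {W F : Ω → ℝ}
    {Θ : Set Ω}
    (hZ : ∀ ω, Z ω = ∑ k ∈ s, (h k ω : ℂ) * A k ω + D ω)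
    (hA : ∀ k ∈ s, ∀ ω, A k ω = A₀ k ω + h k ω * A'₀ k ω + h k ω ^ 2 * A'' k ω)
    (hind : ∀ k ∈ s, IndepFun (h k) (fun ω => (A₀ k ω, A'₀ k ω, Z₀ k ω, Y₀ k ω)) μ)
    (hmean : ∀ k ∈ s, ∫ ω, h k ω ∂μ = 0) (hvar : ∀ k ∈ s, ∫ ω, h k ω ^ 2 ∂μ = σ2)
    (mZ : Measurable Z) (mD : Measurable D) (mh : ∀ k ∈ s, Measurable (h k))
    (mA₀ : ∀ k ∈ s, Measurable (A₀ k)) (mA' : ∀ k ∈ s, Measurable (A' k))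
    (mA'₀ : ∀ k ∈ s, Measurable (A'₀ k)) (mA'' : ∀ k ∈ s, Measurable (A'' k))
    (mZ₀ : ∀ k ∈ s, Measurable (Z₀ k)) (mY₀ : ∀ k ∈ s, Measurable (Y₀ k))
    (mΘ : MeasurableSet Θ)
    (W1 : ∀ ω, 1 ≤ W ω) (hW : ∀ d : ℕ, Integrable (fun ω => W ω ^ d) μ)
    (bZ : ∀ ω, ‖Z ω‖ ≤ W ω) (bD : ∀ ω, ‖D ω‖ ≤ W ω) (bh : ∀ k ∈ s, ∀ ω, |h k ω| ≤ W ω)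
    (bA : ∀ k ∈ s, ∀ ω, ‖A k ω‖ ≤ W ω)
    (bA₀ : ∀ k ∈ s, ∀ ω, ‖A₀ k ω‖ ≤ W ω) (bA' : ∀ k ∈ s, ∀ ω, ‖A' k ω‖ ≤ W ω)
    (bA'₀ : ∀ k ∈ s, ∀ ω, ‖A'₀ k ω‖ ≤ W ω) (bA'' : ∀ k ∈ s, ∀ ω, ‖A'' k ω‖ ≤ W ω)
    (bZ₀ : ∀ k ∈ s, ∀ ω, ‖Z₀ k ω‖ ≤ W ω)
    (nY₀ : ∀ k ∈ s, ∀ ω, 0 ≤ Y₀ k ω) (bY₀ : ∀ k ∈ s, ∀ ω, Y₀ k ω ≤ W ω ^ d)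
    (hF : Integrable F μ) (nF : ∀ ω, 0 ≤ F ω)
    (hΘ : ∀ ω ∈ Θ, ∀ k ∈ s, |h k ω| * ‖A k ω‖ * ‖oddPow m (Z ω) - oddPow m (Z₀ k ω)‖ +
      |h k ω| ^ 3 * ‖A'' k ω‖ * ‖Z₀ k ω‖ ^ (2 * m + 1) ≤ h k ω ^ 2 * Y₀ k ω)
    (hΘF : ∀ ω ∈ Θ, ‖D ω + σ2 * ∑ k ∈ s, A' k ω‖ * ‖Z ω‖ ^ (2 * m + 1) +
      σ2 * ∑ k ∈ s, (‖A' k ω * oddPow m (Z ω) - A'₀ k ω * oddPow m (Z₀ k ω)‖ + Y₀ k ω) ≤ F ω) :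
    ∫ ω, ‖Z ω‖ ^ (2 * m + 2) ∂μ ≤ ∫ ω, F ω ∂μ +
      (1 + (4 * σ2 + 3) * s.card) * ∫ ω in Θᶜ, W ω ^ d ∂μ := by
  have W0 : ∀ ω, 0 ≤ W ω := fun ω => zero_le_one.trans (W1 ω)
  have mQ := measurable_oddPow m
  have mA : ∀ k ∈ s, Measurable (A k) := fun k hk => by
    have e : A k = fun ω => A₀ k ω + h k ω * A'₀ k ω + h k ω ^ 2 * A'' k ω := funext (hA k hk)
    rw [e]
    have := mh k hk
    have := mA₀ k hk
    have := mA'₀ k hk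
    have := mA'' k hk
    fun_prop
  have bQ : ∀ ω, ‖oddPow m (Z ω)‖ ≤ W ω ^ (2 * m + 1) := fun ω => by
    rw [norm_oddPow]; exact pow_le_pow_left₀ (norm_nonneg _) (bZ ω) _
  have bQ₀ : ∀ k ∈ s, ∀ ω, ‖oddPow m (Z₀ k ω)‖ ≤ W ω ^ (2 * m + 1) := fun k hk ω => by
    rw [norm_oddPow]; exact pow_le_pow_left₀ (norm_nonneg _) (bZ₀ k hk ω) _
  have Wd : ∀ ω, ∀ j ≤ d, W ω ^ j ≤ W ω ^ d := fun ω j hj => pow_le_pow_right₀ (W1 ω) hj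
  -- integrability of the various terms
  have iA'Q : ∀ k ∈ s, Integrable (fun ω => A' k ω * oddPow m (Z ω)) μ := fun k hk => by
    refine integrable_of_norm_le_mul_pow hW
      ((mA' k hk).mul (mQ.comp mZ)).aestronglyMeasurable 1 (2 * m + 2) fun ω => ?_
    rw [norm_mul]
    calc _ ≤ W ω * W ω ^ (2 * m + 1) := by gcongr; exacts [W0 ω, bA' k hk ω, bQ ω]
      _ = _ := by ring
  have iA'Q₀ : ∀ k ∈ s, Integrable (fun ω => A'₀ k ω * oddPow m (Z₀ k ω)) μ := fun k hk => by
    refine integrable_of_norm_le_mul_pow hW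
      ((mA'₀ k hk).mul (mQ.comp (mZ₀ k hk))).aestronglyMeasurable 1 (2 * m + 2) fun ω => ?_
    rw [norm_mul]
    calc _ ≤ W ω * W ω ^ (2 * m + 1) := by gcongr; exacts [W0 ω, bA'₀ k hk ω, bQ₀ k hk ω]
      _ = _ := by ring
  have iDQ : Integrable (fun ω => D ω * oddPow m (Z ω)) μ := by
    refine integrable_of_norm_le_mul_pow hW
      (mD.mul (mQ.comp mZ)).aestronglyMeasurable 1 (2 * m + 2) fun ω => ?_
    rw [norm_mul]
    calc _ ≤ W ω * W ω ^ (2 * m + 1) := by gcongr; exacts [W0 ω, bD ω, bQ ω]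
      _ = _ := by ring
  have mhc : ∀ k ∈ s, Measurable (fun ω => (h k ω : ℂ)) := fun k hk =>
    Complex.measurable_ofReal.comp (mh k hk)
  have nhc : ∀ k ∈ s, ∀ ω, ‖(h k ω : ℂ)‖ ≤ W ω := fun k hk ω => by
    rw [Complex.norm_real]; exact bh k hk ω
  have ihAQ : ∀ k ∈ s, Integrable
      (fun ω => (h k ω : ℂ) * A k ω * (oddPow m (Z ω) - oddPow m (Z₀ k ω))) μ := fun k hk => by
    refine integrable_of_norm_le_mul_pow hW (((mhc k hk).mul (mA k hk)).mul
      ((mQ.comp mZ).sub (mQ.comp (mZ₀ k hk)))).aestronglyMeasurable 2 (2 * m + 3) fun ω => ?_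
    rw [norm_mul, norm_mul]
    calc _ ≤ W ω * W ω * (W ω ^ (2 * m + 1) + W ω ^ (2 * m + 1)) := by
          have := W0 ω
          gcongr
          exacts [nhc k hk ω, bA k hk ω,
            (norm_sub_le _ _).trans (add_le_add (bQ ω) (bQ₀ k hk ω))]
      _ = _ := by ring
  have ih3 : ∀ k ∈ s, Integrable
      (fun ω => (h k ω : ℂ) ^ 3 * A'' k ω * oddPow m (Z₀ k ω)) μ := fun k hk => by
    refine integrable_of_norm_le_mul_pow hW ((((mhc k hk).pow_const 3).mul (mA'' k hk)).mul
      (mQ.comp (mZ₀ k hk))).aestronglyMeasurable 1 (2 * m + 5) fun ω => ?_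
    rw [norm_mul, norm_mul, norm_pow]
    calc _ ≤ W ω ^ 3 * W ω * W ω ^ (2 * m + 1) := by
          have := W0 ω
          gcongr
          exacts [nhc k hk ω, bA'' k hk ω, bQ₀ k hk ω]
      _ = _ := by ring
  have ih1 : ∀ k ∈ s, Integrable
      (fun ω => (h k ω : ℂ) * (A₀ k ω * oddPow m (Z₀ k ω))) μ := fun k hk => by
    refine integrable_of_norm_le_mul_pow hW ((mhc k hk).mul ((mA₀ k hk).mul
      (mQ.comp (mZ₀ k hk)))).aestronglyMeasurable 1 (2 * m + 3) fun ω => ?_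
    rw [norm_mul, norm_mul]
    calc _ ≤ W ω * (W ω * W ω ^ (2 * m + 1)) := by
          have := W0 ω
          gcongr
          exacts [nhc k hk ω, bA₀ k hk ω, bQ₀ k hk ω]
      _ = _ := by ring
  have ih2 : ∀ k ∈ s, Integrable
      (fun ω => (h k ω : ℂ) ^ 2 * (A'₀ k ω * oddPow m (Z₀ k ω))) μ := fun k hk => by
    refine integrable_of_norm_le_mul_pow hW (((mhc k hk).pow_const 2).mul ((mA'₀ k hk).mul
      (mQ.comp (mZ₀ k hk)))).aestronglyMeasurable 1 (2 * m + 4) fun ω => ?_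
    rw [norm_mul, norm_mul, norm_pow]
    calc _ ≤ W ω ^ 2 * (W ω * W ω ^ (2 * m + 1)) := by
          have := W0 ω
          gcongr
          exacts [nhc k hk ω, bA'₀ k hk ω, bQ₀ k hk ω]
      _ = _ := by ring
  -- the decoupled expectations
  have e1 : ∀ k ∈ s, ∫ ω, (h k ω : ℂ) * (A₀ k ω * oddPow m (Z₀ k ω)) ∂μ = 0 := fun k hk => by
    have hi : IndepFun (fun ω => (h k ω : ℂ)) (fun ω => A₀ k ω * oddPow m (Z₀ k ω)) μ :=
      (hind k hk).comp (φ := fun x : ℝ => (x : ℂ))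
        (ψ := fun x : ℂ × ℂ × ℂ × ℝ => x.1 * oddPow m x.2.2.1) Complex.measurable_ofReal
        (measurable_fst.mul (mQ.comp (measurable_fst.comp (measurable_snd.comp measurable_snd))))
    rw [hi.integral_fun_mul_eq_mul_integral (mhc k hk).aestronglyMeasurable
      ((mA₀ k hk).mul (mQ.comp (mZ₀ k hk))).aestronglyMeasurable, integral_complex_ofReal,
      hmean k hk]
    simp
  have e2 : ∀ k ∈ s, ∫ ω, (h k ω : ℂ) ^ 2 * (A'₀ k ω * oddPow m (Z₀ k ω)) ∂μ =
      σ2 * ∫ ω, A'₀ k ω * oddPow m (Z₀ k ω) ∂μ := fun k hk => by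
    have hi : IndepFun (fun ω => (h k ω : ℂ) ^ 2) (fun ω => A'₀ k ω * oddPow m (Z₀ k ω)) μ :=
      (hind k hk).comp (φ := fun x : ℝ => (x : ℂ) ^ 2)
        (ψ := fun x : ℂ × ℂ × ℂ × ℝ => x.2.1 * oddPow m x.2.2.1)
        (Complex.measurable_ofReal.pow_const 2)
        ((measurable_fst.comp measurable_snd).mul
          (mQ.comp (measurable_fst.comp (measurable_snd.comp measurable_snd))))
    rw [hi.integral_fun_mul_eq_mul_integral ((mhc k hk).pow_const 2).aestronglyMeasurable
      ((mA'₀ k hk).mul (mQ.comp (mZ₀ k hk))).aestronglyMeasurable]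
    congr 1
    rw [← hvar k hk, ← integral_complex_ofReal]
    push_cast; rfl
  have iY₀ : ∀ k ∈ s, Integrable (Y₀ k) μ := fun k hk =>
    integrable_of_norm_le_mul_pow hW (mY₀ k hk).aestronglyMeasurable 1 d fun ω => by
      rw [one_mul, Real.norm_eq_abs, abs_of_nonneg (nY₀ k hk ω)]; exact bY₀ k hk ω
  have ihY : ∀ k ∈ s, Integrable (fun ω => h k ω ^ 2 * Y₀ k ω) μ := fun k hk =>
    integrable_of_norm_le_mul_pow hW
      (((mh k hk).pow_const 2).mul (mY₀ k hk)).aestronglyMeasurable 1 (2 + d) fun ω => by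
        rw [one_mul, norm_mul, norm_pow, Real.norm_eq_abs, Real.norm_eq_abs,
          abs_of_nonneg (nY₀ k hk ω), pow_add]
        have := nY₀ k hk ω
        gcongr
        exacts [bh k hk ω, bY₀ k hk ω]
  have e3 : ∀ k ∈ s, ∫ ω, h k ω ^ 2 * Y₀ k ω ∂μ = σ2 * ∫ ω, Y₀ k ω ∂μ := fun k hk => by
    have hi : IndepFun (fun ω => h k ω ^ 2) (fun ω => Y₀ k ω) μ :=
      (hind k hk).comp (φ := fun x : ℝ => x ^ 2)
        (ψ := fun x : ℂ × ℂ × ℂ × ℝ => x.2.2.2)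
        (measurable_id.pow_const 2)
        (measurable_snd.comp (measurable_snd.comp measurable_snd))
    rw [hi.integral_fun_mul_eq_mul_integral ((mh k hk).pow_const 2).aestronglyMeasurable
      (mY₀ k hk).aestronglyMeasurable, hvar k hk]
  -- the exact decomposition
  have key : ((∫ ω, ‖Z ω‖ ^ (2 * m + 2) ∂μ : ℝ) : ℂ) =
      ∫ ω, ((D ω + σ2 * ∑ k ∈ s, A' k ω) * oddPow m (Z ω) +
        σ2 * ∑ k ∈ s, (A'₀ k ω * oddPow m (Z₀ k ω) - A' k ω * oddPow m (Z ω))) ∂μ +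
      ∑ k ∈ s, ∫ ω, ((h k ω : ℂ) * A k ω * (oddPow m (Z ω) - oddPow m (Z₀ k ω)) +
        (h k ω : ℂ) ^ 3 * A'' k ω * oddPow m (Z₀ k ω)) ∂μ := by
    -- The terms A' Z-power added for the drift are subtracted again in the second sum, so this
    -- integral is only that of D plus the decoupled second-order terms.
    have r1 : ∫ ω, ((D ω + σ2 * ∑ k ∈ s, A' k ω) * oddPow m (Z ω) +
        σ2 * ∑ k ∈ s, (A'₀ k ω * oddPow m (Z₀ k ω) - A' k ω * oddPow m (Z ω))) ∂μ =
        ∫ ω, D ω * oddPow m (Z ω) ∂μ +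
          ∑ k ∈ s, σ2 * ∫ ω, A'₀ k ω * oddPow m (Z₀ k ω) ∂μ := by
      rw [← Finset.mul_sum, ← integral_finsetSum _ iA'Q₀, ← integral_const_mul,
        ← integral_add iDQ ((integrable_finsetSum _ iA'Q₀).const_mul _)]
      refine integral_congr_ae (Filter.Eventually.of_forall fun ω => ?_)
      simp only [Finset.sum_sub_distrib, ← Finset.sum_mul]
      ring
    -- Replace the power of Z by that of Z₀ and expand A. The first order vanishes since h is
    -- centred and independent of the rest, the second produces σ2 times a decoupled mean, and what
    -- is left is the change of the power and the cubic term.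
    have r2 : ∀ k ∈ s, σ2 * ∫ ω, A'₀ k ω * oddPow m (Z₀ k ω) ∂μ +
        ∫ ω, ((h k ω : ℂ) * A k ω * (oddPow m (Z ω) - oddPow m (Z₀ k ω)) +
        (h k ω : ℂ) ^ 3 * A'' k ω * oddPow m (Z₀ k ω)) ∂μ =
        ∫ ω, (h k ω : ℂ) * A k ω * oddPow m (Z ω) ∂μ := fun k hk => by
      have i3 : Integrable (fun ω =>
          (h k ω : ℂ) * A k ω * (oddPow m (Z ω) - oddPow m (Z₀ k ω)) +
          (h k ω : ℂ) ^ 3 * A'' k ω * oddPow m (Z₀ k ω)) μ := (ihAQ k hk).add (ih3 k hk)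
      have i12 : Integrable (fun ω => (h k ω : ℂ) * (A₀ k ω * oddPow m (Z₀ k ω)) +
          (h k ω : ℂ) ^ 2 * (A'₀ k ω * oddPow m (Z₀ k ω))) μ := (ih1 k hk).add (ih2 k hk)
      rw [← e2 k hk, ← zero_add (∫ ω, (h k ω : ℂ) ^ 2 * _ ∂μ), ← e1 k hk,
        ← integral_add (ih1 k hk) (ih2 k hk), ← integral_add i12 i3]
      refine integral_congr_ae (Filter.Eventually.of_forall fun ω => ?_)
      simp only
      linear_combination (-(h k ω : ℂ) * oddPow m (Z₀ k ω)) * hA k hk ω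
    have ihAQ' : ∀ k ∈ s, Integrable (fun ω => (h k ω : ℂ) * A k ω * oddPow m (Z ω)) μ :=
      fun k hk => by
        refine integrable_of_norm_le_mul_pow hW (((mhc k hk).mul (mA k hk)).mul
          (mQ.comp mZ)).aestronglyMeasurable 1 (2 * m + 3) fun ω => ?_
        rw [norm_mul, norm_mul]
        calc _ ≤ W ω * W ω * W ω ^ (2 * m + 1) := by
              have := W0 ω
              gcongr
              exacts [nhc k hk ω, bA k hk ω, bQ ω]
          _ = _ := by ring
    rw [r1, add_assoc, ← Finset.sum_add_distrib, Finset.sum_congr rfl r2,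
      ← integral_finsetSum _ ihAQ', ← integral_add iDQ (integrable_finsetSum _ ihAQ'),
      ← integral_complex_ofReal]
    refine integral_congr_ae (Filter.Eventually.of_forall fun ω => ?_)
    simp only
    rw [← mul_oddPow, ← Finset.sum_mul, ← add_mul, add_comm (D ω), ← hZ]
  -- bounding the terms
  have iWΘ : Integrable (Θᶜ.indicator fun ω => W ω ^ d) μ := (hW d).indicator mΘ.compl
  have hind0 : ∀ ω, 0 ≤ Θᶜ.indicator (fun ω => W ω ^ d) ω :=
    fun ω => Set.indicator_nonneg (fun ω _ => pow_nonneg (W0 ω) d) ω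
  -- On Θ the integrand is at most h² Y₀. Since Y₀ is independent of h, the square can be replaced
  -- by the variance; this is why Y₀ must be built from decoupled quantities only. Off Θ the crude
  -- bound W is used.
  have b2 : ∀ k ∈ s, ‖∫ ω, ((h k ω : ℂ) * A k ω * (oddPow m (Z ω) - oddPow m (Z₀ k ω)) +
        (h k ω : ℂ) ^ 3 * A'' k ω * oddPow m (Z₀ k ω)) ∂μ‖ ≤
        σ2 * ∫ ω, Y₀ k ω ∂μ + 3 * ∫ ω in Θᶜ, W ω ^ d ∂μ := fun k hk => by
    rw [← e3 k hk, ← integral_indicator mΘ.compl, ← integral_const_mul,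
      ← integral_add (ihY k hk) (iWΘ.const_mul 3)]
    refine norm_integral_le_of_norm_le ((ihY k hk).add (iWΘ.const_mul 3))
      (Filter.Eventually.of_forall fun ω => ?_)
    have hb : ‖(h k ω : ℂ) * A k ω * (oddPow m (Z ω) - oddPow m (Z₀ k ω)) +
        (h k ω : ℂ) ^ 3 * A'' k ω * oddPow m (Z₀ k ω)‖ ≤
        |h k ω| * ‖A k ω‖ * ‖oddPow m (Z ω) - oddPow m (Z₀ k ω)‖ +
        |h k ω| ^ 3 * ‖A'' k ω‖ * ‖Z₀ k ω‖ ^ (2 * m + 1) := by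
      refine (norm_add_le _ _).trans (le_of_eq ?_)
      rw [norm_mul, norm_mul, norm_mul, norm_mul, norm_pow, Complex.norm_real, norm_oddPow,
        Real.norm_eq_abs]
    refine hb.trans ?_
    by_cases hω : ω ∈ Θ
    · have := hind0 ω
      linarith [hΘ ω hω k hk]
    · rw [Set.indicator_of_mem (show ω ∈ Θᶜ from hω)]
      have t1 : |h k ω| * ‖A k ω‖ * ‖oddPow m (Z ω) - oddPow m (Z₀ k ω)‖ ≤
          2 * W ω ^ d := by
        calc _ ≤ W ω * W ω * (W ω ^ (2 * m + 1) + W ω ^ (2 * m + 1)) := by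
              have := W0 ω
              gcongr
              exacts [bh k hk ω, bA k hk ω,
                (norm_sub_le _ _).trans (add_le_add (bQ ω) (bQ₀ k hk ω))]
          _ = 2 * W ω ^ (2 * m + 3) := by ring
          _ ≤ _ := by gcongr; exacts [W1 ω, by omega]
      have t2 : |h k ω| ^ 3 * ‖A'' k ω‖ * ‖Z₀ k ω‖ ^ (2 * m + 1) ≤ W ω ^ d := by
        calc _ ≤ W ω ^ 3 * W ω * W ω ^ (2 * m + 1) := by
              have := W0 ω
              gcongr
              exacts [bh k hk ω, bA'' k hk ω, bZ₀ k hk ω]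
          _ = W ω ^ (2 * m + 5) := by ring
          _ ≤ _ := Wd ω _ hd
      have t3 : 0 ≤ h k ω ^ 2 * Y₀ k ω := mul_nonneg (sq_nonneg _) (nY₀ k hk ω)
      linarith
  have iD : Integrable (fun ω => (D ω + σ2 * ∑ k ∈ s, A' k ω) * oddPow m (Z ω)) μ := by
    have : (fun ω => (D ω + σ2 * ∑ k ∈ s, A' k ω) * oddPow m (Z ω)) = fun ω =>
        D ω * oddPow m (Z ω) + σ2 * ∑ k ∈ s, A' k ω * oddPow m (Z ω) := by
      funext ω; rw [← Finset.sum_mul]; ring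
    rw [this]
    exact iDQ.add ((integrable_finsetSum _ iA'Q).const_mul _)
  have iS : Integrable (fun ω => ∑ k ∈ s,
      (A'₀ k ω * oddPow m (Z₀ k ω) - A' k ω * oddPow m (Z ω))) μ :=
    integrable_finsetSum _ fun k hk => (iA'Q₀ k hk).sub (iA'Q k hk)
  have b1 : ‖∫ ω, ((D ω + σ2 * ∑ k ∈ s, A' k ω) * oddPow m (Z ω) +
        σ2 * ∑ k ∈ s, (A'₀ k ω * oddPow m (Z₀ k ω) - A' k ω * oddPow m (Z ω))) ∂μ‖ +
        ∑ k ∈ s, σ2 * ∫ ω, Y₀ k ω ∂μ ≤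
      ∫ ω, F ω ∂μ + (1 + 4 * σ2 * s.card) * ∫ ω in Θᶜ, W ω ^ d ∂μ := by
    have iG : Integrable (fun ω => ‖(D ω + σ2 * ∑ k ∈ s, A' k ω) * oddPow m (Z ω) +
        σ2 * ∑ k ∈ s, (A'₀ k ω * oddPow m (Z₀ k ω) - A' k ω * oddPow m (Z ω))‖) μ :=
      (iD.add (iS.const_mul _)).norm
    refine (add_le_add_left (norm_integral_le_integral_norm _) _).trans ?_
    rw [← Finset.mul_sum, ← integral_finsetSum _ iY₀, ← integral_const_mul,
      ← integral_add iG ((integrable_finsetSum _ iY₀).const_mul _),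
      ← integral_indicator mΘ.compl, ← integral_const_mul, ← integral_add hF (iWΘ.const_mul _)]
    refine integral_mono (iG.add ((integrable_finsetSum _ iY₀).const_mul _))
      (hF.add (iWΘ.const_mul _)) fun ω => ?_
    simp only
    have g1 : ‖(D ω + σ2 * ∑ k ∈ s, A' k ω) * oddPow m (Z ω) +
        σ2 * ∑ k ∈ s, (A'₀ k ω * oddPow m (Z₀ k ω) - A' k ω * oddPow m (Z ω))‖ +
        σ2 * ∑ k ∈ s, Y₀ k ω ≤ ‖D ω + σ2 * ∑ k ∈ s, A' k ω‖ * ‖Z ω‖ ^ (2 * m + 1) +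
      σ2 * ∑ k ∈ s, (‖A' k ω * oddPow m (Z ω) - A'₀ k ω * oddPow m (Z₀ k ω)‖ + Y₀ k ω) := by
      rw [Finset.sum_add_distrib, mul_add, ← add_assoc]
      gcongr
      refine (norm_add_le _ _).trans (add_le_add ?_ ?_)
      · rw [norm_mul, norm_oddPow]
      · rw [norm_mul, Complex.norm_real, Real.norm_eq_abs, abs_of_nonneg hσ]
        gcongr
        refine (norm_sum_le _ _).trans (Finset.sum_le_sum fun k _ => ?_)
        rw [norm_sub_rev]
    refine g1.trans ?_
    by_cases hω : ω ∈ Θ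
    · rw [Set.indicator_of_notMem (by simpa using hω)]
      linarith [hΘF ω hω]
    · rw [Set.indicator_of_mem (show ω ∈ Θᶜ from hω)]
      have t1 : ‖D ω + σ2 * ∑ k ∈ s, A' k ω‖ * ‖Z ω‖ ^ (2 * m + 1) ≤
          (1 + σ2 * s.card) * W ω ^ d := by
        have : ‖D ω + σ2 * ∑ k ∈ s, A' k ω‖ ≤ (1 + σ2 * s.card) * W ω := by
          refine (norm_add_le _ _).trans ?_
          rw [norm_mul, Complex.norm_real, Real.norm_eq_abs, abs_of_nonneg hσ]
          have h1 : ‖∑ k ∈ s, A' k ω‖ ≤ s.card * W ω :=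
            (norm_sum_le _ _).trans ((Finset.sum_le_sum fun k hk => bA' k hk ω).trans (by simp))
          have := bD ω
          nlinarith
        calc _ ≤ (1 + σ2 * s.card) * W ω * W ω ^ (2 * m + 1) := by
              have := W0 ω
              gcongr
              exact bZ ω
          _ = (1 + σ2 * s.card) * W ω ^ (2 * m + 2) := by ring
          _ ≤ _ := by
            gcongr
            exacts [W1 ω, by omega]
      have t2 : ∑ k ∈ s, (‖A' k ω * oddPow m (Z ω) - A'₀ k ω * oddPow m (Z₀ k ω)‖ + Y₀ k ω) ≤
          s.card * (3 * W ω ^ d) := by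
        rw [← nsmul_eq_mul]
        refine Finset.sum_le_card_nsmul _ _ _ fun k hk => ?_
        have t3 : ‖A' k ω * oddPow m (Z ω) - A'₀ k ω * oddPow m (Z₀ k ω)‖ ≤ 2 * W ω ^ d := by
          calc _ ≤ W ω * W ω ^ (2 * m + 1) + W ω * W ω ^ (2 * m + 1) := by
                have := W0 ω
                refine (norm_sub_le _ _).trans ?_
                rw [norm_mul, norm_mul]
                gcongr
                exacts [bA' k hk ω, bQ ω, bA'₀ k hk ω, bQ₀ k hk ω]
            _ = 2 * W ω ^ (2 * m + 2) := by ring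
            _ ≤ _ := by gcongr; exacts [W1 ω, by omega]
        linarith [bY₀ k hk ω]
      have t4 := mul_le_mul_of_nonneg_left t2 hσ
      have := nF ω
      have e : (1 + 4 * σ2 * s.card) * W ω ^ d = (1 + σ2 * s.card) * W ω ^ d +
        σ2 * (s.card * (3 * W ω ^ d)) := by ring
      linarith
  have hre : ∫ ω, ‖Z ω‖ ^ (2 * m + 2) ∂μ = ‖((∫ ω, ‖Z ω‖ ^ (2 * m + 2) ∂μ : ℝ) : ℂ)‖ := by
    rw [Complex.norm_real, Real.norm_eq_abs, abs_of_nonneg]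
    exact integral_nonneg fun ω => by positivity
  rw [hre, key]
  refine (norm_add_le _ _).trans ?_
  have h3 := (norm_sum_le s fun k => ∫ ω, ((h k ω : ℂ) * A k ω *
    (oddPow m (Z ω) - oddPow m (Z₀ k ω)) +
        (h k ω : ℂ) ^ 3 * A'' k ω * oddPow m (Z₀ k ω)) ∂μ).trans (Finset.sum_le_sum b2)
  rw [Finset.sum_add_distrib, Finset.sum_const, nsmul_eq_mul] at h3
  linarith

/-- Absorbing a small multiple of a power. -/
lemma mul_add_pow_le {x v K : ℝ} (hx : 0 ≤ x) (hv : 0 ≤ v) (hK : 1 ≤ K) (c : ℝ) (hc : 0 ≤ c)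
    (r : ℕ) :
    K * v * (x + c * v) ^ r ≤
      x ^ (r + 1) / 2 + (K * (2 * K * (1 + c) ^ r + c) ^ r) * v ^ (r + 1) := by
  set l := 2 * K * (1 + c) ^ r with hl
  have h1c : 1 ≤ (1 + c) ^ r := one_le_pow₀ (by linarith)
  have hl1 : 1 ≤ l := by nlinarith
  -- The threshold l is chosen so that for x ≥ l v the left-hand side is bounded by exactly half of
  -- the power of x; below it everything is a multiple of the power of v.
  rcases le_total x (l * v) with h | h
  · have : K * v * (x + c * v) ^ r ≤ K * v * ((l + c) * v) ^ r := by
      gcongr; linarith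
    refine this.trans ?_
    rw [mul_pow]
    have : 0 ≤ x ^ (r + 1) / 2 := by positivity
    have e : K * v * ((l + c) ^ r * v ^ r) = K * (l + c) ^ r * v ^ (r + 1) := by ring
    rw [e]; linarith
  · have hv' : v ≤ x / l := by rw [le_div_iff₀ (by linarith)]; linarith
    have hvx : v ≤ x := by nlinarith
    have : K * v * (x + c * v) ^ r ≤ K * (x / l) * ((1 + c) * x) ^ r := by
      gcongr; nlinarith
    refine this.trans ?_
    have e : K * (x / l) * ((1 + c) * x) ^ r = x ^ (r + 1) / 2 := by
      rw [mul_pow, hl]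
      have : 0 < (1 + c) ^ r := by linarith
      field_simp
      ring
    rw [e]
    have : 0 ≤ K * (l + c) ^ r * v ^ (r + 1) := by positivity
    linarith

/-- Markov's inequality for moments together with the Cauchy-Schwarz inequality on a rare event. -/
lemma setIntegral_pow_le {Ω : Type*} [MeasurableSpace Ω] {μ : Measure Ω} [IsProbabilityMeasure μ]
    {W : Ω → ℝ} (mW : Measurable W) (W0 : ∀ ω, 0 ≤ W ω)
    (hW : ∀ d : ℕ, Integrable (fun ω => W ω ^ d) μ) {S : Set Ω} (hS : MeasurableSet S) (d : ℕ) :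
    ∫ ω in S, W ω ^ d ∂μ ≤ √(μ.real S) * √(∫ ω, W ω ^ (2 * d) ∂μ) := by
  rw [← integral_indicator hS]
  have e : (S.indicator fun ω => W ω ^ d) = fun ω => S.indicator (fun _ => (1 : ℝ)) ω * W ω ^ d := by
    funext ω; by_cases h : ω ∈ S <;> simp [h]
  rw [e]
  have cs := integral_mul_le_Lp_mul_Lq_of_nonneg (μ := μ) (f := S.indicator (fun _ => (1 : ℝ)))
    (g := fun ω => W ω ^ d) Real.HolderConjugate.two_two
    (Filter.Eventually.of_forall fun ω => Set.indicator_nonneg (fun _ _ => zero_le_one) ω)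
    (Filter.Eventually.of_forall fun ω => pow_nonneg (W0 ω) d)
    ((memLp_indicator_const _ hS 1 (Or.inr (measure_ne_top _ _))))
    (by
      have : (ENNReal.ofReal 2) = 2 := by norm_num
      rw [this, memLp_two_iff_integrable_sq (mW.pow_const d).aestronglyMeasurable]
      simp_rw [← pow_mul]
      exact hW _)
  refine cs.trans (le_of_eq ?_)
  have e1 : ∫ ω, S.indicator (fun _ => (1 : ℝ)) ω ^ (2 : ℝ) ∂μ = μ.real S := by
    have : (fun ω => S.indicator (fun _ => (1 : ℝ)) ω ^ (2 : ℝ)) = S.indicator (fun _ => (1 : ℝ)) := by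
      funext ω; by_cases h : ω ∈ S <;> simp [h]
    rw [this, integral_indicator hS]; simp
  have e2 : ∫ ω, (W ω ^ d) ^ (2 : ℝ) ∂μ = ∫ ω, W ω ^ (2 * d) ∂μ := by
    congr 1; funext ω
    rw [Real.rpow_two, ← pow_mul, mul_comm]
  rw [e1, e2, ← Real.sqrt_eq_rpow, ← Real.sqrt_eq_rpow]

lemma measure_lt_le_of_moment {Ω : Type*} [MeasurableSpace Ω] {μ : Measure Ω}
    [IsProbabilityMeasure μ] {X : Ω → ℝ} (hX : ∀ ω, 0 ≤ X ω) (k : ℕ)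
    (hint : Integrable (fun ω => X ω ^ k) μ) {t : ℝ} (ht : 0 < t) :
    μ.real {ω | t < X ω} ≤ (∫ ω, X ω ^ k ∂μ) / t ^ k := by
  rw [le_div_iff₀ (by positivity), mul_comm]
  have h := mul_meas_ge_le_integral_of_nonneg (μ := μ)
    (Filter.Eventually.of_forall fun ω => pow_nonneg (hX ω) k) hint (t ^ k)
  refine le_trans ?_ h
  gcongr
  · exact measure_ne_top _ _
  · intro hω
    exact pow_le_pow_left₀ ht.le (le_of_lt hω) k

end LaplacianLocalLaw
end

noncomputable section
namespace LaplacianLocalLaw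

/-! ### Ensembles and events of overwhelming probability -/

/-- A random Laplacian-type matrix together with its size, sparsity and probability space. -/
structure Ensemble.{u} (β : ℝ) (c : ℕ → ℝ) where
  N : ℕ
  q : ℝ
  Ω : Type u
  mΩ : MeasurableSpace Ω
  μ : Measure Ω
  prob : IsProbabilityMeasure μ
  H : Ω → Matrix (Fin (N + 1)) (Fin (N + 1)) ℝ
  model : IsRandomLaplacianType N β q c μ H

attribute [instance] Ensemble.mΩ Ensemble.prob

universe u v w

variable {β : ℝ} {c : ℕ → ℝ}

/-- The events `A M x` hold with overwhelming probability, uniformly in `x ∈ S M`. -/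
def WHP {ι : Ensemble.{u} β c → Type v} (S : ∀ M, Set (ι M))
    (A : ∀ M : Ensemble.{u} β c, ι M → Set M.Ω) : Prop :=
  ∀ k : ℕ, ∃ N₀ : ℕ, ∀ M : Ensemble.{u} β c, N₀ ≤ M.N → ∀ x ∈ S M,
    M.μ.real (A M x)ᶜ ≤ ((M.N : ℝ) ^ k)⁻¹

/-- The map f allows the new event at x to follow from an old event at another deterministic
parameter, such as a shifted or lifted spectral parameter. -/
lemma WHP.mono {ι : Ensemble.{u} β c → Type v} {ι' : Ensemble.{u} β c → Type w}
    {S : ∀ M, Set (ι M)} {S' : ∀ M, Set (ι' M)}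
    {A : ∀ M : Ensemble.{u} β c, ι M → Set M.Ω} {A' : ∀ M : Ensemble.{u} β c, ι' M → Set M.Ω}
    (hA : WHP S A) (f : ∀ M, ι' M → ι M)
    (h : ∃ N₀ : ℕ, ∀ M : Ensemble.{u} β c, N₀ ≤ M.N → ∀ x ∈ S' M,
      f M x ∈ S M ∧ A M (f M x) ⊆ A' M x) : WHP S' A' := by
  intro k
  obtain ⟨N₁, h1⟩ := hA k
  obtain ⟨N₂, h2⟩ := h
  refine ⟨max N₁ N₂, fun M hM x hx => ?_⟩
  obtain ⟨h3, h4⟩ := h2 M (le_of_max_le_right hM) x hx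
  refine le_trans (measureReal_mono ?_) (h1 M (le_of_max_le_left hM) _ h3)
  exact Set.compl_subset_compl.2 h4

lemma WHP.inter {ι : Ensemble.{u} β c → Type v} {S : ∀ M, Set (ι M)}
    {A B : ∀ M : Ensemble.{u} β c, ι M → Set M.Ω} (hA : WHP S A) (hB : WHP S B) :
    WHP S (fun M x => A M x ∩ B M x) := by
  intro k
  obtain ⟨N₁, h1⟩ := hA (k + 1)
  obtain ⟨N₂, h2⟩ := hB (k + 1)
  refine ⟨max 2 (max N₁ N₂), fun M hM x hx => ?_⟩
  have hN : (2 : ℝ) ≤ M.N := by exact_mod_cast le_of_max_le_left hM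
  have hM' := le_of_max_le_right hM
  rw [Set.compl_inter]
  refine (measureReal_union_le _ _).trans ((add_le_add (h1 M (le_of_max_le_left hM') x hx)
    (h2 M (le_of_max_le_right hM') x hx)).trans ?_)
  rw [pow_succ, mul_inv, ← two_mul]
  have : 0 < ((M.N : ℝ) ^ k)⁻¹ := by positivity
  have h5 : (M.N : ℝ)⁻¹ ≤ 2⁻¹ := inv_anti₀ (by norm_num) hN
  nlinarith

/-- A union bound: polynomially many events cost only a fixed shift of the exponent. -/
lemma WHP.biInter {ι : Ensemble.{u} β c → Type v} {κ : Ensemble.{u} β c → Type w}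
    {S : ∀ M, Set (ι M)} (J : ∀ M, ι M → Finset (κ M))
    {A : ∀ M : Ensemble.{u} β c, ι M × κ M → Set M.Ω} (a : ℕ)
    (hJ : ∃ N₀ : ℕ, ∀ M : Ensemble.{u} β c, N₀ ≤ M.N → ∀ x ∈ S M,
      ((J M x).card : ℝ) ≤ (M.N : ℝ) ^ a)
    (hA : WHP (fun M => {p : ι M × κ M | p.1 ∈ S M ∧ p.2 ∈ J M p.1}) A) :
    WHP S (fun M x => ⋂ j ∈ J M x, A M (x, j)) := by
  intro k
  obtain ⟨N₁, h1⟩ := hA (k + a)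
  obtain ⟨N₂, h2⟩ := hJ
  refine ⟨max 1 (max N₁ N₂), fun M hM x hx => ?_⟩
  have hN : (1 : ℝ) ≤ M.N := by exact_mod_cast le_of_max_le_left hM
  have hM' := le_of_max_le_right hM
  have e : (⋂ j ∈ J M x, A M (x, j))ᶜ = ⋃ j ∈ J M x, (A M (x, j))ᶜ := by
    simp [Set.compl_iInter]
  rw [e]
  calc M.μ.real (⋃ j ∈ J M x, (A M (x, j))ᶜ) ≤ ∑ j ∈ J M x, M.μ.real (A M (x, j))ᶜ :=
        measureReal_biUnion_finset_le _ _
    _ ≤ ∑ _j ∈ J M x, ((M.N : ℝ) ^ (k + a))⁻¹ :=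
        Finset.sum_le_sum fun j hj => h1 M (le_of_max_le_left hM') (x, j) ⟨hx, hj⟩
    _ = (J M x).card * ((M.N : ℝ) ^ (k + a))⁻¹ := by simp
    _ ≤ (M.N : ℝ) ^ a * ((M.N : ℝ) ^ (k + a))⁻¹ := by
        gcongr; exact h2 M (le_of_max_le_right hM') x hx
    _ = _ := by
        have : (M.N : ℝ) ≠ 0 := by positivity
        rw [pow_add]; field_simp

lemma WHP.of_forall {ι : Ensemble.{u} β c → Type v} {S : ∀ M, Set (ι M)}
    {A : ∀ M : Ensemble.{u} β c, ι M → Set M.Ω}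
    (h : ∃ N₀ : ℕ, ∀ M : Ensemble.{u} β c, N₀ ≤ M.N → ∀ x ∈ S M, ∀ ω, ω ∈ A M x) : WHP S A := by
  obtain ⟨N₀, h⟩ := h
  refine fun k => ⟨N₀, fun M hM x hx => ?_⟩
  have : (A M x)ᶜ = ∅ := Set.compl_empty_iff.2 (Set.eq_univ_of_forall (h M hM x hx))
  rw [this]; simp

/-! ### A small power of `N` -/

/-- The number `N ^ (1 / P)`, in powers of which all errors are measured. -/
def scale (P N : ℕ) : ℝ := (N : ℝ) ^ ((P : ℝ)⁻¹)

lemma scale_pow {P : ℕ} (hP : P ≠ 0) (N : ℕ) : scale P N ^ P = N :=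
  Real.rpow_inv_natCast_pow (Nat.cast_nonneg _) hP

lemma one_le_scale (P : ℕ) {N : ℕ} (hN : 1 ≤ N) : 1 ≤ scale P N :=
  Real.one_le_rpow (by exact_mod_cast hN) (by positivity)

lemma eventually_le_scale {P : ℕ} (hP : P ≠ 0) (K : ℝ) :
    ∃ N₀ : ℕ, 1 ≤ N₀ ∧ ∀ N : ℕ, N₀ ≤ N → K ≤ scale P N := by
  obtain ⟨n, hn⟩ := exists_nat_ge (max K 1 ^ P)
  refine ⟨max 1 n, le_max_left _ _, fun N hN => ?_⟩
  have h1 : max K 1 ^ P ≤ scale P N ^ P := by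
    rw [scale_pow hP]
    exact hn.trans (by exact_mod_cast le_of_max_le_right hN)
  exact (le_max_left K 1).trans (le_of_pow_le_pow_left₀ hP (by unfold scale; positivity) h1)

lemma scale_pow_le_rpow {P : ℕ} (hP : P ≠ 0) {a : ℝ} {j : ℕ} (h : (j : ℝ) ≤ a * P) {N : ℕ}
    (hN : 1 ≤ N) : scale P N ^ j ≤ (N : ℝ) ^ a := by
  rw [scale, ← Real.rpow_natCast, ← Real.rpow_mul (Nat.cast_nonneg _)]
  refine Real.rpow_le_rpow_of_exponent_le (by exact_mod_cast hN) ?_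
  have : (0 : ℝ) < P := by exact_mod_cast Nat.pos_of_ne_zero hP
  rw [inv_mul_le_iff₀ this]; linarith

/-! ### Elementary properties of an ensemble -/

namespace Ensemble

variable (M : Ensemble.{u} β c)

lemma hsymm (ω : M.Ω) (i j : Fin (M.N + 1)) : M.H ω i j = M.H ω j i := M.model.symm ω i j

lemma measurable_H : Measurable fun ω (a b : Fin (M.N + 1)) => M.H ω a b :=
  measurable_pi_lambda _ fun a => measurable_pi_lambda _ fun b => M.model.measurable a b

lemma one_le_q (hβ : 0 < β) (hN : 1 ≤ M.N) : 1 ≤ M.q :=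
  (Real.one_le_rpow (by exact_mod_cast hN) hβ.le).trans M.model.le_q

lemma q_sq_le (hβ : 0 < β) (hN : 1 ≤ M.N) : M.q ^ 2 ≤ M.N := by
  have h1 := M.one_le_q hβ hN
  have h2 := pow_le_pow_left₀ (by linarith) M.model.q_le 2
  rwa [← Real.sqrt_eq_rpow, Real.sq_sqrt (Nat.cast_nonneg _)] at h2

lemma scale_pow_le_q {P : ℕ} (hP : P ≠ 0) {j : ℕ} (h : (j : ℝ) ≤ β * P) (hN : 1 ≤ M.N) :
    scale P M.N ^ j ≤ M.q :=
  (scale_pow_le_rpow hP h hN).trans M.model.le_q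

/-- The matrix of Laplacian type with given off-diagonal entries. -/
def ofWeights {n : ℕ} (x : {p : Fin n × Fin n // p.1 < p.2} → ℝ) (a b : Fin n) : ℝ :=
  let y : Fin n → Fin n → ℝ := fun a b =>
    if h : a < b then x ⟨(a, b), h⟩ else if h : b < a then x ⟨(b, a), h⟩ else 0
  if a = b then -∑ k ∈ Finset.univ.erase a, y a k else y a b

lemma measurable_ofWeights {n : ℕ} :
    Measurable (ofWeights : ({p : Fin n × Fin n // p.1 < p.2} → ℝ) → Fin n → Fin n → ℝ) := by
  have hy : ∀ a b : Fin n, Measurable fun x : {p : Fin n × Fin n // p.1 < p.2} → ℝ =>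
      if h : a < b then x ⟨(a, b), h⟩ else if h : b < a then x ⟨(b, a), h⟩ else 0 := by
    intro a b
    by_cases h1 : a < b
    · simp only [h1, dif_pos]; fun_prop
    · by_cases h2 : b < a
      · simp only [h1, h2, dif_pos, dif_neg, not_false_eq_true]; fun_prop
      · simp only [h1, h2, dif_neg, not_false_eq_true]; fun_prop
  refine measurable_pi_lambda _ fun a => measurable_pi_lambda _ fun b => ?_
  unfold ofWeights
  by_cases h : a = b
  · simp only [h, if_true]
    exact (Finset.measurable_sum _ fun k _ => hy b k).neg
  · simp only [h, if_false]
    exact hy a b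

/-- Setting the weight of one edge to zero and refilling the diagonal gives the cut matrix, so the
cut matrix is a function of all the other weights. Row sums remain zero because `edgeVec` sums to
zero. -/
lemma cut_eq_ofWeights (ω : M.Ω) {i k : Fin (M.N + 1)} (hik : i < k) :
    (cut (M.H ω) i k : Fin (M.N + 1) → Fin (M.N + 1) → ℝ) =
      ofWeights (fun p => if p = ⟨(i, k), hik⟩ then 0 else M.H ω p.1.1 p.1.2) := by
  have hy : ∀ a b : Fin (M.N + 1), a ≠ b →
      (if h : a < b then (if (⟨(a, b), h⟩ : {p : Fin (M.N + 1) × Fin (M.N + 1) // p.1 < p.2}) =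
          ⟨(i, k), hik⟩ then (0 : ℝ) else M.H ω a b)
        else if h : b < a then (if (⟨(b, a), h⟩ : {p : Fin (M.N + 1) × Fin (M.N + 1) // p.1 < p.2})
          = ⟨(i, k), hik⟩ then (0 : ℝ) else M.H ω b a) else 0) = cut (M.H ω) i k a b := by
    intro a b hab
    rcases lt_or_gt_of_ne hab with h | h
    · rw [dif_pos h]
      by_cases h1 : a = i ∧ b = k
      · obtain ⟨rfl, rfl⟩ := h1
        simp [cut, edgeVec, hab, hab.symm]
      · have : ¬ ((⟨(a, b), h⟩ : {p : Fin (M.N + 1) × Fin (M.N + 1) // p.1 < p.2}) =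
          ⟨(i, k), hik⟩) := by simpa using h1
        rw [if_neg this]
        have : edgeVec i k a * edgeVec i k b = 0 := by
          unfold edgeVec
          by_cases ha : a = i
          · have hb : b ≠ k := fun hb => h1 ⟨ha, hb⟩
            have hb2 : b ≠ i := fun hb2 => hab (ha.trans hb2.symm)
            simp [hb, hb2]
          · by_cases ha2 : a = k
            · have hb : b ≠ i := by rintro rfl; omega
              have hb2 : b ≠ k := fun hb2 => hab (ha2.trans hb2.symm)
              simp [hb, hb2]
            · simp [ha, ha2]
        simp [cut, this]
    · rw [dif_neg (not_lt.2 h.le), dif_pos h]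
      by_cases h1 : b = i ∧ a = k
      · obtain ⟨rfl, rfl⟩ := h1
        simp [cut, edgeVec, hab, hab.symm, M.hsymm ω a b]
      · have : ¬ ((⟨(b, a), h⟩ : {p : Fin (M.N + 1) × Fin (M.N + 1) // p.1 < p.2}) =
          ⟨(i, k), hik⟩) := by simpa using h1
        rw [if_neg this]
        have : edgeVec i k a * edgeVec i k b = 0 := by
          unfold edgeVec
          by_cases ha : b = i
          · have hb : a ≠ k := fun hb => h1 ⟨ha, hb⟩
            have hb2 : a ≠ i := fun hb2 => hab (hb2.trans ha.symm)
            simp [hb, hb2]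
          · by_cases ha2 : b = k
            · have hb : a ≠ i := by rintro rfl; omega
              have hb2 : a ≠ k := fun hb2 => hab (hb2.trans ha2.symm)
              simp [hb, hb2]
            · simp [ha, ha2]
        simp [cut, this, M.hsymm ω a b]
  have hdiag : ∀ a, cut (M.H ω) i k a a =
      -∑ b ∈ Finset.univ.erase a, cut (M.H ω) i k a b := by
    intro a
    simp only [cut, M.model.diag ω a, Finset.sum_add_distrib]
    have h0 : ∑ b, edgeVec i k b = 0 := by simp [edgeVec]
    have h1 : ∑ b ∈ Finset.univ.erase a, M.H ω i k * (edgeVec i k a * edgeVec i k b) =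
        - (M.H ω i k * (edgeVec i k a * edgeVec i k a)) := by
      rw [← Finset.mul_sum, ← Finset.mul_sum, Finset.sum_erase_eq_sub (Finset.mem_univ a), h0]
      ring
    rw [h1]; ring
  funext a b
  unfold ofWeights
  by_cases hab : a = b
  · subst hab
    rw [if_pos rfl, hdiag a]
    congr 1
    refine Finset.sum_congr rfl fun b hb => ?_
    exact (hy a b (Finset.ne_of_mem_erase hb).symm).symm
  · rw [if_neg hab]
    exact (hy a b hab).symm

lemma indep_cut_of_lt {i k : Fin (M.N + 1)} (hik : i < k) :
    IndepFun (fun ω => M.H ω i k)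
      (fun ω (a b : Fin (M.N + 1)) => cut (M.H ω) i k a b) M.μ := by
  classical
  set e : {p : Fin (M.N + 1) × Fin (M.N + 1) // p.1 < p.2} := ⟨(i, k), hik⟩ with he
  have h := M.model.indep.indepFun_finset {e} (Finset.univ.erase e) (by simp)
    (fun p => M.model.measurable _ _)
  have m1 : Measurable fun x : (({e} : Finset {p : Fin (M.N + 1) × Fin (M.N + 1) // p.1 < p.2}) →
      ℝ) => x ⟨e, Finset.mem_singleton_self e⟩ := measurable_pi_apply _
  -- The family of the other weights is extended by 0 at the removed edge, which is exactly the
  -- value that the cut matrix uses there.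
  have m2 : Measurable fun y : (((Finset.univ : Finset
        {p : Fin (M.N + 1) × Fin (M.N + 1) // p.1 < p.2}).erase e : Finset _) → ℝ) =>
      ofWeights (fun p => if hp : p ∈ (Finset.univ : Finset _).erase e then y ⟨p, hp⟩ else 0) := by
    refine measurable_ofWeights.comp (measurable_pi_lambda _ fun p => ?_)
    by_cases hp : p ∈ Finset.univ.erase e
    · simp only [hp, dif_pos]; exact measurable_pi_apply _
    · simp only [hp]; exact measurable_const
  have h2 := h.comp m1 m2
  refine h2.congr (Filter.Eventually.of_forall fun ω => rfl)
    (Filter.Eventually.of_forall fun ω => ?_)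
  have := M.cut_eq_ofWeights ω hik
  refine Eq.trans ?_ this.symm
  simp only [Function.comp_apply]
  congr 1
  funext p
  by_cases hp : p = e
  · simp [hp, ← he]
  · simp [hp, ← he]

lemma cut_comm {n : ℕ} {A : Matrix (Fin n) (Fin n) ℝ} (hA : ∀ i j, A i j = A j i) (i k : Fin n) :
    cut A i k = cut A k i := by
  funext a b
  simp only [cut, edgeVec, hA i k]; ring

/-- An off-diagonal entry is independent of the matrix with the corresponding edge removed. -/
lemma indep_cut {i k : Fin (M.N + 1)} (hik : i ≠ k) :
    IndepFun (fun ω => M.H ω i k)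
      (fun ω (a b : Fin (M.N + 1)) => cut (M.H ω) i k a b) M.μ := by
  rcases lt_or_gt_of_ne hik with h | h
  · exact M.indep_cut_of_lt h
  · have := M.indep_cut_of_lt h
    simp_rw [M.hsymm _ i k, cut_comm (M.hsymm _) i k]
    exact this

/-! ### A crude bound -/

/-- A random variable dominating all entries and the size of the matrix. -/
def crude (ω : M.Ω) : ℝ :=
  ∑ p : Fin (M.N + 1) × Fin (M.N + 1), (1 + if p.1 = p.2 then 0 else |M.H ω p.1 p.2|)

lemma measurable_crude : Measurable M.crude := by
  refine Finset.measurable_sum _ fun p _ => measurable_const.add ?_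
  by_cases h : p.1 = p.2
  · simp only [h, if_true]; exact measurable_const
  · simp only [h, if_false]
    exact (M.model.measurable _ _).abs

lemma crude_ge (ω : M.Ω) : ((M.N : ℝ) + 1) ^ 2 ≤ M.crude ω := by
  have : ∑ _p : Fin (M.N + 1) × Fin (M.N + 1), (1 : ℝ) ≤ M.crude ω := by
    refine Finset.sum_le_sum fun p _ => ?_
    split_ifs <;> simp
  simp only [Finset.sum_const, Finset.card_univ, Fintype.card_prod, Fintype.card_fin,
    nsmul_eq_mul] at this
  push_cast at this
  nlinarith

lemma one_le_crude (ω : M.Ω) : 1 ≤ M.crude ω := by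
  have := M.crude_ge ω
  have h : (0 : ℝ) ≤ M.N := Nat.cast_nonneg _
  nlinarith

lemma N_add_one_le_crude (ω : M.Ω) : (M.N : ℝ) + 1 ≤ M.crude ω := by
  have := M.crude_ge ω
  have h : (0 : ℝ) ≤ M.N := Nat.cast_nonneg _
  nlinarith

lemma abs_H_le_crude (ω : M.Ω) {i j : Fin (M.N + 1)} (hij : i ≠ j) : |M.H ω i j| ≤ M.crude ω := by
  have : ∀ p ∈ (Finset.univ : Finset (Fin (M.N + 1) × Fin (M.N + 1))),
      0 ≤ (1 + if p.1 = p.2 then (0 : ℝ) else |M.H ω p.1 p.2|) := by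
    intro p _; split_ifs <;> positivity
  have h := Finset.single_le_sum this (Finset.mem_univ (i, j))
  simp only [hij, if_false] at h
  unfold crude
  linarith

lemma abs_diag_le_crude (ω : M.Ω) (i : Fin (M.N + 1)) : |M.H ω i i| ≤ M.crude ω := by
  rw [M.model.diag, abs_neg]
  refine (Finset.abs_sum_le_sum_abs _ _).trans ?_
  unfold crude
  rw [Fintype.sum_prod_type]
  refine le_trans ?_ (Finset.single_le_sum (f := fun a => ∑ b,
    (1 + if a = b then (0 : ℝ) else |M.H ω a b|)) (fun a _ => Finset.sum_nonneg fun b _ => by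
      split_ifs <;> positivity) (Finset.mem_univ i))
  refine le_trans ?_ (Finset.sum_le_sum_of_subset_of_nonneg (Finset.erase_subset i Finset.univ)
    fun b _ _ => by split_ifs <;> positivity)
  refine Finset.sum_le_sum fun b hb => ?_
  rw [if_neg (Finset.ne_of_mem_erase hb).symm]; linarith

/-- Moments are assumed from order 3 on; the lower ones are dominated by 1 plus the moment of order
p + 3. -/
lemma integrable_abs_pow {i j : Fin (M.N + 1)} (hij : i ≠ j) (p : ℕ) :
    Integrable (fun ω => |M.H ω i j| ^ p) M.μ := by
  refine ((integrable_const (1 : ℝ)).add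
    (M.model.moment_integrable i j hij (p + 3) (by omega))).mono'
    ((M.model.measurable i j).abs.pow_const p).aestronglyMeasurable
    (Filter.Eventually.of_forall fun ω => ?_)
  simp only [Pi.add_apply]
  rw [Real.norm_eq_abs, abs_of_nonneg (by positivity)]
  rcases le_total |M.H ω i j| 1 with h | h
  · have := pow_le_one₀ (n := p) (abs_nonneg _) h
    have : 0 ≤ |M.H ω i j| ^ (p + 3) := by positivity
    linarith
  · have := pow_le_pow_right₀ h (show p ≤ p + 3 by omega)
    linarith

lemma integral_abs_pow_le (hβ : 0 < β) (hN : 1 ≤ M.N) {i j : Fin (M.N + 1)} (hij : i ≠ j)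
    (p : ℕ) (hp : 3 ≤ p) : ∫ ω, |M.H ω i j| ^ p ∂M.μ ≤ |c p| / (M.q ^ (p - 2) * M.N) := by
  have hq := M.one_le_q hβ hN
  refine (M.model.moment_le i j hij p hp).trans ?_
  gcongr
  exact le_abs_self _

/-- The power mean inequality over the (N + 1)² index pairs, followed by (1 + x)^(d+1) ≤ 2^d (1 +
x^(d+1)). -/
lemma crude_pow_le (ω : M.Ω) (d : ℕ) : M.crude ω ^ (d + 1) ≤
    (((M.N : ℝ) + 1) ^ 2) ^ d * ∑ p : Fin (M.N + 1) × Fin (M.N + 1),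
          (2 ^ d * (1 + if p.1 = p.2 then 0 else |M.H ω p.1 p.2| ^ (d + 1))) := by
  have h0 : ∀ p ∈ (Finset.univ : Finset (Fin (M.N + 1) × Fin (M.N + 1))),
      0 ≤ (1 + if p.1 = p.2 then (0 : ℝ) else |M.H ω p.1 p.2|) := by
    intro p _; split_ifs <;> positivity
  have h := pow_sum_div_card_le_sum_pow h0 d
  have hc : ((Finset.univ : Finset (Fin (M.N + 1) × Fin (M.N + 1))).card : ℝ) =
      ((M.N : ℝ) + 1) ^ 2 := by
    simp only [Finset.card_univ, Fintype.card_prod, Fintype.card_fin]; push_cast; ring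
  rw [hc, div_le_iff₀ (by positivity), mul_comm] at h
  refine h.trans ?_
  gcongr with p _
  refine (add_pow_le zero_le_one (by split_ifs <;> positivity) (d + 1)).trans (le_of_eq ?_)
  split_ifs <;> simp

lemma integrable_crude_pow (d : ℕ) : Integrable (fun ω => M.crude ω ^ d) M.μ := by
  cases d with
  | zero => simp
  | succ d =>
    have hsum : Integrable (fun ω => ((((M.N : ℝ) + 1) ^ 2) ^ d *
        ∑ p : Fin (M.N + 1) × Fin (M.N + 1),
          (2 ^ d * (1 + if p.1 = p.2 then 0 else |M.H ω p.1 p.2| ^ (d + 1))))) M.μ := by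
      refine (integrable_finsetSum _ fun p _ => ?_).const_mul _
      refine ((integrable_const _).add ?_).const_mul _
      by_cases h : p.1 = p.2
      · simp [h]
      · simpa [h] using M.integrable_abs_pow h (d + 1)
    refine hsum.mono' (M.measurable_crude.pow_const _).aestronglyMeasurable
      (Filter.Eventually.of_forall fun ω => ?_)
    have h0 := M.one_le_crude ω
    rw [Real.norm_eq_abs, abs_of_nonneg (by positivity)]
    exact M.crude_pow_le ω d

lemma integral_abs_pow_le_const (hβ : 0 < β) (hN : 1 ≤ M.N) {i j : Fin (M.N + 1)} (hij : i ≠ j)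
    (p : ℕ) : ∫ ω, |M.H ω i j| ^ p ∂M.μ ≤ 1 + |c (p + 3)| := by
  have hq := M.one_le_q hβ hN
  have h1 : ∫ ω, |M.H ω i j| ^ p ∂M.μ ≤ ∫ ω, (1 + |M.H ω i j| ^ (p + 3)) ∂M.μ := by
    refine integral_mono (M.integrable_abs_pow hij p)
      ((integrable_const _).add (M.integrable_abs_pow hij _)) fun ω => ?_
    simp only
    rcases le_total |M.H ω i j| 1 with h | h
    · have := pow_le_one₀ (n := p) (abs_nonneg _) h
      have : 0 ≤ |M.H ω i j| ^ (p + 3) := by positivity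
      linarith
    · have := pow_le_pow_right₀ h (show p ≤ p + 3 by omega)
      linarith
  refine h1.trans ?_
  rw [integral_add (integrable_const _) (M.integrable_abs_pow hij _)]
  have h2 := M.integral_abs_pow_le hβ hN hij (p + 3) (by omega)
  have h3 : |c (p + 3)| / (M.q ^ (p + 3 - 2) * M.N) ≤ |c (p + 3)| := by
    refine div_le_self (abs_nonneg _) ?_
    have : (1 : ℝ) ≤ M.N := by exact_mod_cast hN
    have h4 : 1 ≤ M.q ^ (p + 3 - 2) := one_le_pow₀ hq
    nlinarith
  simp only [integral_const, probReal_univ, smul_eq_mul, one_mul]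
  linarith

end Ensemble

/-- All moments of the crude bound grow at most polynomially, so multiplying by the indicator of an
event of overwhelmingly small probability makes them negligible. -/
lemma exists_integral_crude_pow_le (hβ : 0 < β) (c : ℕ → ℝ) (d : ℕ) :
    ∃ a N₀ : ℕ, ∀ M : Ensemble.{u} β c, N₀ ≤ M.N →
      ∫ ω, M.crude ω ^ d ∂M.μ ≤ (M.N : ℝ) ^ a := by
  cases d with
  | zero => exact ⟨0, 0, fun M _ => by simp⟩
  | succ d =>
    obtain ⟨N₀, hN₀⟩ := exists_nat_ge (2 ^ d * (2 + |c (d + 4)|))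
    refine ⟨4 * (d + 1) + 1, max 2 N₀, fun M hM => ?_⟩
    have hN : (2 : ℝ) ≤ M.N := by exact_mod_cast le_of_max_le_left hM
    have hN1 : 1 ≤ M.N := le_trans (by norm_num) (le_of_max_le_left hM)
    have hK : 2 ^ d * (2 + |c (d + 4)|) ≤ (M.N : ℝ) :=
      hN₀.trans (by exact_mod_cast le_of_max_le_right hM)
    have hint : ∀ p : Fin (M.N + 1) × Fin (M.N + 1), Integrable (fun ω =>
        (2 ^ d * (1 + if p.1 = p.2 then 0 else |M.H ω p.1 p.2| ^ (d + 1)))) M.μ := fun p => by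
      refine ((integrable_const _).add ?_).const_mul _
      by_cases h : p.1 = p.2
      · simp [h]
      · simpa [h] using M.integrable_abs_pow h (d + 1)
    have hN2 : ((M.N : ℝ) + 1) ^ 2 ≤ (M.N : ℝ) ^ 4 := by
      have : (M.N : ℝ) + 1 ≤ (M.N : ℝ) ^ 2 := by nlinarith
      calc _ ≤ ((M.N : ℝ) ^ 2) ^ 2 := by gcongr
        _ = _ := by ring
    calc ∫ ω, M.crude ω ^ (d + 1) ∂M.μ ≤ ∫ ω, (((M.N : ℝ) + 1) ^ 2) ^ d *
        ∑ p : Fin (M.N + 1) × Fin (M.N + 1),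
          (2 ^ d * (1 + if p.1 = p.2 then 0 else |M.H ω p.1 p.2| ^ (d + 1))) ∂M.μ :=
          integral_mono (M.integrable_crude_pow _)
            ((integrable_finsetSum _ fun p _ => hint p).const_mul _) fun ω => M.crude_pow_le ω d
      _ = (((M.N : ℝ) + 1) ^ 2) ^ d * ∑ p : Fin (M.N + 1) × Fin (M.N + 1), ∫ ω,
          (2 ^ d * (1 + if p.1 = p.2 then 0 else |M.H ω p.1 p.2| ^ (d + 1))) ∂M.μ := by
          rw [integral_const_mul, integral_finsetSum _ fun p _ => hint p]
      _ ≤ (((M.N : ℝ) + 1) ^ 2) ^ d * ∑ _p : Fin (M.N + 1) × Fin (M.N + 1),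
          (2 ^ d * (2 + |c (d + 4)|)) := by
          gcongr with p _
          rw [integral_const_mul]
          gcongr
          by_cases h : p.1 = p.2
          · simp only [h, if_true, add_zero, integral_const, probReal_univ, smul_eq_mul, one_mul]
            linarith [abs_nonneg (c (d + 4))]
          · simp only [h, if_false]
            rw [integral_add (integrable_const _) (M.integrable_abs_pow h _)]
            have := M.integral_abs_pow_le_const hβ hN1 h (d + 1)
            simp only [integral_const, probReal_univ, smul_eq_mul, one_mul]
            linarith
      _ = (((M.N : ℝ) + 1) ^ 2) ^ (d + 1) * (2 ^ d * (2 + |c (d + 4)|)) := by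
          simp only [Finset.sum_const, Finset.card_univ, Fintype.card_prod, Fintype.card_fin,
            nsmul_eq_mul]
          push_cast; ring
      _ ≤ ((M.N : ℝ) ^ 4) ^ (d + 1) * M.N := by gcongr
      _ = _ := by ring

/-- Events of overwhelming probability can be neglected in integrals of powers of `crude`. -/
lemma WHP.setIntegral_crude_le (hβ : 0 < β) {ι : Ensemble.{u} β c → Type v} {S : ∀ M, Set (ι M)}
    {A : ∀ M : Ensemble.{u} β c, ι M → Set M.Ω} (hA : WHP S A)
    (mA : ∀ M, ∀ x ∈ S M, MeasurableSet (A M x)) (d l : ℕ) :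
    ∃ N₀ : ℕ, ∀ M : Ensemble.{u} β c, N₀ ≤ M.N → ∀ x ∈ S M,
      ∫ ω in (A M x)ᶜ, M.crude ω ^ d ∂M.μ ≤ ((M.N : ℝ) ^ l)⁻¹ := by
  obtain ⟨a, N₁, h1⟩ := exists_integral_crude_pow_le.{u} hβ c (2 * d)
  -- The Cauchy-Schwarz inequality takes the square root of the probability, hence 2l; the extra a
  -- cancels the polynomial growth of the moments.
  obtain ⟨N₂, h2⟩ := hA (2 * l + a)
  refine ⟨max 1 (max N₁ N₂), fun M hM x hx => ?_⟩
  have hN : (1 : ℝ) ≤ M.N := by exact_mod_cast le_of_max_le_left hM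
  have hM' := le_of_max_le_right hM
  refine (setIntegral_pow_le M.measurable_crude
    (fun ω => zero_le_one.trans (M.one_le_crude ω)) M.integrable_crude_pow (mA M x hx).compl
    d).trans ?_
  rw [← Real.sqrt_mul measureReal_nonneg]
  refine Real.sqrt_le_iff.2 ⟨by positivity, ?_⟩
  calc _ ≤ ((M.N : ℝ) ^ (2 * l + a))⁻¹ * (M.N : ℝ) ^ a := by
        gcongr
        · exact integral_nonneg fun ω => pow_nonneg (zero_le_one.trans (M.one_le_crude ω)) _
        · exact h2 M (le_of_max_le_right hM') x hx
        · exact h1 M (le_of_max_le_left hM')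
    _ = _ := by
      have : (M.N : ℝ) ≠ 0 := by positivity
      rw [pow_add, mul_comm 2 l, pow_mul]; field_simp

/-- Bounds on all moments give bounds with overwhelming probability. -/
lemma WHP.of_moments {ι : Ensemble.{u} β c → Type v} {S : ∀ M, Set (ι M)} {P : ℕ} (hP : P ≠ 0)
    (X : ∀ M : Ensemble.{u} β c, ι M → M.Ω → ℝ) (b : ∀ M : Ensemble.{u} β c, ι M → ℝ) (a : ℕ)
    (hX : ∀ M, ∀ x ∈ S M, ∀ ω, 0 ≤ X M x ω) (hb : ∃ N₀ : ℕ, ∀ M, N₀ ≤ M.N → ∀ x ∈ S M, 0 < b M x)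
    (h : ∀ r : ℕ, ∃ C : ℝ, ∃ m N₀ : ℕ, r ≤ m ∧ ∀ M : Ensemble.{u} β c, N₀ ≤ M.N → ∀ x ∈ S M,
      Integrable (fun ω => X M x ω ^ m) M.μ ∧
      ∫ ω, X M x ω ^ m ∂M.μ ≤ C * scale P M.N ^ a * b M x ^ m) :
    WHP S (fun M x => {ω | X M x ω ≤ scale P M.N * b M x}) := by
  intro k
  obtain ⟨N₁, hN1⟩ := hb
  -- Markov's inequality at level T b leaves C T^a / T^m. Since N^k = T^(P k), the order must exceed
  -- P k + a, and one more power of T absorbs C.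
  obtain ⟨C, m, N₂, hm, h2⟩ := h (P * k + a + 1)
  obtain ⟨N₃, h31, h3⟩ := eventually_le_scale hP C
  refine ⟨max N₁ (max N₂ N₃), fun M hM x hx => ?_⟩
  have hM' := le_of_max_le_right hM
  have hM1 : 1 ≤ M.N := h31.trans (le_of_max_le_right hM')
  have hbx := hN1 M (le_of_max_le_left hM) x hx
  obtain ⟨hi, hle⟩ := h2 M (le_of_max_le_left hM') x hx
  have hT := one_le_scale P hM1
  have hC := h3 M.N (le_of_max_le_right hM')
  set T := scale P M.N
  have e : {ω | X M x ω ≤ T * b M x}ᶜ = {ω | T * b M x < X M x ω} := by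
    ext ω; simp
  rw [e]
  refine (measure_lt_le_of_moment (hX M x hx) m hi (by positivity)).trans ?_
  rw [div_le_iff₀ (by positivity)]
  have hN : (M.N : ℝ) ^ k = T ^ (P * k) := by rw [pow_mul, scale_pow hP]
  rw [hN]
  have h4 : T ^ (P * k + a + 1) ≤ T ^ m := pow_le_pow_right₀ hT hm
  calc _ ≤ C * T ^ a * b M x ^ m := hle
    _ ≤ T * T ^ a * b M x ^ m := by gcongr
    _ = (T ^ (P * k))⁻¹ * (T ^ (P * k + a + 1) * b M x ^ m) := by
        have : T ≠ 0 := by positivity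
        rw [pow_add, pow_add]; field_simp
    _ ≤ (T ^ (P * k))⁻¹ * (T ^ m * b M x ^ m) := by gcongr
    _ = _ := by rw [mul_pow]

/-- All off-diagonal entries are at most `N ^ ε / q`. -/
lemma whp_abs_H_le (hβ : 0 < β) {P : ℕ} (hP : P ≠ 0) {ι : Ensemble.{u} β c → Type v}
    (S : ∀ M, Set (ι M)) :
    WHP S (fun M _ => {ω | ∀ a b, a ≠ b → |M.H ω a b| ≤ scale P M.N / M.q}) := by
  have h1 : WHP (β := β) (c := c) (ι := fun M => ι M × (Fin (M.N + 1) × Fin (M.N + 1)))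
      (fun M => {p | p.1 ∈ S M ∧ p.2 ∈ Finset.univ.filter fun p => p.1 ≠ p.2})
      (fun M p => {ω | |M.H ω p.2.1 p.2.2| ≤ scale P M.N * (1 / M.q)}) := by
    refine WHP.of_moments (ι := fun M : Ensemble.{u} β c => ι M × (Fin (M.N + 1) × Fin (M.N + 1))) hP
      (fun M p ω => |M.H ω p.2.1 p.2.2|) (fun M _ => 1 / M.q) 0
      (fun M p _ ω => abs_nonneg _) ⟨1, fun M hM _ _ => ?_⟩ fun r => ?_
    · have := M.one_le_q hβ hM
      positivity
    · refine ⟨|c (r + 3)|, r + 3, 1, by omega, fun M hM p hp => ⟨?_, ?_⟩⟩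
      · exact M.integrable_abs_pow (by simpa using hp.2) _
      · have hq := M.one_le_q hβ hM
        refine (M.integral_abs_pow_le hβ hM (by simpa using hp.2) _ (by omega)).trans ?_
        -- The bound q² ≤ N turns the assumed q^(p-2) N in the denominator into the q^p that a
        -- variable of size 1 / q would have.
        have h2 := M.q_sq_le hβ hM
        rw [pow_zero, mul_one, div_pow, one_pow, mul_one_div]
        refine div_le_div_of_nonneg_left (abs_nonneg _) (by positivity) ?_
        calc M.q ^ (r + 3) = M.q ^ (r + 3 - 2) * M.q ^ 2 := by
              rw [← pow_add]; congr 1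
          _ ≤ _ := by gcongr
  have h2 := WHP.biInter (fun M _ => Finset.univ.filter fun p : Fin (M.N + 1) × Fin (M.N + 1) =>
    p.1 ≠ p.2) 4 ⟨2, fun M hM x _ => ?_⟩ h1
  · refine h2.mono (fun M x => x) ⟨0, fun M _ x hx => ⟨hx, fun ω hω a b hab => ?_⟩⟩
    simp only [Set.mem_iInter] at hω
    have := hω (a, b) (by simpa using hab)
    simpa [div_eq_mul_inv] using this
  · have hN : (2 : ℝ) ≤ M.N := by exact_mod_cast hM
    have h3 : ((Finset.univ.filter fun p : Fin (M.N + 1) × Fin (M.N + 1) => p.1 ≠ p.2).card : ℝ) ≤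
        (((M.N : ℝ) + 1) * (M.N + 1)) := by
      refine le_trans (Nat.cast_le.2 (Finset.card_filter_le _ _)) ?_
      simp
    have : (M.N : ℝ) + 1 ≤ (M.N : ℝ) ^ 2 := by nlinarith
    calc _ ≤ (((M.N : ℝ) + 1) * (M.N + 1)) := h3
      _ ≤ (M.N : ℝ) ^ 2 * (M.N : ℝ) ^ 2 := by gcongr
      _ = _ := by ring

end LaplacianLocalLaw
end

noncomputable section
namespace LaplacianLocalLaw

universe u v w

variable {β : ℝ} {c : ℕ → ℝ}

/-! ### The diagonal entries -/

lemma cut_diag {n : ℕ} (A : Matrix (Fin n) (Fin n) ℝ) (i k a : Fin n) :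
    cut A i k a a = A a a + A i k * edgeVec i k a ^ 2 := by
  simp only [cut]; ring

lemma cut_diag_left {n : ℕ} (A : Matrix (Fin n) (Fin n) ℝ) {i k : Fin n} (hik : i ≠ k) :
    cut A i k i i = A i i + A i k := by
  rw [cut_diag]; simp [edgeVec, hik]

lemma sum_pairs {n : ℕ} (f : Fin n → Fin n → ℂ) :
    ∑ p ∈ Finset.univ.filter (fun p : Fin n × Fin n => p.1 ≠ p.2), f p.1 p.2 =
      ∑ i, ∑ k ∈ Finset.univ.erase i, f i k := by
  rw [Finset.sum_filter, Fintype.sum_prod_type]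
  refine Finset.sum_congr rfl fun i _ => ?_
  rw [← Finset.filter_ne', Finset.sum_filter]
  exact Finset.sum_congr rfl fun k _ => by simp only [ne_comm]

lemma card_pairs (n : ℕ) :
    (Finset.univ.filter (fun p : Fin n × Fin n => p.1 ≠ p.2)).card ≤ n ^ 2 := by
  refine (Finset.card_filter_le _ _).trans ?_
  simp [sq]

namespace Ensemble

lemma mean_zero (M : Ensemble.{u} β c) {i k : Fin (M.N + 1)} (h : i ≠ k) :
    ∫ ω, M.H ω i k ∂M.μ = 0 := M.model.mean_zero i k h

lemma sum_erase_H (M : Ensemble.{u} β c) (ω : M.Ω) (i : Fin (M.N + 1)) :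
    ∑ k ∈ Finset.univ.erase i, M.H ω i k = - M.H ω i i := by
  rw [M.model.diag]; ring

lemma N_pow_le_crude_pow (M : Ensemble.{u} β c) (ω : M.Ω) (K : ℝ) (hK : K ≤ M.N) :
    K ≤ M.crude ω := by
  linarith [M.N_add_one_le_crude ω]

lemma measurableSet_abs_H_le (M : Ensemble.{u} β c) (t : ℝ) :
    MeasurableSet {ω | ∀ a b, a ≠ b → |M.H ω a b| ≤ t} := by
  simp only [Set.ofPred_forall]
  refine MeasurableSet.iInter fun a => MeasurableSet.iInter fun b => MeasurableSet.iInter fun _ => ?_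
  exact measurableSet_le (M.model.measurable a b).abs measurable_const

lemma measurableSet_abs_diag_le (M : Ensemble.{u} β c) (t : ℝ) :
    MeasurableSet {ω | ∀ a, |M.H ω a a| ≤ t} := by
  simp only [Set.ofPred_forall]
  refine MeasurableSet.iInter fun a => ?_
  exact measurableSet_le (M.model.measurable a a).abs measurable_const

end Ensemble

/-- The error terms produced by rare events are smaller than any power of `N`. -/
lemma WHP.error_le (hβ : 0 < β) {ι : Ensemble.{u} β c → Type v} {S : ∀ M, Set (ι M)}
    {A : ∀ M : Ensemble.{u} β c, ι M → Set M.Ω} (hA : WHP S A)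
    (mA : ∀ M, ∀ x ∈ S M, MeasurableSet (A M x)) (j d l : ℕ) :
    ∃ N₀ : ℕ, 1 ≤ N₀ ∧ ∀ M : Ensemble.{u} β c, N₀ ≤ M.N → ∀ x ∈ S M, ∀ t : ℕ,
      t ≤ (M.N + 1) ^ 2 → (1 + (4 * (1 / (M.N : ℝ)) + 3) * t) *
        ∫ ω in (A M x)ᶜ, (M.crude ω ^ j) ^ d ∂M.μ ≤ ((M.N : ℝ) ^ l)⁻¹ := by
  -- The prefactor is at most 1 + 7 (N + 1)², hence at most N³, which explains the three additional
  -- powers.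
  obtain ⟨N₁, h1⟩ := hA.setIntegral_crude_le hβ mA (j * d) (l + 3)
  refine ⟨max 29 N₁, by omega, fun M hM x hx t ht => ?_⟩
  have hN : (29 : ℝ) ≤ M.N := by exact_mod_cast le_of_max_le_left hM
  simp_rw [← pow_mul]
  have ht' : (t : ℝ) ≤ ((M.N : ℝ) + 1) ^ 2 := by exact_mod_cast ht
  have h2 : 1 / (M.N : ℝ) ≤ 1 := by rw [div_le_one (by linarith)]; linarith
  have h3 : 0 < 1 / (M.N : ℝ) := by positivity
  have h4 : (1 + (4 * (1 / (M.N : ℝ)) + 3) * t) ≤ (M.N : ℝ) ^ 3 := by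
    calc _ ≤ 1 + (4 * 1 + 3) * ((M.N : ℝ) + 1) ^ 2 := by gcongr
      _ ≤ _ := by nlinarith [sq_nonneg (M.N : ℝ)]
  calc _ ≤ (M.N : ℝ) ^ 3 * ((M.N : ℝ) ^ (l + 3))⁻¹ := by
        gcongr
        · exact integral_nonneg fun ω => pow_nonneg (zero_le_one.trans (M.one_le_crude ω)) _
        · exact h1 M (le_of_max_le_right hM) x hx
    _ = _ := by
      have : (M.N : ℝ) ≠ 0 := by positivity
      rw [pow_add]; field_simp

lemma crude_pow_integrable (M : Ensemble.{u} β c) (j d : ℕ) :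
    Integrable (fun ω => (M.crude ω ^ j) ^ d) M.μ := by
  simp_rw [← pow_mul]; exact M.integrable_crude_pow _

/-- The entry is minus the sum of its row, so decoupling applies with constant coefficients: there
is no drift and no expansion, and only the change of the power when one weight is removed remains.
That change is of lower order in the entry, so half of the moment is absorbed. -/
lemma integral_diag_pow_le (hβ : 0 < β) {P : ℕ} (hP : P ≠ 0) (hPβ : 2 ≤ β * P) (m : ℕ) :
    ∃ C : ℝ, ∃ N₀ : ℕ, ∀ M : Ensemble.{u} β c, N₀ ≤ M.N → ∀ i : Fin (M.N + 1),
      Integrable (fun ω => |M.H ω i i| ^ (2 * m + 2)) M.μ ∧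
      ∫ ω, |M.H ω i i| ^ (2 * m + 2) ∂M.μ ≤ C := by
  obtain ⟨N₁, hN11, h1⟩ := (whp_abs_H_le.{u, 0} (c := c) hβ hP (ι := fun _ => Unit)
    (fun _ => Set.univ)).error_le hβ (fun M _ _ => M.measurableSet_abs_H_le _) 1 (2 * m + 5) 0
  obtain ⟨N₂, h2⟩ := exists_nat_ge ((2 * m + 1) * (3 : ℝ) ^ (2 * m))
  set K : ℝ := (2 * m + 1) * 4 ^ m with hK
  have hK1 : 1 ≤ K := by
    have : (1 : ℝ) ≤ 4 ^ m := one_le_pow₀ (by norm_num)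
    have : (0 : ℝ) ≤ m := Nat.cast_nonneg m
    nlinarith
  set C := K * (2 * K * (1 + 2) ^ (2 * m + 1) + 2) ^ (2 * m + 1) with hC
  refine ⟨2 * (C + 1), max N₁ N₂, fun M hM i => ?_⟩
  have hN1 : N₁ ≤ M.N := le_of_max_le_left hM
  have hN : (1 : ℝ) ≤ M.N := by exact_mod_cast hN11.trans hN1
  have hN2 : (2 * m + 1) * (3 : ℝ) ^ (2 * m) ≤ M.N :=
    h2.trans (by exact_mod_cast le_of_max_le_right hM)
  set W : M.Ω → ℝ := fun ω => M.crude ω ^ 1 with hWdef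
  have hW1 : ∀ ω, 1 ≤ W ω := fun ω => by simpa [hWdef] using M.one_le_crude ω
  have hWv : ∀ ω, |M.H ω i i| ≤ W ω := fun ω => by simpa [hWdef] using M.abs_diag_le_crude ω i
  have hint : Integrable (fun ω => |M.H ω i i| ^ (2 * m + 2)) M.μ :=
    integrable_of_norm_le_mul_pow (crude_pow_integrable M 1)
      ((M.model.measurable i i).abs.pow_const _).aestronglyMeasurable 1 (2 * m + 2) fun ω => by
        rw [one_mul, Real.norm_eq_abs, abs_of_nonneg (by positivity)]
        exact pow_le_pow_left₀ (abs_nonneg _) (hWv ω) _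
  refine ⟨hint, ?_⟩
  have hT : scale P M.N / M.q ≤ 1 := by
    rw [div_le_one (lt_of_lt_of_le one_pos (M.one_le_q hβ (hN11.trans hN1)))]
    have := M.scale_pow_le_q hP (j := 1) (by push_cast; linarith) (hN11.trans hN1)
    simpa using this
  set Z₀ : Fin (M.N + 1) → M.Ω → ℂ := fun k ω => ((cut (M.H ω) i k i i : ℝ) : ℂ) with hZ₀
  -- Written in terms of the cut entry so as to be independent of the removed weight; the entry
  -- itself differs from it by at most 1 on the good event.
  set Y₀ : Fin (M.N + 1) → M.Ω → ℝ := fun k ω => (2 * m + 1) * (2 * ‖Z₀ k ω‖ + 1) ^ (2 * m)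
    with hY₀
  have hm0 : (0 : ℝ) ≤ m := Nat.cast_nonneg m
  have hind : ∀ k ∈ Finset.univ.erase i, IndepFun (fun ω => M.H ω i k)
      (fun ω => ((-1 : ℂ), (0 : ℂ), Z₀ k ω, Y₀ k ω)) M.μ := fun k hk => by
    refine (M.indep_cut (Finset.ne_of_mem_erase hk).symm).comp (φ := id)
      (ψ := fun A : Fin (M.N + 1) → Fin (M.N + 1) → ℝ => ((-1 : ℂ), (0 : ℂ), ((A i i : ℝ) : ℂ),
        (2 * m + 1) * (2 * ‖((A i i : ℝ) : ℂ)‖ + 1) ^ (2 * m))) measurable_id (by fun_prop)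
  have mcut : ∀ k, Measurable fun ω => cut (M.H ω) i k i i := fun k => by
    have h1 := M.model.measurable i i
    have h2 := M.model.measurable i k
    simp only [cut]
    fun_prop
  have hbZ₀ : ∀ k ∈ Finset.univ.erase i, ∀ ω, ‖Z₀ k ω‖ ≤ W ω := fun k hk ω => by
    simp only [hZ₀, Complex.norm_real, cut_diag_left _ (Finset.ne_of_mem_erase hk).symm,
      hWdef, pow_one]
    have e : M.H ω i i + M.H ω i k = - ∑ b ∈ (Finset.univ.erase i).erase k, M.H ω i b := by
      have := M.sum_erase_H ω i
      rw [← Finset.add_sum_erase _ _ hk] at this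
      linarith
    rw [e, norm_neg]
    refine (norm_sum_le _ _).trans ?_
    unfold Ensemble.crude
    rw [Fintype.sum_prod_type]
    refine le_trans ?_ (Finset.single_le_sum (f := fun a => ∑ b,
      (1 + if a = b then (0 : ℝ) else |M.H ω a b|)) (fun a _ => Finset.sum_nonneg fun b _ => by
        split_ifs <;> positivity) (Finset.mem_univ i))
    refine le_trans ?_ (Finset.sum_le_sum_of_subset_of_nonneg
      (Finset.subset_univ ((Finset.univ.erase i).erase k)) fun b _ _ => by
        split_ifs <;> positivity)
    refine Finset.sum_le_sum fun b hb => ?_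
    rw [if_neg (Finset.ne_of_mem_erase (Finset.mem_of_mem_erase hb)).symm, Real.norm_eq_abs]
    linarith
  have main := integral_norm_pow_le_of_decoupling (μ := M.μ) (Finset.univ.erase i) m (2 * m + 5)
    le_rfl (σ2 := 1 / (M.N : ℝ)) (by positivity)
    (Z := fun ω => ((M.H ω i i : ℝ) : ℂ)) (D := fun _ => 0) (h := fun k ω => M.H ω i k)
    (A := fun _ _ => -1) (A₀ := fun _ _ => -1) (A' := fun _ _ => 0) (A'₀ := fun _ _ => 0)
    (A'' := fun _ _ => 0) (Z₀ := Z₀) (Y₀ := Y₀) (W := W)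
    (F := fun ω => |M.H ω i i| ^ (2 * m + 2) / 2 + C)
    (Θ := {ω | ∀ a b, a ≠ b → |M.H ω a b| ≤ scale P M.N / M.q})
    (fun ω => by
      have := M.sum_erase_H ω i
      rw [add_zero, ← Finset.sum_mul, ← Complex.ofReal_sum, this]; push_cast; ring)
    (fun k _ ω => by ring) hind
    (fun k hk => M.mean_zero (Finset.ne_of_mem_erase hk).symm)
    (fun k hk => M.model.variance_eq i k (Finset.ne_of_mem_erase hk).symm)
    (Complex.measurable_ofReal.comp (M.model.measurable i i)) measurable_const
    (fun k _ => M.model.measurable i k) (fun _ _ => measurable_const) (fun _ _ => measurable_const)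
    (fun _ _ => measurable_const) (fun _ _ => measurable_const)
    (fun k _ => Complex.measurable_ofReal.comp (mcut k))
    (fun k _ => by
      have := Complex.measurable_ofReal.comp (mcut k)
      simp only [hY₀, hZ₀]
      fun_prop)
    (M.measurableSet_abs_H_le _) hW1 (crude_pow_integrable M 1)
    (fun ω => by rw [Complex.norm_real]; exact hWv ω)
    (fun ω => by simpa using zero_le_one.trans (hW1 ω))
    (fun k hk ω => by
      simpa [hWdef] using M.abs_H_le_crude ω (Finset.ne_of_mem_erase hk).symm)
    (fun _ _ ω => by simpa using hW1 ω) (fun _ _ ω => by simpa using hW1 ω)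
    (fun _ _ ω => by simpa using zero_le_one.trans (hW1 ω))
    (fun _ _ ω => by simpa using zero_le_one.trans (hW1 ω))
    (fun _ _ ω => by simpa using zero_le_one.trans (hW1 ω)) hbZ₀
    (fun k _ ω => by simp only [hY₀]; positivity)
    (fun k hk ω => by
      have h3 := hW1 ω
      have h4 := hbZ₀ k hk ω
      have h5 : (2 * m + 1) * (3 : ℝ) ^ (2 * m) ≤ W ω := by
        simpa [hWdef] using M.N_pow_le_crude_pow ω _ hN2
      calc Y₀ k ω ≤ (2 * m + 1) * (3 * W ω) ^ (2 * m) := by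
            simp only [hY₀]; gcongr; linarith
        _ = ((2 * m + 1) * (3 : ℝ) ^ (2 * m)) * W ω ^ (2 * m) := by rw [mul_pow]; ring
        _ ≤ W ω * W ω ^ (2 * m) := by gcongr
        _ = W ω ^ (2 * m + 1) := by ring
        _ ≤ _ := pow_le_pow_right₀ h3 (by omega))
    ((hint.div_const 2).add (integrable_const _))
    (fun ω => by positivity)
    (fun ω hω k hk => by
      have hik := (Finset.ne_of_mem_erase hk).symm
      have hh : |M.H ω i k| ≤ 1 := (hω i k hik).trans hT
      have h3 := norm_oddPow_sub_le m ((M.H ω i i : ℝ) : ℂ) (Z₀ k ω)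
      have h4 : ‖((M.H ω i i : ℝ) : ℂ) - Z₀ k ω‖ = |M.H ω i k| := by
        simp only [hZ₀]
        rw [cut_diag_left _ hik, ← Complex.ofReal_sub, Complex.norm_real, Real.norm_eq_abs,
          sub_add_cancel_left, abs_neg]
      have h5 : ‖((M.H ω i i : ℝ) : ℂ)‖ ≤ ‖Z₀ k ω‖ + 1 := by
        have := norm_sub_norm_le ((M.H ω i i : ℝ) : ℂ) (Z₀ k ω)
        linarith
      rw [h4] at h3
      simp only [norm_neg, norm_one, mul_one, norm_zero, mul_zero, zero_mul, add_zero]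
      calc _ ≤ |M.H ω i k| * ((2 * m + 1) * |M.H ω i k| *
            (‖((M.H ω i i : ℝ) : ℂ)‖ + ‖Z₀ k ω‖) ^ (2 * m)) := by gcongr
        _ ≤ |M.H ω i k| * ((2 * m + 1) * |M.H ω i k| * (2 * ‖Z₀ k ω‖ + 1) ^ (2 * m)) := by
          have h6 := pow_le_pow_left₀ (by positivity)
            (show ‖((M.H ω i i : ℝ) : ℂ)‖ + ‖Z₀ k ω‖ ≤ 2 * ‖Z₀ k ω‖ + 1 by linarith) (2 * m)
          gcongr
        _ = |M.H ω i k| ^ 2 * Y₀ k ω := by simp only [hY₀]; ring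
        _ = _ := by rw [sq_abs])
    (fun ω hω => by
      simp only [Finset.sum_const_zero, mul_zero, add_zero, norm_zero, zero_mul, sub_zero,
        zero_add]
      have h6 : ∀ k ∈ Finset.univ.erase i, Y₀ k ω ≤ K * (|M.H ω i i| + 2) ^ (2 * m) :=
        fun k hk => by
          have hik := (Finset.ne_of_mem_erase hk).symm
          have hh : |M.H ω i k| ≤ 1 := (hω i k hik).trans hT
          have h7 : ‖Z₀ k ω‖ ≤ |M.H ω i i| + 1 := by
            simp only [hZ₀]
            rw [cut_diag_left _ hik, Complex.norm_real, Real.norm_eq_abs]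
            exact (abs_add_le _ _).trans (by linarith)
          calc Y₀ k ω ≤ (2 * m + 1) * (2 * (|M.H ω i i| + 2)) ^ (2 * m) := by
                simp only [hY₀]; gcongr; linarith
            _ = _ := by rw [mul_pow, pow_mul (2 : ℝ) 2 m, hK]; norm_num; ring
      have h8 : 1 / (M.N : ℝ) * ∑ k ∈ Finset.univ.erase i, Y₀ k ω ≤
          K * (|M.H ω i i| + 2) ^ (2 * m) := by
        rw [one_div, inv_mul_le_iff₀ (by linarith)]
        refine (Finset.sum_le_card_nsmul _ _ _ h6).trans (le_of_eq ?_)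
        simp
      refine h8.trans ?_
      have h9 := mul_add_pow_le (abs_nonneg (M.H ω i i)) zero_le_one hK1 2 (by norm_num)
        (2 * m + 1)
      simp only [mul_one, one_pow] at h9
      refine le_trans ?_ h9
      gcongr
      · linarith [abs_nonneg (M.H ω i i)]
      · omega)
  have h10 := h1 M hN1 () trivial (Finset.univ.erase i).card
    ((Finset.card_erase_le).trans (by simp [sq]))
  rw [integral_add (hint.div_const 2) (integrable_const _), integral_div] at main
  simp only [Complex.norm_real, Real.norm_eq_abs, integral_const, probReal_univ, smul_eq_mul,
    one_mul] at main
  simp only [pow_zero, inv_one] at h10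
  have h11 := main.trans (add_le_add_right h10 _)
  linarith

/-- The diagonal entries are at most `N ^ ε`. -/
lemma whp_abs_diag_le (hβ : 0 < β) {P : ℕ} (hP : P ≠ 0) (hPβ : 2 ≤ β * P)
    {ι : Ensemble.{u} β c → Type v} (S : ∀ M, Set (ι M)) :
    WHP S (fun M _ => {ω | ∀ a, |M.H ω a a| ≤ scale P M.N}) := by
  have h1 : WHP (β := β) (c := c) (ι := fun M => ι M × Fin (M.N + 1))
      (fun M => {p | p.1 ∈ S M ∧ p.2 ∈ Finset.univ})
      (fun M p => {ω | |M.H ω p.2 p.2| ≤ scale P M.N * 1}) := by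
    refine WHP.of_moments (ι := fun M : Ensemble.{u} β c => ι M × Fin (M.N + 1)) hP
      (fun M p ω => |M.H ω p.2 p.2|) (fun M _ => 1) 0
      (fun M p _ ω => abs_nonneg _) ⟨1, fun M hM _ _ => one_pos⟩ fun r => ?_
    obtain ⟨C, N₀, h⟩ := integral_diag_pow_le.{u} (c := c) hβ hP hPβ r
    refine ⟨C, 2 * r + 2, N₀, by omega, fun M hM p _ => ?_⟩
    obtain ⟨h2, h3⟩ := h M hM p.2
    exact ⟨h2, by simpa using h3⟩
  have h2 := WHP.biInter (fun M _ => (Finset.univ : Finset (Fin (M.N + 1)))) 2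
    ⟨2, fun M hM x _ => ?_⟩ h1
  · refine h2.mono (fun M x => x) ⟨0, fun M _ x hx => ⟨hx, fun ω hω a => ?_⟩⟩
    simp only [Set.mem_iInter] at hω
    simpa using hω a (Finset.mem_univ a)
  · have hN : (2 : ℝ) ≤ M.N := by exact_mod_cast hM
    simp only [Finset.card_univ, Fintype.card_fin]
    push_cast
    nlinarith

end LaplacianLocalLaw
end

noncomputable section
namespace LaplacianLocalLaw

universe u v w

variable {β : ℝ} {c : ℕ → ℝ}

/-! ### Stein's equation for the diagonal entries -/

/-- A function `f.1` with derivative `f.2` that, together with two derivatives, has polynomial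
growth. -/
structure SteinTest (K : ℝ) (A : ℕ) (f : (ℝ → ℂ) × (ℝ → ℂ)) : Prop where
  meas : Measurable f.1
  meas' : Measurable f.2
  bound : ∀ x, ‖f.1 x‖ ≤ K * (1 + |x|) ^ A
  bound' : ∀ x, ‖f.2 x‖ ≤ K * (1 + |x|) ^ A
  lip : ∀ x h : ℝ, ‖f.2 (x + h) - f.2 x‖ ≤ K * |h| * (1 + |x| + |h|) ^ A
  taylor : ∀ x h : ℝ, ‖f.1 (x + h) - f.1 x - h * f.2 x‖ ≤ K * h ^ 2 * (1 + |x| + |h|) ^ A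

namespace SteinTest

variable {K : ℝ} {A : ℕ} {f : (ℝ → ℂ) × (ℝ → ℂ)}

lemma nonneg (hf : SteinTest K A f) : 0 ≤ K := by
  have := (norm_nonneg _).trans (hf.bound 0)
  simpa using this

lemma norm_le (hf : SteinTest K A f) {x w : ℝ} (hw : 1 ≤ w) (hx : |x| ≤ w) :
    ‖f.1 x‖ ≤ K * (2 * w) ^ A := by
  have := hf.nonneg
  refine (hf.bound x).trans ?_
  gcongr; linarith

lemma norm_le' (hf : SteinTest K A f) {x w : ℝ} (hw : 1 ≤ w) (hx : |x| ≤ w) :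
    ‖f.2 x‖ ≤ K * (2 * w) ^ A := by
  have := hf.nonneg
  refine (hf.bound' x).trans ?_
  gcongr; linarith

lemma norm_stein_le (hf : SteinTest K A f) {x w : ℝ} (hw : 1 ≤ w) (hx : |x| ≤ w) :
    ‖f.2 x - x * f.1 x‖ ≤ K * (2 * w) ^ (A + 1) := by
  have h0 := hf.nonneg
  calc _ ≤ ‖f.2 x‖ + |x| * ‖f.1 x‖ := by
        refine (norm_sub_le _ _).trans (le_of_eq ?_)
        rw [norm_mul, Complex.norm_real, Real.norm_eq_abs]
    _ ≤ K * (2 * w) ^ A + w * (K * (2 * w) ^ A) := by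
        have := hf.norm_le hw hx
        have := hf.norm_le' hw hx
        gcongr
    _ = K * (2 * w) ^ A * (1 + w) := by ring
    _ ≤ K * (2 * w) ^ A * (2 * w) := by gcongr; linarith
    _ = _ := by ring

/-- On the range |x| ≤ t of the diagonal entries, f' - x f is Lipschitz for steps of size at most 1,
with a constant that is a power of t. This constant sets the size of all errors below. -/
lemma norm_stein_sub_le (hf : SteinTest K A f) {x h t : ℝ} (ht : 1 ≤ t) (hx : |x| ≤ t)
    (hh : |h| ≤ 1) :
    ‖(f.2 (x + h) - ((x + h : ℝ) : ℂ) * f.1 (x + h)) - (f.2 x - x * f.1 x)‖ ≤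
      4 * K * t * (4 * t) ^ A * |h| := by
  have h0 := hf.nonneg
  have hE : (1 + |x| + |h|) ^ A ≤ (4 * t) ^ A := by
    gcongr; linarith
  have h1 : ‖f.1 (x + h)‖ ≤ K * (4 * t) ^ A := by
    refine (hf.bound _).trans ?_
    have := abs_add_le x h
    gcongr; linarith
  have h2 : ‖f.2 x‖ ≤ K * (4 * t) ^ A := by
    refine (hf.bound' _).trans ?_
    gcongr; linarith
  have h3 : ‖f.1 (x + h) - f.1 x‖ ≤ 2 * K * (4 * t) ^ A * |h| := by
    have e : f.1 (x + h) - f.1 x = (f.1 (x + h) - f.1 x - h * f.2 x) + h * f.2 x := by ring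
    rw [e]
    calc _ ≤ K * h ^ 2 * (4 * t) ^ A + |h| * (K * (4 * t) ^ A) := by
          refine (norm_add_le _ _).trans (add_le_add ((hf.taylor x h).trans (by gcongr)) ?_)
          rw [norm_mul, Complex.norm_real, Real.norm_eq_abs]
          gcongr
      _ ≤ K * |h| * (4 * t) ^ A + |h| * (K * (4 * t) ^ A) := by
          have : h ^ 2 ≤ |h| := by rw [← sq_abs]; nlinarith [abs_nonneg h]
          gcongr
      _ = _ := by ring
  have h4 : ‖f.2 (x + h) - f.2 x‖ ≤ K * |h| * (4 * t) ^ A := (hf.lip x h).trans (by gcongr)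
  have e : (f.2 (x + h) - ((x + h : ℝ) : ℂ) * f.1 (x + h)) - (f.2 x - x * f.1 x) =
      (f.2 (x + h) - f.2 x) - x * (f.1 (x + h) - f.1 x) - h * f.1 (x + h) := by
    push_cast; ring
  rw [e]
  calc _ ≤ K * |h| * (4 * t) ^ A + t * (2 * K * (4 * t) ^ A * |h|) + |h| * (K * (4 * t) ^ A) := by
        refine (norm_sub_le _ _).trans (add_le_add ((norm_sub_le _ _).trans
          (add_le_add h4 ?_)) ?_)
        · rw [norm_mul, Complex.norm_real, Real.norm_eq_abs]
          gcongr
        · rw [norm_mul, Complex.norm_real, Real.norm_eq_abs]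
          gcongr
    _ = K * |h| * (4 * t) ^ A * (2 + 2 * t) := by ring
    _ ≤ K * |h| * (4 * t) ^ A * (4 * t) := by gcongr; linarith
    _ = _ := by ring

end SteinTest

/-- The average of `f' - x f` over the diagonal entries. -/
def steinAvg {N : ℕ} (f : (ℝ → ℂ) × (ℝ → ℂ)) (B : Matrix (Fin (N + 1)) (Fin (N + 1)) ℝ) : ℂ :=
  (1 / (N : ℂ)) * ∑ i, (f.2 (B i i) - (B i i : ℂ) * f.1 (B i i))

lemma measurable_steinAvg {N : ℕ} {f : (ℝ → ℂ) × (ℝ → ℂ)} (h1 : Measurable f.1)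
    (h2 : Measurable f.2) :
    Measurable fun B : Fin (N + 1) → Fin (N + 1) → ℝ => steinAvg f (Matrix.of B) := by
  unfold steinAvg
  refine Measurable.const_mul ?_ _
  refine Finset.measurable_sum _ fun i _ => ?_
  simp only [Matrix.of_apply]
  have m1 : Measurable fun B : Fin (N + 1) → Fin (N + 1) → ℝ => B i i := by fun_prop
  exact (h2.comp m1).sub ((Complex.measurable_ofReal.comp m1).mul (h1.comp m1))

/-- Removing one edge changes only two terms of the average. -/
lemma norm_steinAvg_sub_cut_le {N : ℕ} (hN : 1 ≤ N) {K : ℝ} {A : ℕ} {f : (ℝ → ℂ) × (ℝ → ℂ)}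
    (hf : SteinTest K A f) (B : Matrix (Fin (N + 1)) (Fin (N + 1)) ℝ) {i k : Fin (N + 1)} {t : ℝ}
    (ht : 1 ≤ t) (hB : ∀ a, |B a a| ≤ t) (hik : i ≠ k) (hh : |B i k| ≤ 1) :
    ‖steinAvg f B - steinAvg f (cut B i k)‖ ≤ 2 * (4 * K * t * (4 * t) ^ A) * |B i k| / N := by
  have h0 := hf.nonneg
  set L := 4 * K * t * (4 * t) ^ A with hL
  have hN0 : (0 : ℝ) < N := by exact_mod_cast hN
  unfold steinAvg
  rw [← mul_sub, norm_mul, norm_div, norm_one, Complex.norm_natCast, ← Finset.sum_sub_distrib,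
    one_div, inv_mul_le_iff₀ hN0, mul_div_cancel₀ _ hN0.ne']
  have hz : ∀ a ∈ Finset.univ, a ∉ ({i, k} : Finset (Fin (N + 1))) →
      (f.2 (B a a) - (B a a : ℂ) * f.1 (B a a) - (f.2 (cut B i k a a) -
        (cut B i k a a : ℂ) * f.1 (cut B i k a a))) = 0 := by
    intro a _ ha
    simp only [Finset.mem_insert, Finset.mem_singleton, not_or] at ha
    have : cut B i k a a = B a a := by rw [cut_diag]; simp [edgeVec, ha.1, ha.2]
    rw [this]; ring
  rw [← Finset.sum_subset (Finset.subset_univ _) hz, Finset.sum_pair hik]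
  have hb : ∀ a, edgeVec i k a ^ 2 = 1 →
      ‖f.2 (B a a) - (B a a : ℂ) * f.1 (B a a) - (f.2 (cut B i k a a) -
        (cut B i k a a : ℂ) * f.1 (cut B i k a a))‖ ≤ L * |B i k| := by
    intro a ha
    rw [norm_sub_rev, cut_diag, ha, mul_one]
    exact hf.norm_stein_sub_le ht (hB a) hh
  refine (norm_add_le _ _).trans ?_
  have e1 := hb i (by simp [edgeVec, hik])
  have e2 := hb k (by simp [edgeVec, hik.symm])
  linarith

lemma abs_cut_diag_le_two_mul_crude (M : Ensemble.{u} β c) (ω : M.Ω) {i k : Fin (M.N + 1)}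
    (hik : i ≠ k) (a : Fin (M.N + 1)) : |cut (M.H ω) i k a a| ≤ 2 * M.crude ω := by
  rw [cut_diag]
  refine (abs_add_le _ _).trans ?_
  have h1 := M.abs_diag_le_crude ω a
  have h2 := M.abs_H_le_crude ω hik
  have h3 := edgeVec_sq_le_one i k a
  rw [abs_mul, abs_of_nonneg (sq_nonneg (edgeVec i k a))]
  nlinarith [abs_nonneg (M.H ω i k), sq_nonneg (edgeVec i k a)]

lemma norm_steinAvg_le {N : ℕ} (hN : 1 ≤ N) {K : ℝ} {A : ℕ} {f : (ℝ → ℂ) × (ℝ → ℂ)}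
    (hf : SteinTest K A f) (B : Matrix (Fin (N + 1)) (Fin (N + 1)) ℝ) {w : ℝ}
    (hw : 1 ≤ w) (hB : ∀ a, |B a a| ≤ w) : ‖steinAvg f B‖ ≤ 2 * K * (2 * w) ^ (A + 1) := by
  have h0 := hf.nonneg
  have hN0 : (1 : ℝ) ≤ N := by exact_mod_cast hN
  unfold steinAvg
  rw [norm_mul, norm_div, norm_one, Complex.norm_natCast, one_div, inv_mul_le_iff₀ (by linarith)]
  refine (norm_sum_le _ _).trans ((Finset.sum_le_card_nsmul _ _ (K * (2 * w) ^ (A + 1))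
    fun i _ => hf.norm_stein_le hw (hB i)).trans ?_)
  simp only [Finset.card_univ, Fintype.card_fin, nsmul_eq_mul]
  push_cast
  have : 0 ≤ K * (2 * w) ^ (A + 1) := by positivity
  nlinarith

/-- Since -H_ii is the sum of row i, the term -H_ii f(H_ii) is a sum over weights, in the form
required for decoupling; the average of f' plays the role of the counterterm. -/
lemma steinAvg_eq_sum (M : Ensemble.{u} β c) (f : (ℝ → ℂ) × (ℝ → ℂ)) (ω : M.Ω) :
    steinAvg f (M.H ω) = ∑ p ∈ Finset.univ.filter
        (fun p : Fin (M.N + 1) × Fin (M.N + 1) => p.1 ≠ p.2),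
      (M.H ω p.1 p.2 : ℂ) * ((1 / (M.N : ℂ)) * f.1 (M.H ω p.1 p.1)) +
      (1 / (M.N : ℂ)) * ∑ i, f.2 (M.H ω i i) := by
  rw [sum_pairs (fun i k => (M.H ω i k : ℂ) * ((1 / (M.N : ℂ)) * f.1 (M.H ω i i)))]
  have h : ∀ i, ∑ k ∈ Finset.univ.erase i, (M.H ω i k : ℂ) *
      ((1 / (M.N : ℂ)) * f.1 (M.H ω i i)) =
      -(1 / (M.N : ℂ)) * ((M.H ω i i : ℂ) * f.1 (M.H ω i i)) := fun i => by
    rw [← Finset.sum_mul, ← Complex.ofReal_sum, M.sum_erase_H ω i]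
    push_cast; ring
  simp_rw [h]
  rw [← Finset.mul_sum, steinAvg, Finset.sum_sub_distrib]
  ring

lemma Ensemble.measurable_cut_H (M : Ensemble.{u} β c) (i k : Fin (M.N + 1)) :
    Measurable fun ω (a b : Fin (M.N + 1)) => cut (M.H ω) i k a b :=
  (measurable_cut i k).comp M.measurable_H

lemma Ensemble.measurable_cut_H_apply (M : Ensemble.{u} β c) (i k a b : Fin (M.N + 1)) :
    Measurable fun ω => cut (M.H ω) i k a b :=
  (M.model.measurable a b).add ((M.model.measurable i k).mul_const _)

lemma Ensemble.measurable_steinAvg_cut (M : Ensemble.{u} β c) {f : (ℝ → ℂ) × (ℝ → ℂ)}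
    (h : Measurable f.1) (h' : Measurable f.2) (i k : Fin (M.N + 1)) :
    Measurable fun ω => steinAvg f (cut (M.H ω) i k) :=
  Measurable.comp (g := fun A : Fin (M.N + 1) → Fin (M.N + 1) → ℝ => steinAvg f (Matrix.of A))
    (f := fun ω a b => cut (M.H ω) i k a b) (measurable_steinAvg h h') (M.measurable_cut_H i k)

/-- Increasing h_ik lowers H_ii by the same amount, so the second-order term is -f' with weight 1/N
for each of the N neighbours. It cancels the average of f' exactly, which is the reason for Stein's
operator. -/
lemma stein_drift_eq_zero {N : ℕ} (hN : 1 ≤ N) (g : Fin (N + 1) → ℂ) :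
    (1 / (N : ℂ)) * ∑ i, g i + ((1 / (N : ℝ) : ℝ) : ℂ) *
      ∑ p ∈ Finset.univ.filter (fun p : Fin (N + 1) × Fin (N + 1) => p.1 ≠ p.2),
        -((1 / (N : ℂ)) * g p.1) = 0 := by
  rw [sum_pairs (fun i _ => -((1 / (N : ℂ)) * g i))]
  simp only [Finset.sum_const, Finset.card_erase_of_mem (Finset.mem_univ _),
    Finset.card_univ, Fintype.card_fin, nsmul_eq_mul, Finset.mul_sum,
    ← Finset.sum_add_distrib]
  refine Finset.sum_eq_zero fun i _ => ?_
  have : (N : ℂ) ≠ 0 := by exact_mod_cast (by omega : N ≠ 0)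
  push_cast
  field_simp
  ring

-- Scalar inequality for one edge: g and g₀ are the values of f' with and without the edge, Q and Q₀
-- those of the odd power. There are N (N + 1) ordered pairs, each weighted by the variance 1/N, so
-- each must contribute 1/N times the target; the final division by 2 pays for (N + 1) / N ≤ 2.
set_option maxHeartbeats 1000000 in
lemma stein_term_le {N L τ v x y : ℝ} {g g₀ Q Q₀ : ℂ} (m : ℕ) (hN : 1 ≤ N) (hL : 1 ≤ L)
    (hτ : 0 ≤ τ) (hNτ : 1 / N ≤ τ ^ 2) (hNτ1 : 1 / N ≤ τ) (hv : v = 4 * L * τ) (hx : 0 ≤ x)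
    (hy : 0 ≤ y) (hyx : y ≤ x + v) (hg₀ : ‖g₀‖ ≤ L) (hg : ‖g₀ - g‖ ≤ L * τ)
    (hQ : ‖Q‖ = x ^ (2 * m + 1))
    (hQQ : ‖Q - Q₀‖ ≤ (2 * m + 1) * (2 * L * τ / N) * (2 * y + 2 * L / N) ^ (2 * m)) :
    ‖-((1 / (N : ℂ)) * g) * Q - -((1 / (N : ℂ)) * g₀) * Q₀‖ +
      ((2 * m + 1) * (2 * L ^ 2 / N ^ 2) * (2 * y + 2 * L / N) ^ (2 * m) +
        τ * (L / N) * y ^ (2 * m + 1)) ≤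
      1 / N * ((4 + 8 * ((2 * m + 1) * 4 ^ m)) * v * (x + 2 * v) ^ (2 * m + 1) / 2) := by
  have hm0 : (0 : ℝ) ≤ m := Nat.cast_nonneg m
  have hv0 : 0 ≤ v := by rw [hv]; positivity
  have hN0 : 0 < N := by linarith
  have hLN : 2 * L / N ≤ v := by
    rw [hv, mul_div_assoc, div_eq_mul_one_div]
    nlinarith
  have hbase : (2 * y + 2 * L / N) ^ (2 * m) ≤ 4 ^ m * (x + 2 * v) ^ (2 * m) := by
    calc _ ≤ (2 * (x + 2 * v)) ^ (2 * m) := by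
          gcongr; linarith
      _ = _ := by rw [mul_pow, pow_mul (2 : ℝ) 2 m]; norm_num
  have hdec : -((1 / (N : ℂ)) * g) * Q - -((1 / (N : ℂ)) * g₀) * Q₀ = (1 / (N : ℂ)) *
      ((g₀ - g) * Q - g₀ * (Q - Q₀)) := by ring
  have hxle : x ^ (2 * m + 1) ≤ (x + 2 * v) ^ (2 * m + 1) := by gcongr; linarith
  have hyle : y ^ (2 * m + 1) ≤ (x + 2 * v) ^ (2 * m + 1) := by gcongr; linarith
  set X := (x + 2 * v) ^ (2 * m) with hX
  have hX0 : 0 ≤ X := by positivity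
  have hXs : (x + 2 * v) ^ (2 * m + 1) = X * (x + 2 * v) := by rw [hX, pow_succ]
  have hLN2 : L * (2 * L * τ / N) ≤ v ^ 2 := by
    calc L * (2 * L * τ / N) = 2 * L ^ 2 * τ * (1 / N) := by ring
      _ ≤ 2 * L ^ 2 * τ * τ := by gcongr
      _ ≤ v ^ 2 := by rw [hv]; nlinarith [sq_nonneg (L * τ)]
  have hLN3 : 2 * L ^ 2 / N ≤ v ^ 2 := by
    calc 2 * L ^ 2 / N = 2 * L ^ 2 * (1 / N) := by ring
      _ ≤ 2 * L ^ 2 * τ ^ 2 := by gcongr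
      _ ≤ v ^ 2 := by rw [hv]; nlinarith [sq_nonneg (L * τ)]
  have hLτ : L * τ ≤ v := by rw [hv]; nlinarith [mul_nonneg (zero_le_one.trans hL) hτ]
  have p1 : ‖-((1 / (N : ℂ)) * g) * Q - -((1 / (N : ℂ)) * g₀) * Q₀‖ ≤ 1 / N *
      (v * (X * (x + 2 * v)) + (2 * m + 1) * 4 ^ m * v ^ 2 * X) := by
    have e : ‖(1 / (N : ℂ))‖ = 1 / N := by
      rw [norm_div, norm_one, Complex.norm_real, Real.norm_eq_abs, abs_of_pos hN0]
    rw [hdec, norm_mul, e]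
    gcongr
    refine (norm_sub_le _ _).trans (add_le_add ?_ ?_)
    · rw [norm_mul, hQ, ← hXs]
      exact mul_le_mul (hg.trans hLτ) hxle (by positivity) hv0
    · rw [norm_mul]
      calc _ ≤ L * ((2 * m + 1) * (2 * L * τ / N) * (4 ^ m * X)) := by
            refine mul_le_mul hg₀ (hQQ.trans ?_) (norm_nonneg _) (by linarith)
            gcongr
        _ = (2 * m + 1) * 4 ^ m * (L * (2 * L * τ / N)) * X := by ring
        _ ≤ _ := by gcongr
  have p2 : (2 * m + 1) * (2 * L ^ 2 / N ^ 2) * (2 * y + 2 * L / N) ^ (2 * m) +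
        τ * (L / N) * y ^ (2 * m + 1) ≤ 1 / N * ((2 * m + 1) * 4 ^ m * v ^ 2 * X +
      v * (X * (x + 2 * v))) := by
    calc _ ≤ (2 * m + 1) * (2 * L ^ 2 / N ^ 2) * (4 ^ m * X) +
          τ * (L / N) * (X * (x + 2 * v)) := by
          rw [← hXs]; gcongr
      _ = 1 / N * ((2 * m + 1) * 4 ^ m * (2 * L ^ 2 / N) * X +
          (L * τ) * (X * (x + 2 * v))) := by
          field_simp
      _ ≤ _ := by gcongr
  refine (add_le_add p1 p2).trans ?_
  rw [← mul_add, hXs]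
  refine mul_le_mul_of_nonneg_left ?_ (by positivity)
  rw [mul_assoc (4 + 8 * _) v]
  have h5 : v ^ 2 * X ≤ v * (X * (x + 2 * v)) := by
    have : 0 ≤ v * X * (x + v) := by positivity
    nlinarith
  have h6 : (2 * m + 1) * 4 ^ m * v ^ 2 * X ≤
      (2 * m + 1) * 4 ^ m * (v * (X * (x + 2 * v))) := by
    rw [mul_assoc _ (v ^ 2)]; gcongr
  have h7 : 0 ≤ v * (X * (x + 2 * v)) := by positivity
  have h8 : 0 ≤ (2 * m + 1) * 4 ^ m * (v * (X * (x + 2 * v))) := by positivity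
  clear_value X
  generalize v * (X * (x + 2 * v)) = w at *
  generalize ((2 * (m : ℝ) + 1) * 4 ^ m) = K at *
  linarith

-- Decoupling over ordered pairs. Every weight occurs twice, for its two endpoints, which is
-- harmless: each pair only needs its weight to be independent of its own cut matrix. Removing an
-- edge changes two of the N + 1 summands, so the average moves by O(1/N) times the weight.
set_option maxHeartbeats 1000000 in
lemma integral_steinAvg_pow_le (hβ : 0 < β) {P : ℕ} (hP : P ≠ 0) (hPβ : 2 ≤ β * P) {K : ℝ}
    (hK : 1 ≤ K) (A m : ℕ) :
    ∃ C : ℝ, ∃ N₀ : ℕ, ∀ M : Ensemble.{u} β c, N₀ ≤ M.N → ∀ f : (ℝ → ℂ) × (ℝ → ℂ),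
      SteinTest K A f →
      Integrable (fun ω => ‖steinAvg f (M.H ω)‖ ^ (2 * m + 2)) M.μ ∧
      ∫ ω, ‖steinAvg f (M.H ω)‖ ^ (2 * m + 2) ∂M.μ ≤ C *
        (4 * (4 * K * scale P M.N * (4 * scale P M.N) ^ A) * (scale P M.N / M.q)) ^ (2 * m + 2) := by
  obtain ⟨N₁, hN11, h1⟩ := ((whp_abs_H_le.{u, 0} (c := c) hβ hP (ι := fun _ => Unit)
    (fun _ => Set.univ)).inter (whp_abs_diag_le.{u, 0} (c := c) hβ hP hPβ (ι := fun _ => Unit)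
    (fun _ => Set.univ))).error_le hβ (fun M _ _ => (M.measurableSet_abs_H_le _).inter
      (M.measurableSet_abs_diag_le _)) (A + 2) (2 * m + 5) (m + 1)
  obtain ⟨N₂, h2⟩ := exists_nat_ge (max (2 * K * 4 ^ (A + 1))
    ((2 * m + 1) * 2 * (4 : ℝ) ^ (2 * m) + 1))
  set Km : ℝ := 4 + 8 * ((2 * m + 1) * 4 ^ m) with hKm
  have hm0 : (0 : ℝ) ≤ m := Nat.cast_nonneg m
  have hKm1 : 1 ≤ Km := by
    have : (0 : ℝ) ≤ (2 * m + 1) * 4 ^ m := by positivity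
    linarith
  set C := Km * (2 * Km * (1 + 2) ^ (2 * m + 1) + 2) ^ (2 * m + 1) with hC
  refine ⟨2 * (C + 1), max N₁ N₂, fun M hM f hf => ?_⟩
  have hN1 : N₁ ≤ M.N := le_of_max_le_left hM
  have hMN : 1 ≤ M.N := hN11.trans hN1
  have hN : (1 : ℝ) ≤ M.N := by exact_mod_cast hMN
  have hN2 : max (2 * K * 4 ^ (A + 1)) ((2 * m + 1) * 2 * (4 : ℝ) ^ (2 * m) + 1) ≤ M.N :=
    h2.trans (by exact_mod_cast le_of_max_le_right hM)
  have hK4 := (le_max_left _ _).trans hN2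
  have hm4 := (le_max_right _ _).trans hN2
  have hq := M.one_le_q hβ hMN
  have hq2 := M.q_sq_le hβ hMN
  have hT1 : 1 ≤ scale P M.N := one_le_scale P hMN
  have hTN : scale P M.N ≤ M.N := by
    rw [← scale_pow hP M.N]
    exact le_self_pow₀ hT1 hP
  have hTq : scale P M.N / M.q ≤ 1 := by
    rw [div_le_one (by linarith)]
    have := M.scale_pow_le_q hP (j := 1) (by push_cast; linarith) hMN
    simpa using this
  set T := scale P M.N with hT
  set L := 4 * K * T * (4 * T) ^ A with hL
  have hL1 : 1 ≤ L := by
    have : 1 ≤ (4 * T) ^ A := one_le_pow₀ (by linarith)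
    have : 1 ≤ 4 * K * T := by nlinarith
    rw [hL]; nlinarith
  set v := 4 * L * (T / M.q) with hv
  have hTq0 : 0 < T / M.q := by positivity
  have hNTq : 1 / (M.N : ℝ) ≤ T / M.q := by
    rw [div_le_div_iff₀ (by linarith) (by linarith)]
    nlinarith
  have hNTq2 : 1 / (M.N : ℝ) ≤ (T / M.q) ^ 2 := by
    rw [div_pow, div_le_div_iff₀ (by linarith) (by positivity)]
    nlinarith [one_le_pow₀ hT1 (n := 2)]
  have hvN : 1 / (M.N : ℝ) ≤ v ^ 2 := by
    refine hNTq2.trans ?_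
    gcongr
    rw [hv]; nlinarith
  have hv0 : 0 < v := by positivity
  have hLN : 2 * L / M.N ≤ v := by
    rw [hv, mul_div_assoc, div_eq_mul_one_div]
    nlinarith
  set W : M.Ω → ℝ := fun ω => M.crude ω ^ (A + 2) with hWdef
  have hW1 : ∀ ω, 1 ≤ W ω := fun ω => one_le_pow₀ (M.one_le_crude ω)
  have hcr : ∀ ω, (1 : ℝ) ≤ 2 * M.crude ω := fun ω => by linarith [M.one_le_crude ω]
  have hcrW : ∀ ω, M.crude ω ≤ W ω := fun ω => le_self_pow₀ (M.one_le_crude ω) (by omega)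
  have hbig : ∀ ω, 2 * K * (2 * (2 * M.crude ω)) ^ (A + 1) ≤ W ω := fun ω => by
    have := M.N_pow_le_crude_pow ω _ hK4
    calc _ = (2 * K * 4 ^ (A + 1)) * M.crude ω ^ (A + 1) := by rw [← mul_assoc, mul_pow]; ring
      _ ≤ M.crude ω * M.crude ω ^ (A + 1) := by
        have := M.one_le_crude ω
        gcongr
      _ = _ := by simp only [hWdef]; ring
  have hbig2 : ∀ ω, K * (2 * (2 * M.crude ω)) ^ A ≤ W ω := fun ω => by
    refine le_trans ?_ (hbig ω)
    have := M.one_le_crude ω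
    calc K * (2 * (2 * M.crude ω)) ^ A ≤ K * (2 * (2 * M.crude ω)) ^ (A + 1) := by
          gcongr
          · linarith
          · omega
      _ ≤ _ := by
        have : 0 ≤ K * (2 * (2 * M.crude ω)) ^ (A + 1) := by positivity
        linarith
  have hLW : ∀ ω, L ≤ W ω := fun ω => by
    have h3 := M.N_add_one_le_crude ω
    have h4 : T ≤ M.crude ω := by linarith
    have h5 := M.N_pow_le_crude_pow ω _ hK4
    have h6 : 0 ≤ M.crude ω := by linarith [M.one_le_crude ω]
    have h7 : 0 ≤ K := by linarith
    have h8 : 0 ≤ T := by linarith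
    calc L ≤ 4 * K * M.crude ω * (4 * M.crude ω) ^ A := by rw [hL]; gcongr
      _ = (K * 4 ^ (A + 1)) * M.crude ω ^ (A + 1) := by rw [mul_pow]; ring
      _ ≤ M.crude ω * M.crude ω ^ (A + 1) := by
        have := M.one_le_crude ω
        have : 0 ≤ K * 4 ^ (A + 1) := by positivity
        gcongr
        linarith
      _ = _ := by simp only [hWdef]; ring
  have hdiag : ∀ ω a, |M.H ω a a| ≤ 2 * M.crude ω := fun ω a => by
    have := M.abs_diag_le_crude ω a
    linarith [M.one_le_crude ω]
  have hinvN : ‖(1 / (M.N : ℂ))‖ = 1 / (M.N : ℝ) := by simp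
  have hinvN1 : 1 / (M.N : ℝ) ≤ 1 := by rw [div_le_one (by linarith)]; exact hN
  have hsmall : ∀ x : ℂ, ‖(1 / (M.N : ℂ)) * x‖ ≤ ‖x‖ := fun x => by
    rw [norm_mul, hinvN]
    exact mul_le_of_le_one_left (norm_nonneg x) hinvN1
  have mZ : Measurable fun ω => steinAvg f (M.H ω) :=
    (measurable_steinAvg hf.meas hf.meas').comp M.measurable_H
  have hint : Integrable (fun ω => ‖steinAvg f (M.H ω)‖ ^ (2 * m + 2)) M.μ :=
    integrable_of_norm_le_mul_pow (crude_pow_integrable M (A + 2))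
      (mZ.norm.pow_const _).aestronglyMeasurable 1 (2 * m + 2) fun ω => by
        rw [one_mul, Real.norm_eq_abs, abs_of_nonneg (by positivity)]
        exact pow_le_pow_left₀ (norm_nonneg _)
          ((norm_steinAvg_le hMN hf _ (hcr ω) (hdiag ω)).trans (hbig ω)) _
  refine ⟨hint, ?_⟩
  set s := Finset.univ.filter (fun p : Fin (M.N + 1) × Fin (M.N + 1) => p.1 ≠ p.2) with hs
  have hne : ∀ p ∈ s, p.1 ≠ p.2 := fun p hp => by simpa [hs] using hp
  set Z₀ : Fin (M.N + 1) × Fin (M.N + 1) → M.Ω → ℂ :=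
    fun p ω => steinAvg f (cut (M.H ω) p.1 p.2) with hZ₀
  -- The first term bounds the change of the odd power, the second the cubic Taylor term; one factor
  -- |h| of the latter is estimated by T / q on the good event.
  set y : ℂ → ℝ := fun x => (2 * m + 1) * (2 * L ^ 2 / (M.N : ℝ) ^ 2) *
      (2 * ‖x‖ + 2 * L / M.N) ^ (2 * m) + T / M.q * (L / M.N) * ‖x‖ ^ (2 * m + 1) with hy
  have mcutd : ∀ p : Fin (M.N + 1) × Fin (M.N + 1), Measurable fun ω =>
      cut (M.H ω) p.1 p.2 p.1 p.1 := fun p => M.measurable_cut_H_apply _ _ _ _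
  have mZ₀ : ∀ p, Measurable (Z₀ p) := fun p => M.measurable_steinAvg_cut hf.meas hf.meas' _ _
  have mdiag : ∀ i, Measurable fun ω => M.H ω i i := fun i => M.model.measurable i i
  have my : Measurable y := by simp only [hy]; fun_prop
  have hbZ₀ : ∀ p ∈ s, ∀ ω, ‖Z₀ p ω‖ ≤ W ω := fun p hp ω =>
    (norm_steinAvg_le hMN hf _ (hcr ω)
      (abs_cut_diag_le_two_mul_crude M ω (hne p hp))).trans (hbig ω)
  have hydrop : ∀ x : ℂ, 0 ≤ y x := fun x => by simp only [hy]; positivity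
  have hTay : ∀ p ∈ s, ∀ ω, ‖f.1 (M.H ω p.1 p.1) - f.1 (cut (M.H ω) p.1 p.2 p.1 p.1) +
      M.H ω p.1 p.2 * f.2 (cut (M.H ω) p.1 p.2 p.1 p.1)‖ ≤ K * M.H ω p.1 p.2 ^ 2 *
        (1 + |cut (M.H ω) p.1 p.2 p.1 p.1| + |M.H ω p.1 p.2|) ^ A := fun p hp ω => by
    have := hf.taylor (cut (M.H ω) p.1 p.2 p.1 p.1) (-M.H ω p.1 p.2)
    have e : cut (M.H ω) p.1 p.2 p.1 p.1 + -M.H ω p.1 p.2 = M.H ω p.1 p.1 := by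
      rw [cut_diag_left _ (hne p hp)]; ring
    rw [e, abs_neg, neg_sq] at this
    simpa using this
  -- The Taylor remainder divided by h². At h = 0 division returns 0, and the expansion still holds
  -- because nothing is removed.
  set A'' : Fin (M.N + 1) × Fin (M.N + 1) → M.Ω → ℂ := fun p ω => (1 / (M.N : ℂ)) *
    ((f.1 (M.H ω p.1 p.1) - f.1 (cut (M.H ω) p.1 p.2 p.1 p.1) +
      M.H ω p.1 p.2 * f.2 (cut (M.H ω) p.1 p.2 p.1 p.1)) / (M.H ω p.1 p.2 : ℂ) ^ 2) with hA''
  have bA''aux : ∀ p ∈ s, ∀ ω, ‖A'' p ω‖ ≤ 1 / (M.N : ℝ) * (K *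
        (1 + |cut (M.H ω) p.1 p.2 p.1 p.1| + |M.H ω p.1 p.2|) ^ A) := fun p hp ω => by
    simp only [hA'']
    rw [norm_mul, hinvN, norm_div, norm_pow, Complex.norm_real, Real.norm_eq_abs, sq_abs]
    gcongr
    refine div_le_of_le_mul₀ (sq_nonneg _) ?_ ((hTay p hp ω).trans (le_of_eq (by ring)))
    have := hf.nonneg
    positivity
  have hindep : ∀ p ∈ s, IndepFun (fun ω => M.H ω p.1 p.2)
      (fun ω => ((1 / (M.N : ℂ)) * f.1 (cut (M.H ω) p.1 p.2 p.1 p.1),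
        -((1 / (M.N : ℂ)) * f.2 (cut (M.H ω) p.1 p.2 p.1 p.1)), Z₀ p ω, y (Z₀ p ω))) M.μ :=
    fun p hp => by
    have md : Measurable fun B : Fin (M.N + 1) → Fin (M.N + 1) → ℝ => B p.1 p.1 := by fun_prop
    exact (M.indep_cut (hne p hp)).comp (φ := id)
      (ψ := fun B : Fin (M.N + 1) → Fin (M.N + 1) → ℝ =>
        ((1 / (M.N : ℂ)) * f.1 (B p.1 p.1), -((1 / (M.N : ℂ)) * f.2 (B p.1 p.1)),
          steinAvg f (Matrix.of B), y (steinAvg f (Matrix.of B)))) measurable_id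
      (((hf.meas.comp md).const_mul _).prodMk ((((hf.meas'.comp md).const_mul _).neg).prodMk
        ((measurable_steinAvg hf.meas hf.meas').prodMk
          (my.comp (measurable_steinAvg hf.meas hf.meas')))))
  have hcard : (s.card : ℝ) = (M.N + 1) * M.N := by
    have h := sum_pairs (n := M.N + 1) (fun _ _ => 1)
    simp only [Finset.sum_const, Finset.card_erase_of_mem (Finset.mem_univ _), Finset.card_univ,
      Fintype.card_fin, nsmul_eq_mul, mul_one] at h
    have h' : ((s.card : ℕ) : ℂ) = (((M.N + 1) * M.N : ℕ) : ℂ) := by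
      rw [hs, h]; push_cast; simp
    have h'' := Nat.cast_injective h'
    rw [h'']; push_cast; ring
  have hZdiff : ∀ ω, (∀ a b, a ≠ b → |M.H ω a b| ≤ T / M.q) → (∀ a, |M.H ω a a| ≤ T) →
      ∀ p ∈ s, ‖steinAvg f (M.H ω) - Z₀ p ω‖ ≤ 2 * L * |M.H ω p.1 p.2| / M.N :=
    fun ω h3 h4 p hp => norm_steinAvg_sub_cut_le hMN hf _ hT1 h4 (hne p hp)
      ((h3 _ _ (hne p hp)).trans hTq)
  have hQdiff : ∀ ω, (∀ a b, a ≠ b → |M.H ω a b| ≤ T / M.q) → (∀ a, |M.H ω a a| ≤ T) →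
      ∀ p ∈ s, ‖oddPow m (steinAvg f (M.H ω)) - oddPow m (Z₀ p ω)‖ ≤
        (2 * m + 1) * (2 * L * |M.H ω p.1 p.2| / M.N) *
          (2 * ‖Z₀ p ω‖ + 2 * L / M.N) ^ (2 * m) := fun ω h3 h4 p hp => by
    have h5 := hZdiff ω h3 h4 p hp
    have hh1 := (h3 _ _ (hne p hp)).trans hTq
    refine (norm_oddPow_sub_le m _ _).trans ?_
    have h6 : ‖steinAvg f (M.H ω)‖ + ‖Z₀ p ω‖ ≤ 2 * ‖Z₀ p ω‖ + 2 * L / M.N := by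
      have h7 := norm_sub_norm_le (steinAvg f (M.H ω)) (Z₀ p ω)
      have h8 : 2 * L * |M.H ω p.1 p.2| / M.N ≤ 2 * L / M.N := by
        exact div_le_div_of_nonneg_right (mul_le_of_le_one_right (by positivity) hh1) (by positivity)
      linarith
    have h9 := pow_le_pow_left₀ (by positivity) h6 (2 * m)
    gcongr
  have main := integral_norm_pow_le_of_decoupling (μ := M.μ) s m (2 * m + 5)
    le_rfl (σ2 := 1 / (M.N : ℝ)) (by positivity)
    (Z := fun ω => steinAvg f (M.H ω)) (D := fun ω => (1 / (M.N : ℂ)) * ∑ i, f.2 (M.H ω i i))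
    (h := fun p ω => M.H ω p.1 p.2)
    (A := fun p ω => (1 / (M.N : ℂ)) * f.1 (M.H ω p.1 p.1))
    (A₀ := fun p ω => (1 / (M.N : ℂ)) * f.1 (cut (M.H ω) p.1 p.2 p.1 p.1))
    (A' := fun p ω => -((1 / (M.N : ℂ)) * f.2 (M.H ω p.1 p.1)))
    (A'₀ := fun p ω => -((1 / (M.N : ℂ)) * f.2 (cut (M.H ω) p.1 p.2 p.1 p.1)))
    (A'' := A'') (Z₀ := Z₀) (Y₀ := fun p ω => y (Z₀ p ω)) (W := W)
    (F := fun ω => ‖steinAvg f (M.H ω)‖ ^ (2 * m + 2) / 2 + C * v ^ (2 * m + 2))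
    (Θ := {ω | ∀ a b, a ≠ b → |M.H ω a b| ≤ T / M.q} ∩ {ω | ∀ a, |M.H ω a a| ≤ T})
    (fun ω => steinAvg_eq_sum M f ω)
    (fun p hp ω => by
      simp only [hA'']
      by_cases h0 : M.H ω p.1 p.2 = 0
      · have : cut (M.H ω) p.1 p.2 p.1 p.1 = M.H ω p.1 p.1 := by
          rw [cut_diag_left _ (hne p hp), h0, add_zero]
        rw [this, h0]; simp
      · have : (M.H ω p.1 p.2 : ℂ) ≠ 0 := by exact_mod_cast h0
        field_simp; ring)
    hindep
    (fun p hp => M.mean_zero (hne p hp)) (fun p hp => M.model.variance_eq _ _ (hne p hp))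
    mZ (by
      refine Measurable.const_mul (Finset.measurable_sum _ fun i _ => ?_) _
      exact hf.meas'.comp (mdiag i))
    (fun p _ => M.model.measurable _ _)
    (fun p _ => (hf.meas.comp (mcutd p)).const_mul _)
    (fun p _ => ((hf.meas'.comp (mdiag p.1)).const_mul _).neg)
    (fun p _ => ((hf.meas'.comp (mcutd p)).const_mul _).neg)
    (fun p _ => by
      have m1 := Complex.measurable_ofReal.comp (M.model.measurable p.1 p.2)
      exact ((((hf.meas.comp (mdiag p.1)).sub (hf.meas.comp (mcutd p))).add
        (m1.mul (hf.meas'.comp (mcutd p)))).div (m1.pow_const 2)).const_mul _)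
    (fun p _ => mZ₀ p) (fun p _ => my.comp (mZ₀ p))
    ((M.measurableSet_abs_H_le _).inter (M.measurableSet_abs_diag_le _)) hW1
    (crude_pow_integrable M (A + 2))
    (fun ω => (norm_steinAvg_le hMN hf _ (hcr ω) (hdiag ω)).trans (hbig ω))
    (fun ω => by
      rw [norm_mul, hinvN, one_div, inv_mul_le_iff₀ (by linarith)]
      refine (norm_sum_le _ _).trans ((Finset.sum_le_card_nsmul _ _ _
        fun i _ => hf.norm_le' (hcr ω) (hdiag ω i)).trans ?_)
      simp only [Finset.card_univ, Fintype.card_fin, nsmul_eq_mul]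
      push_cast
      have h5 := hbig ω
      have h6 := M.one_le_crude ω
      have h7 : K * (2 * (2 * M.crude ω)) ^ A ≤ K * (2 * (2 * M.crude ω)) ^ (A + 1) := by
        gcongr
        · linarith
        · omega
      have h8 : 0 ≤ K * (2 * (2 * M.crude ω)) ^ A := by positivity
      nlinarith)
    (fun p hp ω => (M.abs_H_le_crude ω (hne p hp)).trans (hcrW ω))
    (fun p hp ω => (hsmall _).trans ((hf.norm_le (hcr ω) (hdiag ω _)).trans (hbig2 ω)))
    (fun p hp ω => (hsmall _).trans ((hf.norm_le (hcr ω)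
      (abs_cut_diag_le_two_mul_crude M ω (hne p hp) _)).trans (hbig2 ω)))
    (fun p hp ω => by
      rw [norm_neg]
      exact (hsmall _).trans ((hf.norm_le' (hcr ω) (hdiag ω _)).trans (hbig2 ω)))
    (fun p hp ω => by
      rw [norm_neg]
      exact (hsmall _).trans ((hf.norm_le' (hcr ω)
        (abs_cut_diag_le_two_mul_crude M ω (hne p hp) _)).trans (hbig2 ω)))
    (fun p hp ω => by
      refine (bA''aux p hp ω).trans (le_trans ?_ (hbig2 ω))
      refine (mul_le_of_le_one_left (by positivity) hinvN1).trans ?_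
      have h5 := abs_cut_diag_le_two_mul_crude M ω (hne p hp) p.1
      have h6 := M.abs_H_le_crude ω (hne p hp)
      have h7 := M.one_le_crude ω
      gcongr
      linarith)
    hbZ₀ (fun p _ ω => hydrop _)
    (fun p hp ω => by
      have h3 := hW1 ω
      have h4 := hbZ₀ p hp ω
      have h5 := hLW ω
      have h6 : L / M.N ≤ W ω := (div_le_self (by linarith) hN).trans h5
      have h7 : 2 * L ^ 2 / (M.N : ℝ) ^ 2 ≤ 2 * W ω ^ 2 := by
        rw [mul_div_assoc, ← div_pow]; gcongr
      have h8 : (2 * m + 1) * 2 * (4 : ℝ) ^ (2 * m) + 1 ≤ W ω :=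
        (M.N_pow_le_crude_pow ω _ hm4).trans (hcrW ω)
      have h9 : 2 * L / M.N ≤ 2 * W ω := by rw [mul_div_assoc]; linarith
      calc y (Z₀ p ω) ≤ (2 * m + 1) * (2 * W ω ^ 2) * (4 * W ω) ^ (2 * m) +
            1 * W ω * W ω ^ (2 * m + 1) := by
            have h10 : 2 * ‖Z₀ p ω‖ + 2 * L / M.N ≤ 4 * W ω := by linarith
            simp only [hy]
            gcongr
        _ = ((2 * m + 1) * 2 * (4 : ℝ) ^ (2 * m) + 1) * W ω ^ (2 * m + 2) := by
            rw [mul_pow]; ring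
        _ ≤ W ω * W ω ^ (2 * m + 2) := by gcongr
        _ = W ω ^ (2 * m + 3) := by ring
        _ ≤ _ := pow_le_pow_right₀ h3 (by omega))
    ((hint.div_const 2).add (integrable_const _))
    (fun ω => by positivity)
    (fun ω hω p hp => by
      obtain ⟨h3, h4⟩ := hω
      have hh := h3 _ _ (hne p hp)
      have hh1 := hh.trans hTq
      have b1 : ‖(1 / (M.N : ℂ)) * f.1 (M.H ω p.1 p.1)‖ ≤ L / M.N := by
        rw [norm_mul, hinvN, one_div_mul_eq_div]
        gcongr
        refine (hf.norm_le hT1 (h4 _)).trans ?_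
        rw [hL]
        have e1 : (2 * T) ^ A ≤ (4 * T) ^ A := by gcongr; linarith
        have e2 : K ≤ 4 * K * T := by nlinarith
        gcongr
      have b2 : ‖A'' p ω‖ ≤ L / M.N := by
        refine (bA''aux p hp ω).trans ?_
        rw [one_div_mul_eq_div]
        gcongr
        rw [hL]
        have e3 : |cut (M.H ω) p.1 p.2 p.1 p.1| ≤ T + 1 := by
          rw [cut_diag_left _ (hne p hp)]
          exact (abs_add_le _ _).trans (add_le_add (h4 _) hh1)
        have e1 : (1 + |cut (M.H ω) p.1 p.2 p.1 p.1| + |M.H ω p.1 p.2|) ^ A ≤ (4 * T) ^ A := by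
          gcongr; linarith
        have e2 : K ≤ 4 * K * T := by nlinarith
        gcongr
      have b3 := hQdiff ω h3 h4 p hp
      have ha : 0 ≤ |M.H ω p.1 p.2| := abs_nonneg _
      simp only [hy]
      calc _ ≤ |M.H ω p.1 p.2| * (L / M.N) * ((2 * m + 1) * (2 * L * |M.H ω p.1 p.2| / M.N) *
          (2 * ‖Z₀ p ω‖ + 2 * L / M.N) ^ (2 * m)) +
          |M.H ω p.1 p.2| ^ 2 * (T / M.q) * (L / M.N) * ‖Z₀ p ω‖ ^ (2 * m + 1) := by
            rw [pow_succ |M.H ω p.1 p.2| 2]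
            gcongr
        _ = |M.H ω p.1 p.2| ^ 2 * ((2 * m + 1) * (2 * L ^ 2 / (M.N : ℝ) ^ 2) *
      (2 * ‖Z₀ p ω‖ + 2 * L / M.N) ^ (2 * m) + T / M.q * (L / M.N) * ‖Z₀ p ω‖ ^ (2 * m + 1)) := by
            field_simp
        _ = _ := by rw [sq_abs])
    (fun ω hω => by
      obtain ⟨h3, h4⟩ := hω
      set x := ‖steinAvg f (M.H ω)‖ with hx
      have hx0 : 0 ≤ x := norm_nonneg _
      have hD0 : (1 / (M.N : ℂ)) * ∑ i, f.2 (M.H ω i i) + ((1 / (M.N : ℝ) : ℝ) : ℂ) *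
          ∑ p ∈ s, -((1 / (M.N : ℂ)) * f.2 (M.H ω p.1 p.1)) = 0 :=
        stein_drift_eq_zero hMN fun i => f.2 (M.H ω i i)
      rw [hD0, norm_zero, zero_mul, zero_add]
      have hterm : ∀ p ∈ s, ‖-((1 / (M.N : ℂ)) * f.2 (M.H ω p.1 p.1)) *
          oddPow m (steinAvg f (M.H ω)) - -((1 / (M.N : ℂ)) *
            f.2 (cut (M.H ω) p.1 p.2 p.1 p.1)) * oddPow m (Z₀ p ω)‖ + y (Z₀ p ω) ≤
          1 / (M.N : ℝ) * (Km * v * (x + 2 * v) ^ (2 * m + 1) / 2) := fun p hp => by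
        have hh := h3 _ _ (hne p hp)
        have hh1 := hh.trans hTq
        have hzd := hZdiff ω h3 h4 p hp
        have hZx : ‖Z₀ p ω‖ ≤ x + v := by
          have h7 := norm_sub_norm_le (Z₀ p ω) (steinAvg f (M.H ω))
          rw [norm_sub_rev] at h7
          have h8 : 2 * L * |M.H ω p.1 p.2| / M.N ≤ 2 * L / M.N := by
            exact div_le_div_of_nonneg_right (mul_le_of_le_one_right (by positivity) hh1) (by positivity)
          linarith
        have e3 : |cut (M.H ω) p.1 p.2 p.1 p.1| ≤ 2 * T := by
          rw [cut_diag_left _ (hne p hp)]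
          exact (abs_add_le _ _).trans (by linarith [h4 p.1])
        have hA0 : ‖f.2 (cut (M.H ω) p.1 p.2 p.1 p.1)‖ ≤ L := by
          refine (hf.norm_le' (by linarith) e3).trans ?_
          rw [hL, ← mul_assoc 2 2 T, show (2 : ℝ) * 2 = 4 by norm_num]
          have e2 : K ≤ 4 * K * T := by nlinarith
          gcongr
        have hAd : ‖f.2 (cut (M.H ω) p.1 p.2 p.1 p.1) - f.2 (M.H ω p.1 p.1)‖ ≤ L * (T / M.q) := by
          rw [cut_diag_left _ (hne p hp)]
          refine (hf.lip _ _).trans ?_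
          have e1 : (1 + |M.H ω p.1 p.1| + |M.H ω p.1 p.2|) ^ A ≤ (4 * T) ^ A := by
            gcongr; linarith [h4 p.1]
          have e2 : K ≤ 4 * K * T := by nlinarith
          calc _ ≤ (4 * K * T) * (T / M.q) * (4 * T) ^ A := by gcongr
            _ = _ := by rw [hL]; ring
        have hQ := (hQdiff ω h3 h4 p hp).trans (mul_le_mul_of_nonneg_right
          (mul_le_mul_of_nonneg_left (div_le_div_of_nonneg_right
            (mul_le_mul_of_nonneg_left hh (by positivity : 0 ≤ 2 * L)) (by positivity))
            (by positivity)) (by positivity))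
        exact stein_term_le m hN hL1 hTq0.le hNTq2 hNTq hv hx0 (norm_nonneg _) hZx hA0 hAd
          (norm_oddPow _ _) hQ
      have h9 := mul_add_pow_le hx0 hv0.le hKm1 2 (by norm_num) (2 * m + 1)
      refine le_trans ?_ h9
      calc _ ≤ 1 / (M.N : ℝ) * (s.card • (1 / (M.N : ℝ) *
            (Km * v * (x + 2 * v) ^ (2 * m + 1) / 2))) := by
            gcongr
            exact Finset.sum_le_card_nsmul _ _ _ hterm
        _ = (1 + 1 / (M.N : ℝ)) * (Km * v * (x + 2 * v) ^ (2 * m + 1) / 2) := by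
            rw [nsmul_eq_mul, hcard]
            field_simp
        _ ≤ 2 * (Km * v * (x + 2 * v) ^ (2 * m + 1) / 2) := by
            gcongr
            linarith
        _ = _ := by ring)
  have h10 := h1 M hN1 () trivial s.card (card_pairs _)
  -- The rare-event error was requested at order N^(-(m+1)) precisely because 1/N ≤ v².
  have h11 : ((M.N : ℝ) ^ (m + 1))⁻¹ ≤ v ^ (2 * m + 2) := by
    calc ((M.N : ℝ) ^ (m + 1))⁻¹ = (1 / (M.N : ℝ)) ^ (m + 1) := by rw [one_div, inv_pow]
      _ ≤ (v ^ 2) ^ (m + 1) := by gcongr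
      _ = _ := by rw [← pow_mul]; ring
  rw [integral_add (hint.div_const 2) (integrable_const _), integral_div] at main
  simp only [integral_const, probReal_univ, smul_eq_mul, one_mul] at main
  have h12 := main.trans (add_le_add_right (h10.trans h11) _)
  linarith

/-- Stein's equation holds approximately on average over the diagonal entries. -/
lemma whp_steinAvg_le (hβ : 0 < β) {P : ℕ} (hP : P ≠ 0) (hPβ : 2 ≤ β * P) (K : ℝ) (A : ℕ)
    {ι : Ensemble.{u} β c → Type v} (S : ∀ M, Set (ι M))
    (f : ∀ M, ι M → (ℝ → ℂ) × (ℝ → ℂ)) (hf : ∀ M, ∀ x ∈ S M, SteinTest K A (f M x)) :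
    WHP S (fun M x => {ω | ‖steinAvg (f M x) (M.H ω)‖ ≤ scale P M.N ^ (A + 4) / M.q}) := by
  set K' := max K 1
  have hf' : ∀ M, ∀ x ∈ S M, SteinTest K' A (f M x) := fun M x hx => by
    have h := hf M x hx
    have hK : K ≤ K' := le_max_left _ _
    refine ⟨h.meas, h.meas', fun x => (h.bound x).trans (by gcongr),
      fun x => (h.bound' x).trans (by gcongr), fun x t => (h.lip x t).trans (by gcongr),
      fun x t => (h.taylor x t).trans (by gcongr)⟩
  have hK1 : 1 ≤ K' := le_max_right _ _
  have h1 : WHP S (fun M x => {ω | ‖steinAvg (f M x) (M.H ω)‖ ≤ scale P M.N *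
      (4 * (4 * K' * scale P M.N * (4 * scale P M.N) ^ A) * (scale P M.N / M.q))}) := by
    refine WHP.of_moments hP (fun M x ω => ‖steinAvg (f M x) (M.H ω)‖) (fun M _ =>
      4 * (4 * K' * scale P M.N * (4 * scale P M.N) ^ A) * (scale P M.N / M.q)) 0
      (fun M p _ ω => norm_nonneg _) ⟨1, fun M hM _ _ => ?_⟩ fun r => ?_
    · have := M.one_le_q hβ hM
      have := one_le_scale P hM
      positivity
    · obtain ⟨C, N₀, h⟩ := integral_steinAvg_pow_le.{u} (c := c) hβ hP hPβ hK1 A r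
      refine ⟨C, 2 * r + 2, N₀, by omega, fun M hM x hx => ?_⟩
      obtain ⟨h2, h3⟩ := h M hM (f M x) (hf' M x hx)
      exact ⟨h2, by simpa using h3⟩
  obtain ⟨N₀, hN₀, h2⟩ := eventually_le_scale hP (4 * (4 * K' * 4 ^ A))
  refine h1.mono (fun M x => x) ⟨N₀, fun M hM x hx => ⟨hx, fun ω hω => ?_⟩⟩
  have hM1 := hN₀.trans hM
  have h3 := h2 M.N hM
  have h4 := M.one_le_q hβ hM1
  have h5 := one_le_scale P hM1
  refine le_trans (show ‖steinAvg (f M x) (M.H ω)‖ ≤ _ from hω) ?_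
  calc _ = (4 * (4 * K' * 4 ^ A)) * (scale P M.N ^ (A + 3) / M.q) := by
        rw [mul_pow]; ring
    _ ≤ scale P M.N * (scale P M.N ^ (A + 3) / M.q) := by gcongr
    _ = _ := by ring

end LaplacianLocalLaw
end

noncomputable section
namespace LaplacianLocalLaw

/-! ### The error terms in the self-consistent equations: deterministic estimates -/

section deterministic

variable {N : ℕ} {A : Matrix (Fin (N + 1)) (Fin (N + 1)) ℝ} {z : ℂ} {Γ τ B : ℝ}

/-- The largest entry of the remainder. -/
def remainderNorm (A : Matrix (Fin (N + 1)) (Fin (N + 1)) ℝ) (z : ℂ) : ℝ :=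
  ‖(fun a b => remainder A z a b : Fin (N + 1) → Fin (N + 1) → ℂ)‖

lemma remainderNorm_nonneg (A : Matrix (Fin (N + 1)) (Fin (N + 1)) ℝ) (z : ℂ) :
    0 ≤ remainderNorm A z := norm_nonneg _

lemma norm_remainder_le (A : Matrix (Fin (N + 1)) (Fin (N + 1)) ℝ) (z : ℂ)
    (a b : Fin (N + 1)) : ‖remainder A z a b‖ ≤ remainderNorm A z :=
  (norm_le_pi_norm (fun b => remainder A z a b) b).trans
    (norm_le_pi_norm (fun a b => remainder A z a b) a)

lemma remainderNorm_le {x : ℝ} (hx : 0 ≤ x) (h : ∀ a b, ‖remainder A z a b‖ ≤ x) :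
    remainderNorm A z ≤ x :=
  (pi_norm_le_iff_of_nonneg hx).2 fun a => (pi_norm_le_iff_of_nonneg hx).2 fun b => h a b

lemma measurable_remainderNorm (z : ℂ) : Measurable fun A : Fin (N + 1) → Fin (N + 1) → ℝ =>
    remainderNorm (Matrix.of A) z :=
  (measurable_pi_lambda _ fun a => measurable_pi_lambda _ fun b =>
    measurable_remainder z a b).norm

/-- The first derivative of the entry `G k j` in the direction of the edge `{i, k}`. -/
def edgeDeriv (A : Matrix (Fin (N + 1)) (Fin (N + 1)) ℝ) (z : ℂ) (i k j : Fin (N + 1)) : ℂ :=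
  (resolvent A z k i - resolvent A z k k) * (resolvent A z i j - resolvent A z k j)

lemma measurable_edgeDeriv (z : ℂ) (i k j : Fin (N + 1)) :
    Measurable fun A : Fin (N + 1) → Fin (N + 1) → ℝ => edgeDeriv (Matrix.of A) z i k j :=
  ((measurable_resolvent z k i).sub (measurable_resolvent z k k)).mul
    ((measurable_resolvent z i j).sub (measurable_resolvent z k j))

/-- The second order coefficient in the expansion of `G k j` around the matrix without the edge
`{i, k}`. -/
def edgeDeriv₂ (A : Matrix (Fin (N + 1)) (Fin (N + 1)) ℝ) (z : ℂ) (i k j : Fin (N + 1)) : ℂ :=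
  (resolvent (cut A i k) z k i - resolvent (cut A i k) z k k) *
    ((resolvent (cut A i k) z i i - resolvent (cut A i k) z i k) -
      (resolvent (cut A i k) z k i - resolvent (cut A i k) z k k)) *
    (resolvent A z i j - resolvent A z k j)

/-- The rank-one formula, inserted once into itself. Keeping the full resolvent in the last factor
makes the expansion exact; only the zeroth and first coefficients have to be independent of the
weight. -/
lemma resolvent_eq_edge_expansion (hA : ∀ i j, A i j = A j i) (hz : 0 < z.im)
    (i k j : Fin (N + 1)) :
    resolvent A z k j = resolvent (cut A i k) z k j + A i k * edgeDeriv (cut A i k) z i k j +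
      (A i k : ℂ) ^ 2 * edgeDeriv₂ A z i k j := by
  have h1 := resolvent_cut hA hz i k k j
  have h2 := resolvent_cut hA hz i k i j
  have h3 : resolvent A z i j - resolvent A z k j =
      resolvent (cut A i k) z i j - resolvent (cut A i k) z k j + A i k *
      (((resolvent (cut A i k) z i i - resolvent (cut A i k) z i k) -
      (resolvent (cut A i k) z k i - resolvent (cut A i k) z k k)) *
      (resolvent A z i j - resolvent A z k j)) := by
    linear_combination h2 - h1
  unfold edgeDeriv edgeDeriv₂
  linear_combination h1 + (A i k : ℂ) * (resolvent (cut A i k) z k i -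
    resolvent (cut A i k) z k k) * h3

/-- The decoupled error density. -/
def edgeError (m : ℕ) (Γ τ B : ℝ) (A : Matrix (Fin (N + 1)) (Fin (N + 1)) ℝ) (z : ℂ)
    (i k j : Fin (N + 1)) : ℝ :=
  (2 * m + 1) * (‖resolvent A z k j‖ + B) *
    (‖resolvent A z k j‖ + B + 4 * Γ * (remainderNorm A z + B)) *
    (2 * ‖remainder A z i j‖ + (B + 4 * Γ * τ * (remainderNorm A z + B))) ^ (2 * m) +
  τ * (64 * Γ ^ 3) * ‖remainder A z i j‖ ^ (2 * m + 1)

lemma measurable_edgeError (m : ℕ) (Γ τ B : ℝ) (z : ℂ) (i k j : Fin (N + 1)) :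
    Measurable fun A : Fin (N + 1) → Fin (N + 1) → ℝ =>
      edgeError m Γ τ B (Matrix.of A) z i k j := by
  have h1 := (measurable_resolvent z k j).norm
  have h2 := measurable_remainderNorm (N := N) z
  have h3 := (measurable_remainder z i j).norm
  unfold edgeError
  exact ((((h1.add_const B).const_mul _).mul ((h1.add_const B).add
    ((h2.add_const B).const_mul _))).mul
    (((h3.const_mul 2).add (((h2.add_const B).const_mul _).const_add B)).pow_const _)).add
    ((h3.pow_const _).const_mul _)

/-- The deterministic conditions under which the error terms are controlled. -/
structure Tame (A : Matrix (Fin (N + 1)) (Fin (N + 1)) ℝ) (z : ℂ) (Γ τ B : ℝ) : Prop where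
  symm : ∀ i j, A i j = A j i
  im_pos : 0 < z.im
  one_le : 1 ≤ N
  norm_le : ∀ a b, ‖resolvent A z a b‖ ≤ Γ
  entry_le : ∀ a b, a ≠ b → |A a b| ≤ τ
  one_le_Γ : 1 ≤ Γ
  τ_nonneg : 0 ≤ τ
  B_pos : 0 < B
  B_le_one : B ≤ 1
  τ_le : 1000 * Γ ^ 3 * τ ≤ B
  ward_le : 100 * Γ ^ 3 / (N * z.im) ≤ B ^ 2

/-- The estimate for a single edge is quadratic in |G_kj|, so after averaging over k only the first
two moments of |G_kj| enter, and these are controlled by the Ward identity. -/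
lemma average_quadratic {ι : Type*} (s : Finset ι) {n : ℝ} (hn : 0 < n) (hs : (s.card : ℝ) = n)
    (f : ι → ℝ) (p r d b' b u Y : ℝ) :
    1 / n * ∑ k ∈ s, (p + r * (d * (f k + b') + (f k + b) * (f k + b + u)) * Y) =
      p + r * (d * (1 / n * ∑ k ∈ s, f k + b') + (1 / n * ∑ k ∈ s, f k ^ 2 +
        (2 * b + u) * (1 / n * ∑ k ∈ s, f k) + b * (b + u))) * Y := by
  have e : ∀ k ∈ s, p + r * (d * (f k + b') + (f k + b) * (f k + b + u)) * Y =
      (p + r * (d * b' + b * (b + u)) * Y) + (r * (d + (2 * b + u)) * Y) * f k +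
        r * Y * f k ^ 2 := fun k _ => by ring
  rw [Finset.sum_congr rfl e, Finset.sum_add_distrib, Finset.sum_add_distrib, ← Finset.mul_sum,
    ← Finset.mul_sum, Finset.sum_const, nsmul_eq_mul, hs]
  field_simp
  ring

/-- Here a₁ and a₂ stand for the averages of |G_kj| and |G_kj|², and U is the size of the remainder
plus B. The delicate product Γ U a₁ is O(B U) because the Ward identity makes Γ a₁ a small multiple
of B. Thus every term carries a factor B, and B U ≤ V². -/
lemma quadratic_average_le {Γ τ B U V a₁ a₂ : ℝ} (hΓ : 1 ≤ Γ) (hτ : 0 ≤ τ) (hB : 0 < B)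
    (hBU : B ≤ U) (hV : B * U ≤ V ^ 2) (hτB : 1000 * Γ ^ 3 * τ ≤ B) (h₁ : 0 ≤ a₁)
    (ha₁ : Γ * a₁ ≤ B / 7) (ha₂ : a₂ ≤ B ^ 2 / 100) :
    (16 * Γ ^ 2 * τ) * (a₁ + (2 * B + 12 * Γ * U)) +
      (a₂ + (2 * (2 * B) + 12 * Γ * U) * a₁ + 2 * B * (2 * B + 12 * Γ * U)) ≤
      41 * Γ * V ^ 2 := by
  have hU0 : 0 ≤ U := by linarith
  have ha1' : a₁ ≤ B / 7 := by nlinarith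
  have q1 : 12 * Γ * U * a₁ ≤ 2 * (B * U) := by
    have : U * (Γ * a₁) ≤ U * (B / 7) := by gcongr
    have : 0 ≤ B * U := by positivity
    linarith
  have hΓU : U ≤ Γ * U := le_mul_of_one_le_left hU0 hΓ
  have q2 : (16 * Γ ^ 2 * τ) * (a₁ + (2 * B + 12 * Γ * U)) ≤ B * U := by
    have : a₁ + (2 * B + 12 * Γ * U) ≤ 15 * (Γ * U) := by linarith
    calc _ ≤ (16 * Γ ^ 2 * τ) * (15 * (Γ * U)) := by gcongr
      _ = (240 * Γ ^ 3 * τ) * U := by ring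
      _ ≤ B * U := by
        have h11 : 0 ≤ Γ ^ 3 * τ := by positivity
        gcongr
        linarith
  have q3 : B ^ 2 ≤ B * U := by rw [sq]; gcongr
  have q4 : B * U ≤ Γ * (B * U) := le_mul_of_one_le_left (by positivity) hΓ
  have q5 : B * a₁ ≤ B * (U / 7) := by gcongr; linarith
  have q6 : Γ * (B * U) ≤ Γ * V ^ 2 := by gcongr
  have : 0 ≤ B * U := by positivity
  linarith

namespace Tame

variable (h : Tame A z Γ τ B)
include h

lemma pow_mul_τ_le {j : ℕ} (hj : j ≤ 3) : 1000 * Γ ^ j * τ ≤ B := by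
  have h1 := h.one_le_Γ
  have h2 := h.τ_nonneg
  refine le_trans ?_ h.τ_le
  gcongr

lemma pow_mul_ward_le {j : ℕ} (hj : j ≤ 3) : 100 * Γ ^ j / (N * z.im) ≤ B ^ 2 := by
  have h1 := h.one_le_Γ
  have h2 := h.im_pos
  refine le_trans ?_ h.ward_le
  gcongr

lemma edge_le {i k : Fin (N + 1)} (hik : i ≠ k) : 8 * |A i k| * Γ ≤ 1 := by
  have h1 := h.pow_mul_τ_le (j := 1) (by omega)
  have h2 := h.entry_le i k hik
  have h3 := h.one_le_Γ
  have h4 := h.B_le_one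
  have h5 := mul_le_mul_of_nonneg_right h2 (zero_le_one.trans h3)
  nlinarith

lemma six_mul_le : 6 * Γ ^ 2 / (N * z.im) ≤ B := by
  have h1 := h.pow_mul_ward_le (j := 2) (by omega)
  have h2 := h.B_pos
  have h3 := h.B_le_one
  have h4 : 6 * Γ ^ 2 / (N * z.im) ≤ 100 * Γ ^ 2 / (N * z.im) := by
    have := h.im_pos
    gcongr; norm_num
  nlinarith

/-- The perturbation bound involves the remainder of the cut matrix itself, with a factor 4 Γ τ so
small that it can be absorbed into the left-hand side. -/
lemma remainderNorm_cut_le {i k : Fin (N + 1)} (hik : i ≠ k) :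
    remainderNorm (cut A i k) z ≤ 2 * remainderNorm A z + 2 * B := by
  set x := remainderNorm (cut A i k) z with hx
  have hx0 : 0 ≤ x := remainderNorm_nonneg _ _
  have h0 := h.one_le_Γ
  have hB := h.B_pos
  have hR := remainderNorm_nonneg A z
  have key : x ≤ remainderNorm A z + τ * (B + 3 * Γ + 4 * Γ * x) := by
    refine remainderNorm_le (by have := h.τ_nonneg; positivity) fun a b => ?_
    have h1 := norm_remainder_sub_cut_le h.symm h.im_pos h.norm_le (h.edge_le hik)
      (norm_remainder_le (cut A i k) z) a b
    have h2 := norm_sub_norm_le (remainder (cut A i k) z a b) (remainder A z a b)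
    rw [norm_sub_rev] at h2
    have h3 := norm_remainder_le A z a b
    have h4 : |A i k| * (6 * Γ ^ 2 / (N * z.im) + 3 * Γ + 4 * Γ * x) ≤
        τ * (B + 3 * Γ + 4 * Γ * x) :=
      mul_le_mul (h.entry_le i k hik) (by linarith [h.six_mul_le])
        (by have := h.im_pos; positivity) h.τ_nonneg
    linarith
  have h1 := h.pow_mul_τ_le (j := 1) (by omega)
  have h2 := h.pow_mul_τ_le (j := 0) (by omega)
  have h3 := h.B_le_one
  have h4 : τ * (4 * Γ * x) ≤ x / 2 := by nlinarith
  have h5 : τ * B ≤ τ := mul_le_of_le_one_right h.τ_nonneg h3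
  nlinarith

lemma norm_sub_cut_le {i k : Fin (N + 1)} (hik : i ≠ k) (a b : Fin (N + 1)) :
    ‖resolvent A z a b - resolvent (cut A i k) z a b‖ ≤ 8 * Γ ^ 2 * τ := by
  refine (norm_resolvent_sub_cut_le h.symm h.im_pos h.norm_le (h.edge_le hik) a b).trans ?_
  have := h.entry_le i k hik
  gcongr

lemma norm_cut_le {i k : Fin (N + 1)} (hik : i ≠ k) (a b : Fin (N + 1)) :
    ‖resolvent (cut A i k) z a b‖ ≤ 2 * Γ :=
  norm_resolvent_cut_le h.symm h.im_pos h.norm_le (h.edge_le hik) a b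

lemma norm_le_cut_add {i k : Fin (N + 1)} (hik : i ≠ k) (a b : Fin (N + 1)) :
    ‖resolvent A z a b‖ ≤ ‖resolvent (cut A i k) z a b‖ + B := by
  have h1 := h.norm_sub_cut_le hik a b
  have h2 := norm_sub_norm_le (resolvent A z a b) (resolvent (cut A i k) z a b)
  have h3 := h.pow_mul_τ_le (j := 2) (by omega)
  have h4 := mul_nonneg (sq_nonneg Γ) h.τ_nonneg
  nlinarith

lemma norm_cut_le_add {i k : Fin (N + 1)} (hik : i ≠ k) (a b : Fin (N + 1)) :
    ‖resolvent (cut A i k) z a b‖ ≤ ‖resolvent A z a b‖ + B := by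
  have h1 := h.norm_sub_cut_le hik a b
  have h2 := norm_sub_norm_le (resolvent (cut A i k) z a b) (resolvent A z a b)
  rw [norm_sub_rev] at h2
  have h3 := h.pow_mul_τ_le (j := 2) (by omega)
  have h4 := mul_nonneg (sq_nonneg Γ) h.τ_nonneg
  nlinarith

lemma norm_remainder_sub_cut_le {i k : Fin (N + 1)} (hik : i ≠ k) (j : Fin (N + 1)) :
    ‖remainder A z i j - remainder (cut A i k) z i j‖ ≤ |A i k| *
      (‖resolvent (cut A i k) z k j‖ + B + 4 * Γ * (remainderNorm (cut A i k) z + B)) := by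
  refine (norm_remainder_sub_cut_row_le h.symm h.im_pos h.norm_le hik (h.edge_le hik)
    (norm_remainder_le (cut A i k) z) j).trans ?_
  have h1 := h.six_mul_le
  have h2 := h.norm_le_cut_add hik k j
  have h3 : B ≤ 4 * Γ * B := by nlinarith [h.one_le_Γ, h.B_pos]
  refine mul_le_mul_of_nonneg_left ?_ (abs_nonneg _)
  linarith

lemma norm_remainder_sub_cut_le' {i k : Fin (N + 1)} (hik : i ≠ k) (j : Fin (N + 1)) :
    |A i k| * (‖resolvent (cut A i k) z k j‖ + B + 4 * Γ * (remainderNorm (cut A i k) z + B)) ≤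
      B + 4 * Γ * τ * (remainderNorm (cut A i k) z + B) := by
  have h1 := h.norm_cut_le hik k j
  have h2 := h.entry_le i k hik
  have h3 := h.B_pos
  have h4 := h.one_le_Γ
  have h5 := remainderNorm_nonneg (cut A i k) z
  have hτ := h.τ_nonneg
  calc _ ≤ τ * (2 * Γ + B + 4 * Γ * (remainderNorm (cut A i k) z + B)) := by gcongr
    _ = τ * (2 * Γ + B) + 4 * Γ * τ * (remainderNorm (cut A i k) z + B) := by ring
    _ ≤ _ := by
      have h6 := h.pow_mul_τ_le (j := 1) (by omega)
      have h7 := h.pow_mul_τ_le (j := 0) (by omega)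
      have h8 : τ * B ≤ τ := mul_le_of_le_one_right h.τ_nonneg h.B_le_one
      nlinarith [h.τ_nonneg]

lemma norm_edgeDeriv_cut_le {i k : Fin (N + 1)} (hik : i ≠ k) (j : Fin (N + 1)) :
    ‖edgeDeriv (cut A i k) z i k j‖ ≤ 16 * Γ ^ 2 := by
  have h1 := h.norm_cut_le hik
  have h0 := h.one_le_Γ
  unfold edgeDeriv
  rw [norm_mul]
  calc _ ≤ (2 * Γ + 2 * Γ) * (2 * Γ + 2 * Γ) := by
        gcongr
        · exact (norm_sub_le _ _).trans (add_le_add (h1 _ _) (h1 _ _))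
        · exact (norm_sub_le _ _).trans (add_le_add (h1 _ _) (h1 _ _))
    _ = _ := by ring

lemma norm_edgeDeriv₂_le {i k : Fin (N + 1)} (hik : i ≠ k) (j : Fin (N + 1)) :
    ‖edgeDeriv₂ A z i k j‖ ≤ 64 * Γ ^ 3 := by
  have h1 := h.norm_cut_le hik
  have h2 := h.norm_le
  have h0 := h.one_le_Γ
  have h3 : ∀ a b c d, ‖resolvent (cut A i k) z a b - resolvent (cut A i k) z c d‖ ≤
      2 * Γ + 2 * Γ := fun a b c d => (norm_sub_le _ _).trans (add_le_add (h1 _ _) (h1 _ _))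
  unfold edgeDeriv₂
  rw [norm_mul, norm_mul]
  calc _ ≤ (2 * Γ + 2 * Γ) * ((2 * Γ + 2 * Γ) + (2 * Γ + 2 * Γ)) * (Γ + Γ) := by
        gcongr
        · exact h3 _ _ _ _
        · exact (norm_sub_le _ _).trans (add_le_add (h3 _ _ _ _) (h3 _ _ _ _))
        · exact (norm_sub_le _ _).trans (add_le_add (h2 _ _) (h2 _ _))
    _ = _ := by ring

/-- A product of two differences of entries, each of which moves by O(Γ² τ) when the edge is
removed; the condition `τ_le` is made for this cubic power of Γ. -/
lemma norm_edgeDeriv_sub_cut_le {i k : Fin (N + 1)} (hik : i ≠ k) (j : Fin (N + 1)) :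
    ‖edgeDeriv A z i k j - edgeDeriv (cut A i k) z i k j‖ ≤ B := by
  have h1 := h.norm_cut_le hik
  have h2 := h.norm_le
  have h3 := h.norm_sub_cut_le hik
  have h0 := h.one_le_Γ
  have hτ := h.τ_nonneg
  have e : edgeDeriv A z i k j - edgeDeriv (cut A i k) z i k j =
      ((resolvent A z k i - resolvent (cut A i k) z k i) -
        (resolvent A z k k - resolvent (cut A i k) z k k)) *
        (resolvent A z i j - resolvent A z k j) +
      (resolvent (cut A i k) z k i - resolvent (cut A i k) z k k) *
      ((resolvent A z i j - resolvent (cut A i k) z i j) -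
        (resolvent A z k j - resolvent (cut A i k) z k j)) := by
    unfold edgeDeriv; ring
  rw [e]
  calc _ ≤ (8 * Γ ^ 2 * τ + 8 * Γ ^ 2 * τ) * (Γ + Γ) +
        (2 * Γ + 2 * Γ) * (8 * Γ ^ 2 * τ + 8 * Γ ^ 2 * τ) := by
        refine (norm_add_le _ _).trans ?_
        rw [norm_mul, norm_mul]
        gcongr
        · exact (norm_sub_le _ _).trans (add_le_add (h3 _ _) (h3 _ _))
        · exact (norm_sub_le _ _).trans (add_le_add (h2 _ _) (h2 _ _))
        · exact (norm_sub_le _ _).trans (add_le_add (h1 _ _) (h1 _ _))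
        · exact (norm_sub_le _ _).trans (add_le_add (h3 _ _) (h3 _ _))
    _ = 96 * (Γ ^ 3 * τ) := by ring
    _ ≤ _ := by
      have := h.τ_le
      have : 0 ≤ Γ ^ 3 * τ := by positivity
      linarith

lemma sum_sq_le (j : Fin (N + 1)) :
    1 / (N : ℝ) * ∑ k, ‖resolvent A z k j‖ ^ 2 ≤ B ^ 2 / 100 := by
  have h1 := sum_sq_resolvent_le h.symm h.im_pos h.norm_le j
  simp_rw [fun k => resolvent_symm h.symm z k j]
  have h2 := h.pow_mul_ward_le (j := 1) (by omega)
  have h3 : 1 / (N : ℝ) * (Γ / z.im) = (100 * Γ ^ 1 / (N * z.im)) / 100 := by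
    have := h.im_pos.ne'
    have hN : (N : ℝ) ≠ 0 := by have := h.one_le; positivity
    field_simp
  calc _ ≤ 1 / (N : ℝ) * (Γ / z.im) := by gcongr
    _ ≤ _ := by rw [h3]; gcongr

/-- The Cauchy-Schwarz inequality after the Ward identity. The factor Γ is included because the
average of |G_kj| always occurs next to another entry. The numbers match as 7² ≤ 50. -/
lemma sum_le (j : Fin (N + 1)) : Γ * (1 / (N : ℝ) * ∑ k, ‖resolvent A z k j‖) ≤ B / 7 := by
  have hN : (1 : ℝ) ≤ N := by exact_mod_cast h.one_le
  have h0 := h.one_le_Γ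
  have hB := h.B_pos
  have h1 := sum_sq_resolvent_le h.symm h.im_pos h.norm_le j
  simp_rw [← fun k => resolvent_symm h.symm z k j] at h1
  have h2 := sq_sum_le_card_mul_sum_sq (s := Finset.univ)
    (f := fun k : Fin (N + 1) => ‖resolvent A z k j‖)
  simp only [Finset.card_univ, Fintype.card_fin] at h2
  push_cast at h2
  have h3 : 100 * Γ ^ 3 / (N * z.im) = (100 * Γ ^ 2 / N) * (Γ / z.im) := by
    have := h.im_pos.ne'
    field_simp
  have h4 := h.ward_le
  rw [h3] at h4
  refine le_of_sq_le_sq ?_ (by positivity)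
  calc _ = Γ ^ 2 / N ^ 2 * (∑ k, ‖resolvent A z k j‖) ^ 2 := by field_simp
    _ ≤ Γ ^ 2 / N ^ 2 * ((N + 1) * (Γ / z.im)) := by
      gcongr
      exact h2.trans (by gcongr)
    _ ≤ Γ ^ 2 / N ^ 2 * ((2 * N) * (Γ / z.im)) := by
      have := h.im_pos
      gcongr; linarith
    _ = (100 * Γ ^ 2 / N) * (Γ / z.im) / 50 := by
      have := h.im_pos.ne'
      field_simp; norm_num
    _ ≤ B ^ 2 / 50 := by gcongr
    _ ≤ _ := by rw [div_pow]; gcongr; norm_num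

/-- Expanding (G_ki - G_kk)(G_ij - G_kj), the average of -G_kk G_ij is -m_N G_ij and cancels the
counterterm. The three remaining products each contain an entry G_ki or G_kj averaged over k, at a
cost of B / 7 each. -/
lemma norm_drift_le (i j : Fin (N + 1)) :
    ‖mN A z * resolvent A z i j + ((1 / (N : ℝ) : ℝ) : ℂ) *
      ∑ k ∈ Finset.univ.erase i, edgeDeriv A z i k j‖ ≤ B := by
  have hN0 : (N : ℝ) ≠ 0 := by have := h.one_le; positivity
  -- The term k = i vanishes identically, so the sum may run over all k and match the trace exactly.
  have e0 : ∑ k ∈ Finset.univ.erase i, edgeDeriv A z i k j = ∑ k, edgeDeriv A z i k j := by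
    rw [← Finset.add_sum_erase _ _ (Finset.mem_univ i)]
    simp [edgeDeriv]
  have e : mN A z * resolvent A z i j + ((1 / (N : ℝ) : ℝ) : ℂ) * ∑ k, edgeDeriv A z i k j =
      ((1 / (N : ℝ) : ℝ) : ℂ) * ∑ k, (resolvent A z k i * resolvent A z i j -
        resolvent A z k i * resolvent A z k j + resolvent A z k k * resolvent A z k j) := by
    unfold mN Matrix.trace edgeDeriv
    rw [mul_assoc, Finset.sum_mul]
    push_cast
    rw [← mul_add, ← Finset.sum_add_distrib]
    congr 1
    refine Finset.sum_congr rfl fun k _ => ?_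
    rw [Matrix.diag_apply]; ring
  rw [e0, e, norm_mul, Complex.norm_real, Real.norm_eq_abs, abs_of_nonneg (by positivity)]
  have h1 : ‖∑ k, (resolvent A z k i * resolvent A z i j -
        resolvent A z k i * resolvent A z k j + resolvent A z k k * resolvent A z k j)‖ ≤
      2 * (Γ * ∑ k, ‖resolvent A z k i‖) + Γ * ∑ k, ‖resolvent A z k j‖ := by
    rw [Finset.mul_sum, Finset.mul_sum, Finset.mul_sum, ← Finset.sum_add_distrib]
    refine norm_sum_le_of_le _ fun k _ => ?_
    have h2 := h.norm_le
    have h3 : ‖resolvent A z k i * resolvent A z i j‖ ≤ Γ * ‖resolvent A z k i‖ := by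
      rw [norm_mul, mul_comm]; gcongr; exact h2 _ _
    have h4 : ‖resolvent A z k i * resolvent A z k j‖ ≤ Γ * ‖resolvent A z k i‖ := by
      rw [norm_mul, mul_comm]; gcongr; exact h2 _ _
    have h5 : ‖resolvent A z k k * resolvent A z k j‖ ≤ Γ * ‖resolvent A z k j‖ := by
      rw [norm_mul]; gcongr; exact h2 _ _
    have h6 := norm_add_le (resolvent A z k i * resolvent A z i j -
        resolvent A z k i * resolvent A z k j) (resolvent A z k k * resolvent A z k j)
    have h7 := norm_sub_le (resolvent A z k i * resolvent A z i j)
      (resolvent A z k i * resolvent A z k j)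
    linarith
  have h2 := h.sum_le i
  have h3 := h.sum_le j
  have hB := h.B_pos
  calc _ ≤ 1 / (N : ℝ) * (2 * (Γ * ∑ k, ‖resolvent A z k i‖) +
        Γ * ∑ k, ‖resolvent A z k j‖) := by gcongr
    _ = 2 * (Γ * (1 / (N : ℝ) * ∑ k, ‖resolvent A z k i‖)) +
        Γ * (1 / (N : ℝ) * ∑ k, ‖resolvent A z k j‖) := by ring
    _ ≤ _ := by linarith

lemma norm_oddPow_sub_cut_le (m : ℕ) {i k : Fin (N + 1)} (hik : i ≠ k) (j : Fin (N + 1)) :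
    ‖oddPow m (remainder A z i j) - oddPow m (remainder (cut A i k) z i j)‖ ≤
      (2 * m + 1) * (|A i k| * (‖resolvent (cut A i k) z k j‖ + B +
        4 * Γ * (remainderNorm (cut A i k) z + B))) *
      (2 * ‖remainder (cut A i k) z i j‖ +
        (B + 4 * Γ * τ * (remainderNorm (cut A i k) z + B))) ^ (2 * m) := by
  have h1 := h.norm_remainder_sub_cut_le hik j
  have h2 := h.norm_remainder_sub_cut_le' hik j
  have h3 := norm_sub_norm_le (remainder A z i j) (remainder (cut A i k) z i j)
  refine (norm_oddPow_sub_le m _ _).trans ?_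
  have h4 := pow_le_pow_left₀ (by positivity) (show ‖remainder A z i j‖ +
    ‖remainder (cut A i k) z i j‖ ≤ 2 * ‖remainder (cut A i k) z i j‖ +
        (B + 4 * Γ * τ * (remainderNorm (cut A i k) z + B)) by linarith) (2 * m)
  have h5 : 0 ≤ ‖remainder A z i j - remainder (cut A i k) z i j‖ := norm_nonneg _
  exact mul_le_mul (mul_le_mul_of_nonneg_left h1 (by positivity)) h4 (by positivity)
    (mul_nonneg (by positivity) (h5.trans h1))

/-- The pointwise hypothesis of the decoupling estimate: all factors are expressed through the cut
matrix, and h² is pulled out in front. -/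
lemma error_le_edgeError (m : ℕ) {i k : Fin (N + 1)} (hik : i ≠ k) (j : Fin (N + 1)) :
    |A i k| * ‖resolvent A z k j‖ *
        ‖oddPow m (remainder A z i j) - oddPow m (remainder (cut A i k) z i j)‖ +
      |A i k| ^ 3 * ‖edgeDeriv₂ A z i k j‖ * ‖remainder (cut A i k) z i j‖ ^ (2 * m + 1) ≤
      A i k ^ 2 * edgeError m Γ τ B (cut A i k) z i k j := by
  have h1 := h.norm_oddPow_sub_cut_le m hik j
  have h2 := h.norm_le_cut_add hik k j
  have h3 := h.norm_edgeDeriv₂_le hik j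
  have h4 := h.entry_le i k hik
  have h5 := h.B_pos
  have h0 := h.one_le_Γ
  have hτ := h.τ_nonneg
  unfold edgeError
  set G := ‖resolvent (cut A i k) z k j‖
  set X := ‖remainder (cut A i k) z i j‖
  set D := G + B + 4 * Γ * (remainderNorm (cut A i k) z + B)
  set E := (2 * X + (B + 4 * Γ * τ * (remainderNorm (cut A i k) z + B))) ^ (2 * m)
  rw [← sq_abs (A i k)]
  have h6 : |A i k| * ‖resolvent A z k j‖ * ‖oddPow m (remainder A z i j) -
      oddPow m (remainder (cut A i k) z i j)‖ ≤
      |A i k| * (G + B) * ((2 * m + 1) * (|A i k| * D) * E) :=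
    mul_le_mul (mul_le_mul_of_nonneg_left h2 (abs_nonneg _)) h1 (norm_nonneg _) (by positivity)
  have h7 : |A i k| ^ 3 * ‖edgeDeriv₂ A z i k j‖ * X ^ (2 * m + 1) ≤
      |A i k| ^ 2 * (τ * (64 * Γ ^ 3) * X ^ (2 * m + 1)) := by
    calc _ = |A i k| ^ 2 * (|A i k| * ‖edgeDeriv₂ A z i k j‖ * X ^ (2 * m + 1)) := by ring
      _ ≤ _ := by gcongr
  linarith

/-- The size of the error in the moment recursion. -/
def _root_.LaplacianLocalLaw.errorSize (Γ τ B : ℝ)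
    (A : Matrix (Fin (N + 1)) (Fin (N + 1)) ℝ) (z : ℂ) : ℝ :=
  √(B * (remainderNorm A z + B)) + 4 * Γ * τ * (remainderNorm A z + B)

lemma B_add_le_errorSize :
    B + 4 * Γ * τ * (remainderNorm A z + B) ≤ errorSize Γ τ B A z := by
  unfold errorSize
  gcongr
  refine Real.le_sqrt_of_sq_le ?_
  nlinarith [remainderNorm_nonneg A z, h.B_pos]

lemma mul_le_errorSize_sq :
    B * (remainderNorm A z + B) ≤ errorSize Γ τ B A z ^ 2 := by
  have h1 := remainderNorm_nonneg A z
  have h2 := h.B_pos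
  have h3 := h.one_le_Γ
  have h4 := h.τ_nonneg
  calc _ = √(B * (remainderNorm A z + B)) ^ 2 := (Real.sq_sqrt (by positivity)).symm
    _ ≤ _ := by
      unfold errorSize
      gcongr
      have : 0 ≤ 4 * Γ * τ * (remainderNorm A z + B) := by positivity
      linarith

/-- Returns from the cut matrix to A, so that the averages over k are those of a single resolvent.
Passing to A at most triples the remainder size U, whence 3V for the change of the remainder and 9V
in the powers. -/
lemma edge_term_le (m : ℕ) {i k : Fin (N + 1)} (hik : i ≠ k) (j : Fin (N + 1)) :
    ‖edgeDeriv A z i k j * oddPow m (remainder A z i j) -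
      edgeDeriv (cut A i k) z i k j * oddPow m (remainder (cut A i k) z i j)‖ +
      edgeError m Γ τ B (cut A i k) z i k j ≤
    2 * B * (2 * ‖remainder A z i j‖ + 9 * errorSize Γ τ B A z) ^ (2 * m + 1) +
    (2 * m + 1) * ((16 * Γ ^ 2 * τ) * (‖resolvent A z k j‖ + 2 * B +
        12 * Γ * (remainderNorm A z + B)) + (‖resolvent A z k j‖ + 2 * B) *
        (‖resolvent A z k j‖ + 2 * B + 12 * Γ * (remainderNorm A z + B))) *
      (2 * ‖remainder A z i j‖ + 9 * errorSize Γ τ B A z) ^ (2 * m) := by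
  have h1 := h.norm_oddPow_sub_cut_le m hik j
  have h2 := h.norm_cut_le_add hik k j
  have h3 := h.norm_edgeDeriv_cut_le hik j
  have h4 := h.norm_edgeDeriv_sub_cut_le hik j
  have h5 := h.entry_le i k hik
  have hB := h.B_pos
  have hΓ := h.one_le_Γ
  have hτ := h.τ_nonneg
  have h6 := h.remainderNorm_cut_le hik
  have h7 := h.B_add_le_errorSize
  have h8 := h.norm_remainder_sub_cut_le hik j
  have h9 := h.norm_remainder_sub_cut_le' hik j
  have hr := remainderNorm_nonneg (cut A i k) z
  have hr' := remainderNorm_nonneg A z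
  set G := ‖resolvent (cut A i k) z k j‖
  set X₀ := ‖remainder (cut A i k) z i j‖ with hX₀
  set X := ‖remainder A z i j‖ with hX
  set U := remainderNorm A z + B with hU
  set V := errorSize Γ τ B A z
  have hX0 : 0 ≤ X := norm_nonneg _
  have hX00 : 0 ≤ X₀ := norm_nonneg _
  have hG0 : 0 ≤ G := norm_nonneg _
  have hU₀ : remainderNorm (cut A i k) z + B ≤ 3 * U := by linarith
  have hκ : B + 4 * Γ * τ * (remainderNorm (cut A i k) z + B) ≤ 3 * V := by
    have : 4 * Γ * τ * (remainderNorm (cut A i k) z + B) ≤ 4 * Γ * τ * (3 * U) := by gcongr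
    nlinarith
  have hXX : X₀ ≤ X + 3 * V := by
    have h10 := norm_sub_norm_le (remainder (cut A i k) z i j) (remainder A z i j)
    rw [norm_sub_rev] at h10
    linarith
  have hD : G + B + 4 * Γ * (remainderNorm (cut A i k) z + B) ≤
      ‖resolvent A z k j‖ + 2 * B + 12 * Γ * U := by
    have : 4 * Γ * (remainderNorm (cut A i k) z + B) ≤ 4 * Γ * (3 * U) := by gcongr
    linarith
  have hD0 : 0 ≤ G + B + 4 * Γ * (remainderNorm (cut A i k) z + B) := by positivity
  set D := ‖resolvent A z k j‖ + 2 * B + 12 * Γ * U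
  have hV0 : 0 ≤ V := by
    have : 0 ≤ B + 4 * Γ * τ * U := by positivity
    linarith
  have hE : (2 * X₀ + (B + 4 * Γ * τ * (remainderNorm (cut A i k) z + B))) ^ (2 * m) ≤
      (2 * X + 9 * V) ^ (2 * m) := by
    refine pow_le_pow_left₀ (by positivity) ?_ _
    linarith
  have hE0 : 0 ≤ (2 * X₀ + (B + 4 * Γ * τ * (remainderNorm (cut A i k) z + B))) ^ (2 * m) := by
    positivity
  have hQ : ‖oddPow m (remainder A z i j) - oddPow m (remainder (cut A i k) z i j)‖ ≤
      (2 * m + 1) * (τ * D) * (2 * X + 9 * V) ^ (2 * m) := by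
    refine h1.trans ?_
    refine mul_le_mul (mul_le_mul_of_nonneg_left (mul_le_mul h5 hD hD0 hτ) (by positivity)) hE
      hE0 ?_
    have := hD0.trans hD
    positivity
  have hXp : X ^ (2 * m + 1) ≤ (2 * X + 9 * V) ^ (2 * m + 1) :=
    pow_le_pow_left₀ hX0 (by linarith) _
  have hXp0 : X₀ ^ (2 * m + 1) ≤ (2 * X + 9 * V) ^ (2 * m + 1) :=
    pow_le_pow_left₀ hX00 (by linarith) _
  have t1 : ‖edgeDeriv A z i k j * oddPow m (remainder A z i j) -
      edgeDeriv (cut A i k) z i k j * oddPow m (remainder (cut A i k) z i j)‖ ≤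
      B * (2 * X + 9 * V) ^ (2 * m + 1) + 16 * Γ ^ 2 *
        ((2 * m + 1) * (τ * D) * (2 * X + 9 * V) ^ (2 * m)) := by
    have e : edgeDeriv A z i k j * oddPow m (remainder A z i j) -
      edgeDeriv (cut A i k) z i k j * oddPow m (remainder (cut A i k) z i j) =
      (edgeDeriv A z i k j - edgeDeriv (cut A i k) z i k j) * oddPow m (remainder A z i j) +
      edgeDeriv (cut A i k) z i k j * (oddPow m (remainder A z i j) -
        oddPow m (remainder (cut A i k) z i j)) := by ring
    rw [e]
    refine (norm_add_le _ _).trans (add_le_add ?_ ?_)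
    · rw [norm_mul, norm_oddPow]
      exact mul_le_mul h4 hXp (by positivity) hB.le
    · rw [norm_mul]
      exact mul_le_mul h3 hQ (norm_nonneg _) (by positivity)
  have t2 : edgeError m Γ τ B (cut A i k) z i k j ≤
      (2 * m + 1) * (‖resolvent A z k j‖ + 2 * B) * D * (2 * X + 9 * V) ^ (2 * m) +
      B * (2 * X + 9 * V) ^ (2 * m + 1) := by
    unfold edgeError
    refine add_le_add ?_ ?_
    · have hGB : G + B ≤ ‖resolvent A z k j‖ + 2 * B := by linarith
      have := hD0.trans hD
      refine mul_le_mul (mul_le_mul (mul_le_mul_of_nonneg_left hGB (by positivity)) hD hD0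
        (by positivity)) hE hE0 (by positivity)
    · refine mul_le_mul ?_ hXp0 (by positivity) hB.le
      have := h.τ_le
      have : 0 ≤ Γ ^ 3 * τ := by positivity
      linarith
  calc _ ≤ _ := add_le_add t1 t2
    _ = _ := by ring

/-- The drift and the sum over the edges together are one power of V smaller than the moment to be
bounded. The sum over k is where the Ward identity is used: a single edge with large |G_kj| would
not satisfy such a bound. -/
lemma drift_add_sum_le (m : ℕ) (i j : Fin (N + 1)) :
    ‖mN A z * resolvent A z i j + ((1 / (N : ℝ) : ℝ) : ℂ) *
      ∑ k ∈ Finset.univ.erase i, edgeDeriv A z i k j‖ * ‖remainder A z i j‖ ^ (2 * m + 1) +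
    1 / (N : ℝ) * ∑ k ∈ Finset.univ.erase i,
      (‖edgeDeriv A z i k j * oddPow m (remainder A z i j) -
      edgeDeriv (cut A i k) z i k j * oddPow m (remainder (cut A i k) z i j)‖ +
      edgeError m Γ τ B (cut A i k) z i k j) ≤
    ((2 * m + 1) * 44 * 2 ^ (2 * m + 1) * Γ) * errorSize Γ τ B A z *
      (‖remainder A z i j‖ + 5 * errorSize Γ τ B A z) ^ (2 * m + 1) := by
  have hB := h.B_pos
  have hΓ := h.one_le_Γ
  have hτ := h.τ_nonneg
  have hN : (1 : ℝ) ≤ N := by exact_mod_cast h.one_le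
  have h1 := h.norm_drift_le i j
  have h2 := h.sum_le j
  have h3 := h.sum_sq_le j
  have h4 := h.B_add_le_errorSize
  have h5 := h.mul_le_errorSize_sq
  have h6 : ∀ k ∈ Finset.univ.erase i, _ := fun k hk =>
    h.edge_term_le m (Finset.ne_of_mem_erase hk).symm j
  have h7 := Finset.sum_le_sum h6
  have hr' := remainderNorm_nonneg A z
  set X := ‖remainder A z i j‖ with hX
  set U := remainderNorm A z + B with hU
  set V := errorSize Γ τ B A z with hV
  have hX0 : 0 ≤ X := norm_nonneg _
  have hBV : B ≤ V := by
    have : 0 ≤ 4 * Γ * τ * U := by positivity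
    linarith
  have hBU : B ≤ U := by linarith
  have hV0 : 0 ≤ V := hB.le.trans hBV
  set Y := (2 * X + 9 * V) ^ (2 * m) with hY
  have hY0 : 0 ≤ Y := by positivity
  have hYs : (2 * X + 9 * V) ^ (2 * m + 1) = Y * (2 * X + 9 * V) := pow_succ _ _
  rw [hYs] at h7
  have hsum : 1 / (N : ℝ) * ∑ k ∈ Finset.univ.erase i,
      (2 * B * (Y * (2 * X + 9 * V)) + (2 * m + 1) * ((16 * Γ ^ 2 * τ) *
        (‖resolvent A z k j‖ + (2 * B + 12 * Γ * U)) + (‖resolvent A z k j‖ + 2 * B) *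
        (‖resolvent A z k j‖ + 2 * B + 12 * Γ * U)) * Y) ≤
      2 * B * (Y * (2 * X + 9 * V)) + (2 * m + 1) * (41 * Γ * V ^ 2) * Y := by
    have hs1 : ∑ k ∈ Finset.univ.erase i, ‖resolvent A z k j‖ ≤ ∑ k, ‖resolvent A z k j‖ :=
      Finset.sum_le_sum_of_subset_of_nonneg (Finset.erase_subset _ _) fun _ _ _ => norm_nonneg _
    have hs2 : ∑ k ∈ Finset.univ.erase i, ‖resolvent A z k j‖ ^ 2 ≤
        ∑ k, ‖resolvent A z k j‖ ^ 2 :=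
      Finset.sum_le_sum_of_subset_of_nonneg (Finset.erase_subset _ _) fun _ _ _ => by positivity
    have hs3 := mul_le_mul_of_nonneg_left hs1 (by positivity : 0 ≤ 1 / (N : ℝ))
    have hs4 := (mul_le_mul_of_nonneg_left hs2 (by positivity : 0 ≤ 1 / (N : ℝ))).trans h3
    have hs5 := (mul_le_mul_of_nonneg_left hs3 (by positivity : 0 ≤ Γ)).trans h2
    rw [average_quadratic _ (by linarith) (by simp)]
    have := quadratic_average_le hΓ hτ hB hBU h5 h.τ_le (by positivity) hs5 hs4
    gcongr
  simp only [add_assoc _ (2 * B)] at hsum h7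
  have hd : ‖mN A z * resolvent A z i j + ((1 / (N : ℝ) : ℝ) : ℂ) *
      ∑ k ∈ Finset.univ.erase i, edgeDeriv A z i k j‖ * X ^ (2 * m + 1) ≤
      B * (Y * (2 * X + 9 * V)) := by
    rw [← hYs]
    exact mul_le_mul h1 (pow_le_pow_left₀ hX0 (by linarith) _) (by positivity) hB.le
  have h8 := (mul_le_mul_of_nonneg_left h7 (by positivity : 0 ≤ 1 / (N : ℝ))).trans hsum
  have hfin : (2 * X + 9 * V) ^ (2 * m + 1) ≤ 2 ^ (2 * m + 1) * (X + 5 * V) ^ (2 * m + 1) := by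
    rw [← mul_pow]
    exact pow_le_pow_left₀ (by positivity) (by linarith) _
  have hm0 : (0 : ℝ) ≤ m := Nat.cast_nonneg m
  have hYX : 0 ≤ Y * (2 * X + 9 * V) := by positivity
  -- The drift and the two B terms of each edge give the 3, the averaged quadratic part gives 41,
  -- together 44.
  calc _ ≤ B * (Y * (2 * X + 9 * V)) + (2 * B * (Y * (2 * X + 9 * V)) +
        (2 * m + 1) * (41 * Γ * V ^ 2) * Y) := add_le_add hd h8
    _ ≤ 3 * ((2 * m + 1) * Γ * V * (Y * (2 * X + 9 * V))) +
        41 * ((2 * m + 1) * Γ * V * (Y * (2 * X + 9 * V))) := by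
      have w1 : B * (Y * (2 * X + 9 * V)) ≤ (2 * m + 1) * Γ * V * (Y * (2 * X + 9 * V)) := by
        refine mul_le_mul_of_nonneg_right (hBV.trans (le_mul_of_one_le_left hV0 ?_)) hYX
        have : 0 ≤ 2 * (m : ℝ) * Γ := by positivity
        linarith
      have w2 : (2 * m + 1) * (41 * Γ * V ^ 2) * Y ≤
          41 * ((2 * m + 1) * Γ * V * (Y * (2 * X + 9 * V))) := by
        have : V * Y ≤ Y * (2 * X + 9 * V) := by nlinarith
        calc _ = 41 * ((2 * m + 1) * Γ * V * (V * Y)) := by ring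
          _ ≤ _ := by gcongr
      linarith
    _ = (2 * m + 1) * 44 * Γ * V * (2 * X + 9 * V) ^ (2 * m + 1) := by rw [hYs]; ring
    _ ≤ (2 * m + 1) * 44 * Γ * V * (2 ^ (2 * m + 1) * (X + 5 * V) ^ (2 * m + 1)) := by gcongr
    _ = _ := by ring

end Tame

end deterministic

end LaplacianLocalLaw
end

/-! ### Choice of parameters and crude bounds for the moment recursion. -/

noncomputable section
namespace LaplacianLocalLaw

universe u v w

variable {β : ℝ} {c : ℕ → ℝ}

namespace Ensemble

variable (M : Ensemble.{u} β c) {E : Type*} [MeasurableSpace E]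
  {g : Matrix (Fin (M.N + 1)) (Fin (M.N + 1)) ℝ → E}

lemma measurable_of_H
    (hg : Measurable fun A : Fin (M.N + 1) → Fin (M.N + 1) → ℝ => g (Matrix.of A)) :
    Measurable fun ω => g (M.H ω) :=
  Measurable.comp (g := fun A : Fin (M.N + 1) → Fin (M.N + 1) → ℝ => g (Matrix.of A))
    (f := fun ω a b => M.H ω a b) hg M.measurable_H

lemma measurable_of_cut (i k : Fin (M.N + 1))
    (hg : Measurable fun A : Fin (M.N + 1) → Fin (M.N + 1) → ℝ => g (Matrix.of A)) :
    Measurable fun ω => g (cut (M.H ω) i k) :=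
  Measurable.comp (g := fun A : Fin (M.N + 1) → Fin (M.N + 1) → ℝ => g (Matrix.of A))
    (f := fun ω a b => cut (M.H ω) i k a b) hg (M.measurable_cut_H i k)

lemma indepFun_of_cut {i k : Fin (M.N + 1)} (hik : i ≠ k)
    (hg : Measurable fun A : Fin (M.N + 1) → Fin (M.N + 1) → ℝ => g (Matrix.of A)) :
    IndepFun (fun ω => M.H ω i k) (fun ω => g (cut (M.H ω) i k)) M.μ :=
  IndepFun.comp (φ := id) (ψ := fun A : Fin (M.N + 1) → Fin (M.N + 1) → ℝ => g (Matrix.of A))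
    (M.indep_cut hik) measurable_id hg

end Ensemble

lemma norm_mN_le {N : ℕ} (hN : 1 ≤ N) {A : Matrix (Fin (N + 1)) (Fin (N + 1)) ℝ} {z : ℂ} {x : ℝ}
    (h : ∀ a, ‖resolvent A z a a‖ ≤ x) : ‖mN A z‖ ≤ 2 * x := by
  have hN' : (1 : ℝ) ≤ N := by exact_mod_cast hN
  have hx : 0 ≤ x := (norm_nonneg _).trans (h 0)
  have h1 : ‖(resolvent A z).trace‖ ≤ (N + 1) * x := by
    refine (norm_sum_le _ _).trans ((Finset.sum_le_card_nsmul _ _ x fun a _ => h a).trans ?_)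
    simp
  unfold mN
  rw [norm_mul, norm_div, norm_one, Complex.norm_natCast]
  calc _ ≤ 1 / (N : ℝ) * ((N + 1) * x) := by gcongr
    _ ≤ 1 / (N : ℝ) * ((2 * N) * x) := by gcongr; linarith
    _ = _ := by field_simp

/-- Only needed off the good event, and therefore stated through the off-diagonal entries alone: in
the form of a row sum the remainder does not contain the diagonal entry. -/
lemma norm_remainder_le_crude {N : ℕ} {A : Matrix (Fin (N + 1)) (Fin (N + 1)) ℝ} {z : ℂ}
    (hN : 1 ≤ N) (hA : ∀ i j, A i j = A j i) (hz : 0 < z.im) {w : ℝ} (hw : 4 ≤ w)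
    (hNw : (N : ℝ) + 1 ≤ w) (hzw : 1 / z.im ≤ w) (he : ∀ a b, a ≠ b → |A a b| ≤ w)
    (a b : Fin (N + 1)) : ‖remainder A z a b‖ ≤ w ^ 4 := by
  have hG : ∀ a b, ‖resolvent A z a b‖ ≤ w := fun a b =>
    (norm_resolvent_le hA hz a b).trans hzw
  have hm := norm_mN_le hN fun a => hG a a
  rw [remainder_eq_sum hA hz]
  have h1 : ‖∑ c ∈ Finset.univ.erase a, (A a c : ℂ) * resolvent A z c b‖ ≤ w * (w * w) := by
    refine (norm_sum_le _ _).trans ((Finset.sum_le_card_nsmul _ _ (w * w) fun c hc => ?_).trans ?_)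
    · rw [norm_mul, Complex.norm_real, Real.norm_eq_abs]
      have := he a c (Finset.ne_of_mem_erase hc).symm
      have := hG c b
      gcongr
    · rw [nsmul_eq_mul]
      gcongr
      simp only [Finset.card_erase_of_mem (Finset.mem_univ _), Finset.card_univ, Fintype.card_fin]
      simp; linarith
  refine (norm_add_le _ _).trans ((add_le_add h1 ?_).trans
    (?_ : w * (w * w) + 2 * w * w ≤ w ^ 4))
  · rw [norm_mul]
    have := hG a b
    gcongr
  · nlinarith [pow_pos (show 0 < w by linarith) 3, pow_pos (show 0 < w by linarith) 2]

section parameters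

variable {P : ℕ}

/-- The size, before optimisation, of the entries of the remainder. -/
def level (P : ℕ) (M : Ensemble.{u} β c) (z : ℂ) : ℝ := scale P M.N ^ 10 * Psi M.N M.q z

lemma Psi_eq {N : ℕ} {q : ℝ} {z : ℂ} : Psi N q z = 1 / q + 1 / √(N * z.im) := by
  rw [Psi, Real.sqrt_eq_rpow]

lemma level_le_one (hP : P ≠ 0) (hPβ : 40 ≤ β * P) {M : Ensemble.{u} β c}
    (hN : 1 ≤ M.N) (hT : 2 ≤ scale P M.N) {z : ℂ} (hNz : scale P M.N ^ 40 ≤ M.N * z.im) :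
    level P M z ≤ 1 := by
  have hq := M.scale_pow_le_q hP (j := 40) (by exact_mod_cast hPβ) hN
  have hs : scale P M.N ^ 20 ≤ √(M.N * z.im) := by
    refine Real.le_sqrt_of_sq_le ?_
    rw [← pow_mul]; exact hNz
  rw [level, Psi_eq]
  set T := scale P M.N
  have h1 : 1 / M.q ≤ 1 / T ^ 20 :=
    one_div_le_one_div_of_le (by positivity)
      ((pow_le_pow_right₀ (by linarith) (by norm_num)).trans hq)
  have h2 : 1 / √(M.N * z.im) ≤ 1 / T ^ 20 := one_div_le_one_div_of_le (by positivity) hs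
  calc _ ≤ T ^ 10 * (1 / T ^ 20 + 1 / T ^ 20) := by gcongr
    _ = 2 / T ^ 10 := by field_simp; norm_num
    _ ≤ 1 := by
      rw [div_le_one (by positivity)]
      calc 2 ≤ T := hT
        _ ≤ _ := le_self_pow₀ (by linarith) (by norm_num)

lemma level_pos (hβ : 0 < β) {M : Ensemble.{u} β c} (hN : 1 ≤ M.N) {z : ℂ} :
    0 < level P M z := by
  have h1 := M.one_le_q hβ hN
  have h2 := one_le_scale P hN
  rw [level, Psi_eq]
  positivity

/-- The event on which a bound on the resolvent and on the entries of the matrix hold. -/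
def goodEvent (P : ℕ) (M : Ensemble.{u} β c) (z : ℂ) : Set M.Ω :=
  {ω | ∀ a b, ‖resolvent (M.H ω) z a b‖ ≤ scale P M.N ^ 2} ∩
    {ω | ∀ a b, a ≠ b → |M.H ω a b| ≤ scale P M.N / M.q}

lemma measurableSet_goodEvent (M : Ensemble.{u} β c) (z : ℂ) :
    MeasurableSet (goodEvent P M z) := by
  refine MeasurableSet.inter ?_ (M.measurableSet_abs_H_le _)
  simp only [Set.ofPred_forall]
  exact MeasurableSet.iInter fun a => MeasurableSet.iInter fun b =>
    measurableSet_le (M.measurable_of_H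
      (g := fun A => resolvent A z a b) (measurable_resolvent z a b)).norm measurable_const

/-- With Γ = T² and τ = T / q the quantities to be dominated are 1000 T⁷ / q and 100 T⁶ / (N Im z).
The level B = T^10 Ψ exceeds the first and B² exceeds the second, with room for the constants. -/
lemma tame_of_mem_goodEvent (hβ : 0 < β) (hP : P ≠ 0) (hPβ : 40 ≤ β * P) {M : Ensemble.{u} β c}
    (hN : 1 ≤ M.N) (hT : 1000 ≤ scale P M.N) {z : ℂ} (hz : 0 < z.im)
    (hNz : scale P M.N ^ 40 ≤ M.N * z.im) {ω : M.Ω} (hω : ω ∈ goodEvent P M z) :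
    Tame (M.H ω) z (scale P M.N ^ 2) (scale P M.N / M.q) (level P M z) where
  symm := M.hsymm ω
  im_pos := hz
  one_le := hN
  norm_le := hω.1
  entry_le := hω.2
  one_le_Γ := one_le_pow₀ (by linarith)
  τ_nonneg := by have := M.one_le_q hβ hN; positivity
  B_pos := level_pos hβ hN
  B_le_one := level_le_one hP hPβ hN (by linarith) hNz
  τ_le := by
    have hq := M.one_le_q hβ hN
    rw [level, Psi_eq]
    set T := scale P M.N
    calc 1000 * (T ^ 2) ^ 3 * (T / M.q) = (1000 * T ^ 7) / M.q := by ring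
      _ ≤ (T * T ^ 7) / M.q := by gcongr
      _ = T ^ 8 / M.q := by ring
      _ ≤ T ^ 10 / M.q := by gcongr; linarith; norm_num
      _ = T ^ 10 * (1 / M.q + 0) := by ring
      _ ≤ _ := by gcongr; positivity
  ward_le := by
    have hq := M.one_le_q hβ hN
    have hNp : (0 : ℝ) < M.N := by exact_mod_cast hN
    rw [level, Psi_eq]
    set T := scale P M.N
    have h0 : 0 < M.N * z.im := by positivity
    calc 100 * (T ^ 2) ^ 3 / (M.N * z.im) = 100 * T ^ 6 / (M.N * z.im) := by ring
      _ ≤ T ^ 14 * T ^ 6 / (M.N * z.im) := by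
        gcongr
        calc 100 ≤ T := by linarith
          _ ≤ _ := le_self_pow₀ (by linarith) (by norm_num)
      _ = (T ^ 10 * (0 + 1 / √(M.N * z.im))) ^ 2 := by
        rw [zero_add, mul_pow, div_pow, Real.sq_sqrt h0.le]; ring
      _ ≤ _ := by gcongr; positivity

/-- Crude deterministic bounds for the quantities built from a resolvent. -/
lemma crude_bounds {N : ℕ} {A : Matrix (Fin (N + 1)) (Fin (N + 1)) ℝ} {z : ℂ} {w : ℝ}
    (hA : ∀ i j, A i j = A j i) (hz : 0 < z.im) (hw : 16 ≤ w)
    (hzw : 1 / z.im ≤ w) (i k j : Fin (N + 1)) :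
    ‖resolvent A z k j‖ ≤ w ^ 6 ∧ ‖edgeDeriv A z i k j‖ ≤ w ^ 6 ∧
      ‖edgeDeriv₂ A z i k j‖ ≤ w ^ 6 := by
  have hG : ∀ a b, ‖resolvent A z a b‖ ≤ w := fun a b =>
    (norm_resolvent_le hA hz a b).trans hzw
  have hGc : ∀ a b, ‖resolvent (cut A i k) z a b‖ ≤ w := fun a b =>
    (norm_resolvent_le (cut_symm hA i k) hz a b).trans hzw
  have hw1 : 1 ≤ w := by linarith
  refine ⟨(hG _ _).trans (le_self_pow₀ hw1 (by norm_num)), ?_, ?_⟩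
  · unfold edgeDeriv
    rw [norm_mul]
    calc _ ≤ (w + w) * (w + w) := by
          gcongr
          · exact (norm_sub_le _ _).trans (add_le_add (hG _ _) (hG _ _))
          · exact (norm_sub_le _ _).trans (add_le_add (hG _ _) (hG _ _))
      _ = 4 * w ^ 2 := by ring
      _ ≤ w ^ 4 * w ^ 2 := by
        gcongr
        exact le_trans (by linarith) (le_self_pow₀ hw1 (by norm_num))
      _ = _ := by ring
  · have h3 : ∀ a b c d, ‖resolvent (cut A i k) z a b - resolvent (cut A i k) z c d‖ ≤
      w + w := fun a b c d => (norm_sub_le _ _).trans (add_le_add (hGc _ _) (hGc _ _))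
    unfold edgeDeriv₂
    rw [norm_mul, norm_mul]
    calc _ ≤ (w + w) * ((w + w) + (w + w)) * (w + w) := by
          gcongr
          · exact h3 _ _ _ _
          · exact (norm_sub_le _ _).trans (add_le_add (h3 _ _ _ _) (h3 _ _ _ _))
          · exact (norm_sub_le _ _).trans (add_le_add (hG _ _) (hG _ _))
      _ = 16 * w ^ 3 := by ring
      _ ≤ w ^ 3 * w ^ 3 := by
        gcongr
        exact hw.trans (le_self_pow₀ hw1 (by norm_num))
      _ = _ := by ring

lemma edgeError_nonneg (m : ℕ) {N : ℕ} {Γ τ B : ℝ} (hΓ : 0 ≤ Γ) (hτ : 0 ≤ τ) (hB : 0 ≤ B)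
    (A : Matrix (Fin (N + 1)) (Fin (N + 1)) ℝ) (z : ℂ) (i k j : Fin (N + 1)) :
    0 ≤ edgeError m Γ τ B A z i k j := by
  have := remainderNorm_nonneg A z
  unfold edgeError
  positivity

/-- The polynomial bound in the crude variable that decoupling requires everywhere, not only on the
good event. -/
lemma edgeError_le (m : ℕ) {N : ℕ} {A : Matrix (Fin (N + 1)) (Fin (N + 1)) ℝ} {z : ℂ}
    {Γ τ B w : ℝ} (hΓ : 0 ≤ Γ) (hτ : 0 ≤ τ) (hB : 0 ≤ B) (hΓw : Γ ≤ w) (hB1 : B ≤ 1)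
    (hτ1 : 4 * Γ * τ ≤ 1) (hτ3 : 64 * Γ ^ 3 * τ ≤ 1) (hw : 16 ≤ w) (hm : 2 * m + 2 ≤ w)
    (hG : ∀ a b, ‖resolvent A z a b‖ ≤ w) (hR : ∀ a b, ‖remainder A z a b‖ ≤ w ^ 4)
    (i k j : Fin (N + 1)) : edgeError m Γ τ B A z i k j ≤ (w ^ 6) ^ (2 * m + 5) := by
  have hw0 : 0 ≤ w := by linarith
  have hU : remainderNorm A z ≤ w ^ 4 := remainderNorm_le (by positivity) hR
  have hU0 := remainderNorm_nonneg A z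
  have hw4 : 1 ≤ w ^ 4 := one_le_pow₀ (by linarith)
  have hw5 : w ≤ w ^ 5 := le_self_pow₀ (by linarith) (by norm_num)
  have hw46 : 16 * w ^ 4 ≤ w ^ 6 := by
    calc 16 * w ^ 4 ≤ w * w ^ 4 * 1 := by nlinarith
      _ ≤ w * w ^ 4 * w := by gcongr; linarith
      _ = _ := by ring
  have hw56 : 16 * w ^ 5 ≤ w ^ 6 := by
    calc 16 * w ^ 5 ≤ w * w ^ 5 := by gcongr
      _ = _ := by ring
  have hw6 : 1 ≤ w ^ 6 := one_le_pow₀ (by linarith)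
  have h1 : ‖resolvent A z k j‖ + B ≤ w ^ 6 := by linarith [hG k j]
  have h2 : ‖resolvent A z k j‖ + B + 4 * Γ * (remainderNorm A z + B) ≤ w ^ 6 := by
    have : 4 * Γ * (remainderNorm A z + B) ≤ 4 * w * (w ^ 4 + w ^ 4) := by
      gcongr; linarith
    have e : 4 * w * (w ^ 4 + w ^ 4) = 8 * w ^ 5 := by ring
    linarith [hG k j]
  have h3 : 2 * ‖remainder A z i j‖ + (B + 4 * Γ * τ * (remainderNorm A z + B)) ≤ w ^ 6 := by
    have : 4 * Γ * τ * (remainderNorm A z + B) ≤ 1 * (w ^ 4 + w ^ 4) := by gcongr; linarith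
    linarith [hR i j]
  have h4 : ‖remainder A z i j‖ ≤ w ^ 6 := by linarith [hR i j]
  unfold edgeError
  calc _ ≤ (2 * m + 1) * w ^ 6 * w ^ 6 * (w ^ 6) ^ (2 * m) + 1 * (w ^ 6) ^ (2 * m + 1) := by
        have h5 : τ * (64 * Γ ^ 3) ≤ 1 := by linarith
        gcongr
    _ ≤ (2 * m + 1) * w ^ 6 * w ^ 6 * (w ^ 6) ^ (2 * m) + w ^ 6 * (w ^ 6) ^ (2 * m + 1) := by
        gcongr
    _ = (2 * m + 2) * (w ^ 6) ^ (2 * m + 2) := by ring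
    _ ≤ w ^ 6 * (w ^ 6) ^ (2 * m + 2) := by
        gcongr
        linarith
    _ = (w ^ 6) ^ (2 * m + 3) := by ring
    _ ≤ _ := pow_le_pow_right₀ hw6 (by omega)

lemma edgeVec_mul_edgeVec_eq_zero {n : ℕ} {i k a b : Fin n} (hab : a ≠ b)
    (h : ¬ ((a = i ∧ b = k) ∨ (a = k ∧ b = i))) : edgeVec i k a * edgeVec i k b = 0 := by
  unfold edgeVec
  split_ifs <;> simp_all

lemma abs_cut_le {n : ℕ} {A : Matrix (Fin n) (Fin n) ℝ} (hA : ∀ i j, A i j = A j i)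
    {i k a b : Fin n} (hik : i ≠ k) (hab : a ≠ b) : |cut A i k a b| ≤ |A a b| := by
  by_cases h : (a = i ∧ b = k) ∨ (a = k ∧ b = i)
  · have : cut A i k a b = 0 := by
      rcases h with ⟨rfl, rfl⟩ | ⟨rfl, rfl⟩
      · simp [cut, edgeVec, hik, hik.symm]
      · simp [cut, edgeVec, hik, hik.symm, hA a b]
    rw [this, abs_zero]
    exact abs_nonneg _
  · rw [cut, edgeVec_mul_edgeVec_eq_zero hab h, mul_zero, add_zero]

end parameters

end LaplacianLocalLaw
end

/-! ### Moments of a single entry of the remainder. -/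

noncomputable section
namespace LaplacianLocalLaw

universe u v w

variable {β : ℝ} {c : ℕ → ℝ} {P : ℕ}

lemma measurable_errorSize {N : ℕ} (Γ τ B : ℝ) (z : ℂ) :
    Measurable fun A : Fin (N + 1) → Fin (N + 1) → ℝ => errorSize Γ τ B (Matrix.of A) z := by
  have h := (measurable_remainderNorm (N := N) z).add_const B
  unfold errorSize
  exact (h.const_mul B).sqrt.add (h.const_mul _)

/-- The constant in the absorbed moment inequality. -/
def momentConst (m : ℕ) : ℝ :=
  ((2 * m + 1) * 44 * 2 ^ (2 * m + 1)) * (2 * ((2 * m + 1) * 44 * 2 ^ (2 * m + 1)) *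
    (1 + 5) ^ (2 * m + 1) + 5) ^ (2 * m + 1)

lemma momentConst_nonneg (m : ℕ) : 0 ≤ momentConst m := by unfold momentConst; positivity

/-- Absorption with constant K Γ. The power of Γ is pulled out of the constant, since Γ grows with N
while `momentConst` must depend on m only. -/
lemma absorb_le (m : ℕ) {x v Γ : ℝ} (hx : 0 ≤ x) (hv : 0 ≤ v) (hΓ : 1 ≤ Γ) :
    ((2 * m + 1) * 44 * 2 ^ (2 * m + 1) * Γ) * v * (x + 5 * v) ^ (2 * m + 1) ≤
      x ^ (2 * m + 2) / 2 + momentConst m * Γ ^ (2 * m + 2) * v ^ (2 * m + 2) := by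
  set K : ℝ := (2 * m + 1) * 44 * 2 ^ (2 * m + 1) with hK
  have hK1 : 1 ≤ K := by
    have h1 : (1 : ℝ) ≤ 2 ^ (2 * m + 1) := one_le_pow₀ (by norm_num)
    have h2 : (0 : ℝ) ≤ m := Nat.cast_nonneg m
    rw [hK]
    have : (44 : ℝ) ≤ (2 * m + 1) * 44 := by linarith
    nlinarith
  have h := mul_add_pow_le hx hv (by nlinarith : 1 ≤ K * Γ) 5 (by norm_num) (2 * m + 1)
  refine h.trans ?_
  have hv' : 0 ≤ v ^ (2 * m + 2) := by positivity
  have h3 : (2 * (K * Γ) * (1 + 5) ^ (2 * m + 1) + 5) ^ (2 * m + 1) ≤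
      (Γ * (2 * K * (1 + 5) ^ (2 * m + 1) + 5)) ^ (2 * m + 1) := by
    refine pow_le_pow_left₀ (by positivity) ?_ _
    nlinarith
  have h4 : K * Γ * (2 * (K * Γ) * (1 + 5) ^ (2 * m + 1) + 5) ^ (2 * m + 1) ≤
      momentConst m * Γ ^ (2 * m + 2) := by
    calc _ ≤ K * Γ * (Γ * (2 * K * (1 + 5) ^ (2 * m + 1) + 5)) ^ (2 * m + 1) := by gcongr
      _ = _ := by rw [mul_pow, momentConst, ← hK]; ring
  have h5 := mul_le_mul_of_nonneg_right h4 hv'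
  exact add_le_add le_rfl h5

/-- Bound for the moments of an entry of the remainder by those of the size of the error. -/
lemma integral_remainder_pow_le (hβ : 0 < β) (hP : P ≠ 0) (hPβ : 40 ≤ β * P)
    {S : Ensemble.{u} β c → Set ℂ}
    (hS : ∀ M, ∀ z ∈ S M, 0 < z.im ∧ scale P M.N ^ 40 ≤ M.N * z.im)
    (hΓ : WHP S (fun M z => {ω | ∀ a b, ‖resolvent (M.H ω) z a b‖ ≤ scale P M.N ^ 2})) (m : ℕ) :
    ∃ N₀ : ℕ, 1 ≤ N₀ ∧ ∀ M : Ensemble.{u} β c, N₀ ≤ M.N → ∀ z ∈ S M,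
      (∀ d : ℕ, Integrable (fun ω => remainderNorm (M.H ω) z ^ d) M.μ) ∧
      Integrable (fun ω => errorSize (scale P M.N ^ 2) (scale P M.N / M.q) (level P M z)
          (M.H ω) z ^ (2 * m + 2)) M.μ ∧
      ∀ i j, ∫ ω, ‖remainder (M.H ω) z i j‖ ^ (2 * m + 2) ∂M.μ ≤
        2 * momentConst m * (scale P M.N ^ 2) ^ (2 * m + 2) *
          ∫ ω, errorSize (scale P M.N ^ 2) (scale P M.N / M.q) (level P M z)
            (M.H ω) z ^ (2 * m + 2) ∂M.μ + 2 * ((M.N : ℝ) ^ (m + 5))⁻¹ := by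
  obtain ⟨N₁, hN11, h1⟩ := (hΓ.inter (whp_abs_H_le.{u, 0} (c := c) hβ hP S)).error_le hβ
    (fun M z _ => measurableSet_goodEvent M z) 6 (2 * m + 5) (m + 5)
  obtain ⟨N₂, -, h2⟩ := eventually_le_scale hP 1000
  refine ⟨max (max N₁ N₂) (2 * m + 16), le_max_of_le_left (le_max_of_le_left hN11),
    fun M hM z hz => ?_⟩
  have hN1 : N₁ ≤ M.N := le_of_max_le_left (le_of_max_le_left hM)
  have hMN : 1 ≤ M.N := hN11.trans hN1
  have hN : (1 : ℝ) ≤ M.N := by exact_mod_cast hMN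
  have hT : 1000 ≤ scale P M.N := h2 _ (le_of_max_le_right (le_of_max_le_left hM))
  have hm16 : (2 * m + 16 : ℝ) ≤ M.N := by exact_mod_cast le_of_max_le_right hM
  obtain ⟨hz0, hNz⟩ := hS M z hz
  have hq := M.one_le_q hβ hMN
  set Γ := scale P M.N ^ 2 with hΓdef
  set τ := scale P M.N / M.q with hτdef
  set B := level P M z with hBdef
  have tame : ∀ ω ∈ goodEvent P M z, Tame (M.H ω) z Γ τ B := fun ω hω =>
    tame_of_mem_goodEvent hβ hP hPβ hMN hT hz0 hNz hω
  have hΓ1 : 1 ≤ Γ := one_le_pow₀ (by linarith)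
  have hτ0 : 0 ≤ τ := by positivity
  have hB0 : 0 < B := level_pos hβ hMN
  have hB1 : B ≤ 1 := level_le_one hP hPβ hMN (by linarith) hNz
  have hTq : scale P M.N ^ 40 ≤ M.q := M.scale_pow_le_q hP (j := 40) (by exact_mod_cast hPβ) hMN
  have hT3 : 64 * Γ ^ 3 * τ ≤ 1 := by
    rw [hΓdef, hτdef, ← mul_div_assoc, div_le_one (by linarith)]
    refine le_trans ?_ hTq
    calc _ = 64 * scale P M.N ^ 7 := by ring
      _ ≤ scale P M.N ^ 33 * scale P M.N ^ 7 := by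
        gcongr
        exact le_trans (by linarith) (le_self_pow₀ (by linarith : 1 ≤ scale P M.N) (by norm_num))
      _ = _ := by ring
  have hT1 : 4 * Γ * τ ≤ 1 := by
    refine le_trans ?_ hT3
    have : Γ ≤ Γ ^ 3 := le_self_pow₀ hΓ1 (by norm_num)
    gcongr
    norm_num
  have hTN : scale P M.N ^ 40 ≤ M.N := by
    refine hTq.trans ((le_self_pow₀ hq (by norm_num)).trans (M.q_sq_le hβ hMN))
  have hΓN : Γ ≤ M.N := (pow_le_pow_right₀ (by linarith) (by norm_num)).trans hTN
  have hzN : 1 / z.im ≤ M.N := by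
    rw [div_le_iff₀ hz0]
    exact le_trans (one_le_pow₀ (by linarith)) hNz
  -- crude bounds
  set W : M.Ω → ℝ := fun ω => M.crude ω ^ 6 with hW
  have hNc : ∀ ω, (M.N : ℝ) ≤ M.crude ω := fun ω => by linarith [M.N_add_one_le_crude ω]
  have hc1 : ∀ ω, 1 ≤ M.crude ω := M.one_le_crude
  have hm0 : (0 : ℝ) ≤ m := Nat.cast_nonneg m
  have hc16 : ∀ ω, 16 ≤ M.crude ω := fun ω => by linarith [hNc ω]
  have hcm : ∀ ω, 2 * m + 2 ≤ M.crude ω := fun ω => by linarith [hNc ω]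
  have hzc : ∀ ω, 1 / z.im ≤ M.crude ω := fun ω => hzN.trans (hNc ω)
  have hW1 : ∀ ω, 1 ≤ W ω := fun ω => one_le_pow₀ (hc1 ω)
  have hcW : ∀ ω, ∀ j ≤ 6, M.crude ω ^ j ≤ W ω := fun ω j hj => pow_le_pow_right₀ (hc1 ω) hj
  have hcs : ∀ ω i k, ∀ a b, cut (M.H ω) i k a b = cut (M.H ω) i k b a := fun ω i k =>
    cut_symm (M.hsymm ω) i k
  have bR : ∀ ω a b, ‖remainder (M.H ω) z a b‖ ≤ M.crude ω ^ 4 := fun ω a b =>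
    norm_remainder_le_crude hMN (M.hsymm ω) hz0 (by linarith [hc16 ω]) (M.N_add_one_le_crude ω)
      (hzc ω) (fun a b hab => M.abs_H_le_crude ω hab) a b
  have bRc : ∀ ω, ∀ i k, i ≠ k → ∀ a b, ‖remainder (cut (M.H ω) i k) z a b‖ ≤ M.crude ω ^ 4 :=
    fun ω i k hik a b =>
    norm_remainder_le_crude hMN (hcs ω i k) hz0 (by linarith [hc16 ω]) (M.N_add_one_le_crude ω)
      (hzc ω) (fun a b hab => (abs_cut_le (M.hsymm ω) hik hab).trans (M.abs_H_le_crude ω hab)) a b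
  have mRN : Measurable fun ω => remainderNorm (M.H ω) z :=
    M.measurable_of_H (g := fun A => remainderNorm A z) (measurable_remainderNorm z)
  have mV : Measurable fun ω => errorSize Γ τ B (M.H ω) z :=
    M.measurable_of_H (g := fun A => errorSize Γ τ B A z) (measurable_errorSize Γ τ B z)
  have bRN : ∀ ω, remainderNorm (M.H ω) z ≤ M.crude ω ^ 4 := fun ω =>
    remainderNorm_le (by have := hc1 ω; positivity) (bR ω)
  have iRN : ∀ d : ℕ, Integrable (fun ω => remainderNorm (M.H ω) z ^ d) M.μ := fun d =>
    integrable_of_norm_le_mul_pow (crude_pow_integrable M 4)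
      (mRN.pow_const d).aestronglyMeasurable 1 d fun ω => by
        have := remainderNorm_nonneg (M.H ω) z
        rw [one_mul, Real.norm_eq_abs, abs_of_nonneg (by positivity)]
        exact pow_le_pow_left₀ this (bRN ω) d
  have nV : ∀ ω, 0 ≤ errorSize Γ τ B (M.H ω) z := fun ω => by
    have := remainderNorm_nonneg (M.H ω) z
    unfold errorSize; positivity
  have bV : ∀ ω, errorSize Γ τ B (M.H ω) z ≤ W ω := fun ω => by
    have h3 := remainderNorm_nonneg (M.H ω) z
    have h4 := bRN ω
    have h5 : √(B * (remainderNorm (M.H ω) z + B)) ≤ remainderNorm (M.H ω) z + B := by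
      refine Real.sqrt_le_iff.2 ⟨by positivity, ?_⟩
      nlinarith
    have h6 : 4 * Γ * τ * (remainderNorm (M.H ω) z + B) ≤ remainderNorm (M.H ω) z + B :=
      mul_le_of_le_one_left (by positivity) hT1
    have h7 : 1 ≤ M.crude ω ^ 4 := one_le_pow₀ (hc1 ω)
    have h8 : 16 * M.crude ω ^ 4 ≤ W ω := by
      calc 16 * M.crude ω ^ 4 ≤ M.crude ω * M.crude ω ^ 4 * 1 := by
            have := hc16 ω; nlinarith
        _ ≤ M.crude ω * M.crude ω ^ 4 * M.crude ω := by
            have := hc1 ω; gcongr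
        _ = _ := by simp only [hW]; ring
    unfold errorSize
    linarith
  have iV : Integrable (fun ω => errorSize Γ τ B (M.H ω) z ^ (2 * m + 2)) M.μ :=
    integrable_of_norm_le_mul_pow (crude_pow_integrable M 6)
      (mV.pow_const _).aestronglyMeasurable 1 (2 * m + 2) fun ω => by
        rw [one_mul, Real.norm_eq_abs, abs_of_nonneg (pow_nonneg (nV ω) _)]
        exact pow_le_pow_left₀ (nV ω) (bV ω) _
  refine ⟨iRN, iV, fun i j => ?_⟩
  have mR : Measurable fun ω => remainder (M.H ω) z i j :=
    M.measurable_of_H (g := fun A => remainder A z i j) (measurable_remainder z i j)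
  have iR : Integrable (fun ω => ‖remainder (M.H ω) z i j‖ ^ (2 * m + 2)) M.μ :=
    integrable_of_norm_le_mul_pow (crude_pow_integrable M 4)
      (mR.norm.pow_const _).aestronglyMeasurable 1 (2 * m + 2) fun ω => by
        rw [one_mul, Real.norm_eq_abs, abs_of_nonneg (by positivity)]
        exact pow_le_pow_left₀ (norm_nonneg _) (bR ω i j) _
  have hne : ∀ k ∈ Finset.univ.erase i, i ≠ k := fun k hk => (Finset.ne_of_mem_erase hk).symm
  have hGc : ∀ ω i k a b, ‖resolvent (cut (M.H ω) i k) z a b‖ ≤ M.crude ω := fun ω i k a b =>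
    (norm_resolvent_le (hcs ω i k) hz0 a b).trans (hzc ω)
  have mG : ∀ a b, Measurable fun ω => resolvent (M.H ω) z a b := fun a b =>
    M.measurable_of_H (g := fun A => resolvent A z a b) (measurable_resolvent z a b)
  have mGc : ∀ k a b, Measurable fun ω => resolvent (cut (M.H ω) i k) z a b := fun k a b =>
    M.measurable_of_cut i k (g := fun A => resolvent A z a b) (measurable_resolvent z a b)
  have hd := fun ω => hc1 ω
  -- The counterterm is m_N G_ij and the coefficient of h_ik is G_kj, expanded around the matrix
  -- without the edge {i, k}. The good event carries the a priori bound on G, and the tame estimates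
  -- are exactly the last two hypotheses.
  have main := integral_norm_pow_le_of_decoupling (μ := M.μ) (Finset.univ.erase i) m (2 * m + 5)
    le_rfl (σ2 := 1 / (M.N : ℝ)) (by positivity)
    (Z := fun ω => remainder (M.H ω) z i j) (D := fun ω => mN (M.H ω) z * resolvent (M.H ω) z i j)
    (h := fun k ω => M.H ω i k)
    (A := fun k ω => resolvent (M.H ω) z k j)
    (A₀ := fun k ω => resolvent (cut (M.H ω) i k) z k j)
    (A' := fun k ω => edgeDeriv (M.H ω) z i k j)
    (A'₀ := fun k ω => edgeDeriv (cut (M.H ω) i k) z i k j)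
    (A'' := fun k ω => edgeDeriv₂ (M.H ω) z i k j)
    (Z₀ := fun k ω => remainder (cut (M.H ω) i k) z i j)
    (Y₀ := fun k ω => edgeError m Γ τ B (cut (M.H ω) i k) z i k j) (W := W)
    (F := fun ω => ‖remainder (M.H ω) z i j‖ ^ (2 * m + 2) / 2 +
      momentConst m * Γ ^ (2 * m + 2) * errorSize Γ τ B (M.H ω) z ^ (2 * m + 2))
    (Θ := goodEvent P M z)
    (fun ω => remainder_eq_sum (M.hsymm ω) hz0 i j)
    (fun k hk ω => resolvent_eq_edge_expansion (M.hsymm ω) hz0 i k j)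
    (fun k hk => M.indepFun_of_cut (hne k hk) (g := fun A => (resolvent A z k j,
      edgeDeriv A z i k j, remainder A z i j, edgeError m Γ τ B A z i k j))
      ((measurable_resolvent z k j).prodMk ((measurable_edgeDeriv z i k j).prodMk
        ((measurable_remainder z i j).prodMk (measurable_edgeError m Γ τ B z i k j)))))
    (fun k hk => M.mean_zero (hne k hk)) (fun k hk => M.model.variance_eq _ _ (hne k hk))
    mR ((M.measurable_of_H (g := fun A => mN A z) (measurable_mN z)).mul (mG i j))
    (fun k _ => M.model.measurable _ _) (fun k _ => mGc k k j)
    (fun k _ => M.measurable_of_H (g := fun A => edgeDeriv A z i k j) (measurable_edgeDeriv z i k j))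
    (fun k _ => M.measurable_of_cut i k (g := fun A => edgeDeriv A z i k j)
      (measurable_edgeDeriv z i k j))
    (fun k _ => by
      unfold edgeDeriv₂
      exact (((mGc k k i).sub (mGc k k k)).mul (((mGc k i i).sub (mGc k i k)).sub
        ((mGc k k i).sub (mGc k k k)))).mul ((mG i j).sub (mG k j)))
    (fun k _ => M.measurable_of_cut i k (g := fun A => remainder A z i j)
      (measurable_remainder z i j))
    (fun k _ => M.measurable_of_cut i k (g := fun A => edgeError m Γ τ B A z i k j)
      (measurable_edgeError m Γ τ B z i k j))
    (measurableSet_goodEvent M z) hW1 (crude_pow_integrable M 6)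
    (fun ω => (bR ω i j).trans (hcW ω 4 (by norm_num)))
    (fun ω => by
      have hG : ∀ a b, ‖resolvent (M.H ω) z a b‖ ≤ M.crude ω := fun a b =>
        (norm_resolvent_le (M.hsymm ω) hz0 a b).trans (hzc ω)
      have h3 := norm_mN_le hMN fun a => hG a a
      have h4 := hc16 ω
      rw [norm_mul]
      calc _ ≤ 2 * M.crude ω * M.crude ω := by gcongr; exact hG i j
        _ ≤ M.crude ω * M.crude ω * M.crude ω := by gcongr; linarith
        _ = M.crude ω ^ 3 := by ring
        _ ≤ _ := hcW ω 3 (by norm_num))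
    (fun k hk ω => (M.abs_H_le_crude ω (hne k hk)).trans
      ((pow_one (M.crude ω)).symm.le.trans (hcW ω 1 (by norm_num))))
    (fun k _ ω => (crude_bounds (M.hsymm ω) hz0 (hc16 ω) (hzc ω) i k j).1)
    (fun k _ ω => (crude_bounds (hcs ω i k) hz0 (hc16 ω) (hzc ω) i k j).1)
    (fun k _ ω => (crude_bounds (M.hsymm ω) hz0 (hc16 ω) (hzc ω) i k j).2.1)
    (fun k _ ω => (crude_bounds (hcs ω i k) hz0 (hc16 ω) (hzc ω) i k j).2.1)
    (fun k _ ω => (crude_bounds (M.hsymm ω) hz0 (hc16 ω) (hzc ω) i k j).2.2)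
    (fun k hk ω => (bRc ω i k (hne k hk) i j).trans (hcW ω 4 (by norm_num)))
    (fun k _ ω => edgeError_nonneg m (by linarith) hτ0 hB0.le _ _ _ _ _)
    (fun k hk ω => edgeError_le m (by linarith) hτ0 hB0.le (hΓN.trans (hNc ω)) hB1 hT1 hT3
      (hc16 ω) (hcm ω) (hGc ω i k) (bRc ω i k (hne k hk)) i k j)
    ((iR.div_const 2).add (iV.const_mul _))
    (fun ω => by
      have := nV ω
      have := momentConst_nonneg m
      positivity)
    (fun ω hω k hk => (tame ω hω).error_le_edgeError m (hne k hk) j)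
    (fun ω hω => ((tame ω hω).drift_add_sum_le m i j).trans
      (absorb_le m (norm_nonneg _) (nV ω) hΓ1))
  have h10 := h1 M hN1 z hz (Finset.univ.erase i).card (by
    simp only [Finset.card_erase_of_mem (Finset.mem_univ _), Finset.card_univ, Fintype.card_fin]
    rw [Nat.add_sub_cancel]
    nlinarith)
  rw [integral_add (iR.div_const 2) (iV.const_mul _), integral_div, integral_const_mul] at main
  have h12 := main.trans (add_le_add_right h10 _)
  linarith

end LaplacianLocalLaw
end

/-! ### Closing the recursion for the largest entry of the remainder. -/

noncomputable section
namespace LaplacianLocalLaw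

universe u v w

variable {β : ℝ} {c : ℕ → ℝ} {P : ℕ}

/-- Replacing the maximum by a sum loses a factor (N + 1)² in every moment, which disappears when
the order of the moment is large compared with P. -/
lemma remainderNorm_pow_le {N : ℕ} (A : Matrix (Fin (N + 1)) (Fin (N + 1)) ℝ) (z : ℂ) (p : ℕ) :
    remainderNorm A z ^ p ≤ ∑ i, ∑ j, ‖remainder A z i j‖ ^ p := by
  obtain ⟨⟨i, j⟩, h0⟩ := Finite.exists_max
    (fun p : Fin (N + 1) × Fin (N + 1) => ‖remainder A z p.1 p.2‖)
  have h1 : remainderNorm A z ≤ ‖remainder A z i j‖ :=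
    remainderNorm_le (norm_nonneg _) fun a b => h0 (a, b)
  calc _ ≤ ‖remainder A z i j‖ ^ p := pow_le_pow_left₀ (remainderNorm_nonneg _ _) h1 p
    _ ≤ ∑ j, ‖remainder A z i j‖ ^ p := Finset.single_le_sum
      (f := fun j => ‖remainder A z i j‖ ^ p) (fun j _ => by positivity) (Finset.mem_univ j)
    _ ≤ _ := Finset.single_le_sum
      (f := fun i => ∑ j, ‖remainder A z i j‖ ^ p) (fun i _ => by positivity) (Finset.mem_univ i)

/-- The part √(B U) enters with half the power of U, so the arithmetic-geometric inequality trades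
it for a quarter of U^(2m+2) and a multiple of B^(2m+2). The part linear in U has a small factor κ
and takes another quarter. -/
lemma errorSize_pow_le {B U κ a : ℝ} (hB : 0 ≤ B) (hU : 0 ≤ U) (hκ : 0 ≤ κ) (ha : 0 ≤ a) (m : ℕ)
    (haκ : a * 2 ^ (2 * m + 2) * κ ^ (2 * m + 2) ≤ 1 / 4) :
    a * (√(B * U) + κ * U) ^ (2 * m + 2) ≤
      U ^ (2 * m + 2) / 2 + (a * 2 ^ (2 * m + 2)) ^ 2 * B ^ (2 * m + 2) := by
  have h1 := add_pow_le (Real.sqrt_nonneg (B * U)) (mul_nonneg hκ hU) (2 * m + 2)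
  have e : √(B * U) ^ (2 * m + 2) = B ^ (m + 1) * U ^ (m + 1) := by
    rw [show 2 * m + 2 = 2 * (m + 1) by ring, pow_mul, Real.sq_sqrt (by positivity), mul_pow]
  have h2 : (2 : ℝ) ^ (2 * m + 2 - 1) ≤ 2 ^ (2 * m + 2) :=
    pow_le_pow_right₀ (by norm_num) (by omega)
  rw [e, mul_pow] at h1
  set b := a * 2 ^ (2 * m + 2) with hb
  have hUU : U ^ (2 * m + 2) = (U ^ (m + 1)) ^ 2 := by rw [← pow_mul]; ring
  have hBB : B ^ (2 * m + 2) = (B ^ (m + 1)) ^ 2 := by rw [← pow_mul]; ring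
  have hU2 : 0 ≤ U ^ (2 * m + 2) := by positivity
  calc _ ≤ a * (2 ^ (2 * m + 2) * (B ^ (m + 1) * U ^ (m + 1) + κ ^ (2 * m + 2) *
        U ^ (2 * m + 2))) := by
        gcongr
        refine h1.trans ?_
        gcongr
    _ = (b * B ^ (m + 1)) * U ^ (m + 1) + (b * κ ^ (2 * m + 2)) * U ^ (2 * m + 2) := by
        rw [hb]; ring
    _ ≤ (U ^ (2 * m + 2) / 4 + b ^ 2 * B ^ (2 * m + 2)) + 1 / 4 * U ^ (2 * m + 2) := by
        gcongr
        rw [hUU, hBB]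
        nlinarith [sq_nonneg (U ^ (m + 1) / 2 - b * B ^ (m + 1))]
    _ = _ := by ring

/-- The entries of the remainder are small as soon as the resolvent is bounded by a small power
of `N`. -/
theorem whp_remainderNorm_le (hβ : 0 < β) (hP : P ≠ 0) (hPβ : 40 ≤ β * P)
    {S : Ensemble.{u} β c → Set ℂ}
    (hS : ∀ M, ∀ z ∈ S M, 0 < z.im ∧ scale P M.N ^ 40 ≤ M.N * z.im)
    (hΓ : WHP S (fun M z => {ω | ∀ a b, ‖resolvent (M.H ω) z a b‖ ≤ scale P M.N ^ 2})) :
    WHP S (fun M z => {ω | remainderNorm (M.H ω) z ≤ scale P M.N ^ 15 * Psi M.N M.q z}) := by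
  have key : WHP S (fun M z => {ω | remainderNorm (M.H ω) z + level P M z ≤
      scale P M.N * ((scale P M.N ^ 2) ^ 2 * level P M z)}) := by
    -- The constant a of the recursion enters squared in front of the power of B. It contains Γ to
    -- the order of the moment, giving the factor Γ² in the bound, and N², giving N⁴ = T^(4P), a
    -- loss independent of the order.
    refine WHP.of_moments hP (fun M z ω => remainderNorm (M.H ω) z + level P M z)
      (fun M z => (scale P M.N ^ 2) ^ 2 * level P M z) (4 * P) ?_ ?_ fun r => ?_
    · intro M z _ ω
      have h1 := remainderNorm_nonneg (M.H ω) z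
      have h2 : 0 ≤ scale P M.N := by unfold scale; positivity
      have h3 : 0 ≤ M.q := (Real.rpow_nonneg (Nat.cast_nonneg _) _).trans M.model.le_q
      have : 0 ≤ level P M z := by rw [level, Psi_eq]; positivity
      positivity
    · refine ⟨1, fun M hM z _ => ?_⟩
      have h1 := level_pos (P := P) hβ hM (z := z)
      have h2 := one_le_scale P hM
      positivity
    -- Orders above P ensure that T^(2P+1), coming from N² and one constant, is beaten by T^(2m+2).
    · set m := r + P with hm
      obtain ⟨N₁, hN11, h1⟩ := integral_remainder_pow_le hβ hP hPβ hS hΓ m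
      set C₁ : ℝ := 8 * 2 ^ (2 * m + 2) * momentConst m with hC₁
      have hC₁0 : 0 ≤ C₁ := by have := momentConst_nonneg m; positivity
      obtain ⟨N₂, -, h2⟩ := eventually_le_scale hP (max 4 (4 * (C₁ * 2 ^ (2 * m + 2))))
      refine ⟨2 * (9 * 2 ^ (2 * m + 2) + (C₁ * 2 ^ (2 * m + 2)) ^ 2), 2 * m + 2, max N₁ N₂,
        by omega, fun M hM z hz => ?_⟩
      have hN1 : N₁ ≤ M.N := le_of_max_le_left hM
      have hMN : 1 ≤ M.N := hN11.trans hN1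
      have hN : (1 : ℝ) ≤ M.N := by exact_mod_cast hMN
      have hT := h2 _ (le_of_max_le_right hM)
      have hT4 := (le_max_left _ _).trans hT
      have hTC := (le_max_right _ _).trans hT
      obtain ⟨i1, i2, h3⟩ := h1 M hN1 z hz
      have hq := M.one_le_q hβ hMN
      have hTq : scale P M.N ^ 40 ≤ M.q :=
        M.scale_pow_le_q hP (j := 40) (by exact_mod_cast hPβ) hMN
      have hB0 : 0 < level P M z := level_pos hβ hMN
      have hBq : 1 / M.q ≤ level P M z := by
        rw [level, Psi_eq]
        calc 1 / M.q = 1 * (1 / M.q + 0) := by ring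
          _ ≤ _ := by
            gcongr
            · exact one_le_pow₀ (by linarith)
            · positivity
      have hTP : scale P M.N ^ P = M.N := scale_pow hP _
      set T := scale P M.N with hTdef
      set B := level P M z with hB
      have hBN : ((M.N : ℝ) ^ (m + 1))⁻¹ ≤ B ^ (2 * m + 2) := by
        calc ((M.N : ℝ) ^ (m + 1))⁻¹ ≤ ((M.q ^ 2) ^ (m + 1))⁻¹ := by
              have := M.q_sq_le hβ hMN
              gcongr
          _ = (1 / M.q) ^ (2 * m + 2) := by
              rw [← pow_mul, one_div, inv_pow]; ring
          _ ≤ _ := by gcongr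
      have e : ∀ ω, (remainderNorm (M.H ω) z + B) ^ (2 * m + 2) ≤ 2 ^ (2 * m + 2) *
          (∑ i, ∑ j, ‖remainder (M.H ω) z i j‖ ^ (2 * m + 2) + B ^ (2 * m + 2)) := fun ω => by
        refine (add_pow_le (remainderNorm_nonneg _ _) hB0.le _).trans ?_
        have h4 := remainderNorm_pow_le (M.H ω) z (2 * m + 2)
        have h5 : (2 : ℝ) ^ (2 * m + 2 - 1) ≤ 2 ^ (2 * m + 2) :=
          pow_le_pow_right₀ (by norm_num) (by omega)
        have := remainderNorm_nonneg (M.H ω) z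
        gcongr
      have iRij : ∀ i j, Integrable (fun ω => ‖remainder (M.H ω) z i j‖ ^ (2 * m + 2)) M.μ :=
        fun i j => (i1 (2 * m + 2)).mono'
          ((M.measurable_of_H (g := fun A => remainder A z i j)
            (measurable_remainder z i j)).norm.pow_const _).aestronglyMeasurable
          (Filter.Eventually.of_forall fun ω => by
            rw [Real.norm_eq_abs, abs_of_nonneg (by positivity)]
            exact pow_le_pow_left₀ (norm_nonneg _) (norm_remainder_le _ _ _ _) _)
      have iSum : Integrable (fun ω => ∑ i, ∑ j, ‖remainder (M.H ω) z i j‖ ^ (2 * m + 2)) M.μ :=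
        integrable_finsetSum _ fun i _ => integrable_finsetSum _ fun j _ => iRij i j
      have iSumB : Integrable (fun ω => 2 ^ (2 * m + 2) *
          (∑ i, ∑ j, ‖remainder (M.H ω) z i j‖ ^ (2 * m + 2) + B ^ (2 * m + 2))) M.μ :=
        (iSum.add (integrable_const (B ^ (2 * m + 2)))).const_mul _
      have iU : Integrable (fun ω => (remainderNorm (M.H ω) z + B) ^ (2 * m + 2)) M.μ := by
        refine iSumB.mono' ?_ (Filter.Eventually.of_forall fun ω => ?_)
        · exact (((M.measurable_of_H (g := fun A => remainderNorm A z)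
            (measurable_remainderNorm z)).add_const B).pow_const _).aestronglyMeasurable
        · have := remainderNorm_nonneg (M.H ω) z
          rw [Real.norm_eq_abs, abs_of_nonneg (by positivity)]
          exact e ω
      refine ⟨iU, ?_⟩
      have h4 : ∫ ω, (remainderNorm (M.H ω) z + B) ^ (2 * m + 2) ∂M.μ ≤ 2 ^ (2 * m + 2) *
          (∑ i, ∑ j, ∫ ω, ‖remainder (M.H ω) z i j‖ ^ (2 * m + 2) ∂M.μ + B ^ (2 * m + 2)) := by
        refine (integral_mono iU iSumB e).trans ?_
        rw [integral_const_mul, integral_add iSum (integrable_const _), integral_finsetSum _ fun i _ =>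
          integrable_finsetSum _ fun j _ => iRij i j]
        simp_rw [integral_finsetSum _ fun j _ => iRij _ j]
        simp
      set EV := ∫ ω, errorSize (T ^ 2) (T / M.q) B (M.H ω) z ^ (2 * m + 2) ∂M.μ with hEV
      set EU := ∫ ω, (remainderNorm (M.H ω) z + B) ^ (2 * m + 2) ∂M.μ with hEU
      have hEV0 : 0 ≤ EV := integral_nonneg fun ω => by
        have : errorSize (T ^ 2) (T / M.q) B (M.H ω) z ^ (2 * m + 2) =
          (errorSize (T ^ 2) (T / M.q) B (M.H ω) z ^ 2) ^ (m + 1) := by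
          rw [← pow_mul]; ring
        simp only [Pi.zero_apply, this]
        positivity
      have h5 : ∑ i, ∑ j, ∫ ω, ‖remainder (M.H ω) z i j‖ ^ (2 * m + 2) ∂M.μ ≤
          (M.N + 1) ^ 2 * (2 * momentConst m * (T ^ 2) ^ (2 * m + 2) * EV +
            2 * ((M.N : ℝ) ^ (m + 5))⁻¹) := by
        refine (Finset.sum_le_sum fun i _ => Finset.sum_le_sum fun j _ => h3 i j).trans ?_
        simp only [Finset.sum_const, Finset.card_univ, Fintype.card_fin, nsmul_eq_mul]
        push_cast
        exact le_of_eq (by ring)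
      have hN4 : ((M.N : ℝ) + 1) ^ 2 ≤ 4 * M.N ^ 2 := by nlinarith
      have h6 : ((M.N : ℝ) + 1) ^ 2 * (2 * ((M.N : ℝ) ^ (m + 5))⁻¹) ≤ 8 * B ^ (2 * m + 2) := by
        calc _ ≤ 4 * (M.N : ℝ) ^ 2 * (2 * ((M.N : ℝ) ^ (m + 5))⁻¹) := by gcongr
          _ = 8 * ((M.N : ℝ) ^ (m + 3))⁻¹ := by
            have : (M.N : ℝ) ≠ 0 := by positivity
            field_simp
            ring
          _ ≤ 8 * ((M.N : ℝ) ^ (m + 1))⁻¹ := by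
            have := pow_le_pow_right₀ hN (show m + 1 ≤ m + 3 by omega)
            gcongr
          _ ≤ _ := by gcongr
      set a := C₁ * M.N ^ 2 * (T ^ 2) ^ (2 * m + 2) with ha
      have ha0 : 0 ≤ a := by positivity
      have h7 : EU ≤ a * EV + 9 * 2 ^ (2 * m + 2) * B ^ (2 * m + 2) := by
        have hmc := momentConst_nonneg m
        calc EU ≤ 2 ^ (2 * m + 2) * ((M.N + 1) ^ 2 * (2 * momentConst m *
              (T ^ 2) ^ (2 * m + 2) * EV + 2 * ((M.N : ℝ) ^ (m + 5))⁻¹) + B ^ (2 * m + 2)) := by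
              refine h4.trans ?_
              gcongr
          _ = 2 ^ (2 * m + 2) * ((M.N + 1) ^ 2 * (2 * momentConst m *
              (T ^ 2) ^ (2 * m + 2) * EV)) + 2 ^ (2 * m + 2) * ((M.N + 1) ^ 2 *
                (2 * ((M.N : ℝ) ^ (m + 5))⁻¹) + B ^ (2 * m + 2)) := by ring
          _ ≤ 2 ^ (2 * m + 2) * (4 * M.N ^ 2 * (2 * momentConst m *
              (T ^ 2) ^ (2 * m + 2) * EV)) + 2 ^ (2 * m + 2) * (8 * B ^ (2 * m + 2) +
              B ^ (2 * m + 2)) := by gcongr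
          _ = _ := by rw [ha, hC₁]; ring
      have hκ : a * 2 ^ (2 * m + 2) * (4 * T ^ 2 * (T / M.q)) ^ (2 * m + 2) ≤ 1 / 4 := by
        -- One factor T² is the Γ of the recursion, the rest is κ = 4 Γ τ. Their product is below 1
        -- / T because q is at least T^40.
        have hs : T ^ 2 * (4 * T ^ 2 * (T / M.q)) ≤ 1 / T := by
          rw [show T ^ 2 * (4 * T ^ 2 * (T / M.q)) = 4 * T ^ 5 / M.q by ring,
            div_le_div_iff₀ (by linarith) (by linarith)]
          calc 4 * T ^ 5 * T ≤ T * T ^ 5 * T := by gcongr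
            _ = T ^ 7 := by ring
            _ ≤ T ^ 40 := pow_le_pow_right₀ (by linarith) (by norm_num)
            _ ≤ 1 * M.q := by linarith
        have hT0 : 0 < T := by linarith
        calc _ = C₁ * 2 ^ (2 * m + 2) * M.N ^ 2 *
              (T ^ 2 * (4 * T ^ 2 * (T / M.q))) ^ (2 * m + 2) := by rw [ha, mul_pow (T ^ 2)]; ring
          _ ≤ C₁ * 2 ^ (2 * m + 2) * M.N ^ 2 * (1 / T) ^ (2 * m + 2) := by gcongr
          _ ≤ T / 4 * M.N ^ 2 * (1 / T) ^ (2 * m + 2) := by gcongr; linarith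
          _ = 1 / 4 * (T ^ (2 * P + 1) / T ^ (2 * m + 2)) := by
            rw [← hTP, one_div_pow]
            ring
          _ ≤ 1 / 4 * 1 := by
            gcongr
            rw [div_le_one (by positivity)]
            exact pow_le_pow_right₀ (by linarith) (by omega)
          _ = _ := by ring
      have h8 : a * EV ≤ EU / 2 + (a * 2 ^ (2 * m + 2)) ^ 2 * B ^ (2 * m + 2) := by
        rw [hEV, hEU, ← integral_const_mul, ← integral_div]
        have : ∫ ω, (remainderNorm (M.H ω) z + B) ^ (2 * m + 2) / 2 ∂M.μ +
            (a * 2 ^ (2 * m + 2)) ^ 2 * B ^ (2 * m + 2) =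
            ∫ ω, ((remainderNorm (M.H ω) z + B) ^ (2 * m + 2) / 2 +
            (a * 2 ^ (2 * m + 2)) ^ 2 * B ^ (2 * m + 2)) ∂M.μ := by
          rw [integral_add (iU.div_const 2) (integrable_const _)]
          simp
        rw [this]
        refine integral_mono (i2.const_mul _) ((iU.div_const 2).add (integrable_const _))
          fun ω => ?_
        have := remainderNorm_nonneg (M.H ω) z
        exact errorSize_pow_le hB0.le (by positivity) (by positivity) ha0 m hκ
      have h9 : EU ≤ 2 * (9 * 2 ^ (2 * m + 2) + (a * 2 ^ (2 * m + 2)) ^ 2) * B ^ (2 * m + 2) := by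
        linarith
      refine h9.trans ?_
      have hT1 : 1 ≤ T ^ (4 * P) * ((T ^ 2) ^ 2) ^ (2 * m + 2) := by
        have h1 : 1 ≤ T ^ (4 * P) := one_le_pow₀ (by linarith)
        have h2 : 1 ≤ ((T ^ 2) ^ 2) ^ (2 * m + 2) := one_le_pow₀ (one_le_pow₀ (one_le_pow₀ (by linarith)))
        nlinarith
      have e2 : (a * 2 ^ (2 * m + 2)) ^ 2 = (C₁ * 2 ^ (2 * m + 2)) ^ 2 *
          (T ^ (4 * P) * ((T ^ 2) ^ 2) ^ (2 * m + 2)) := by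
        rw [ha, ← hTP]; ring
      rw [e2, mul_pow ((T ^ 2) ^ 2)]
      calc _ ≤ 2 * (9 * 2 ^ (2 * m + 2) * (T ^ (4 * P) * ((T ^ 2) ^ 2) ^ (2 * m + 2)) +
            (C₁ * 2 ^ (2 * m + 2)) ^ 2 *
          (T ^ (4 * P) * ((T ^ 2) ^ 2) ^ (2 * m + 2))) * B ^ (2 * m + 2) := by
            have := le_mul_of_one_le_right (by positivity : (0 : ℝ) ≤ 9 * 2 ^ (2 * m + 2)) hT1
            gcongr
        _ = _ := by ring
  refine key.mono (fun M z => z) ⟨1, fun M hM z hz => ⟨hz, fun ω hω => ?_⟩⟩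
  have h1 := level_pos (P := P) hβ hM (z := z)
  have h2 : remainderNorm (M.H ω) z + level P M z ≤
      scale P M.N * ((scale P M.N ^ 2) ^ 2 * level P M z) := hω
  have h3 : scale P M.N * ((scale P M.N ^ 2) ^ 2 * level P M z) =
      scale P M.N ^ 15 * Psi M.N M.q z := by rw [level]; ring
  rw [h3] at h2
  exact le_trans (by linarith) h2

end LaplacianLocalLaw
end

noncomputable section
namespace LaplacianLocalLaw

universe u v w

variable {β : ℝ} {c : ℕ → ℝ} {P : ℕ}

/-! ### The solution of Stein's equation for the Stieltjes transform -/

/-- The Fourier kernel of the standard Gaussian law at complex frequency `w`. -/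
def gaussKernel (w : ℂ) (s : ℝ) : ℂ := Complex.exp (-(s : ℂ) ^ 2 / 2 + Complex.I * s * w)

lemma measurable_gaussKernel (w : ℂ) : Measurable (gaussKernel w) := by
  unfold gaussKernel; fun_prop

lemma norm_gaussKernel_le {w : ℂ} (hw : 0 < w.im) {s : ℝ} (hs : 0 < s) :
    ‖gaussKernel w s‖ ≤ Real.exp (-(1 / 2) * s ^ 2) := by
  rw [gaussKernel, Complex.norm_exp]
  have h1 : (-(s : ℂ) ^ 2 / 2 + Complex.I * s * w).re = -s ^ 2 / 2 - s * w.im := by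
    rw [show -(s : ℂ) ^ 2 / 2 = ((-s ^ 2 / 2 : ℝ) : ℂ) by push_cast; ring]
    have h2 : (Complex.I * s * w).re = -(s * w.im) := by simp
    rw [Complex.add_re, Complex.ofReal_re, h2]
    ring
  rw [h1]
  refine Real.exp_le_exp.2 ?_
  have := mul_pos hs hw
  linarith

/-- The mass of the standard Gaussian kernel on the half line. -/
def halfMass : ℝ := ∫ s in Set.Ioi (0 : ℝ), Real.exp (-(1 / 2) * s ^ 2)

lemma halfMass_nonneg : 0 ≤ halfMass := integral_nonneg fun _ => (Real.exp_pos _).le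

lemma integrable_gaussKernel_mul {w : ℂ} (hw : 0 < w.im) {g : ℝ → ℂ} (hg : Measurable g) {C : ℝ}
    (hC : ∀ s, 0 < s → ‖g s‖ ≤ C) :
    IntegrableOn (fun s => gaussKernel w s * g s) (Set.Ioi 0) := by
  have h0 : IntegrableOn (fun s : ℝ => Real.exp (-(1 / 2) * s ^ 2) * C) (Set.Ioi 0) :=
    ((integrable_exp_neg_mul_sq (by norm_num)).integrableOn).mul_const C
  refine Integrable.mono' h0 ((measurable_gaussKernel w).mul hg).aestronglyMeasurable ?_
  refine (ae_restrict_iff' measurableSet_Ioi).2 (Filter.Eventually.of_forall fun s hs => ?_)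
  rw [norm_mul]
  exact mul_le_mul (norm_gaussKernel_le hw hs) (hC s hs) (norm_nonneg _) (Real.exp_pos _).le

lemma norm_integral_gaussKernel_mul_le {w : ℂ} (hw : 0 < w.im) {g : ℝ → ℂ} {C : ℝ}
    (hC : ∀ s, 0 < s → ‖g s‖ ≤ C) :
    ‖∫ s in Set.Ioi (0 : ℝ), gaussKernel w s * g s‖ ≤ C * halfMass := by
  have h0 : IntegrableOn (fun s : ℝ => Real.exp (-(1 / 2) * s ^ 2) * C) (Set.Ioi 0) :=
    ((integrable_exp_neg_mul_sq (by norm_num)).integrableOn).mul_const C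
  refine (norm_integral_le_of_norm_le h0 ?_).trans ?_
  · refine (ae_restrict_iff' measurableSet_Ioi).2 (Filter.Eventually.of_forall fun s hs => ?_)
    rw [norm_mul]
    exact mul_le_mul (norm_gaussKernel_le hw hs) (hC s hs) (norm_nonneg _) (Real.exp_pos _).le
  · rw [integral_mul_const, mul_comm]; rfl

/-- The Cauchy kernel `1 / (x - w - i s)`. -/
def cauchyKernel (w : ℂ) (x s : ℝ) : ℂ := 1 / ((x : ℂ) - w - Complex.I * s)

lemma cauchyKernel_eq (w : ℂ) (x s : ℝ) :
    cauchyKernel w x s = 1 / ((x : ℂ) - (w + Complex.I * s)) := by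
  rw [cauchyKernel, sub_sub]

lemma norm_cauchyKernel_le {w : ℂ} {b : ℝ} (hb : 0 < b) (hw : b ≤ w.im) (x : ℝ) {s : ℝ}
    (hs : 0 ≤ s) : ‖cauchyKernel w x s‖ ≤ 1 / b := by
  rw [cauchyKernel_eq]
  have h1 : b ≤ (w + Complex.I * s).im := by simp; linarith
  exact (norm_inv_sub_le (hb.trans_le h1) x).trans (one_div_le_one_div_of_le hb h1)

lemma cauchyKernel_denom_ne {w : ℂ} (hw : 0 < w.im) (x : ℝ) {s : ℝ} (hs : 0 ≤ s) :
    (x : ℂ) - w - Complex.I * s ≠ 0 := by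
  rw [sub_sub]
  exact sub_ne_zero_of_im_pos (by simp; linarith) x

lemma cauchyKernel_add_sub {w : ℂ} (hw : 0 < w.im) (x h : ℝ) {s : ℝ} (hs : 0 ≤ s) :
    cauchyKernel w (x + h) s - cauchyKernel w x s =
      -(h * (cauchyKernel w x s * cauchyKernel w (x + h) s)) := by
  have h1 := cauchyKernel_denom_ne hw x hs
  have h2 := cauchyKernel_denom_ne hw (x + h) hs
  unfold cauchyKernel
  push_cast at h2 ⊢
  field_simp
  ring

lemma measurable_cauchyKernel (w : ℂ) (x : ℝ) : Measurable (cauchyKernel w x) := by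
  unfold cauchyKernel; fun_prop

/-- The solution of Stein's equation with right-hand side `1 / (x - w)`, and its derivative. -/
def steinSolution (w : ℂ) : (ℝ → ℂ) × (ℝ → ℂ) :=
  (fun x => ∫ s in Set.Ioi (0 : ℝ), gaussKernel w s * (Complex.I * cauchyKernel w x s),
   fun x => ∫ s in Set.Ioi (0 : ℝ), gaussKernel w s * (-Complex.I * cauchyKernel w x s ^ 2))

lemma measurable_integral_gaussKernel_mul (w : ℂ) {g : ℝ → ℝ → ℂ}
    (hg : Measurable (Function.uncurry g)) :
    Measurable fun x => ∫ s in Set.Ioi (0 : ℝ), gaussKernel w s * g x s := by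
  have h : StronglyMeasurable fun p : ℝ × ℝ => gaussKernel w p.2 * g p.1 p.2 :=
    (((measurable_gaussKernel w).comp measurable_snd).mul hg).stronglyMeasurable
  exact (h.integral_prod_right' (ν := volume.restrict (Set.Ioi (0 : ℝ)))).measurable

lemma measurable_cauchyKernel_uncurry (w : ℂ) :
    Measurable (Function.uncurry (cauchyKernel w)) := by
  unfold cauchyKernel Function.uncurry; fun_prop

/-- Each derivative in x produces another Cauchy kernel, and all of them are at most 1 / b because s
≥ 0 only pushes the pole further up. Hence the solution and its derivatives are bounded, uniformly
in w with Im w ≥ b, and the growth exponent is 0. -/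
lemma steinTest_steinSolution {w : ℂ} {b : ℝ} (hb : 0 < b) (hw : b ≤ w.im) :
    SteinTest ((1 / b + (1 / b) ^ 2 + 2 * (1 / b) ^ 3) * halfMass) 0 (steinSolution w) := by
  have hw0 := hb.trans_le hw
  have hJ := halfMass_nonneg
  set r := 1 / b with hr
  have hr0 : 0 ≤ r := by positivity
  have hk : ∀ x s : ℝ, 0 < s → ‖cauchyKernel w x s‖ ≤ r := fun x s hs =>
    norm_cauchyKernel_le hb hw x hs.le
  have hk2 : ∀ x s : ℝ, 0 < s → ‖cauchyKernel w x s ^ 2‖ ≤ r ^ 2 := fun x s hs => by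
    rw [norm_pow]; exact pow_le_pow_left₀ (norm_nonneg _) (hk x s hs) 2
  have i1 : ∀ x, IntegrableOn (fun s => gaussKernel w s * (Complex.I * cauchyKernel w x s))
      (Set.Ioi 0) := fun x => integrable_gaussKernel_mul hw0
        ((measurable_cauchyKernel w x).const_mul _) (C := r) fun s hs => by
          simpa using hk x s hs
  have i2 : ∀ x, IntegrableOn (fun s => gaussKernel w s * (-Complex.I * cauchyKernel w x s ^ 2))
      (Set.Ioi 0) := fun x => integrable_gaussKernel_mul hw0
        (((measurable_cauchyKernel w x).pow_const 2).const_mul _) (C := r ^ 2) fun s hs => by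
          simpa using hk2 x s hs
  refine ⟨?_, ?_, fun x => ?_, fun x => ?_, fun x h => ?_, fun x h => ?_⟩
  · exact measurable_integral_gaussKernel_mul w
      (g := fun x s => Complex.I * cauchyKernel w x s)
      ((measurable_cauchyKernel_uncurry w).const_mul _)
  · exact measurable_integral_gaussKernel_mul w
      (g := fun x s => -Complex.I * cauchyKernel w x s ^ 2)
      (((measurable_cauchyKernel_uncurry w).pow_const 2).const_mul _)
  · rw [pow_zero, mul_one]
    refine (norm_integral_gaussKernel_mul_le hw0 (C := r) fun s hs => ?_).trans ?_
    · simpa using hk x s hs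
    · exact mul_le_mul_of_nonneg_right (by nlinarith [pow_nonneg hr0 2, pow_nonneg hr0 3]) hJ
  · rw [pow_zero, mul_one]
    refine (norm_integral_gaussKernel_mul_le hw0 (C := r ^ 2) fun s hs => ?_).trans ?_
    · simpa using hk2 x s hs
    · exact mul_le_mul_of_nonneg_right (by nlinarith [pow_nonneg hr0 2, pow_nonneg hr0 3]) hJ
  · have e : (steinSolution w).2 (x + h) - (steinSolution w).2 x =
        ∫ s in Set.Ioi (0 : ℝ), gaussKernel w s * (-Complex.I * cauchyKernel w (x + h) s ^ 2 -
          -Complex.I * cauchyKernel w x s ^ 2) := by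
      simp only [steinSolution, mul_sub]
      exact (integral_sub (i2 (x + h)) (i2 x)).symm
    rw [e, pow_zero, mul_one]
    refine (norm_integral_gaussKernel_mul_le hw0 (C := 2 * r ^ 3 * |h|) fun s hs => ?_).trans ?_
    · have e2 : -Complex.I * cauchyKernel w (x + h) s ^ 2 - -Complex.I * cauchyKernel w x s ^ 2 =
          Complex.I * h * (cauchyKernel w x s * cauchyKernel w (x + h) s *
            (cauchyKernel w x s + cauchyKernel w (x + h) s)) := by
        have := cauchyKernel_add_sub hw0 x h hs.le
        linear_combination (-Complex.I * (cauchyKernel w x s + cauchyKernel w (x + h) s)) * this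
      rw [e2]
      simp only [norm_mul, Complex.norm_I, Complex.norm_real, Real.norm_eq_abs, one_mul]
      have n1 : ‖cauchyKernel w x s + cauchyKernel w (x + h) s‖ ≤ r + r :=
        (norm_add_le _ _).trans (add_le_add (hk _ _ hs) (hk _ _ hs))
      have n2 : ‖cauchyKernel w x s‖ * ‖cauchyKernel w (x + h) s‖ ≤ r * r :=
        mul_le_mul (hk _ _ hs) (hk _ _ hs) (norm_nonneg _) hr0
      have n3 := mul_le_mul n2 n1 (norm_nonneg _) (by positivity)
      calc _ ≤ |h| * (r * r * (r + r)) := mul_le_mul_of_nonneg_left n3 (abs_nonneg h)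
        _ = _ := by ring
    · have : 0 ≤ (r + r ^ 2) * (halfMass * |h|) := by positivity
      linarith
  · have e : (steinSolution w).1 (x + h) - (steinSolution w).1 x - h * (steinSolution w).2 x =
        ∫ s in Set.Ioi (0 : ℝ), gaussKernel w s * (Complex.I * cauchyKernel w (x + h) s -
          Complex.I * cauchyKernel w x s - h * (-Complex.I * cauchyKernel w x s ^ 2)) := by
      simp only [steinSolution]
      have i3 : IntegrableOn (fun s => gaussKernel w s * (Complex.I * cauchyKernel w (x + h) s) -
          gaussKernel w s * (Complex.I * cauchyKernel w x s)) (Set.Ioi 0) :=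
        (i1 (x + h)).sub (i1 x)
      rw [← integral_const_mul, ← integral_sub (i1 (x + h)) (i1 x),
        ← integral_sub i3 ((i2 x).const_mul _)]
      refine integral_congr_ae (Filter.Eventually.of_forall fun s => ?_)
      simp only
      ring
    rw [e, pow_zero, mul_one]
    refine (norm_integral_gaussKernel_mul_le hw0 (C := r ^ 3 * h ^ 2) fun s hs => ?_).trans ?_
    · have e2 : Complex.I * cauchyKernel w (x + h) s - Complex.I * cauchyKernel w x s -
          h * (-Complex.I * cauchyKernel w x s ^ 2) =
          Complex.I * h ^ 2 * (cauchyKernel w x s ^ 2 * cauchyKernel w (x + h) s) := by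
        have := cauchyKernel_add_sub hw0 x h hs.le
        linear_combination (Complex.I - Complex.I * h * cauchyKernel w x s) * this
      rw [e2]
      simp only [norm_mul, norm_pow, Complex.norm_I, Complex.norm_real, Real.norm_eq_abs, one_mul,
        sq_abs]
      have n2 : ‖cauchyKernel w x s‖ ^ 2 * ‖cauchyKernel w (x + h) s‖ ≤ r ^ 2 * r :=
        mul_le_mul (by simpa using hk2 x s hs) (hk _ _ hs) (norm_nonneg _) (by positivity)
      calc _ ≤ h ^ 2 * (r ^ 2 * r) := mul_le_mul_of_nonneg_left n2 (sq_nonneg h)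
        _ = _ := by ring
    · have : 0 ≤ (r + r ^ 2 + r ^ 3) * (halfMass * h ^ 2) := by positivity
      linarith

lemma inv_sub_eq_integral {w : ℂ} (hw : 0 < w.im) (x : ℝ) :
    1 / ((x : ℂ) - w) =
      Complex.I * ∫ t in Set.Ioi (0 : ℝ), Complex.exp (Complex.I * (w - x) * t) := by
  have hre : (Complex.I * (w - x)).re < 0 := by simp; exact hw
  rw [integral_exp_mul_complex_Ioi hre]
  have h1 := sub_ne_zero_of_im_pos hw x
  have h2 : w - x ≠ 0 := fun h => h1 (by rw [← neg_sub, h, neg_zero])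
  simp only [Complex.ofReal_zero, mul_zero, Complex.exp_zero]
  field_simp [Complex.I_ne_zero]
  ring_nf

/-- Write 1 / (x - w) as a Laplace integral of exponentials, exchange the integrals, and insert the
characteristic function of the Gaussian law. -/
lemma gaussStieltjes_eq_integral {w : ℂ} (hw : 0 < w.im) :
    gaussStieltjes w = ∫ s in Set.Ioi (0 : ℝ), gaussKernel w s * Complex.I := by
  unfold gaussStieltjes
  simp_rw [inv_sub_eq_integral hw]
  rw [integral_const_mul, integral_mul_const, mul_comm]
  congr 1
  rw [integral_integral_swap]
  · refine setIntegral_congr_fun measurableSet_Ioi fun t _ => ?_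
    have h1 : ∀ x : ℝ, Complex.exp (Complex.I * (w - x) * t) =
        Complex.exp (Complex.I * t * w) * Complex.exp (((-t : ℝ) : ℂ) * x * Complex.I) := by
      intro x
      rw [← Complex.exp_add]; congr 1; push_cast; ring
    simp only [h1]
    rw [integral_const_mul, ← charFun_apply_real, charFun_gaussianReal, ← Complex.exp_add,
      gaussKernel]
    congr 1
    push_cast; simp; ring
  · have m : Measurable (Function.uncurry fun (x : ℝ) (t : ℝ) =>
        Complex.exp (Complex.I * (w - x) * t)) := by
      unfold Function.uncurry; fun_prop
    have h0 : Integrable (fun p : ℝ × ℝ => (fun _ : ℝ => (1 : ℝ)) p.1 * Real.exp (-w.im * p.2))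
        ((gaussianReal 0 1).prod (volume.restrict (Set.Ioi 0))) :=
      Integrable.mul_prod (integrable_const (1 : ℝ)) (exp_neg_integrableOn_Ioi 0 hw)
    refine h0.mono' m.aestronglyMeasurable (Filter.Eventually.of_forall fun p => ?_)
    simp only [Function.uncurry, Complex.norm_exp, one_mul]
    refine le_of_eq (congrArg _ ?_)
    simp [Complex.mul_re, Complex.mul_im]

lemma hasDerivAt_gaussKernel (w : ℂ) (s : ℝ) :
    HasDerivAt (gaussKernel w) (gaussKernel w s * (Complex.I * (w + Complex.I * s))) s := by
  unfold gaussKernel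
  have h1 : HasDerivAt (fun s : ℝ => (s : ℂ)) 1 s := Complex.ofRealCLM.hasDerivAt
  have h2 := ((((h1.pow 2).neg).div_const 2).add (((h1.const_mul Complex.I).mul_const w))).cexp
  convert h2 using 1
  simp only [Pi.add_apply, Pi.neg_apply, Pi.pow_apply]
  linear_combination
    (Complex.exp (-(s : ℂ) ^ 2 / 2 + Complex.I * s * w) * s) * Complex.I_mul_I

lemma hasDerivAt_cauchyKernel {w : ℂ} (hw : 0 < w.im) (x : ℝ) {s : ℝ} (hs : 0 ≤ s) :
    HasDerivAt (cauchyKernel w x) (Complex.I * cauchyKernel w x s ^ 2) s := by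
  have h1 : HasDerivAt (fun s : ℝ => (s : ℂ)) 1 s := Complex.ofRealCLM.hasDerivAt
  have h2 := ((h1.const_mul Complex.I).const_sub ((x : ℂ) - w)).inv (cauchyKernel_denom_ne hw x hs)
  have e : cauchyKernel w x = (fun s : ℝ => (x : ℂ) - w - Complex.I * s)⁻¹ := by
    funext s; simp [cauchyKernel]
  rw [← e] at h2
  refine h2.congr_deriv ?_
  simp [cauchyKernel, div_eq_mul_inv]

/-- The combination x f - f' minus the Gaussian transform has an integrand that is the total
derivative in s of `gaussKernel` times `cauchyKernel`. This product tends to 0 at infinity and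
equals 1 / (x - w) at s = 0. -/
lemma steinSolution_equation {w : ℂ} (hw : 0 < w.im) (x : ℝ) :
    (steinSolution w).2 x - x * (steinSolution w).1 x = 1 / ((x : ℂ) - w) - gaussStieltjes w := by
  have hk : ∀ s : ℝ, 0 < s → ‖cauchyKernel w x s‖ ≤ 1 / w.im := fun s hs =>
    norm_cauchyKernel_le hw le_rfl x hs.le
  have hk2 : ∀ s : ℝ, 0 < s → ‖cauchyKernel w x s ^ 2‖ ≤ (1 / w.im) ^ 2 := fun s hs => by
    rw [norm_pow]; exact pow_le_pow_left₀ (norm_nonneg _) (hk s hs) 2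
  have i1 : IntegrableOn (fun s => gaussKernel w s * (Complex.I * cauchyKernel w x s))
      (Set.Ioi 0) := integrable_gaussKernel_mul hw
        ((measurable_cauchyKernel w x).const_mul _) (C := 1 / w.im) fun s hs => by
          simpa using hk s hs
  have i2 : IntegrableOn (fun s => gaussKernel w s * (-Complex.I * cauchyKernel w x s ^ 2))
      (Set.Ioi 0) := integrable_gaussKernel_mul hw
        (((measurable_cauchyKernel w x).pow_const 2).const_mul _) (C := (1 / w.im) ^ 2)
        fun s hs => by simpa using hk2 s hs
  have i0 : IntegrableOn (fun s => gaussKernel w s * Complex.I) (Set.Ioi 0) :=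
    integrable_gaussKernel_mul hw measurable_const (C := 1) fun s _ => by simp
  have hpt : ∀ s, 0 ≤ s → gaussKernel w s * (Complex.I * (w + Complex.I * s)) * cauchyKernel w x s
      + gaussKernel w s * (Complex.I * cauchyKernel w x s ^ 2) =
      x * (gaussKernel w s * (Complex.I * cauchyKernel w x s)) - gaussKernel w s * Complex.I -
        gaussKernel w s * (-Complex.I * cauchyKernel w x s ^ 2) := by
    intro s hs
    have h1 : cauchyKernel w x s * ((x : ℂ) - w - Complex.I * s) = 1 := by
      rw [cauchyKernel]; exact one_div_mul_cancel (cauchyKernel_denom_ne hw x hs)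
    linear_combination (-gaussKernel w s * Complex.I) * h1
  have hint : IntegrableOn (fun s : ℝ => x * (gaussKernel w s * (Complex.I * cauchyKernel w x s)) -
      gaussKernel w s * Complex.I - gaussKernel w s * (-Complex.I * cauchyKernel w x s ^ 2))
      (Set.Ioi 0) := ((i1.const_mul (x : ℂ)).sub i0).sub i2
  have key := integral_Ioi_of_hasDerivAt_of_tendsto' (a := 0) (m := 0)
    (f := fun s => gaussKernel w s * cauchyKernel w x s)
    (f' := fun s : ℝ => x * (gaussKernel w s * (Complex.I * cauchyKernel w x s)) -
      gaussKernel w s * Complex.I - gaussKernel w s * (-Complex.I * cauchyKernel w x s ^ 2))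
    (fun s hs => by
      rw [← hpt s hs]
      exact (hasDerivAt_gaussKernel w s).mul (hasDerivAt_cauchyKernel hw x hs)) hint ?_
  · have i3 : IntegrableOn (fun s : ℝ => x * (gaussKernel w s * (Complex.I * cauchyKernel w x s)) -
        gaussKernel w s * Complex.I) (Set.Ioi 0) := (i1.const_mul (x : ℂ)).sub i0
    rw [integral_sub i3 i2, integral_sub (i1.const_mul (x : ℂ)) i0,
      integral_const_mul, ← gaussStieltjes_eq_integral hw] at key
    have h0 : gaussKernel w 0 * cauchyKernel w x 0 = 1 / ((x : ℂ) - w) := by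
      simp [gaussKernel, cauchyKernel]
    rw [h0] at key
    simp only [steinSolution]
    linear_combination -key
  · have h0 : Filter.Tendsto (fun s : ℝ => Real.exp (-(1 / 2) * s ^ 2) * (1 / w.im)) Filter.atTop
        (nhds 0) := by
      rw [← zero_mul (1 / w.im)]
      refine Filter.Tendsto.mul_const _ (Real.tendsto_exp_atBot.comp ?_)
      exact (Filter.tendsto_pow_atTop (by norm_num)).const_mul_atTop_of_neg (by norm_num)
    refine squeeze_zero_norm' ?_ h0
    filter_upwards [Filter.eventually_gt_atTop 0] with s hs
    rw [norm_mul]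
    exact mul_le_mul (norm_gaussKernel_le hw hs) (hk s hs) (norm_nonneg _) (Real.exp_pos _).le

/-! ### The Stieltjes transform of the diagonal entries -/

/-- The Stieltjes transform of the diagonal entries. -/
def diagStieltjes {N : ℕ} (B : Matrix (Fin (N + 1)) (Fin (N + 1)) ℝ) (w : ℂ) : ℂ :=
  (1 / (N : ℂ)) * ∑ i, 1 / ((B i i : ℂ) - w)

/-- There are N + 1 diagonal entries but the normalisation is 1 / N, hence the additional term of
order 1 / N. -/
lemma steinAvg_steinSolution {N : ℕ} (hN : 1 ≤ N) (B : Matrix (Fin (N + 1)) (Fin (N + 1)) ℝ) {w : ℂ}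
    (hw : 0 < w.im) : steinAvg (steinSolution w) B =
      diagStieltjes B w - gaussStieltjes w - gaussStieltjes w / N := by
  have hN' : (N : ℂ) ≠ 0 := by exact_mod_cast (by omega : N ≠ 0)
  unfold steinAvg diagStieltjes
  simp_rw [steinSolution_equation hw]
  rw [Finset.sum_sub_distrib]
  simp only [Finset.sum_const, Finset.card_univ, Fintype.card_fin, nsmul_eq_mul]
  push_cast
  field_simp
  ring

lemma whp_diagStieltjes_sub_le_of_le_im (hβ : 0 < β) (hP : P ≠ 0) (hPβ : 2 ≤ β * P) {b : ℝ}
    (hb : 0 < b) {S : Ensemble.{u} β c → Set ℂ} (hS : ∀ M, ∀ w ∈ S M, b ≤ w.im) :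
    WHP S (fun M w => {ω | ‖diagStieltjes (M.H ω) w - gaussStieltjes w‖ ≤
      scale P M.N ^ 5 / M.q}) := by
  obtain ⟨N₀, hN₀, h2⟩ := eventually_le_scale hP (1 + 1 / b)
  refine (whp_steinAvg_le hβ hP hPβ _ 0 S (fun _ w => steinSolution w) fun M w hw =>
    steinTest_steinSolution hb (hS M w hw)).mono (fun M w => w)
    ⟨N₀, fun M hM w hw => ⟨hw, fun ω hω => ?_⟩⟩
  have hM1 := hN₀.trans hM
  have hω' : ‖steinAvg (steinSolution w) (M.H ω)‖ ≤ scale P M.N ^ (0 + 4) / M.q := hω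
  have hw0 := hb.trans_le (hS M w hw)
  rw [steinAvg_steinSolution hM1 _ hw0] at hω'
  have hq := M.one_le_q hβ hM1
  have hqN := M.q_sq_le hβ hM1
  have hT := h2 M.N hM
  have hT1 := one_le_scale P hM1
  have h3 : ‖gaussStieltjes w / (M.N : ℂ)‖ ≤ 1 / b / M.q := by
    rw [norm_div, Complex.norm_natCast]
    have hqN' : M.q ≤ M.N := by nlinarith
    have := (norm_gaussStieltjes_le hw0).trans (one_div_le_one_div_of_le hb (hS M w hw))
    gcongr
  show ‖diagStieltjes (M.H ω) w - gaussStieltjes w‖ ≤ _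
  have e : diagStieltjes (M.H ω) w - gaussStieltjes w = (diagStieltjes (M.H ω) w -
    gaussStieltjes w - gaussStieltjes w / M.N) + gaussStieltjes w / M.N := by ring
  rw [e]
  refine (norm_add_le _ _).trans ((add_le_add hω' h3).trans ?_)
  rw [← add_div]
  refine div_le_div_of_nonneg_right ?_ (by linarith)
  have h4 := one_le_pow₀ hT1 (n := 4)
  have h5 : 0 ≤ 1 / b := by positivity
  calc scale P M.N ^ (0 + 4) + 1 / b ≤ scale P M.N ^ 4 + scale P M.N ^ 4 * (1 / b) := by
        rw [zero_add]; exact add_le_add_right (le_mul_of_one_le_left h5 h4) _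
    _ = scale P M.N ^ 4 * (1 + 1 / b) := by ring
    _ ≤ scale P M.N ^ 4 * scale P M.N := mul_le_mul_of_nonneg_left hT (by positivity)
    _ = _ := by ring

end LaplacianLocalLaw
end

noncomputable section
namespace LaplacianLocalLaw

universe u v w

variable {β : ℝ} {c : ℕ → ℝ} {P : ℕ}

/-! ### Stieltjes transforms far away from the support -/

/-- The partial fraction identity behind divided differences: with step i, the n-th difference of a
Cauchy kernel is a product of n + 1 Cauchy kernels. -/
lemma fwdDiff_iter_inv_sub (n : ℕ) (x : ℝ) {w : ℂ} (hw : 0 < w.im) :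
    (fwdDiff Complex.I)^[n] (fun w : ℂ => 1 / ((x : ℂ) - w)) w =
      (n.factorial : ℂ) * Complex.I ^ n *
        ∏ k ∈ Finset.range (n + 1), 1 / ((x : ℂ) - (w + k * Complex.I)) := by
  induction n generalizing w with
  | zero => simp
  | succ n ih =>
    have hw' : 0 < (w + Complex.I).im := by simp; linarith
    have hne : ∀ k : ℕ, (x : ℂ) - (w + k * Complex.I) ≠ 0 := fun k =>
      sub_ne_zero_of_im_pos (by simp; positivity) x
    rw [Function.iterate_succ_apply', fwdDiff, ih hw, ih hw', Finset.prod_range_succ _ n]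
    have e1 : ∏ k ∈ Finset.range n, 1 / ((x : ℂ) - (w + Complex.I + k * Complex.I)) =
        ∏ k ∈ Finset.range n, 1 / ((x : ℂ) - (w + (k + 1 : ℕ) * Complex.I)) :=
      Finset.prod_congr rfl fun k _ => by push_cast; ring_nf
    rw [e1, Finset.prod_range_succ' _ n, Finset.prod_range_succ _ (n + 1),
      Finset.prod_range_succ' _ n]
    set p := ∏ k ∈ Finset.range n, 1 / ((x : ℂ) - (w + (k + 1 : ℕ) * Complex.I))
    have h0 := hne 0
    have h1 := hne (n + 1)
    have e2 : w + Complex.I + n * Complex.I = w + (n + 1 : ℕ) * Complex.I := by push_cast; ring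
    rw [e2, Nat.factorial_succ]
    set a := (x : ℂ) - (w + (0 : ℕ) * Complex.I) with ha
    set b := (x : ℂ) - (w + (n + 1 : ℕ) * Complex.I) with hb
    have hab : a = b + (n + 1) * Complex.I := by rw [ha, hb]; push_cast; ring
    have key : 1 / b - 1 / a = (n + 1) * Complex.I * (1 / a * (1 / b)) := by
      rw [div_sub_div _ _ h1 h0]; field_simp; rw [hab]; ring
    push_cast
    linear_combination (n.factorial * Complex.I ^ n * p) * key

/-- The factor at w itself may be near the real axis and is bounded by 1 / Im w. Every other factor
has a denominator y with |y| ≥ 1, so |Re w| ≤ |y| + |x| ≤ (1 + |x|) |y|, which gains one power of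
|Re w|. -/
lemma norm_fwdDiff_iter_inv_sub_le (n : ℕ) (x : ℝ) {w : ℂ} (hw : 0 < w.im) (hr : 0 < |w.re|) :
    ‖(fwdDiff Complex.I)^[n] (fun w : ℂ => 1 / ((x : ℂ) - w)) w‖ ≤
      n.factorial / (w.im * |w.re| ^ n) * (1 + |x|) ^ n := by
  rw [fwdDiff_iter_inv_sub n x hw, norm_mul, norm_mul, norm_pow, Complex.norm_I, one_pow, mul_one,
    Complex.norm_natCast, norm_prod, Finset.prod_range_succ']
  have h0 : ‖1 / ((x : ℂ) - (w + (0 : ℕ) * Complex.I))‖ ≤ 1 / w.im := by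
    simpa using norm_inv_sub_le hw x
  have h1 : ∀ k ∈ Finset.range n, ‖1 / ((x : ℂ) - (w + (k + 1 : ℕ) * Complex.I))‖ ≤
      (1 + |x|) / |w.re| := by
    intro k _
    set y := (x : ℂ) - (w + (k + 1 : ℕ) * Complex.I)
    have a1 : 1 ≤ ‖y‖ := by
      have := im_le_norm_sub (w := w + (k + 1 : ℕ) * Complex.I) x
      have h2 : (w + (k + 1 : ℕ) * Complex.I).im = w.im + (k + 1) := by simp
      rw [h2] at this
      have : (0 : ℝ) ≤ k := Nat.cast_nonneg k
      linarith
    have a2 : |w.re| ≤ ‖y‖ + |x| := by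
      have h3 := Complex.abs_re_le_norm y
      have h4 : y.re = x - w.re := by simp [y]
      rw [h4] at h3
      have := abs_sub_abs_le_abs_sub w.re x
      rw [abs_sub_comm] at this
      linarith
    rw [norm_div, norm_one, div_le_div_iff₀ (by linarith) hr]
    have : |x| * 1 ≤ |x| * ‖y‖ := mul_le_mul_of_nonneg_left a1 (abs_nonneg x)
    linarith
  have h2 := Finset.prod_le_prod (fun k _ => norm_nonneg _) h1
  rw [Finset.prod_const, Finset.card_range] at h2
  have h3 := mul_le_mul h2 h0 (norm_nonneg _) (by positivity)
  calc _ ≤ (n.factorial : ℝ) * (((1 + |x|) / |w.re|) ^ n * (1 / w.im)) :=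
        mul_le_mul_of_nonneg_left h3 (Nat.cast_nonneg _)
    _ = _ := by rw [div_pow]; field_simp

/-- The coefficient of f(w) in the n-th difference is a sign, so f(w) is recovered from the
difference and the values at the higher points w + k i, whose binomial weights sum to at most 2^n.
-/
lemma norm_le_norm_fwdDiff_iter_add (f : ℂ → ℂ) (n : ℕ) (w : ℂ) {e : ℝ}
    (h : ∀ k ∈ Finset.Icc 1 n, ‖f (w + k • Complex.I)‖ ≤ e) (he : 0 ≤ e) :
    ‖f w‖ ≤ ‖(fwdDiff Complex.I)^[n] f w‖ + 2 ^ n * e := by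
  have h1 := fwdDiff_iter_eq_sum_shift Complex.I f n w
  rw [Finset.sum_range_succ'] at h1
  simp only [zero_smul, add_zero, Nat.choose_zero_right, Nat.sub_zero, Nat.cast_one, mul_one] at h1
  have h2 : ‖((-1 : ℤ) ^ n) • f w‖ = ‖f w‖ := by
    rcases neg_one_pow_eq_or ℤ n with h | h <;> simp [h]
  have h3 : ‖∑ k ∈ Finset.range n, ((-1 : ℤ) ^ (n - (k + 1)) * (n.choose (k + 1) : ℤ)) •
      f (w + (k + 1) • Complex.I)‖ ≤ 2 ^ n * e := by
    refine (norm_sum_le _ _).trans ?_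
    have h4 : ∀ k ∈ Finset.range n, ‖((-1 : ℤ) ^ (n - (k + 1)) * (n.choose (k + 1) : ℤ)) •
        f (w + (k + 1) • Complex.I)‖ ≤ n.choose (k + 1) * e := by
      intro k hk
      have h5 := h (k + 1) (Finset.mem_Icc.2 ⟨by omega, by simpa using hk⟩)
      rw [zsmul_eq_mul, norm_mul]
      refine mul_le_mul (le_of_eq ?_) h5 (norm_nonneg _) (Nat.cast_nonneg _)
      push_cast
      simp
    refine (Finset.sum_le_sum h4).trans ?_
    rw [← Finset.sum_mul]
    refine mul_le_mul_of_nonneg_right ?_ he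
    have h6 := Nat.sum_range_choose n
    rw [Finset.sum_range_succ'] at h6
    have h7 : ∑ k ∈ Finset.range n, n.choose (k + 1) ≤ 2 ^ n := by omega
    exact_mod_cast h7
  rw [← h2]
  have h8 : ((-1 : ℤ) ^ n) • f w = (fwdDiff Complex.I)^[n] f w -
      ∑ k ∈ Finset.range n, ((-1 : ℤ) ^ (n - (k + 1)) * (n.choose (k + 1) : ℤ)) •
        f (w + (k + 1) • Complex.I) := by rw [h1]; abel
  rw [h8]
  exact (norm_sub_le _ _).trans (add_le_add le_rfl h3)

lemma fwdDiff_iter_diagStieltjes {N : ℕ} (B : Matrix (Fin (N + 1)) (Fin (N + 1)) ℝ) (n : ℕ)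
    (w : ℂ) : (fwdDiff Complex.I)^[n] (diagStieltjes B) w =
      (1 / (N : ℂ)) * ∑ i, (fwdDiff Complex.I)^[n] (fun w : ℂ => 1 / ((B i i : ℂ) - w)) w := by
  simp only [fwdDiff_iter_eq_sum_shift, diagStieltjes, zsmul_eq_mul]
  rw [Finset.sum_comm, Finset.mul_sum]
  refine Finset.sum_congr rfl fun k _ => ?_
  rw [← Finset.mul_sum]; ring

lemma fwdDiff_iter_gaussStieltjes (n : ℕ) {w : ℂ} (hw : 0 < w.im) :
    (fwdDiff Complex.I)^[n] gaussStieltjes w =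
      ∫ x : ℝ, (fwdDiff Complex.I)^[n] (fun w : ℂ => 1 / ((x : ℂ) - w)) w ∂(gaussianReal 0 1) := by
  simp only [fwdDiff_iter_eq_sum_shift, gaussStieltjes, zsmul_eq_mul]
  rw [integral_finsetSum]
  · exact Finset.sum_congr rfl fun k _ => (integral_const_mul _ _).symm
  · intro k _
    exact (integrable_inv_sub (by simp; positivity)).const_mul _

lemma integrable_one_add_abs_pow_gaussian (n : ℕ) :
    Integrable (fun x : ℝ => (1 + |x|) ^ n) (gaussianReal 0 1) := by
  have h1 : MemLp (fun x : ℝ => 1 + |x|) (n : ENNReal) (gaussianReal 0 1) := by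
    have h2 := (memLp_id_gaussianReal (μ := 0) (v := 1) (n : NNReal)).norm
    have h3 := (memLp_const (μ := gaussianReal 0 1) (p := ((n : NNReal) : ENNReal)) (1 : ℝ)).add h2
    rw [ENNReal.coe_natCast] at h3
    exact h3
  refine (h1.integrable_norm_pow').congr (Filter.Eventually.of_forall fun x => ?_)
  simp only [Real.norm_eq_abs]
  rw [abs_of_nonneg (by positivity)]

lemma norm_fwdDiff_iter_gaussStieltjes_le (n : ℕ) {w : ℂ} (hw : 0 < w.im) (hr : 0 < |w.re|) :
    ‖(fwdDiff Complex.I)^[n] gaussStieltjes w‖ ≤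
      n.factorial / (w.im * |w.re| ^ n) * ∫ x : ℝ, (1 + |x|) ^ n ∂(gaussianReal 0 1) := by
  rw [fwdDiff_iter_gaussStieltjes n hw, ← integral_const_mul]
  exact norm_integral_le_of_norm_le ((integrable_one_add_abs_pow_gaussian n).const_mul _)
    (Filter.Eventually.of_forall fun x => norm_fwdDiff_iter_inv_sub_le n x hw hr)

lemma norm_fwdDiff_iter_diagStieltjes_le {N : ℕ} (hN : 1 ≤ N)
    {B : Matrix (Fin (N + 1)) (Fin (N + 1)) ℝ} {τ : ℝ} (hB : ∀ i, |B i i| ≤ τ) (n : ℕ) {w : ℂ}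
    (hw : 0 < w.im) (hr : 0 < |w.re|) :
    ‖(fwdDiff Complex.I)^[n] (diagStieltjes B) w‖ ≤
      n.factorial / (w.im * |w.re| ^ n) * (2 * (1 + τ) ^ n) := by
  rw [fwdDiff_iter_diagStieltjes, norm_mul, norm_div, norm_one, Complex.norm_natCast]
  have hN' : (1 : ℝ) ≤ N := by exact_mod_cast hN
  have h1 : ‖∑ i, (fwdDiff Complex.I)^[n] (fun w : ℂ => 1 / ((B i i : ℂ) - w)) w‖ ≤
      ∑ _i : Fin (N + 1), n.factorial / (w.im * |w.re| ^ n) * (1 + τ) ^ n := by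
    refine norm_sum_le_of_le _ fun i _ => (norm_fwdDiff_iter_inv_sub_le n _ hw hr).trans ?_
    refine mul_le_mul_of_nonneg_left (pow_le_pow_left₀ (by positivity) ?_ n) (by positivity)
    linarith [hB i]
  rw [Finset.sum_const, Finset.card_univ, Fintype.card_fin, nsmul_eq_mul] at h1
  set X := (n.factorial : ℝ) / (w.im * |w.re| ^ n) * (1 + τ) ^ n with hX
  have hτ : 0 ≤ τ := (abs_nonneg _).trans (hB 0)
  have hX0 : 0 ≤ X := by positivity
  calc _ ≤ 1 / (N : ℝ) * (((N + 1 : ℕ) : ℝ) * X) := mul_le_mul_of_nonneg_left h1 (by positivity)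
    _ = ((N : ℝ) + 1) / N * X := by push_cast; ring
    _ ≤ 2 * X := by
        refine mul_le_mul_of_nonneg_right ?_ hX0
        rw [div_le_iff₀ (by linarith)]; linarith
    _ = _ := by rw [hX]; ring

/-- With |Re w| ≥ T³, the P factors gain T^(3P) = N³. One N is lost to 1 / Im w and another to the
P-th power of the diagonal entries, which leaves 1 / N ≤ 1 / q. -/
lemma far_error_le {N : ℕ} (hN : 1 ≤ N) (hP : P ≠ 0) {η r q K : ℝ} (hη : 1 / (N : ℝ) ≤ η)
    (hr : scale P N ^ 3 ≤ r) (hq : 0 < q) (hqN : q ≤ N) (hK : 0 ≤ K)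
    (hT : (P.factorial : ℝ) * (2 ^ (P + 1) + K) ≤ scale P N) :
    P.factorial / (η * r ^ P) * (2 * (1 + scale P N) ^ P) + P.factorial / (η * r ^ P) * K ≤
      scale P N / q := by
  set T := scale P N with hTd
  have hT1 : 1 ≤ T := one_le_scale P hN
  have hTP : T ^ P = N := scale_pow hP N
  have hN' : (1 : ℝ) ≤ N := by exact_mod_cast hN
  have hη0 : 0 < η := lt_of_lt_of_le (by positivity) hη
  have hr0 : 0 < r := lt_of_lt_of_le (by positivity) hr
  have h1 : (N : ℝ) ^ 2 ≤ η * r ^ P := by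
    have h2 : (N : ℝ) ^ 3 ≤ r ^ P := by
      rw [← hTP, ← pow_mul, mul_comm, pow_mul]
      exact pow_le_pow_left₀ (by positivity) hr P
    calc (N : ℝ) ^ 2 = 1 / N * (N : ℝ) ^ 3 := by field_simp
      _ ≤ _ := mul_le_mul hη h2 (by positivity) hη0.le
  have h3 : 2 * (1 + T) ^ P + K ≤ (2 ^ (P + 1) + K) * N := by
    have h4 : (1 + T) ^ P ≤ (2 * T) ^ P := pow_le_pow_left₀ (by positivity) (by linarith) P
    rw [mul_pow, hTP] at h4
    have : K * 1 ≤ K * N := mul_le_mul_of_nonneg_left hN' hK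
    calc _ ≤ 2 * (2 ^ P * (N : ℝ)) + K * N := by linarith
      _ = _ := by ring
  have hq2 : q / N ≤ 1 := by rw [div_le_one (by linarith)]; exact hqN
  calc _ = P.factorial / (η * r ^ P) * (2 * (1 + T) ^ P + K) := by ring
    _ ≤ P.factorial / (N : ℝ) ^ 2 * ((2 ^ (P + 1) + K) * N) :=
        mul_le_mul (div_le_div_of_nonneg_left (Nat.cast_nonneg _) (by positivity) h1) h3
          (by positivity) (by positivity)
    _ = (P.factorial * (2 ^ (P + 1) + K)) / N := by field_simp
    _ ≤ T / N := div_le_div_of_nonneg_right hT (by positivity)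
    _ ≤ T / q := div_le_div_of_nonneg_left (by positivity) hq hqN

/-- The points w + k i with k ≥ 1 have imaginary part at least 1, where the comparison is known.
Taking differences of order P lifts it to w itself, since both transforms have a negligible
difference there: the diagonal entries are at most T and the Gaussian law has all moments. -/
lemma whp_diagStieltjes_sub_le_of_le_re (hβ : 0 < β) (hP : P ≠ 0) (hPβ : 2 ≤ β * P)
    {S : Ensemble.{u} β c → Set ℂ}
    (hS : ∀ M, ∀ w ∈ S M, 1 / (M.N : ℝ) ≤ w.im ∧ scale P M.N ^ 3 ≤ |w.re|) :
    WHP S (fun M w => {ω | ‖diagStieltjes (M.H ω) w - gaussStieltjes w‖ ≤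
      scale P M.N ^ 7 / M.q}) := by
  set K := ∫ x : ℝ, (1 + |x|) ^ P ∂(gaussianReal 0 1) with hKd
  have hK : 0 ≤ K := integral_nonneg fun x => by positivity
  have hcl := (whp_diagStieltjes_sub_le_of_le_im.{u} (c := c) hβ hP hPβ one_pos
    (S := fun _ => {w : ℂ | 1 ≤ w.im}) fun M w hw => hw)
  have hJ : ∃ N₀ : ℕ, ∀ M : Ensemble.{u} β c, N₀ ≤ M.N → ∀ w ∈ S M,
      ((Finset.Icc 1 P).card : ℝ) ≤ (M.N : ℝ) ^ 1 :=
    ⟨P, fun M hM _ _ => by rw [Nat.card_Icc, pow_one]; exact_mod_cast (by omega)⟩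
  have h1 := WHP.biInter (S := S) (fun _ _ => Finset.Icc 1 P) 1 hJ
    (hcl.mono (S' := fun M => {p : ℂ × ℕ | p.1 ∈ S M ∧ p.2 ∈ Finset.Icc 1 P})
      (A' := fun M p => {ω | ‖diagStieltjes (M.H ω) (p.1 + p.2 • Complex.I) -
        gaussStieltjes (p.1 + p.2 • Complex.I)‖ ≤ scale P M.N ^ 5 / M.q})
      (fun _ p => p.1 + p.2 • Complex.I) ⟨0, fun M _ p hp => ⟨?_, subset_rfl⟩⟩)
  · obtain ⟨N₁, hN₁, hT⟩ := eventually_le_scale hP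
      ((P.factorial : ℝ) * (2 ^ (P + 1) + K))
    obtain ⟨N₂, hN₂, hT'⟩ := eventually_le_scale hP ((2 : ℝ) ^ P + 1)
    refine (h1.inter (whp_abs_diag_le hβ hP hPβ S)).mono (fun M w => w)
      ⟨max N₁ N₂, fun M hM w hw => ⟨hw, fun ω hω => ?_⟩⟩
    have hM1 := hN₁.trans (le_of_max_le_left hM)
    have hT := hT M.N (le_of_max_le_left hM)
    have hT' := hT' M.N (le_of_max_le_right hM)
    have hT1 := one_le_scale P hM1
    have hq := M.one_le_q hβ hM1
    have hqN : M.q ≤ M.N := by nlinarith [M.q_sq_le hβ hM1]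
    obtain ⟨hω1, hω2⟩ := hω
    have hω2 : ∀ a, |M.H ω a a| ≤ scale P M.N := hω2
    obtain ⟨hη, hr⟩ := hS M w hw
    have hη0 : 0 < w.im := lt_of_lt_of_le (by positivity) hη
    have hr0 : 0 < |w.re| := lt_of_lt_of_le (by positivity) hr
    have h2 := norm_le_norm_fwdDiff_iter_add
      (fun w => diagStieltjes (M.H ω) w - gaussStieltjes w) P w (e := scale P M.N ^ 5 / M.q)
      (fun k hk => by
        have := Set.mem_iInter₂.1 hω1 k hk
        exact this) (by positivity)
    have h3 : (fwdDiff Complex.I)^[P] (fun w => diagStieltjes (M.H ω) w - gaussStieltjes w) w =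
        (fwdDiff Complex.I)^[P] (diagStieltjes (M.H ω)) w -
          (fwdDiff Complex.I)^[P] gaussStieltjes w := by
      simp only [fwdDiff_iter_eq_sum_shift, smul_sub, Finset.sum_sub_distrib]
    have h4 := norm_fwdDiff_iter_diagStieltjes_le hM1 hω2 P hη0 hr0
    have h5 := norm_fwdDiff_iter_gaussStieltjes_le P hη0 hr0
    have h6 := far_error_le hM1 hP hη hr (by linarith) hqN hK hT
    rw [h3] at h2
    refine h2.trans ?_
    have h7 := (norm_sub_le _ _).trans ((add_le_add h4 h5).trans h6)
    have h8 : scale P M.N ≤ scale P M.N ^ 5 := le_self_pow₀ hT1 (by norm_num)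
    calc _ ≤ scale P M.N / M.q + 2 ^ P * (scale P M.N ^ 5 / M.q) := add_le_add h7 le_rfl
      _ = (scale P M.N + 2 ^ P * scale P M.N ^ 5) / M.q := by ring
      _ ≤ (scale P M.N ^ 7) / M.q := by
          refine div_le_div_of_nonneg_right ?_ (by linarith)
          calc _ ≤ (2 ^ P + 1) * scale P M.N ^ 5 := by linarith
            _ ≤ scale P M.N * scale P M.N ^ 5 := mul_le_mul_of_nonneg_right hT' (by positivity)
            _ = scale P M.N ^ 6 := by ring
            _ ≤ _ := pow_le_pow_right₀ hT1 (by norm_num)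
  · obtain ⟨h1, h2⟩ := hp
    have h3 : (1 : ℝ) ≤ p.2 := by exact_mod_cast (Finset.mem_Icc.1 h2).1
    have h4 := (hS M p.1 h1).1
    have h5 : 0 ≤ 1 / (M.N : ℝ) := by positivity
    show 1 ≤ (p.1 + p.2 • Complex.I).im
    simp
    linarith

end LaplacianLocalLaw
end

noncomputable section
namespace LaplacianLocalLaw

/-! ### The limiting Stieltjes transform -/

lemma mfc_im_nonneg {z : ℂ} (hz : 0 < z.im) : 0 ≤ (mfc z).im := (mfc_spec hz).1

lemma mfc_eq {z : ℂ} (hz : 0 < z.im) : mfc z = gaussStieltjes (z + mfc z) :=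
  ((isFreeConvSolution_iff _ _).1 (mfc_spec hz)).2

lemma im_le_im_add_mfc {z : ℂ} (hz : 0 < z.im) : z.im ≤ (z + mfc z).im := by
  rw [Complex.add_im]; linarith [mfc_im_nonneg hz]

/-- The squared mean is at most the mean square, which is the imaginary part divided by Im w. -/
lemma norm_gaussStieltjes_sq_le {w : ℂ} (hw : 0 < w.im) :
    ‖gaussStieltjes w‖ ^ 2 ≤ (gaussStieltjes w).im / w.im := by
  rw [im_gaussStieltjes hw, mul_div_cancel_left₀ _ hw.ne']
  set f : ℝ → ℝ := fun x => ‖1 / ((x : ℂ) - w)‖ with hf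
  have i1 : Integrable f (gaussianReal 0 1) := (integrable_inv_sub hw).norm
  have i2 : Integrable (fun x => f x ^ 2) (gaussianReal 0 1) := (memLp_inv_sub hw 2).integrable_norm_pow'
  set t := ∫ x, f x ∂(gaussianReal 0 1) with ht
  have h1 : ‖gaussStieltjes w‖ ≤ t := norm_integral_le_integral_norm _
  have h2 : 0 ≤ ∫ x, (f x - t) ^ 2 ∂(gaussianReal 0 1) := integral_nonneg fun x => sq_nonneg _
  have e : ∀ x, (f x - t) ^ 2 = f x ^ 2 - 2 * t * f x + t ^ 2 := fun x => by ring
  have i3 : Integrable (fun x => f x ^ 2 - 2 * t * f x) (gaussianReal 0 1) :=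
    i2.sub (i1.const_mul _)
  simp_rw [e] at h2
  rw [integral_add i3 (integrable_const _), integral_sub i2 (i1.const_mul _),
    integral_const_mul, ← ht] at h2
  simp only [integral_const, probReal_univ, smul_eq_mul, one_mul] at h2
  have h3 : ‖gaussStieltjes w‖ ^ 2 ≤ t ^ 2 := pow_le_pow_left₀ (norm_nonneg _) h1 2
  linarith

/-- At the fixed point the preceding bound reads |m|² ≤ Im m / (Im z + Im m), and this is at most 1.
-/
lemma norm_mfc_le_one {z : ℂ} (hz : 0 < z.im) : ‖mfc z‖ ≤ 1 := by
  have h1 := norm_gaussStieltjes_sq_le (hz.trans_le (im_le_im_add_mfc hz))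
  rw [← mfc_eq hz, Complex.add_im] at h1
  have h2 := mfc_im_nonneg hz
  have h3 : (mfc z).im / (z.im + (mfc z).im) ≤ 1 := by
    rw [div_le_one (by linarith)]; linarith
  nlinarith [norm_nonneg (mfc z)]

/-- The fixed point map contracts with factor 1 / (1 + ε), because Im m ≤ 1. Comparing the two fixed
point equations and absorbing gives the Lipschitz constant 1 / ε. -/
lemma norm_mfc_sub_le {z w : ℂ} {ε : ℝ} (hε : 0 < ε) (hz : ε ≤ z.im) (hw : ε ≤ w.im) :
    ‖mfc z - mfc w‖ ≤ ‖z - w‖ / ε := by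
  have hz0 := hε.trans_le hz
  have hw0 := hε.trans_le hw
  have key := norm_gaussStieltjes_sub_sq_le (hz0.trans_le (im_le_im_add_mfc hz0))
    (hw0.trans_le (im_le_im_add_mfc hw0))
  rw [← mfc_eq hz0, ← mfc_eq hw0, Complex.add_im, Complex.add_im] at key
  have hb : ∀ u : ℂ, ε ≤ u.im → (mfc u).im / (u.im + (mfc u).im) ≤ 1 / (1 + ε) := by
    intro u hu
    have hu0 := hε.trans_le hu
    have h1 := mfc_im_nonneg hu0
    have h2 : (mfc u).im ≤ 1 :=
      ((le_abs_self _).trans (Complex.abs_im_le_norm _)).trans (norm_mfc_le_one hu0)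
    rw [div_le_div_iff₀ (by linarith) (by linarith)]
    nlinarith
  have hn : 0 ≤ (mfc w).im / (w.im + (mfc w).im) :=
    div_nonneg (mfc_im_nonneg hw0) (by linarith [mfc_im_nonneg hw0])
  have h3 : ‖mfc z - mfc w‖ ^ 2 ≤ (‖z + mfc z - (w + mfc w)‖ * (1 / (1 + ε))) ^ 2 := by
    refine key.trans ?_
    rw [mul_pow, sq (1 / (1 + ε))]
    exact mul_le_mul_of_nonneg_left (mul_le_mul (hb z hz) (hb w hw) hn (by positivity))
      (sq_nonneg _)
  have h4 := le_of_sq_le_sq h3 (by positivity)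
  have h5 : ‖z + mfc z - (w + mfc w)‖ ≤ ‖z - w‖ + ‖mfc z - mfc w‖ := by
    rw [add_sub_add_comm]; exact norm_add_le _ _
  rw [mul_one_div, le_div_iff₀ (by linarith)] at h4
  rw [le_div_iff₀ hε]
  linarith

lemma gaussianReal_real_Icc_ge {x y R : ℝ} (hx : |x| ≤ R) (hy : |y| ≤ R) :
    gaussianPDFReal 0 1 R * (y - x) ≤ (gaussianReal 0 1).real (Set.Icc x y) := by
  have hpdf : ∀ t ∈ Set.Icc x y, gaussianPDFReal 0 1 R ≤ gaussianPDFReal 0 1 t := by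
    intro t ht
    have h1 : |t| ≤ R := abs_le.2 ⟨(neg_le_of_abs_le hx).trans ht.1, ht.2.trans (le_of_abs_le hy)⟩
    have h2 : t ^ 2 ≤ R ^ 2 := by rw [← sq_abs t]; exact pow_le_pow_left₀ (abs_nonneg _) h1 2
    unfold gaussianPDFReal
    refine mul_le_mul_of_nonneg_left (Real.exp_le_exp.2 ?_) (by positivity)
    simp
    linarith
  have h0 : 0 ≤ gaussianPDFReal 0 1 R := gaussianPDFReal_nonneg _ _ _
  have h1 : ENNReal.ofReal (gaussianPDFReal 0 1 R * (y - x)) ≤ gaussianReal 0 1 (Set.Icc x y) := by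
    rw [gaussianReal_apply 0 (by norm_num), ENNReal.ofReal_mul h0, ← Real.volume_Icc,
      ← setLIntegral_const]
    refine setLIntegral_mono' measurableSet_Icc fun t ht => ?_
    exact ENNReal.ofReal_le_ofReal (hpdf t ht)
  exact (ENNReal.ofReal_le_iff_le_toReal (measure_ne_top _ _)).1 h1

/-- The imaginary part of `z + m_fc(z)` is bounded below on compact sets. -/
lemma exists_le_im_add_mfc (L : ℝ) : ∃ b : ℝ, 0 < b ∧ b ≤ 1 ∧
    ∀ z : ℂ, 0 < z.im → |z.re| ≤ L → b ≤ (z + mfc z).im := by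
  have hpos : 0 < gaussianPDFReal 0 1 (L + 2) := gaussianPDFReal_pos 0 1 _ (by norm_num)
  refine ⟨min 1 (gaussianPDFReal 0 1 (L + 2)), lt_min one_pos hpos, min_le_left _ _,
    fun z hz hL => ?_⟩
  set w := z + mfc z with hw
  have hw0 : 0 < w.im := hz.trans_le (im_le_im_add_mfc hz)
  rcases le_total 1 w.im with h | h
  · exact (min_le_left _ _).trans h
  refine (min_le_right _ _).trans ?_
  have hre : |w.re| ≤ L + 1 := by
    rw [hw, Complex.add_re]
    exact (abs_add_le _ _).trans
      (add_le_add hL ((Complex.abs_re_le_norm _).trans (norm_mfc_le_one hz)))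
  have hI := abs_le.1 hre
  have h1 := gaussianReal_real_Icc_ge (x := w.re - w.im) (y := w.re + w.im) (R := L + 2)
    (abs_le.2 ⟨by linarith, by linarith⟩) (abs_le.2 ⟨by linarith, by linarith⟩)
  have h2 : (gaussStieltjes w).im ≤ w.im := by
    have := mfc_eq hz
    rw [← hw] at this
    rw [← this, hw, Complex.add_im]
    linarith
  have h3 := im_gaussStieltjes hw0
  set f : ℝ → ℝ := fun x => ‖1 / ((x : ℂ) - w)‖ ^ 2 with hf
  have i2 : Integrable f (gaussianReal 0 1) := (memLp_inv_sub hw0 2).integrable_norm_pow'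
  -- Within distance Im w of Re w one has |x - w|² ≤ 2 (Im w)². Since Im m_fc ≤ Im w, the Gaussian
  -- mass of that interval, at least its length times the density at L + 2, forces Im w to be at
  -- least this density.
  have h4 : 1 / (2 * w.im ^ 2) * (gaussianReal 0 1).real (Set.Icc (w.re - w.im) (w.re + w.im)) ≤
      ∫ x, f x ∂(gaussianReal 0 1) := by
    have h5 : ∫ x in Set.Icc (w.re - w.im) (w.re + w.im), 1 / (2 * w.im ^ 2) ∂(gaussianReal 0 1) ≤
        ∫ x in Set.Icc (w.re - w.im) (w.re + w.im), f x ∂(gaussianReal 0 1) := by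
      refine setIntegral_mono_on (integrable_const _) i2.integrableOn measurableSet_Icc
        fun x hx => ?_
      simp only [hf, norm_div, norm_one, div_pow, one_pow]
      refine one_div_le_one_div_of_le ?_ ?_
      · have := norm_pos_iff.2 (sub_ne_zero_of_im_pos hw0 x)
        positivity
      · rw [← Complex.normSq_eq_norm_sq, Complex.normSq_apply]
        simp only [Complex.sub_re, Complex.sub_im, Complex.ofReal_re, Complex.ofReal_im]
        have : (x - w.re) ^ 2 ≤ w.im ^ 2 := sq_le_sq' (by linarith [hx.1]) (by linarith [hx.2])
        nlinarith
    have h6 := setIntegral_le_integral (s := Set.Icc (w.re - w.im) (w.re + w.im)) i2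
      (Filter.Eventually.of_forall fun x => by positivity)
    rw [setIntegral_const, smul_eq_mul, mul_comm] at h5
    exact h5.trans h6
  have h7 : 1 / (2 * w.im ^ 2) * (gaussianPDFReal 0 1 (L + 2) * (2 * w.im)) ≤
      ∫ x, f x ∂(gaussianReal 0 1) := by
    refine le_trans (mul_le_mul_of_nonneg_left ?_ (by positivity)) h4
    linarith
  have h8 := mul_le_mul_of_nonneg_left h7 hw0.le
  rw [← h3] at h8
  have h9 : w.im * (1 / (2 * w.im ^ 2) * (gaussianPDFReal 0 1 (L + 2) * (2 * w.im))) =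
      gaussianPDFReal 0 1 (L + 2) := by field_simp
  linarith

end LaplacianLocalLaw
end

noncomputable section
namespace LaplacianLocalLaw

/-! ### Stability of the self-consistent equation -/

section Stability

variable {N : ℕ} {A : Matrix (Fin (N + 1)) (Fin (N + 1)) ℝ} {z : ℂ}

lemma mN_im (A : Matrix (Fin (N + 1)) (Fin (N + 1)) ℝ) (z : ℂ) :
    (mN A z).im = (1 / (N : ℝ)) * ∑ a, (resolvent A z a a).im := by
  unfold mN
  rw [show (1 / (N : ℂ)) = ((1 / (N : ℝ) : ℝ) : ℂ) by push_cast; rfl, Complex.im_ofReal_mul,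
    Matrix.trace, Complex.im_sum]
  rfl

lemma mN_im_nonneg (hA : ∀ i j, A i j = A j i) (hz : 0 < z.im) : 0 ≤ (mN A z).im := by
  rw [mN_im]
  exact mul_nonneg (by positivity) (Finset.sum_nonneg fun a _ => im_resolvent_nonneg hA hz a)

lemma im_diagStieltjes (A : Matrix (Fin (N + 1)) (Fin (N + 1)) ℝ) {w : ℂ} :
    (diagStieltjes A w).im = w.im * ((1 / (N : ℝ)) * ∑ a, ‖1 / ((A a a : ℂ) - w)‖ ^ 2) := by
  have h : ∀ x : ℝ, (1 / ((x : ℂ) - w)).im = w.im * ‖1 / ((x : ℂ) - w)‖ ^ 2 := by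
    intro x
    simp only [one_div, Complex.inv_im, norm_inv, inv_pow, ← Complex.normSq_eq_norm_sq]
    simp [div_eq_mul_inv]
  unfold diagStieltjes
  rw [show (1 / (N : ℂ)) = ((1 / (N : ℝ) : ℝ) : ℂ) by push_cast; rfl, Complex.im_ofReal_mul,
    Complex.im_sum]
  simp_rw [h]
  rw [← Finset.mul_sum]; ring

lemma inv_sub_sub_inv_sub {w₁ w₂ : ℂ} (h₁ : 0 < w₁.im) (h₂ : 0 < w₂.im) (x : ℝ) :
    1 / ((x : ℂ) - w₁) - 1 / ((x : ℂ) - w₂) =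
      (w₁ - w₂) * (1 / ((x : ℂ) - w₁) * (1 / ((x : ℂ) - w₂))) := by
  have := sub_ne_zero_of_im_pos h₁ x
  have := sub_ne_zero_of_im_pos h₂ x
  field_simp
  ring

lemma diagStieltjes_sub {w₁ w₂ : ℂ} (h₁ : 0 < w₁.im) (h₂ : 0 < w₂.im) :
    diagStieltjes A w₁ - diagStieltjes A w₂ = (w₁ - w₂) *
      ((1 / (N : ℂ)) * ∑ a, 1 / ((A a a : ℂ) - w₁) * (1 / ((A a a : ℂ) - w₂))) := by
  unfold diagStieltjes
  rw [← mul_sub, ← Finset.sum_sub_distrib]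
  simp_rw [inv_sub_sub_inv_sub h₁ h₂]
  rw [← Finset.mul_sum]; ring

/-- For p and r the two Cauchy factors, Re(p r) is half of |p|² + |r|² - |p - conj r|². Moreover p -
conj r = (w₁ - conj w₂) p conj r, and w₁ - conj w₂ has imaginary part Im w₁ + Im w₂. This quantifies
how far the average of p r stays away from 1. -/
lemma re_mul_inv_sub_le {w₁ w₂ : ℂ} (h₁ : 0 < w₁.im) (h₂ : 0 < w₂.im) (x : ℝ) :
    (1 / ((x : ℂ) - w₁) * (1 / ((x : ℂ) - w₂))).re ≤
      (‖1 / ((x : ℂ) - w₁)‖ ^ 2 + ‖1 / ((x : ℂ) - w₂)‖ ^ 2) / 2 -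
        (w₁.im + w₂.im) ^ 2 * (‖1 / ((x : ℂ) - w₁)‖ ^ 2 * ‖1 / ((x : ℂ) - w₂)‖ ^ 2) / 2 := by
  set p := 1 / ((x : ℂ) - w₁) with hp
  set r := 1 / ((x : ℂ) - w₂) with hr
  have e1 : (p * r).re = (‖p‖ ^ 2 + ‖r‖ ^ 2) / 2 - ‖p - (starRingEnd ℂ) r‖ ^ 2 / 2 := by
    simp only [← Complex.normSq_eq_norm_sq, Complex.normSq_apply, Complex.mul_re, Complex.sub_re,
      Complex.sub_im, Complex.conj_re, Complex.conj_im]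
    ring
  have e2 : p - (starRingEnd ℂ) r = (w₁ - (starRingEnd ℂ) w₂) * (p * (starRingEnd ℂ) r) := by
    have a1 := sub_ne_zero_of_im_pos h₁ x
    have a2 : (x : ℂ) - (starRingEnd ℂ) w₂ ≠ 0 := by
      have := sub_ne_zero_of_im_pos h₂ x
      intro h
      apply this
      have := congrArg (starRingEnd ℂ) h
      simpa using this
    rw [hp, hr]
    simp only [map_div₀, map_one, map_sub, Complex.conj_ofReal]
    field_simp
    ring
  have h3 : (w₁.im + w₂.im) ^ 2 ≤ ‖w₁ - (starRingEnd ℂ) w₂‖ ^ 2 := by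
    refine pow_le_pow_left₀ (by linarith) ?_ 2
    have := Complex.abs_im_le_norm (w₁ - (starRingEnd ℂ) w₂)
    rw [Complex.sub_im, Complex.conj_im, sub_neg_eq_add] at this
    exact (le_abs_self _).trans this
  rw [e1, e2, norm_mul, norm_mul, RCLike.norm_conj, mul_pow, mul_pow]
  have := mul_le_mul_of_nonneg_right h3 (show 0 ≤ ‖p‖ ^ 2 * ‖r‖ ^ 2 by positivity)
  linarith

lemma re_avg_mul_le (hN : 1 ≤ N) {w₁ w₂ : ℂ} (h₁ : 0 < w₁.im) (h₂ : 0 < w₂.im) {s : ℝ}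
    (hs : 0 ≤ s) (hs₁ : ∀ a, s ≤ ‖1 / ((A a a : ℂ) - w₁)‖)
    (hs₂ : ∀ a, s ≤ ‖1 / ((A a a : ℂ) - w₂)‖) :
    ((1 / (N : ℂ)) * ∑ a, 1 / ((A a a : ℂ) - w₁) * (1 / ((A a a : ℂ) - w₂))).re ≤
      ((diagStieltjes A w₁).im / w₁.im + (diagStieltjes A w₂).im / w₂.im) / 2 -
        (w₁.im + w₂.im) ^ 2 * s ^ 4 / 2 := by
  have hN' : (1 : ℝ) ≤ N := by exact_mod_cast hN
  rw [im_diagStieltjes, im_diagStieltjes, mul_div_cancel_left₀ _ h₁.ne',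
    mul_div_cancel_left₀ _ h₂.ne',
    show (1 / (N : ℂ)) = ((1 / (N : ℝ) : ℝ) : ℂ) by push_cast; rfl, Complex.re_ofReal_mul,
    Complex.re_sum]
  have h3 : ∀ a, (1 / ((A a a : ℂ) - w₁) * (1 / ((A a a : ℂ) - w₂))).re ≤
      (‖1 / ((A a a : ℂ) - w₁)‖ ^ 2 + ‖1 / ((A a a : ℂ) - w₂)‖ ^ 2) / 2 -
        (w₁.im + w₂.im) ^ 2 * s ^ 4 / 2 := by
    intro a
    refine (re_mul_inv_sub_le h₁ h₂ _).trans ?_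
    have h4 : s ^ 4 ≤ ‖1 / ((A a a : ℂ) - w₁)‖ ^ 2 * ‖1 / ((A a a : ℂ) - w₂)‖ ^ 2 := by
      calc s ^ 4 = s ^ 2 * s ^ 2 := by ring
        _ ≤ _ := mul_le_mul (pow_le_pow_left₀ hs (hs₁ a) 2) (pow_le_pow_left₀ hs (hs₂ a) 2)
          (by positivity) (by positivity)
    have := mul_le_mul_of_nonneg_left h4 (sq_nonneg (w₁.im + w₂.im))
    linarith
  have h5 := Finset.sum_le_sum fun a (_ : a ∈ Finset.univ) => h3 a
  rw [Finset.sum_sub_distrib, ← Finset.sum_div, Finset.sum_add_distrib, Finset.sum_const,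
    Finset.card_univ, Fintype.card_fin, nsmul_eq_mul] at h5
  have h6 := mul_le_mul_of_nonneg_left h5 (show 0 ≤ 1 / (N : ℝ) by positivity)
  refine h6.trans ?_
  have h7 : (w₁.im + w₂.im) ^ 2 * s ^ 4 / 2 ≤
      1 / (N : ℝ) * (((N + 1 : ℕ) : ℝ) * ((w₁.im + w₂.im) ^ 2 * s ^ 4 / 2)) := by
    rw [← mul_assoc]
    refine le_mul_of_one_le_left (by positivity) ?_
    push_cast
    rw [one_div, inv_mul_eq_div, le_div_iff₀ (by linarith)]
    linarith
  linarith

/-- Subtracting the two approximate equations gives (m₁ - m₂)(1 - X) = small, where X averages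
products of Cauchy factors. The imaginary part of each equation bounds the mean square of its
factors by 1 plus an error, so Re X is at most 1 minus the gap plus the errors. -/
lemma norm_sub_mul_le_of_le_norm (hN : 1 ≤ N) (hz : 0 < z.im) {m₁ m₂ : ℂ} (h₁ : 0 ≤ m₁.im)
    (h₂ : 0 ≤ m₂.im) {s : ℝ} (hs : 0 ≤ s) (hs₁ : ∀ a, s ≤ ‖1 / ((A a a : ℂ) - (z + m₁))‖)
    (hs₂ : ∀ a, s ≤ ‖1 / ((A a a : ℂ) - (z + m₂))‖) {ε₁ ε₂ : ℝ}
    (hε₁ : ‖m₁ - diagStieltjes A (z + m₁)‖ ≤ ε₁) (hε₂ : ‖m₂ - diagStieltjes A (z + m₂)‖ ≤ ε₂) :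
    ‖m₁ - m₂‖ * (((z + m₁).im + (z + m₂).im) ^ 2 * s ^ 4 / 2 -
      ε₁ / (2 * (z + m₁).im) - ε₂ / (2 * (z + m₂).im)) ≤ ε₁ + ε₂ := by
  set w₁ := z + m₁ with hw₁
  set w₂ := z + m₂ with hw₂
  have e₁ : w₁.im = z.im + m₁.im := Complex.add_im _ _
  have e₂ : w₂.im = z.im + m₂.im := Complex.add_im _ _
  have b₁ : 0 < w₁.im := by linarith
  have b₂ : 0 < w₂.im := by linarith
  set X := (1 / (N : ℂ)) * ∑ a, 1 / ((A a a : ℂ) - w₁) * (1 / ((A a a : ℂ) - w₂)) with hX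
  have hsub := diagStieltjes_sub (A := A) b₁ b₂
  rw [← hX, show w₁ - w₂ = m₁ - m₂ by rw [hw₁, hw₂]; ring] at hsub
  have hmul : (m₁ - m₂) * (1 - X) = (m₁ - diagStieltjes A w₁) - (m₂ - diagStieltjes A w₂) := by
    linear_combination hsub
  have hre := re_avg_mul_le hN b₁ b₂ hs hs₁ hs₂
  rw [← hX] at hre
  have key : ∀ (m w : ℂ) (ε : ℝ), 0 < w.im → m.im ≤ w.im → ‖m - diagStieltjes A w‖ ≤ ε →
      (diagStieltjes A w).im / w.im ≤ 1 + ε / w.im := by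
    intro m w ε hw hm hε
    have h := (abs_le.1 ((Complex.abs_im_le_norm _).trans hε)).1
    rw [Complex.sub_im] at h
    rw [← sub_nonneg, show 1 + ε / w.im - (diagStieltjes A w).im / w.im =
      (ε - (diagStieltjes A w).im + w.im) / w.im by field_simp; ring]
    exact div_nonneg (by linarith) hw.le
  have k₁ := key m₁ w₁ ε₁ b₁ (by linarith) hε₁
  have k₂ := key m₂ w₂ ε₂ b₂ (by linarith) hε₂
  have h5 : (w₁.im + w₂.im) ^ 2 * s ^ 4 / 2 - ε₁ / (2 * w₁.im) - ε₂ / (2 * w₂.im) ≤ ‖1 - X‖ := by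
    have h6 := (le_abs_self _).trans (Complex.abs_re_le_norm (1 - X))
    rw [Complex.sub_re, Complex.one_re] at h6
    have h7 : ε₁ / (2 * w₁.im) = ε₁ / w₁.im / 2 := by field_simp
    have h8 : ε₂ / (2 * w₂.im) = ε₂ / w₂.im / 2 := by field_simp
    rw [h7, h8]
    linarith
  refine (mul_le_mul_of_nonneg_left h5 (norm_nonneg _)).trans ?_
  rw [← norm_mul, hmul]
  exact (norm_sub_le _ _).trans (add_le_add hε₁ hε₂)

/-- Far from the diagonal entries the products in X are at most 1/4, and (N + 1) / N ≤ 2, so |X| ≤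
1/2 and no cancellation is required. -/
lemma norm_sub_le_of_norm_le (hN : 1 ≤ N) (hz : 0 < z.im) {m₁ m₂ : ℂ} (h₁ : 0 ≤ m₁.im)
    (h₂ : 0 ≤ m₂.im) (hs₁ : ∀ a, ‖1 / ((A a a : ℂ) - (z + m₁))‖ ≤ 1 / 2)
    (hs₂ : ∀ a, ‖1 / ((A a a : ℂ) - (z + m₂))‖ ≤ 1 / 2) {ε₁ ε₂ : ℝ}
    (hε₁ : ‖m₁ - diagStieltjes A (z + m₁)‖ ≤ ε₁) (hε₂ : ‖m₂ - diagStieltjes A (z + m₂)‖ ≤ ε₂) :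
    ‖m₁ - m₂‖ ≤ 2 * (ε₁ + ε₂) := by
  have hN' : (1 : ℝ) ≤ N := by exact_mod_cast hN
  set w₁ := z + m₁ with hw₁
  set w₂ := z + m₂ with hw₂
  have b₁ : 0 < w₁.im := by rw [hw₁, Complex.add_im]; linarith
  have b₂ : 0 < w₂.im := by rw [hw₂, Complex.add_im]; linarith
  set X := (1 / (N : ℂ)) * ∑ a, 1 / ((A a a : ℂ) - w₁) * (1 / ((A a a : ℂ) - w₂)) with hX
  have hsub := diagStieltjes_sub (A := A) b₁ b₂
  rw [← hX, show w₁ - w₂ = m₁ - m₂ by rw [hw₁, hw₂]; ring] at hsub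
  have hXn : ‖X‖ ≤ 1 / 2 := by
    rw [hX, norm_mul, norm_div, norm_one, Complex.norm_natCast]
    have h3 : ‖∑ a, 1 / ((A a a : ℂ) - w₁) * (1 / ((A a a : ℂ) - w₂))‖ ≤
        ∑ _a : Fin (N + 1), (1 / 2 * (1 / 2) : ℝ) := by
      refine norm_sum_le_of_le _ fun a _ => ?_
      rw [norm_mul]
      exact mul_le_mul (hs₁ a) (hs₂ a) (norm_nonneg _) (by norm_num)
    rw [Finset.sum_const, Finset.card_univ, Fintype.card_fin, nsmul_eq_mul] at h3
    refine (mul_le_mul_of_nonneg_left h3 (by positivity)).trans ?_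
    push_cast
    rw [one_div, inv_mul_eq_div, div_le_iff₀ (by linarith)]
    linarith
  have e : m₁ - m₂ = (m₁ - diagStieltjes A w₁) - (m₂ - diagStieltjes A w₂) + (m₁ - m₂) * X := by
    linear_combination hsub
  have h4 : ‖m₁ - m₂‖ ≤ ε₁ + ε₂ + ‖m₁ - m₂‖ * (1 / 2) := by
    calc ‖m₁ - m₂‖ = ‖(m₁ - diagStieltjes A w₁) - (m₂ - diagStieltjes A w₂) + (m₁ - m₂) * X‖ := by
          rw [← e]
      _ ≤ _ := (norm_add_le _ _).trans (add_le_add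
          ((norm_sub_le _ _).trans (add_le_add hε₁ hε₂)) (by
            rw [norm_mul]; exact mul_le_mul_of_nonneg_left hXn (norm_nonneg _)))
  linarith

lemma resolvent_eq_sub_remainder (hA : ∀ i j, A i j = A j i) (hz : 0 < z.im) (a b : Fin (N + 1)) :
    resolvent A z a b = ((if a = b then 1 else 0) - remainder A z a b) *
      (1 / ((A a a : ℂ) - (z + mN A z))) := by
  have h := sub_ne_zero_of_im_pos (w := z + mN A z)
    (by rw [Complex.add_im]; linarith [mN_im_nonneg hA hz]) (A a a)
  rw [mul_one_div, eq_div_iff h, remainder]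
  ring

/-- On the diagonal G_aa = (1 - R_aa) / (A_aa - z - m_N), and |1 - R_aa| ≥ 1/2, so the bound on G
passes to the reciprocal of the denominator. -/
lemma norm_inv_sub_mN_le (hA : ∀ i j, A i j = A j i) (hz : 0 < z.im) {Γ : ℝ}
    (hΓ : ∀ a b, ‖resolvent A z a b‖ ≤ Γ) (hR : remainderNorm A z ≤ 1 / 2) (a : Fin (N + 1)) :
    ‖1 / ((A a a : ℂ) - (z + mN A z))‖ ≤ 2 * Γ := by
  have h1 := resolvent_eq_sub_remainder hA hz a a
  rw [if_pos rfl] at h1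
  have h2 : 1 / 2 ≤ ‖1 - remainder A z a a‖ := by
    have h3 := norm_sub_norm_le (1 : ℂ) (remainder A z a a)
    rw [norm_one] at h3
    linarith [norm_remainder_le A z a a]
  have h4 := hΓ a a
  rw [h1, norm_mul] at h4
  have := mul_le_mul_of_nonneg_right h2 (norm_nonneg (1 / ((A a a : ℂ) - (z + mN A z))))
  linarith

lemma norm_mN_sub_diagStieltjes_le (hN : 1 ≤ N) (hA : ∀ i j, A i j = A j i) (hz : 0 < z.im) {Γ : ℝ}
    (hΓ : ∀ a b, ‖resolvent A z a b‖ ≤ Γ) (hR : remainderNorm A z ≤ 1 / 2) :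
    ‖mN A z - diagStieltjes A (z + mN A z)‖ ≤ 4 * Γ * remainderNorm A z := by
  have hN' : (1 : ℝ) ≤ N := by exact_mod_cast hN
  have e : mN A z - diagStieltjes A (z + mN A z) = (1 / (N : ℂ)) *
      ∑ a, -(remainder A z a a * (1 / ((A a a : ℂ) - (z + mN A z)))) := by
    have h1 : mN A z = (1 / (N : ℂ)) * ∑ a, resolvent A z a a := rfl
    have h2 : ∀ a, resolvent A z a a = (1 / ((A a a : ℂ) - (z + mN A z))) +
        -(remainder A z a a * (1 / ((A a a : ℂ) - (z + mN A z)))) := fun a => by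
      conv_lhs => rw [resolvent_eq_sub_remainder hA hz a a, if_pos rfl]
      ring
    rw [Finset.sum_congr rfl fun a _ => h2 a, Finset.sum_add_distrib, mul_add] at h1
    rw [diagStieltjes]
    linear_combination h1
  have hρ := remainderNorm_nonneg A z
  have hΓ0 : 0 ≤ Γ := (norm_nonneg _).trans (hΓ 0 0)
  rw [e, norm_mul, norm_div, norm_one, Complex.norm_natCast]
  have h3 : ‖∑ a, -(remainder A z a a * (1 / ((A a a : ℂ) - (z + mN A z))))‖ ≤
      ∑ _a : Fin (N + 1), remainderNorm A z * (2 * Γ) := by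
    refine norm_sum_le_of_le _ fun a _ => ?_
    rw [norm_neg, norm_mul]
    exact mul_le_mul (norm_remainder_le A z a a) (norm_inv_sub_mN_le hA hz hΓ hR a)
      (norm_nonneg _) hρ
  rw [Finset.sum_const, Finset.card_univ, Fintype.card_fin, nsmul_eq_mul] at h3
  refine (mul_le_mul_of_nonneg_left h3 (by positivity)).trans ?_
  push_cast
  have hx : 0 ≤ remainderNorm A z * (2 * Γ) := by positivity
  rw [one_div, inv_mul_eq_div, div_le_iff₀ (by linarith)]
  nlinarith

/-- The gap is at least T^(-14) / 2, from (Im w₂)² ≥ T^(-2) and s⁴ = T^(-12). The errors, divided by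
the imaginary parts, are at most 3 T^19 ψ, and the bound on T^50 ψ makes them a fraction of T^(-15).
-/
lemma stability_margin {T ψ b₁ b₂ s : ℝ} (hT : 4 ≤ T) (hψ : 0 ≤ ψ) (hψ' : T ^ 50 * ψ ≤ 2)
    (h₁ : 1 / T ^ 2 ≤ b₁) (h₂ : 1 / T ≤ b₂) (hs : s = 1 / T ^ 3) :
    1 / T ^ 15 ≤ (b₁ + b₂) ^ 2 * s ^ 4 / 2 - (4 * T ^ 17 * ψ) / (2 * b₁) - (T ^ 7 * ψ) / (2 * b₂) := by
  have hT0 : 0 < T := by linarith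
  have hb₁ : 0 < b₁ := lt_of_lt_of_le (by positivity) h₁
  have hb₂ : 0 < b₂ := lt_of_lt_of_le (by positivity) h₂
  have a1 : 1 / T ^ 14 ≤ (b₁ + b₂) ^ 2 * s ^ 4 := by
    have : (1 / T) ^ 2 ≤ (b₁ + b₂) ^ 2 := pow_le_pow_left₀ (by positivity) (by linarith) 2
    calc 1 / T ^ 14 = (1 / T) ^ 2 * s ^ 4 := by rw [hs]; field_simp
      _ ≤ _ := mul_le_mul_of_nonneg_right this (by rw [hs]; positivity)
  have a2 : (4 * T ^ 17 * ψ) / (2 * b₁) ≤ 2 * T ^ 19 * ψ := by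
    rw [div_le_iff₀ (by positivity)]
    have : 1 ≤ T ^ 2 * b₁ := by
      rw [div_le_iff₀ (by positivity)] at h₁; linarith
    calc 4 * T ^ 17 * ψ = 4 * T ^ 17 * ψ * 1 := by ring
      _ ≤ 4 * T ^ 17 * ψ * (T ^ 2 * b₁) := mul_le_mul_of_nonneg_left this (by positivity)
      _ = _ := by ring
  have a3 : (T ^ 7 * ψ) / (2 * b₂) ≤ T ^ 19 * ψ := by
    rw [div_le_iff₀ (by positivity)]
    have : 1 ≤ T * b₂ := by
      rw [div_le_iff₀ (by positivity)] at h₂; linarith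
    have h8 : T ^ 8 ≤ T ^ 19 := pow_le_pow_right₀ (by linarith) (by norm_num)
    have : T ^ 7 * ψ * 1 ≤ T ^ 7 * ψ * (T * b₂) := mul_le_mul_of_nonneg_left this (by positivity)
    have h9 : T ^ 8 * (ψ * b₂) ≤ T ^ 19 * (ψ * b₂) := mul_le_mul_of_nonneg_right h8 (by positivity)
    have : 0 ≤ T ^ 19 * (ψ * b₂) := by positivity
    linarith
  have a4 : T ^ 19 * ψ ≤ 1 / T ^ 15 / 8 := by
    have h16 : (16 : ℝ) ≤ T ^ 16 := by
      calc (16 : ℝ) ≤ 4 ^ 16 := by norm_num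
        _ ≤ _ := pow_le_pow_left₀ (by norm_num) hT 16
    have h3 : (T ^ 34 * ψ) * 16 ≤ 2 := by
      refine le_trans ?_ hψ'
      calc _ ≤ (T ^ 34 * ψ) * T ^ 16 := mul_le_mul_of_nonneg_left h16 (by positivity)
        _ = _ := by ring
    rw [div_div, le_div_iff₀ (by positivity)]
    linarith
  have a5 : 4 * (1 / T ^ 15) ≤ 1 / T ^ 14 := by
    rw [mul_one_div, div_le_div_iff₀ (by positivity) (by positivity)]
    have : T ^ 14 * 4 ≤ T ^ 14 * T := mul_le_mul_of_nonneg_left hT (by positivity)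
    linarith
  have : 0 ≤ 1 / T ^ 15 := by positivity
  linarith

/-- The self-consistent equation with small errors determines the resolvent. -/
lemma resolvent_close_of_remainder (hN : 1 ≤ N) (hA : ∀ i j, A i j = A j i) (hz : 0 < z.im)
    {T ψ : ℝ} (hT : 4 ≤ T) (hψ : 0 ≤ ψ) (hψ' : T ^ 50 * ψ ≤ 2)
    (hΓ : ∀ a b, ‖resolvent A z a b‖ ≤ T ^ 2) (hv : ∀ a, |A a a| ≤ T)
    (hR : remainderNorm A z ≤ T ^ 15 * ψ)
    (hF : ‖mfc z - diagStieltjes A (z + mfc z)‖ ≤ T ^ 7 * ψ)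
    (hcase : ((∀ a, ‖1 / ((A a a : ℂ) - (z + mN A z))‖ ≤ 1 / 2) ∧
        ∀ a, ‖1 / ((A a a : ℂ) - (z + mfc z))‖ ≤ 1 / 2) ∨
      (‖z‖ ≤ T ∧ 1 / T ^ 2 ≤ (z + mN A z).im ∧ 1 / T ≤ (z + mfc z).im)) :
    ‖mN A z - mfc z‖ ≤ T ^ 40 * ψ ∧
      ∀ a b, ‖resolvent A z a b - if a = b then 1 / ((A a a : ℂ) - (z + mfc z)) else 0‖ ≤
        T ^ 40 * ψ := by
  have hT1 : 1 ≤ T := by linarith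
  have hT0 : 0 < T := by linarith
  have m1 := mN_im_nonneg hA hz
  have m2 := mfc_im_nonneg hz
  have b₁ : 0 < (z + mN A z).im := by rw [Complex.add_im]; linarith
  have b₂ : 0 < (z + mfc z).im := by rw [Complex.add_im]; linarith
  have hψ35 : T ^ 15 * ψ ≤ 1 / 2 := by
    have h4 : (4 : ℝ) ≤ T ^ 35 := by
      calc (4 : ℝ) ≤ 4 ^ 35 := by norm_num
        _ ≤ _ := pow_le_pow_left₀ (by norm_num) hT 35
    have : T ^ 15 * ψ * 4 ≤ T ^ 15 * ψ * T ^ 35 := mul_le_mul_of_nonneg_left h4 (by positivity)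
    have e : T ^ 15 * ψ * T ^ 35 = T ^ 50 * ψ := by ring
    linarith
  have hR2 := hR.trans hψ35
  have hx : ∀ a, ‖1 / ((A a a : ℂ) - (z + mN A z))‖ ≤ 2 * T ^ 2 :=
    norm_inv_sub_mN_le hA hz hΓ hR2
  have he₁ : ‖mN A z - diagStieltjes A (z + mN A z)‖ ≤ 4 * T ^ 17 * ψ := by
    refine (norm_mN_sub_diagStieltjes_le hN hA hz hΓ hR2).trans ?_
    calc _ ≤ 4 * T ^ 2 * (T ^ 15 * ψ) := mul_le_mul_of_nonneg_left hR (by positivity)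
      _ = _ := by ring
  have hmN : ‖mN A z‖ ≤ 2 * T ^ 2 := norm_mN_le hN fun a => hΓ a a
  have hp : T ^ 7 * ψ ≤ T ^ 17 * ψ :=
    mul_le_mul_of_nonneg_right (pow_le_pow_right₀ hT1 (by norm_num)) hψ
  have main : ‖mN A z - mfc z‖ ≤ T ^ 34 * ψ ∧ ∀ a, ‖1 / ((A a a : ℂ) - (z + mfc z))‖ ≤ T := by
    rcases hcase with ⟨h1, h2⟩ | ⟨h1, h2, h3⟩
    · refine ⟨?_, fun a => (h2 a).trans (by linarith)⟩
      refine (norm_sub_le_of_norm_le hN hz m1 m2 h1 h2 he₁ hF).trans ?_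
      have h10 : (10 : ℝ) ≤ T ^ 17 := by
        calc (10 : ℝ) ≤ 4 ^ 17 := by norm_num
          _ ≤ _ := pow_le_pow_left₀ (by norm_num) hT 17
      have : 10 * (T ^ 17 * ψ) ≤ T ^ 17 * (T ^ 17 * ψ) :=
        mul_le_mul_of_nonneg_right h10 (by positivity)
      have e : T ^ 17 * (T ^ 17 * ψ) = T ^ 34 * ψ := by ring
      linarith
    -- In the bounded region the denominators are at most T + T + 2T² ≤ T³, which is the lower bound
    -- s for the Cauchy factors in the gap.
    · have hlow : ∀ (m : ℂ), 0 < (z + m).im → ‖m‖ ≤ 2 * T ^ 2 → ∀ a,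
          1 / T ^ 3 ≤ ‖1 / ((A a a : ℂ) - (z + m))‖ := by
        intro m hm hm2 a
        rw [norm_div, norm_one]
        refine one_div_le_one_div_of_le (norm_pos_iff.2 (sub_ne_zero_of_im_pos hm _)) ?_
        have h5 : ‖(A a a : ℂ) - (z + m)‖ ≤ |A a a| + (‖z‖ + ‖m‖) := by
          refine (norm_sub_le _ _).trans (add_le_add ?_ (norm_add_le _ _))
          rw [Complex.norm_real, Real.norm_eq_abs]
        have h6 := hv a
        have h7 : 4 * T ^ 2 ≤ T ^ 3 := by
          calc 4 * T ^ 2 ≤ T * T ^ 2 := mul_le_mul_of_nonneg_right hT (by positivity)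
            _ = _ := by ring
        have h8 : T ≤ T ^ 2 := le_self_pow₀ hT1 (by norm_num)
        linarith
      have hm2 : ‖mfc z‖ ≤ 2 * T ^ 2 := (norm_mfc_le_one hz).trans (by nlinarith)
      have h4 := norm_sub_mul_le_of_le_norm hN hz m1 m2 (s := 1 / T ^ 3) (by positivity)
        (hlow _ b₁ hmN) (hlow _ b₂ hm2) he₁ hF
      have h5 := stability_margin hT hψ hψ' h2 h3 rfl
      have h6 := (mul_le_mul_of_nonneg_left h5 (norm_nonneg _)).trans h4
      refine ⟨?_, fun a => ?_⟩
      · rw [mul_one_div, div_le_iff₀ (by positivity)] at h6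
        refine h6.trans ?_
        have h10 : (5 : ℝ) ≤ T ^ 2 := by nlinarith
        have : 5 * (T ^ 17 * ψ * T ^ 15) ≤ T ^ 2 * (T ^ 17 * ψ * T ^ 15) :=
          mul_le_mul_of_nonneg_right h10 (by positivity)
        have e : T ^ 2 * (T ^ 17 * ψ * T ^ 15) = T ^ 34 * ψ := by ring
        have h11 : (4 * T ^ 17 * ψ + T ^ 7 * ψ) * T ^ 15 ≤ (5 * (T ^ 17 * ψ)) * T ^ 15 :=
          mul_le_mul_of_nonneg_right (by linarith) (by positivity)
        linarith
      · refine (norm_inv_sub_le b₂ _).trans ?_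
        rw [div_le_iff₀ b₂]
        rw [div_le_iff₀ hT0] at h3
        linarith
  obtain ⟨hm, hy⟩ := main
  have h34 : T ^ 34 * ψ ≤ T ^ 40 * ψ :=
    mul_le_mul_of_nonneg_right (pow_le_pow_right₀ hT1 (by norm_num)) hψ
  refine ⟨hm.trans h34, fun a b => ?_⟩
  set x := 1 / ((A a a : ℂ) - (z + mN A z)) with hxd
  set y := 1 / ((A a a : ℂ) - (z + mfc z)) with hyd
  -- The deviation consists of the remainder times the reciprocal at m_N and, on the diagonal, the
  -- effect of replacing m_N by m_fc.
  have e : resolvent A z a b - (if a = b then y else 0) =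
      -(remainder A z a b * x) + (if a = b then (mN A z - mfc z) * (x * y) else 0) := by
    rw [resolvent_eq_sub_remainder hA hz a b, ← hxd]
    have h1 := inv_sub_sub_inv_sub b₁ b₂ (A a a)
    rw [← hxd, ← hyd] at h1
    split_ifs with hab
    · linear_combination h1
    · ring
  have n1 : ‖remainder A z a b * x‖ ≤ (T ^ 15 * ψ) * (2 * T ^ 2) := by
    rw [norm_mul]
    exact mul_le_mul ((norm_remainder_le A z a b).trans hR) (hx a) (norm_nonneg _) (by positivity)
  have n2 : ‖if a = b then (mN A z - mfc z) * (x * y) else 0‖ ≤ (T ^ 34 * ψ) * (2 * T ^ 2 * T) := by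
    split_ifs
    · rw [norm_mul, norm_mul]
      exact mul_le_mul hm (mul_le_mul (hx a) (hy a) (norm_nonneg _) (by positivity))
        (by positivity) (by positivity)
    · rw [norm_zero]; positivity
  rw [e]
  refine (norm_add_le _ _).trans ?_
  rw [norm_neg]
  have p1 : T ^ 17 * ψ ≤ T ^ 37 * ψ :=
    mul_le_mul_of_nonneg_right (pow_le_pow_right₀ hT1 (by norm_num)) hψ
  have p2 : 4 * (T ^ 37 * ψ) ≤ T ^ 3 * (T ^ 37 * ψ) := by
    refine mul_le_mul_of_nonneg_right ?_ (by positivity)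
    exact hT.trans (le_self_pow₀ hT1 (by norm_num))
  have e2 : T ^ 3 * (T ^ 37 * ψ) = T ^ 40 * ψ := by ring
  linarith

end Stability

end LaplacianLocalLaw
end

noncomputable section
namespace LaplacianLocalLaw

universe u v w

variable {β : ℝ} {c : ℕ → ℝ} {P : ℕ}

/-! ### Descent in the spectral parameter -/

lemma WHP.union {ι : Ensemble.{u} β c → Type v} {S S' : ∀ M, Set (ι M)}
    {A : ∀ M : Ensemble.{u} β c, ι M → Set M.Ω} (h : WHP S A) (h' : WHP S' A) :
    WHP (fun M => S M ∪ S' M) A := by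
  intro k
  obtain ⟨N₁, h1⟩ := h k
  obtain ⟨N₂, h2⟩ := h' k
  refine ⟨max N₁ N₂, fun M hM x hx => ?_⟩
  rcases hx with hx | hx
  · exact h1 M (le_of_max_le_left hM) x hx
  · exact h2 M (le_of_max_le_right hM) x hx

/-- The diagonal entries are close to a Gaussian sample. -/
lemma whp_diagStieltjes_sub_le (hβ : 0 < β) (hP : P ≠ 0) (hPβ : 2 ≤ β * P) {b : ℝ} (hb : 0 < b) :
    WHP (fun M : Ensemble.{u} β c => {w : ℂ | b ≤ w.im} ∪
      {w : ℂ | 1 / (M.N : ℝ) ≤ w.im ∧ scale P M.N ^ 3 ≤ |w.re|})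
      (fun M w => {ω | ‖diagStieltjes (M.H ω) w - gaussStieltjes w‖ ≤ scale P M.N ^ 7 / M.q}) := by
  refine WHP.union ?_ (whp_diagStieltjes_sub_le_of_le_re hβ hP hPβ fun M w hw => hw)
  refine (whp_diagStieltjes_sub_le_of_le_im hβ hP hPβ hb (S := fun _ => {w : ℂ | b ≤ w.im})
    fun M w hw => hw).mono (fun M w => w) ⟨1, fun M hM w hw => ⟨hw, fun ω hω => ?_⟩⟩
  refine le_trans (show ‖diagStieltjes (M.H ω) w - gaussStieltjes w‖ ≤ _ from hω) ?_
  have hT1 := one_le_scale P hM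
  have hq := M.one_le_q hβ hM
  exact div_le_div_of_nonneg_right (pow_le_pow_right₀ hT1 (by norm_num)) (by linarith)

/-- Spectral parameters at which the self-consistent equation is stable and above the optimal
scale. -/
def stableSet (P : ℕ) (L : ℝ) (N : ℕ) : Set ℂ :=
  {z | (2 ≤ z.im ∨ scale P N ^ 4 ≤ |z.re| ∨ |z.re| ≤ L ∧ z.im ≤ 2) ∧
    scale P N ^ 100 ≤ N * z.im}

/-- The event that the resolvent is close to its deterministic equivalent. -/
def closeEvent (P : ℕ) (M : Ensemble.{u} β c) (z : ℂ) : Set M.Ω :=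
  {ω | ‖mN (M.H ω) z - mfc z‖ ≤ scale P M.N ^ 40 * Psi M.N M.q z ∧
    ∀ a b, ‖resolvent (M.H ω) z a b - if a = b then 1 / ((M.H ω a a : ℂ) - (z + mfc z)) else 0‖ ≤
      scale P M.N ^ 40 * Psi M.N M.q z}

lemma im_pos_of_mem_stableSet {L : ℝ} {N : ℕ} (hN : 1 ≤ N) {z : ℂ} (hz : z ∈ stableSet P L N) :
    0 < z.im := by
  have h1 : 0 < scale P N ^ 100 := pow_pos (by linarith [one_le_scale P hN]) _
  exact pos_of_mul_pos_right (h1.trans_le hz.2) (Nat.cast_nonneg _)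

lemma Psi_nonneg {N : ℕ} {q : ℝ} (hq : 0 ≤ q) (z : ℂ) : 0 ≤ Psi N q z := by
  rw [Psi_eq]; positivity

lemma scale_pow_mul_Psi_le {T q x : ℝ} (hT : 1 ≤ T) (hq : T ^ 50 ≤ q) (hx : T ^ 100 ≤ x) :
    T ^ 50 * (1 / q + 1 / √x) ≤ 2 := by
  have h0 : 0 < T ^ 50 := by positivity
  have h1 : T ^ 50 ≤ √x := by
    refine Real.le_sqrt_of_sq_le ?_
    rw [← pow_mul]; exact hx
  have h2 : T ^ 50 * (1 / q) ≤ 1 := by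
    rw [mul_one_div, div_le_one (by linarith)]; exact hq
  have h3 : T ^ 50 * (1 / √x) ≤ 1 := by
    rw [mul_one_div, div_le_one (by linarith)]; exact h1
  rw [mul_add]; linarith

lemma two_le_norm_sub_of_re {T v : ℝ} {z m : ℂ} (hT : 4 ≤ T) (hz : T ^ 4 ≤ |z.re|) (hv : |v| ≤ T)
    (hm : ‖m‖ ≤ 2 * T ^ 2) : 2 ≤ ‖(v : ℂ) - (z + m)‖ := by
  have h1 := Complex.abs_re_le_norm ((v : ℂ) - (z + m))
  have h2 : ((v : ℂ) - (z + m)).re = v - (z.re + m.re) := by simp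
  rw [h2] at h1
  have h3 : |z.re| ≤ |v - (z.re + m.re)| + (|v| + |m.re|) := by
    have e : z.re = -(v - (z.re + m.re)) + (v + -m.re) := by ring
    calc |z.re| = |-(v - (z.re + m.re)) + (v + -m.re)| := by rw [← e]
      _ ≤ _ := (abs_add_le _ _).trans (add_le_add (abs_neg _).le
        ((abs_add_le _ _).trans (by rw [abs_neg])))
  have h4 := (Complex.abs_re_le_norm m).trans hm
  have h5 : 16 * T ^ 2 ≤ T ^ 4 := by
    have : (16 : ℝ) ≤ T ^ 2 := by nlinarith
    calc 16 * T ^ 2 ≤ T ^ 2 * T ^ 2 := mul_le_mul_of_nonneg_right this (sq_nonneg T)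
      _ = _ := by ring
  nlinarith

lemma norm_inv_le_half {x : ℂ} (h : 2 ≤ ‖x‖) : ‖1 / x‖ ≤ 1 / 2 := by
  rw [norm_div, norm_one]
  exact one_div_le_one_div_of_le (by norm_num) h

/-- One round of the argument: from the weak bounds T² on G and T^(-2) on Im(z + m_N) to the law
itself. The second bound is only required where z is neither high nor far out, since elsewhere
stability is automatic. -/
lemma whp_closeEvent (hβ : 0 < β) (hP : P ≠ 0) (hPβ : 100 ≤ β * P) {L : ℝ}
    (hL : 0 ≤ L) {S : Ensemble.{u} β c → Set ℂ} (hS : ∀ M, S M ⊆ stableSet P L M.N)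
    (hΓ : WHP S (fun M z => {ω | ∀ a b, ‖resolvent (M.H ω) z a b‖ ≤ scale P M.N ^ 2}))
    (hb : WHP S (fun M z => {ω | |z.re| ≤ L → z.im ≤ 2 →
      1 / scale P M.N ^ 2 ≤ (z + mN (M.H ω) z).im})) :
    WHP S (closeEvent P) := by
  obtain ⟨b, hb0, hb1, hbm⟩ := exists_le_im_add_mfc L
  have hrem : WHP S (fun M z => {ω | remainderNorm (M.H ω) z ≤
      scale P M.N ^ 15 * Psi M.N M.q z}) := by
    obtain ⟨N₀, h1⟩ : ∃ N₀ : ℕ, 1 ≤ N₀ := ⟨1, le_rfl⟩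
    -- The conditions on the spectral parameters are required for every ensemble, not only for large
    -- N, so the set is emptied when N = 0.
    have h2 := whp_remainderNorm_le hβ hP (by linarith)
      (S := fun M => {z | z ∈ S M ∧ 1 ≤ M.N}) (fun M z hz => by
        have hT1 := one_le_scale P hz.2
        exact ⟨im_pos_of_mem_stableSet hz.2 (hS M hz.1),
          (pow_le_pow_right₀ hT1 (by norm_num)).trans (hS M hz.1).2⟩)
      (hΓ.mono (fun M z => z) ⟨0, fun M _ z hz => ⟨hz.1, subset_rfl⟩⟩)
    exact h2.mono (fun M z => z) ⟨N₀, fun M hM z hz => ⟨⟨hz, h1.trans hM⟩, subset_rfl⟩⟩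
  -- The comparison with the Gaussian transform is used at z + m_fc(z), which is deterministic, so
  -- the pointwise statement suffices; at the random point z + m_N it would have to be uniform.
  have hF := (whp_diagStieltjes_sub_le.{u} (c := c) hβ hP (by linarith) hb0).mono (S' := S)
    (A' := fun M z => {ω | ‖mfc z - diagStieltjes (M.H ω) (z + mfc z)‖ ≤ scale P M.N ^ 7 / M.q})
    (fun M z => z + mfc z) (by
      obtain ⟨N₀, hN₀, h4⟩ := eventually_le_scale hP 4
      refine ⟨N₀, fun M hM z hz => ?_⟩
      have hM1 := hN₀.trans hM
      have hT := h4 M.N hM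
      have hz0 := im_pos_of_mem_stableSet hM1 (hS M hz)
      refine ⟨?_, fun ω hω => ?_⟩
      · rcases (hS M hz).1 with h | h | ⟨h, h'⟩
        · exact Or.inl (show b ≤ _ by linarith [im_le_im_add_mfc hz0])
        · refine Or.inr ⟨?_, ?_⟩
          · refine le_trans ?_ (im_le_im_add_mfc hz0)
            have hN' : (0 : ℝ) < M.N := by exact_mod_cast hM1
            rw [div_le_iff₀ hN', mul_comm]
            exact (one_le_pow₀ (by linarith)).trans (hS M hz).2
          · have h5 := abs_sub_abs_le_abs_sub z.re (-(mfc z).re)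
            rw [abs_neg, sub_neg_eq_add, ← Complex.add_re] at h5
            have h6 := (Complex.abs_re_le_norm _).trans (norm_mfc_le_one hz0)
            have h7 : 4 * scale P M.N ^ 3 ≤ scale P M.N ^ 4 := by
              calc 4 * scale P M.N ^ 3 ≤ scale P M.N * scale P M.N ^ 3 :=
                    mul_le_mul_of_nonneg_right hT (by positivity)
                _ = _ := by ring
            have h8 : 1 ≤ scale P M.N ^ 3 := one_le_pow₀ (by linarith)
            linarith
        · exact Or.inl (hbm z hz0 h)
      · have h5 : ‖diagStieltjes (M.H ω) (z + mfc z) - gaussStieltjes (z + mfc z)‖ ≤ _ := hω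
        rw [← mfc_eq hz0, norm_sub_rev] at h5
        exact h5)
  obtain ⟨N₀, hN₀, h4⟩ := eventually_le_scale hP (4 + (L + 2) + 1 / b)
  refine ((hΓ.inter hb).inter ((hrem.inter hF).inter
    (whp_abs_diag_le hβ hP (by linarith) S))).mono (fun M z => z)
    ⟨N₀, fun M hM z hz => ⟨hz, fun ω hω => ?_⟩⟩
  obtain ⟨⟨o1, o2⟩, ⟨o3, o4⟩, o5⟩ := hω
  have o1 : ∀ a b, ‖resolvent (M.H ω) z a b‖ ≤ scale P M.N ^ 2 := o1
  have o2 : |z.re| ≤ L → z.im ≤ 2 → 1 / scale P M.N ^ 2 ≤ (z + mN (M.H ω) z).im := o2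
  have o3 : remainderNorm (M.H ω) z ≤ scale P M.N ^ 15 * Psi M.N M.q z := o3
  have o4 : ‖mfc z - diagStieltjes (M.H ω) (z + mfc z)‖ ≤ scale P M.N ^ 7 / M.q := o4
  have o5 : ∀ a, |M.H ω a a| ≤ scale P M.N := o5
  have hM1 := hN₀.trans hM
  have hT := h4 M.N hM
  have hib : 0 < 1 / b := by positivity
  have hz0 := im_pos_of_mem_stableSet hM1 (hS M hz)
  have hq1 := M.one_le_q hβ hM1
  have hT1 := one_le_scale P hM1
  have hA := M.hsymm ω
  have hψ : 0 ≤ Psi M.N M.q z := Psi_nonneg (by linarith) z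
  have hmN := norm_mN_le hM1 fun a => o1 a a
  have hψ' : scale P M.N ^ 50 * Psi M.N M.q z ≤ 2 := by
    rw [Psi_eq]
    exact scale_pow_mul_Psi_le hT1 (M.scale_pow_le_q hP (by push_cast; linarith) hM1) (hS M hz).2
  have o4' : ‖mfc z - diagStieltjes (M.H ω) (z + mfc z)‖ ≤ scale P M.N ^ 7 * Psi M.N M.q z := by
    refine o4.trans ?_
    rw [div_eq_mul_one_div, Psi_eq]
    exact mul_le_mul_of_nonneg_left (le_add_of_nonneg_right (by positivity)) (by positivity)
  have hT4 : 4 ≤ scale P M.N := by linarith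
  have him₁ : z.im ≤ (z + mN (M.H ω) z).im := by
    rw [Complex.add_im]; linarith [mN_im_nonneg hA hz0]
  have him₂ := im_le_im_add_mfc hz0
  have hmfc : ‖mfc z‖ ≤ 2 * scale P M.N ^ 2 := (norm_mfc_le_one hz0).trans (by nlinarith)
  have e : closeEvent P M z = {ω | ‖mN (M.H ω) z - mfc z‖ ≤ scale P M.N ^ 40 * Psi M.N M.q z ∧
    ∀ a b, ‖resolvent (M.H ω) z a b - if a = b then 1 / ((M.H ω a a : ℂ) - (z + mfc z)) else 0‖ ≤
      scale P M.N ^ 40 * Psi M.N M.q z} := rfl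
  rw [e]
  refine resolvent_close_of_remainder hM1 hA hz0 hT4 hψ hψ' o1 o5 o3 o4' ?_
  rcases (hS M hz).1 with h | h | ⟨h, h'⟩
  · exact Or.inl ⟨fun a => norm_inv_le_half ((h.trans him₁).trans (im_le_norm_sub _)),
      fun a => norm_inv_le_half ((h.trans him₂).trans (im_le_norm_sub _))⟩
  · exact Or.inl ⟨fun a => norm_inv_le_half (two_le_norm_sub_of_re hT4 h (o5 a) hmN),
      fun a => norm_inv_le_half (two_le_norm_sub_of_re hT4 h (o5 a) hmfc)⟩
  · refine Or.inr ⟨?_, o2 h h', ?_⟩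
    · have h7 := Complex.norm_le_abs_re_add_abs_im z
      rw [abs_of_pos hz0] at h7
      linarith
    · refine le_trans ?_ (hbm z hz0 h)
      rw [div_le_iff₀ (by linarith)]
      have h8 : 1 / b ≤ scale P M.N := by linarith
      rw [div_le_iff₀ hb0] at h8
      linarith

/-- The spectral parameter with imaginary part enlarged by the factor `T`, but not above `2`. -/
def lift (T : ℝ) (z : ℂ) : ℂ := ⟨z.re, max z.im (min 2 (T * z.im))⟩

lemma lift_im_le {T : ℝ} (hT : 1 ≤ T) {z : ℂ} (hz : 0 < z.im) : (lift T z).im ≤ T * z.im :=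
  max_le (le_mul_of_one_le_left hz.le hT) (min_le_right _ _)

lemma le_lift_im (T : ℝ) (z : ℂ) : z.im ≤ (lift T z).im := le_max_left _ _

lemma lift_mem_stableSet {L : ℝ} {N : ℕ} {T : ℝ} {z : ℂ} (hz : z ∈ stableSet P L N) :
    lift T z ∈ stableSet P L N := by
  refine ⟨?_, hz.2.trans (mul_le_mul_of_nonneg_left (le_lift_im T z) (Nat.cast_nonneg _))⟩
  rcases hz.1 with h | h | ⟨h, h'⟩
  · exact Or.inl (h.trans (le_lift_im T z))
  · exact Or.inr (Or.inl h)
  · exact Or.inr (Or.inr ⟨h, max_le h' (min_le_left _ _)⟩)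

lemma le_lift_im_of_le {T : ℝ} (hT : 1 ≤ T) {z : ℂ} {k : ℕ} (hz : 2 / T ^ (k + 1) ≤ z.im) :
    2 / T ^ k ≤ (lift T z).im := by
  have hT0 : 0 < T := by linarith
  refine le_max_of_le_right (le_min ?_ ?_)
  · exact div_le_self (by norm_num) (one_le_pow₀ hT)
  · calc 2 / T ^ k = T * (2 / T ^ (k + 1)) := by rw [pow_succ]; field_simp
      _ ≤ _ := mul_le_mul_of_nonneg_left hz hT0.le

/-- Each Im G_aa loses at most a factor 4T when the point is lowered, and Im z loses at most T, so
their sum loses at most 4T. -/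
lemma mN_im_ge_of_lift {N : ℕ} {A : Matrix (Fin (N + 1)) (Fin (N + 1)) ℝ}
    (hA : ∀ i j, A i j = A j i) {z : ℂ} (hz : 0 < z.im) {T : ℝ} (hT : 1 ≤ T) :
    1 / (4 * T) * (lift T z + mN A (lift T z)).im ≤ (z + mN A z).im := by
  have hT0 : 0 < T := by linarith
  set ζ := lift T z with hζ
  have hle : z.im ≤ ζ.im := le_lift_im T z
  have hζ0 := hz.trans_le hle
  have hr : 1 / T ≤ z.im / ζ.im := by
    rw [div_le_div_iff₀ hT0 hζ0, one_mul, mul_comm]; exact lift_im_le hT hz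
  have h1 : 1 / (4 * T) * (mN A ζ).im ≤ (mN A z).im := by
    rw [mN_im, mN_im, ← mul_assoc, mul_comm (1 / (4 * T)), mul_assoc, Finset.mul_sum]
    refine mul_le_mul_of_nonneg_left (Finset.sum_le_sum fun a _ => ?_) (by positivity)
    refine le_trans ?_ (im_resolvent_ge_of_im_le hA hz hle rfl a)
    have := mul_le_mul_of_nonneg_right hr (im_resolvent_nonneg hA hζ0 a)
    have e : 1 / (4 * T) * (resolvent A ζ a a).im = 1 / T * (resolvent A ζ a a).im / 4 := by
      field_simp
    rw [e]; linarith
  have h2 : 1 / (4 * T) * ζ.im ≤ z.im := by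
    have h3 := lift_im_le hT hz
    rw [one_div, inv_mul_le_iff₀ (by positivity)]
    have : 0 ≤ T * z.im := by positivity
    linarith
  rw [Complex.add_im, Complex.add_im, mul_add]
  linarith

/-- The law at the lifted point bounds G there by 1 / b plus a small error, hence by T / 2. Lowering
the point costs 1 + T, which gives T². In the same way Im(z + m_N) is at least b - ε ≥ 4 / T at the
lifted point and T^(-2) at z. These are the inputs of the next round. -/
lemma whp_closeEvent_succ (hβ : 0 < β) (hP : P ≠ 0) (hPβ : 100 ≤ β * P) {L : ℝ} (hL : 0 ≤ L) (k : ℕ)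
    (h : WHP (fun M : Ensemble.{u} β c => stableSet P L M.N ∩ {z | 2 / scale P M.N ^ k ≤ z.im})
      (closeEvent P)) :
    WHP (fun M : Ensemble.{u} β c => stableSet P L M.N ∩ {z | 2 / scale P M.N ^ (k + 1) ≤ z.im})
      (closeEvent P) := by
  obtain ⟨b, hb0, hb1, hbm⟩ := exists_le_im_add_mfc L
  obtain ⟨N₀, hN₀, h4⟩ := eventually_le_scale hP (4 + 5 / b)
  have key : WHP (fun M : Ensemble.{u} β c => stableSet P L M.N ∩
      {z | 2 / scale P M.N ^ (k + 1) ≤ z.im})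
      (fun M z => {ω | (∀ a b, ‖resolvent (M.H ω) z a b‖ ≤ scale P M.N ^ 2) ∧
        (|z.re| ≤ L → z.im ≤ 2 → 1 / scale P M.N ^ 2 ≤ (z + mN (M.H ω) z).im)}) := by
    refine (h.inter (whp_abs_diag_le hβ hP (by linarith) _)).mono (fun M z => lift (scale P M.N) z)
      ⟨N₀, fun M hM z hz => ?_⟩
    have hM1 := hN₀.trans hM
    have hT := h4 M.N hM
    set T := scale P M.N with hTd
    have hib : 5 ≤ 5 / b := by rw [le_div_iff₀ hb0]; linarith
    have hT4 : 4 ≤ T := by linarith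
    have hT1 : 1 ≤ T := by linarith
    have hz0 := im_pos_of_mem_stableSet hM1 hz.1
    have hζ := lift_mem_stableSet (T := T) hz.1
    set ζ := lift T z with hζd
    have hζ0 := im_pos_of_mem_stableSet hM1 hζ
    refine ⟨⟨hζ, le_lift_im_of_le hT1 hz.2⟩, fun ω hω => ?_⟩
    obtain ⟨⟨o1, o2⟩, o3⟩ := hω
    have o3 : ∀ a, |M.H ω a a| ≤ T := o3
    have hA := M.hsymm ω
    have hψ' : T ^ 50 * Psi M.N M.q ζ ≤ 2 := by
      rw [Psi_eq]
      exact scale_pow_mul_Psi_le hT1 (M.scale_pow_le_q hP (by push_cast; linarith) hM1) hζ.2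
    have hψ : 0 ≤ Psi M.N M.q ζ := Psi_nonneg (by linarith [M.one_le_q hβ hM1]) ζ
    have hε : T * (T ^ 40 * Psi M.N M.q ζ) ≤ 1 := by
      have h2 : (2 : ℝ) ≤ T ^ 9 := by
        calc (2 : ℝ) ≤ 4 ^ 9 := by norm_num
          _ ≤ _ := pow_le_pow_left₀ (by norm_num) hT4 9
      have : T ^ 41 * Psi M.N M.q ζ * 2 ≤ T ^ 41 * Psi M.N M.q ζ * T ^ 9 :=
        mul_le_mul_of_nonneg_left h2 (by positivity)
      have e : T ^ 41 * Psi M.N M.q ζ * T ^ 9 = T ^ 50 * Psi M.N M.q ζ := by ring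
      have e' : T * (T ^ 40 * Psi M.N M.q ζ) = T ^ 41 * Psi M.N M.q ζ := by ring
      linarith
    set ε := T ^ 40 * Psi M.N M.q ζ with hεd
    have hε0 : 0 ≤ ε := by positivity
    have hε1 : ε ≤ 1 := by nlinarith
    have hy : ∀ a, ‖1 / ((M.H ω a a : ℂ) - (ζ + mfc ζ))‖ ≤ 1 / b := by
      intro a
      have hb1' : 1 / 2 ≤ 1 / b := one_div_le_one_div_of_le hb0 (by linarith)
      have him₂ := im_le_im_add_mfc hζ0
      rcases hζ.1 with h | h | ⟨h, h'⟩
      · exact (norm_inv_le_half ((h.trans him₂).trans (im_le_norm_sub _))).trans hb1'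
      · exact (norm_inv_le_half (two_le_norm_sub_of_re hT4 h (o3 a)
          ((norm_mfc_le_one hζ0).trans (by nlinarith)))).trans hb1'
      · exact (norm_inv_sub_le (hζ0.trans_le him₂) _).trans
          (one_div_le_one_div_of_le hb0 (hbm ζ hζ0 h))
    have hΓ : ∀ a c, ‖resolvent (M.H ω) ζ a c‖ ≤ T / 2 := by
      intro a c
      have h5 : ‖(if a = c then 1 / ((M.H ω a a : ℂ) - (ζ + mfc ζ)) else 0 : ℂ)‖ ≤ 1 / b := by
        split_ifs
        · exact hy a
        · rw [norm_zero]; positivity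
      have h6 := norm_le_norm_add_norm_sub' (resolvent (M.H ω) ζ a c)
        (if a = c then 1 / ((M.H ω a a : ℂ) - (ζ + mfc ζ)) else 0)
      have h7 := o2 a c
      have h8 : 5 / b = 5 * (1 / b) := by ring
      linarith
    refine ⟨fun a c => ?_, fun hL' _ => ?_⟩
    · refine (norm_resolvent_le_of_im_le hA hz0 (le_lift_im T z) rfl hΓ a c).trans ?_
      have h5 : ζ.im / z.im ≤ T := by rw [div_le_iff₀ hz0]; exact lift_im_le hT1 hz0
      calc (1 + ζ.im / z.im) * (T / 2) ≤ (1 + T) * (T / 2) :=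
            mul_le_mul_of_nonneg_right (by linarith) (by linarith)
        _ ≤ T ^ 2 := by nlinarith
    · refine le_trans ?_ (mN_im_ge_of_lift hA hz0 hT1)
      have h5 := hbm ζ hζ0 hL'
      have h6 := (abs_le.1 ((Complex.abs_im_le_norm _).trans o1)).1
      rw [Complex.sub_im] at h6
      rw [Complex.add_im] at h5 ⊢
      have h7 : 4 / T ≤ ζ.im + (mN (M.H ω) ζ).im := by
        have h8 : b * T ≥ 5 := by
          have : 5 / b ≤ T := by linarith
          rw [div_le_iff₀ hb0] at this; linarith
        have h9 : b - ε ≤ ζ.im + (mN (M.H ω) ζ).im := by linarith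
        refine le_trans ?_ h9
        rw [div_le_iff₀ (by linarith)]
        nlinarith
      calc 1 / T ^ 2 = 1 / (4 * T) * (4 / T) := by field_simp
        _ ≤ _ := mul_le_mul_of_nonneg_left h7 (by positivity)
  refine whp_closeEvent hβ hP hPβ hL (fun M => Set.inter_subset_left)
    (key.mono (fun M z => z) ⟨0, fun M _ z hz => ⟨hz, fun ω hω => hω.1⟩⟩)
    (key.mono (fun M z => z) ⟨0, fun M _ z hz => ⟨hz, fun ω hω => hω.2⟩⟩)

/-- For Im z ≥ 2 the a priori bounds are deterministic: |G_ab| ≤ 1 / Im z, and Im m_N ≥ 0. -/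
lemma whp_closeEvent_zero (hβ : 0 < β) (hP : P ≠ 0) (hPβ : 100 ≤ β * P) {L : ℝ} (hL : 0 ≤ L) :
    WHP (fun M : Ensemble.{u} β c => stableSet P L M.N ∩ {z | 2 / scale P M.N ^ 0 ≤ z.im})
      (closeEvent P) := by
  refine whp_closeEvent hβ hP hPβ hL (fun M => Set.inter_subset_left)
    (WHP.of_forall ⟨1, fun M hM z hz ω a b => ?_⟩) (WHP.of_forall ⟨1, fun M hM z hz ω _ _ => ?_⟩)
  all_goals
    have hT1 := one_le_scale P hM
    have hz2 : 2 ≤ z.im := by simpa using hz.2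
    have hz0 : 0 < z.im := by linarith
    have hT2 : 1 ≤ scale P M.N ^ 2 := one_le_pow₀ hT1
  · refine (norm_resolvent_le (M.hsymm ω) hz0 a b).trans ?_
    rw [div_le_iff₀ hz0]; nlinarith
  · rw [Complex.add_im]
    have := mN_im_nonneg (M.hsymm ω) hz0
    have h3 : 1 / scale P M.N ^ 2 ≤ 1 := by rw [div_le_one (by linarith)]; exact hT2
    linarith

/-- The local law at a fixed spectral parameter. -/
theorem whp_closeEvent_stableSet (hβ : 0 < β) (hP : P ≠ 0) (hPβ : 100 ≤ β * P) {L : ℝ}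
    (hL : 0 ≤ L) : WHP (fun M : Ensemble.{u} β c => stableSet P L M.N) (closeEvent P) := by
  have h : ∀ k, WHP (fun M : Ensemble.{u} β c => stableSet P L M.N ∩
      {z | 2 / scale P M.N ^ k ≤ z.im}) (closeEvent P) := by
    intro k
    induction k with
    | zero => exact whp_closeEvent_zero hβ hP hPβ hL
    | succ k ih => exact whp_closeEvent_succ hβ hP hPβ hL k ih
  obtain ⟨N₀, hN₀, h4⟩ := eventually_le_scale hP 2
  -- P descents suffice: T^P = N, and N Im z ≥ T^100 ≥ 2 on the stable set.
  refine (h P).mono (fun M z => z) ⟨N₀, fun M hM z hz => ⟨⟨hz, ?_⟩, subset_rfl⟩⟩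
  have hT := h4 M.N hM
  have hN : (0 : ℝ) < M.N := by exact_mod_cast hN₀.trans hM
  show 2 / scale P M.N ^ P ≤ z.im
  rw [scale_pow hP, div_le_iff₀ hN, mul_comm]
  exact (hT.trans (le_self_pow₀ (by linarith) (by norm_num))).trans hz.2

end LaplacianLocalLaw
end

noncomputable section
namespace LaplacianLocalLaw

universe u v w

variable {β : ℝ} {c : ℕ → ℝ} {P : ℕ}

/-! ### Uniformity in the spectral parameter -/

/-- One point of D is chosen in every grid cell that meets D. The net must lie inside D because the
law is only known there. -/
lemma exists_finset_net {D : Set ℂ} {R δ : ℝ} (hδ : 0 < δ) (hR : 0 ≤ R)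
    (hD : ∀ z ∈ D, |z.re| ≤ R ∧ |z.im| ≤ R) :
    ∃ J : Finset ℂ, ↑J ⊆ D ∧ (J.card : ℝ) ≤ (2 * R / δ + 3) ^ 2 ∧
      ∀ z ∈ D, ∃ w ∈ J, ‖z - w‖ ≤ 2 * δ := by
  classical
  set f : ℂ → ℤ × ℤ := fun z => (⌊z.re / δ⌋, ⌊z.im / δ⌋) with hf
  set K : ℕ := ⌊R / δ⌋₊ + 1 with hK
  have hRδ : 0 ≤ R / δ := by positivity
  set I : Finset ℤ := Finset.Icc (-(K : ℤ)) (⌊R / δ⌋₊ : ℤ) with hI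
  have hfloor : ∀ x : ℝ, |x| ≤ R → ⌊x / δ⌋ ∈ I := by
    intro x hx
    obtain ⟨h1, h2⟩ := abs_le.1 hx
    have h3 : x / δ ≤ R / δ := by gcongr
    have h4 : -(R / δ) ≤ x / δ := by rw [← neg_div]; gcongr
    rw [hI, Finset.mem_Icc]
    constructor
    · rw [Int.le_floor]
      have := Nat.lt_floor_add_one (R / δ)
      push_cast [hK]
      linarith
    · have := Int.floor_le_floor h3
      rwa [← Int.natCast_floor_eq_floor hRδ] at this
  have hfin : ∀ z ∈ D, f z ∈ I ×ˢ I := fun z hz =>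
    Finset.mem_product.2 ⟨hfloor _ (hD z hz).1, hfloor _ (hD z hz).2⟩
  set Q := (I ×ˢ I).filter fun p => ∃ z ∈ D, f z = p with hQ
  have hch : ∀ p : ℤ × ℤ, ∃ z : ℂ, p ∈ Q → z ∈ D ∧ f z = p := by
    intro p
    by_cases hp : p ∈ Q
    · obtain ⟨z, hz⟩ := (Finset.mem_filter.1 hp).2
      exact ⟨z, fun _ => hz⟩
    · exact ⟨0, fun h => absurd h hp⟩
  choose g hg using hch
  refine ⟨Q.image g, ?_, ?_, fun z hz => ?_⟩
  · intro w hw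
    obtain ⟨p, hp, rfl⟩ := Finset.mem_image.1 (Finset.mem_coe.1 hw)
    exact (hg p hp).1
  · have h1 : (Q.image g).card ≤ I.card * I.card :=
      Finset.card_image_le.trans ((Finset.card_filter_le _ _).trans (Finset.card_product I I).le)
    have h2 : (I.card : ℝ) ≤ 2 * R / δ + 3 := by
      have h3 : I.card = 2 * ⌊R / δ⌋₊ + 2 := by rw [hI, Int.card_Icc, hK]; omega
      have h4 := Nat.floor_le hRδ
      rw [h3]
      push_cast
      rw [mul_div_assoc]
      linarith
    calc ((Q.image g).card : ℝ) ≤ (I.card : ℝ) * I.card := by exact_mod_cast h1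
      _ = (I.card : ℝ) ^ 2 := by ring
      _ ≤ _ := pow_le_pow_left₀ (Nat.cast_nonneg _) h2 2
  · have hp : f z ∈ Q := Finset.mem_filter.2 ⟨hfin z hz, z, hz, rfl⟩
    refine ⟨g (f z), Finset.mem_image_of_mem g hp, ?_⟩
    have h1 := (hg _ hp).2
    have h2 : ∀ x y : ℝ, ⌊x / δ⌋ = ⌊y / δ⌋ → |x - y| ≤ δ := by
      intro x y hxy
      have h3 := Int.abs_sub_lt_one_of_floor_eq_floor hxy
      rw [← sub_div, abs_div, abs_of_pos hδ, div_lt_one hδ] at h3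
      exact h3.le
    have h3 := h2 _ _ (congrArg Prod.fst h1)
    have h4 := h2 _ _ (congrArg Prod.snd h1)
    refine (Complex.norm_le_abs_re_add_abs_im _).trans ?_
    rw [Complex.sub_re, Complex.sub_im, abs_sub_comm z.re, abs_sub_comm z.im]
    linarith

lemma norm_mN_sub_le {N : ℕ} (hN : 1 ≤ N) {A : Matrix (Fin (N + 1)) (Fin (N + 1)) ℝ} {z w : ℂ}
    {x : ℝ} (h : ∀ a, ‖resolvent A z a a - resolvent A w a a‖ ≤ x) :
    ‖mN A z - mN A w‖ ≤ 2 * x := by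
  have hN' : (1 : ℝ) ≤ N := by exact_mod_cast hN
  have hx : 0 ≤ x := (norm_nonneg _).trans (h 0)
  have e : mN A z - mN A w = (1 / (N : ℂ)) * ∑ a, (resolvent A z a a - resolvent A w a a) := by
    rw [Finset.sum_sub_distrib, mul_sub]; rfl
  rw [e, norm_mul, norm_div, norm_one, Complex.norm_natCast]
  have h3 := norm_sum_le_of_le Finset.univ fun a _ => h a
  rw [Finset.sum_const, Finset.card_univ, Fintype.card_fin, nsmul_eq_mul] at h3
  refine (mul_le_mul_of_nonneg_left h3 (by positivity)).trans ?_
  push_cast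
  rw [one_div, inv_mul_eq_div, div_le_iff₀ (by linarith)]
  nlinarith

/-- The control parameter depends on Im z through an inverse square root, hence the pair 4 and 2. -/
lemma Psi_le_two_mul_Psi {N : ℕ} (hN : 1 ≤ N) {q : ℝ} (hq : 0 < q) {z w : ℂ} (hz : 0 < z.im)
    (hw : z.im / 4 ≤ w.im) : Psi N q w ≤ 2 * Psi N q z := by
  have hN' : (0 : ℝ) < N := by exact_mod_cast hN
  have h1 : √(N * z.im) ≤ 2 * √(N * w.im) := by
    rw [show (2 : ℝ) = √4 by rw [show (4 : ℝ) = 2 ^ 2 by norm_num, Real.sqrt_sq (by norm_num)],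
      ← Real.sqrt_mul (by norm_num)]
    refine Real.sqrt_le_sqrt ?_
    have : N * (z.im / 4) ≤ N * w.im := mul_le_mul_of_nonneg_left hw hN'.le
    linarith
  have h2 : 0 < √(N * z.im) := Real.sqrt_pos.2 (by positivity)
  have h3 : 1 / √(N * w.im) ≤ 2 * (1 / √(N * z.im)) := by
    rw [mul_one_div, div_le_div_iff₀ (by linarith) h2]
    linarith
  have h4 : 0 ≤ 1 / q := by positivity
  rw [Psi_eq, Psi_eq]
  linarith

/-- The bounds of the local law are stable under small changes of the spectral parameter. -/
lemma close_of_close_of_norm_sub_le {N : ℕ} (hN : 5 ≤ N)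
    {A : Matrix (Fin (N + 1)) (Fin (N + 1)) ℝ} (hA : ∀ i j, A i j = A j i) {q : ℝ} (hq : 0 < q)
    (hqN : q ≤ N) {z w : ℂ} (hz : 1 / (N : ℝ) ≤ z.im) (hw : 1 / (N : ℝ) ≤ w.im)
    (hzw : ‖z - w‖ ≤ 1 / (N : ℝ) ^ 10) {t : ℝ} (ht : 1 ≤ t)
    (hm : ‖mN A w - mfc w‖ ≤ t * Psi N q w)
    (hG : ∀ a b, ‖resolvent A w a b - if a = b then 1 / ((A a a : ℂ) - (w + mfc w)) else 0‖ ≤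
      t * Psi N q w) :
    ‖mN A z - mfc z‖ ≤ 3 * t * Psi N q z ∧
      ∀ a b, ‖resolvent A z a b - if a = b then 1 / ((A a a : ℂ) - (z + mfc z)) else 0‖ ≤
        3 * t * Psi N q z := by
  have hN5 : (5 : ℝ) ≤ N := by exact_mod_cast hN
  have hN0 : (0 : ℝ) < N := by linarith
  have hε : 0 < 1 / (N : ℝ) := by positivity
  have hz0 := hε.trans_le hz
  have hw0 := hε.trans_le hw
  have hpow : ∀ {i j : ℕ}, i ≤ j → 1 / (N : ℝ) ^ j ≤ 1 / (N : ℝ) ^ i := fun h =>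
    one_div_le_one_div_of_le (by positivity) (pow_le_pow_right₀ (by linarith) h)
  have hres : ∀ a b, ‖resolvent A z a b - resolvent A w a b‖ ≤ 2 * (1 / (N : ℝ) ^ 7) := by
    intro a b
    refine (norm_resolvent_sub_le hA hε hz hw a b).trans ?_
    calc ‖z - w‖ * (((N + 1 : ℕ) : ℝ) / (1 / (N : ℝ)) ^ 2)
        ≤ 1 / (N : ℝ) ^ 10 * ((2 * N) / (1 / (N : ℝ)) ^ 2) := by
          refine mul_le_mul hzw (div_le_div_of_nonneg_right ?_ (by positivity)) (by positivity)
            (by positivity)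
          push_cast; linarith
      _ = _ := by field_simp
  have hmN := norm_mN_sub_le (by omega) fun a => hres a a
  have hmfc : ‖mfc z - mfc w‖ ≤ 1 / (N : ℝ) ^ 9 := by
    refine (norm_mfc_sub_le hε hz hw).trans ?_
    rw [div_le_iff₀ hε]
    refine hzw.trans (le_of_eq ?_)
    field_simp
  have hinv : ∀ a, ‖1 / ((A a a : ℂ) - (z + mfc z)) - 1 / ((A a a : ℂ) - (w + mfc w))‖ ≤
      2 * (1 / (N : ℝ) ^ 7) := by
    intro a
    have b₁ := im_le_im_add_mfc hz0
    have b₂ := im_le_im_add_mfc hw0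
    rw [inv_sub_sub_inv_sub (hz0.trans_le b₁) (hw0.trans_le b₂), norm_mul, norm_mul]
    have h1 : ∀ u : ℂ, 1 / (N : ℝ) ≤ u.im → ‖1 / ((A a a : ℂ) - u)‖ ≤ N := by
      intro u hu
      refine (norm_inv_sub_le (hε.trans_le hu) _).trans ?_
      rw [div_le_iff₀ (hε.trans_le hu)]
      rw [div_le_iff₀ hN0] at hu
      linarith
    have h2 : ‖z + mfc z - (w + mfc w)‖ ≤ 1 / (N : ℝ) ^ 9 + 1 / (N : ℝ) ^ 9 := by
      rw [add_sub_add_comm]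
      exact (norm_add_le _ _).trans (add_le_add (hzw.trans (hpow (by norm_num))) hmfc)
    calc _ ≤ (1 / (N : ℝ) ^ 9 + 1 / (N : ℝ) ^ 9) * ((N : ℝ) * N) :=
          mul_le_mul h2 (mul_le_mul (h1 _ (hz.trans b₁)) (h1 _ (hw.trans b₂)) (norm_nonneg _)
            hN0.le) (by positivity) (by positivity)
      _ = _ := by field_simp; ring
  have hΨ : Psi N q w ≤ 2 * Psi N q z := by
    refine Psi_le_two_mul_Psi (by omega) hq hz0 ?_
    have h1 := (abs_le.1 ((Complex.abs_im_le_norm _).trans hzw)).2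
    rw [Complex.sub_im] at h1
    have h2 : 1 / (N : ℝ) ^ 10 ≤ 1 / (N : ℝ) ^ 2 := hpow (by norm_num)
    have h3 : 1 / (N : ℝ) ^ 2 ≤ 1 / (N : ℝ) * (1 / 5) := by
      rw [sq, ← one_div_mul_one_div]
      exact mul_le_mul_of_nonneg_left (one_div_le_one_div_of_le (by norm_num) hN5) hε.le
    linarith
  have hsmall : 5 * (1 / (N : ℝ) ^ 7) ≤ Psi N q z := by
    have h1 : 1 / (N : ℝ) ^ 7 ≤ 1 / (N : ℝ) ^ 2 := hpow (by norm_num)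
    have h3 : 1 / (N : ℝ) ^ 2 ≤ 1 / (N : ℝ) * (1 / 5) := by
      rw [sq, ← one_div_mul_one_div]
      exact mul_le_mul_of_nonneg_left (one_div_le_one_div_of_le (by norm_num) hN5) hε.le
    have h4 : 1 / (N : ℝ) ≤ 1 / q := one_div_le_one_div_of_le hq hqN
    have h5 : 0 ≤ 1 / √(N * z.im) := by positivity
    rw [Psi_eq]
    linarith
  have h97 : 1 / (N : ℝ) ^ 9 ≤ 1 / (N : ℝ) ^ 7 := hpow (by norm_num)
  have hΨ0 : 0 ≤ Psi N q z := Psi_nonneg hq.le z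
  have htΨ : t * Psi N q w ≤ 2 * (t * Psi N q z) := by
    calc _ ≤ t * (2 * Psi N q z) := mul_le_mul_of_nonneg_left hΨ (by linarith)
      _ = _ := by ring
  have h1Ψ : Psi N q z ≤ t * Psi N q z := le_mul_of_one_le_left hΨ0 ht
  have h7 : 0 ≤ 1 / (N : ℝ) ^ 7 := by positivity
  constructor
  · have e : mN A z - mfc z = (mN A z - mN A w) + (mN A w - mfc w) - (mfc z - mfc w) := by ring
    rw [e]
    refine (norm_sub_le _ _).trans ((add_le_add ((norm_add_le _ _).trans
      (add_le_add hmN hm)) hmfc).trans ?_)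
    linarith
  · intro a b
    set y : ℂ → ℂ := fun u => if a = b then 1 / ((A a a : ℂ) - (u + mfc u)) else 0 with hy
    have hyy : ‖y z - y w‖ ≤ 2 * (1 / (N : ℝ) ^ 7) := by
      simp only [hy]
      split_ifs
      · exact hinv a
      · simp only [sub_zero, norm_zero]; positivity
    have e : resolvent A z a b - y z = (resolvent A z a b - resolvent A w a b) +
        (resolvent A w a b - y w) - (y z - y w) := by ring
    show ‖resolvent A z a b - y z‖ ≤ _
    rw [e]
    refine (norm_sub_le _ _).trans ((add_le_add ((norm_add_le _ _).trans
      (add_le_add (hres a b) (hG a b))) hyy).trans ?_)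
    linarith

/-- The bound T^100 ≤ ξ matches the three parts of the domain with the three alternatives: high,
bounded, and far out. The lower bound on Im z yields N Im z ≥ ξ³ ≥ T^100; in the high part N ≥ T^100
already suffices. -/
lemma spectralDomain_subset_stableSet (hP : P ≠ 0) (hP100 : 100 ≤ P) {ν : ℝ}
    (hν : 100 ≤ ν * P) (L : ℝ) {N : ℕ} (hN : 1 ≤ N) :
    spectralDomain N ν L ⊆ stableSet P L N := by
  have hT1 := one_le_scale P hN
  have hN' : (1 : ℝ) ≤ N := by exact_mod_cast hN
  have hξ : scale P N ^ 100 ≤ xi N ν := scale_pow_le_rpow hP (by push_cast; linarith) hN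
  have hξ1 : 1 ≤ xi N ν := (one_le_pow₀ hT1).trans hξ
  have hlow : ∀ z : ℂ, xi N ν ^ 3 / (N : ℝ) ≤ z.im → scale P N ^ 100 ≤ N * z.im := by
    intro z hz
    rw [div_le_iff₀ (by linarith)] at hz
    have := le_self_pow₀ hξ1 (n := 3) (by norm_num)
    linarith
  rintro z ((⟨-, h2, -⟩ | ⟨h1, h2, h3⟩) | ⟨h1, -, h2, -⟩)
  · refine ⟨Or.inl h2, ?_⟩
    have h4 : scale P N ^ 100 ≤ N := by
      rw [← scale_pow hP N]; exact pow_le_pow_right₀ hT1 hP100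
    nlinarith
  · exact ⟨Or.inr (Or.inr ⟨h1, h3⟩), hlow z h2⟩
  · refine ⟨Or.inr (Or.inl ?_), hlow z h2⟩
    have h4 : scale P N ^ 4 ≤ scale P N ^ 100 := pow_le_pow_right₀ hT1 (by norm_num)
    linarith

lemma abs_le_of_mem_spectralDomain {N : ℕ} {ν L : ℝ} (hL : 0 < L) {z : ℂ}
    (hz : z ∈ spectralDomain N ν L) :
    |z.re| ≤ 2 * xi N ν + L + 2 ∧ |z.im| ≤ 2 * xi N ν + L + 2 := by
  have hξ : 0 ≤ xi N ν := by unfold xi; positivity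
  have h0 : 0 ≤ xi N ν ^ 3 / (N : ℝ) := by positivity
  rcases hz with ((⟨h1, h2, h3⟩ | ⟨h1, h2, h3⟩) | ⟨-, h1, h2, h3⟩)
  all_goals exact ⟨by linarith, abs_le.2 ⟨by linarith, by linarith⟩⟩

lemma card_net_bound {n N : ℕ} {ν L : ℝ} (hL : 0 < L) (hν : ν ≤ n) (hN : 1 ≤ N)
    (hNL : 8 * (L + 4) + 3 ≤ N) :
    (2 * (2 * xi N ν + L + 2) / (1 / (N : ℝ) ^ 10 / 2) + 3) ^ 2 ≤ (N : ℝ) ^ (2 * (n + 11)) := by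
  have hN' : (1 : ℝ) ≤ N := by exact_mod_cast hN
  have hξ : xi N ν ≤ (N : ℝ) ^ n := by
    unfold xi
    rw [← Real.rpow_natCast]
    exact Real.rpow_le_rpow_of_exponent_le hN' hν
  have hξ0 : 0 ≤ xi N ν := by unfold xi; positivity
  have h1 : 1 ≤ (N : ℝ) ^ n := one_le_pow₀ hN'
  have h2 : 1 ≤ (N : ℝ) ^ (n + 10) := one_le_pow₀ hN'
  have h3 : 2 * xi N ν + L + 2 ≤ (L + 4) * (N : ℝ) ^ n := by nlinarith
  rw [mul_comm 2 (n + 11), pow_mul]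
  refine pow_le_pow_left₀ (by positivity) ?_ 2
  calc 2 * (2 * xi N ν + L + 2) / (1 / (N : ℝ) ^ 10 / 2) + 3
      = 4 * (2 * xi N ν + L + 2) * (N : ℝ) ^ 10 + 3 := by field_simp; ring
    _ ≤ 4 * ((L + 4) * (N : ℝ) ^ n) * (N : ℝ) ^ 10 + 3 * (N : ℝ) ^ (n + 10) := by
        have : 2 * xi N ν + L + 2 ≤ (L + 4) * (N : ℝ) ^ n := h3
        have := mul_le_mul_of_nonneg_right this (show 0 ≤ (N : ℝ) ^ 10 by positivity)
        linarith
    _ = (4 * (L + 4) + 3) * (N : ℝ) ^ (n + 10) := by ring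
    _ ≤ N * (N : ℝ) ^ (n + 10) := mul_le_mul_of_nonneg_right (by linarith) (by positivity)
    _ = _ := by ring

/-- The local law, uniformly on the spectral domain. -/
theorem whp_close_spectralDomain (hβ : 0 < β) {L : ℝ} (hL : 0 < L) {ν : ℝ} (hν : 0 < ν) :
    WHP (fun _ : Ensemble.{u} β c => (Set.univ : Set Unit)) (fun M _ => {ω |
      ∀ z ∈ spectralDomain M.N ν L, ‖mN (M.H ω) z - mfc z‖ ≤ xi M.N ν * Psi M.N M.q z ∧
        ∀ a b, ‖resolvent (M.H ω) z a b -
          if a = b then 1 / ((M.H ω a a : ℂ) - (z + mfc z)) else 0‖ ≤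
            xi M.N ν * Psi M.N M.q z}) := by
  -- This makes T^100 at most N^β, hence at most q, and at most ξ. Since P is chosen from β and ν
  -- alone, all thresholds on N keep the required dependence.
  obtain ⟨P, hPl⟩ := exists_nat_ge (max 100 (max (100 / β) (100 / ν)))
  have hP100' : (100 : ℝ) ≤ P := (le_max_left _ _).trans hPl
  have hPβ : 100 ≤ β * P := by
    have := ((le_max_left _ _).trans (le_max_right _ _)).trans hPl
    rw [div_le_iff₀ hβ] at this; linarith
  have hPν : 100 ≤ ν * P := by
    have := ((le_max_right _ _).trans (le_max_right _ _)).trans hPl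
    rw [div_le_iff₀ hν] at this; linarith
  have hP100 : 100 ≤ P := by exact_mod_cast hP100'
  have hP : P ≠ 0 := by omega
  obtain ⟨n, hn⟩ := exists_nat_ge ν
  have hnet : ∀ M : Ensemble.{u} β c, ∃ J : Finset ℂ, ↑J ⊆ spectralDomain M.N ν L ∧
      (1 ≤ M.N → (J.card : ℝ) ≤ (2 * (2 * xi M.N ν + L + 2) / (1 / (M.N : ℝ) ^ 10 / 2) + 3) ^ 2 ∧
        ∀ z ∈ spectralDomain M.N ν L, ∃ w ∈ J, ‖z - w‖ ≤ 1 / (M.N : ℝ) ^ 10) := by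
    intro M
    by_cases hM : 1 ≤ M.N
    · have hN' : (0 : ℝ) < M.N := by exact_mod_cast hM
      have hξ : 0 ≤ xi M.N ν := by unfold xi; positivity
      obtain ⟨J, h1, h2, h3⟩ := exists_finset_net (D := spectralDomain M.N ν L)
        (R := 2 * xi M.N ν + L + 2) (δ := 1 / (M.N : ℝ) ^ 10 / 2) (by positivity) (by positivity)
        fun z hz => abs_le_of_mem_spectralDomain hL hz
      refine ⟨J, h1, fun _ => ⟨h2, fun z hz => ?_⟩⟩
      obtain ⟨w, hw, hzw⟩ := h3 z hz
      exact ⟨w, hw, by linarith⟩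
    · exact ⟨∅, by simp, fun h => absurd h hM⟩
  choose J hJ1 hJ2 using hnet
  obtain ⟨N₁, hN₁⟩ := exists_nat_ge (8 * (L + 4) + 3)
  have h1 := WHP.biInter (ι := fun _ : Ensemble.{u} β c => Unit) (κ := fun _ => ℂ)
    (S := fun _ => Set.univ) (fun M _ => J M) (A := fun M p => closeEvent P M p.2) (2 * (n + 11))
    ⟨max 1 N₁, fun M hM _ _ => by
      have hM1 := le_of_max_le_left hM
      have hM2 : (N₁ : ℝ) ≤ M.N := by exact_mod_cast le_of_max_le_right hM
      exact (hJ2 M hM1).1.trans (card_net_bound hL hn hM1 (hN₁.trans hM2))⟩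
    ((whp_closeEvent_stableSet hβ hP hPβ hL.le).mono (fun M p => p.2)
      ⟨1, fun M hM p hp => ⟨spectralDomain_subset_stableSet hP hP100 hPν L hM
        (hJ1 M (Finset.mem_coe.2 hp.2)), subset_rfl⟩⟩)
  obtain ⟨N₂, hN₂, hT⟩ := eventually_le_scale hP 3
  refine h1.mono (fun M x => x) ⟨max 5 N₂, fun M hM x hx => ⟨hx, fun ω hω z hz => ?_⟩⟩
  have hM5 := le_of_max_le_left hM
  have hM1 : 1 ≤ M.N := by omega
  have hT3 := hT M.N (le_of_max_le_right hM)
  have hT1 := one_le_scale P hM1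
  have hN' : (0 : ℝ) < M.N := by exact_mod_cast hM1
  obtain ⟨w, hw, hzw⟩ := (hJ2 M hM1).2 z hz
  obtain ⟨c1, c2⟩ := Set.mem_iInter₂.1 hω w hw
  have him : ∀ u ∈ spectralDomain M.N ν L, 1 / (M.N : ℝ) ≤ u.im := by
    intro u hu
    have := (spectralDomain_subset_stableSet hP hP100 hPν L hM1 hu).2
    rw [div_le_iff₀ hN', mul_comm]
    exact (one_le_pow₀ hT1).trans this
  have hq := M.one_le_q hβ hM1
  have hqN : M.q ≤ M.N := by nlinarith [M.q_sq_le hβ hM1]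
  have h40 : 1 ≤ scale P M.N ^ 40 := one_le_pow₀ hT1
  obtain ⟨d1, d2⟩ := close_of_close_of_norm_sub_le hM5 (M.hsymm ω) (by linarith) hqN (him z hz)
    (him w (hJ1 M (Finset.mem_coe.2 hw))) hzw h40 c1 c2
  -- Passing from the net to the domain costs the factor 3, which is absorbed in one more power of
  -- T; the total T^41 is still at most ξ.
  have hξ : 3 * scale P M.N ^ 40 ≤ xi M.N ν := by
    calc 3 * scale P M.N ^ 40 ≤ scale P M.N * scale P M.N ^ 40 :=
          mul_le_mul_of_nonneg_right hT3 (by positivity)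
      _ = scale P M.N ^ 41 := by ring
      _ ≤ _ := scale_pow_le_rpow hP (by push_cast; linarith) hM1
  have hψ : 0 ≤ Psi M.N M.q z := Psi_nonneg (by linarith) z
  have hfin := mul_le_mul_of_nonneg_right hξ hψ
  exact ⟨d1.trans hfin, fun a b => (d2 a b).trans hfin⟩

end LaplacianLocalLaw
end


/-- The constant `C` depends only on the parameters `β, c, L, ν` of the model and of the domain, and
`N₀` on these and on `D`. The exceptional event is the one where some bound fails for some point
of the spectral domain or for some pair of indices. -/
theorem theoremt (β : ℝ) (hβ : 0 < β) (c : ℕ → ℝ) (L : ℝ) (hL : 0 < L) (ν : ℝ) (hν : 0 < ν) :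
    ∃ C : ℝ, 0 < C ∧ ∀ D : ℝ, 0 < D → ∃ N₀ : ℕ, ∀ N : ℕ, N₀ ≤ N →
      ∀ (q : ℝ) (Ω : Type*) [MeasurableSpace Ω] (μ : Measure Ω) [IsProbabilityMeasure μ]
        (H : Ω → Matrix (Fin (N + 1)) (Fin (N + 1)) ℝ),
        LaplacianLocalLaw.IsRandomLaplacianType N β q c μ H →
        μ {ω | ¬ ∀ z ∈ LaplacianLocalLaw.spectralDomain N ν L,
            ‖LaplacianLocalLaw.mN (H ω) z - LaplacianLocalLaw.mfc z‖ ≤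
              C * LaplacianLocalLaw.xi N ν * LaplacianLocalLaw.Psi N q z ∧
            ∀ i j : Fin (N + 1),
              ‖LaplacianLocalLaw.resolvent (H ω) z i j -
                  (if i = j then
                    1 / (-((∑ k ∈ Finset.univ.erase i, H ω i k : ℝ) : ℂ) - z -
                      LaplacianLocalLaw.mfc z)
                  else 0)‖ ≤
                C * LaplacianLocalLaw.xi N ν * LaplacianLocalLaw.Psi N q z} ≤
          ENNReal.ofReal ((N : ℝ) ^ (-D)) := by
  obtain hwhp := LaplacianLocalLaw.whp_close_spectralDomain (c := c) hβ hL hν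
  -- All constants are already absorbed in ξ, so C = 1 works.
  refine ⟨1, one_pos, fun D _ => ?_⟩
  obtain ⟨k, hk⟩ := exists_nat_ge D
  obtain ⟨N₀, h⟩ := hwhp k
  refine ⟨max 1 N₀, fun N hN q Ω _ μ _ H hH => ?_⟩
  have hN1 : (1 : ℝ) ≤ N := by exact_mod_cast le_of_max_le_left hN
  have h1 := h ⟨N, q, Ω, inferInstance, μ, inferInstance, H, hH⟩ (le_of_max_le_right hN) ()
    (Set.mem_univ _)
  refine (measure_mono (t := _) ?_).trans ((ENNReal.le_ofReal_iff_toReal_le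
    (measure_ne_top _ _) (by positivity)).2 (h1.trans ?_))
  · intro ω hω hω'
    refine hω fun z hz => ?_
    obtain ⟨h2, h3⟩ := hω' z hz
    rw [one_mul]
    refine ⟨h2, fun i j => ?_⟩
    have e : -((∑ k ∈ Finset.univ.erase i, H ω i k : ℝ) : ℂ) - z - LaplacianLocalLaw.mfc z =
        (H ω i i : ℂ) - (z + LaplacianLocalLaw.mfc z) := by
      rw [hH.diag ω i]; push_cast; ring
    rw [e]
    exact h3 i j
  · show ((N : ℝ) ^ k)⁻¹ ≤ (N : ℝ) ^ (-D)
    rw [Real.rpow_neg (by positivity), ← Real.rpow_natCast]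
    exact inv_anti₀ (by positivity) (Real.rpow_le_rpow_of_exponent_le hN1 hk)
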